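/- **Theorem.** Let $k$ be an algebraically closed field, let $D=\operatorname{Hom}_k(-,k)$, and let $\Lambda$ be a basic finite dimensional $k$-algebra of global dimension $\leq 1$ which is $\tau_1$-finite, i.e. the endofunctor $\tau_1 = H^0(D\Lambda\overset{\mathbf L}{\otimes}_\Lambda -[-1]) = \operatorname{Tor}_1^\Lambda(D\Lambda,-)$ of the category of finitely generated $\Lambda$-modules is nilpotent. Let $$\Pi := \Pi_2(\Lambda) = T_\Lambda \operatorname{Ext}^1_\Lambda(D\Lambda,\Lambda)$$ be its $2$-preprojective algebra, i.e. the tensor algebra of the $\Lambda$-bimodule $\operatorname{Ext}^1_\Lambda(D\Lambda,\Lambda)$, graded by tensor degree. Then $\Pi$ is finite dimensional over $k$, and 1. $\Pi$ is selfinjective, i.e. $\Pi$ is injective as a left and as a right module over itself; 2. $\Pi$ is bimodule stably $(1)$-twisted $2$-Calabi–Yau: writing $\Pi^{\mathrm e}=\Pi\otimes_k\Pi^{\mathrm{op}}$, the complex $\mathbf R\!\operatorname{Hom}_{\Pi^{\mathrm e}}(\Pi,\Pi^{\mathrm e})$ has bounded cohomology and there is an isomorphism $$\mathbf R\!\operatorname{Hom}_{\Pi^{\mathrm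 e}}(\Pi,\Pi^{\mathrm e})[3]\;\cong\;\Pi(1)$$ in the quotient $\mathrm D^{\mathrm b}(\operatorname{gr}\Pi^{\mathrm e})/\operatorname{gr\,perf}\Pi^{\mathrm e}$ of the bounded derived category of finitely generated $\mathbb Z$-graded $\Pi$-bimodules by the perfect complexes, where $M(1)_n=M_{n+1}$. In particular, the stable category $\operatorname{\underline{mod}}\Pi$ of finitely generated $\Pi$-modules is $2$-Calabi–Yau: its Hom-spaces are finite dimensional and there are isomorphisms $D\operatorname{\underline{Hom}}_\Pi(X,Y)\cong\operatorname{\underline{Hom}}_\Pi(Y,\Omega^{-2}X)$ natural in $X$ and $Y$, where $\Omega^{-1}$ is the cosyzygy functor, i.e. the suspension of $\operatorname{\underline{mod}}\Pi$. -/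

import Mathlib

open CategoryTheory Limits
open scoped TensorProduct
universe u
namespace Preproj
noncomputable section

section Internal

variable {M ι σ : Type*} [AddCommGroup M] [DecidableEq ι] [SetLike σ M] [AddSubgroupClass σ M]
  {gr : ι → σ}

theorem isInternal_of
    (h₁ : ∀ (s : Finset ι) (x : ι → M), (∀ i, x i ∈ gr i) → ∑ i ∈ s, x i = 0 → ∀ i ∈ s, x i = 0)
    (h₂ : ∀ m : M, ∃ (s : Finset ι) (x : ι → M), (∀ i, x i ∈ gr i) ∧ m = ∑ i ∈ s, x i) :
    DirectSum.IsInternal gr := by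
  classical
  constructor
  · rw [injective_iff_map_eq_zero]
    intro a ha
    rw [DirectSum.coeAddMonoidHom_eq_dfinsuppSum] at ha
    ext i
    by_cases hi : i ∈ DFinsupp.support a
    · exact h₁ _ (fun i => (a i : M)) (fun i => (a i).2) ha i hi
    · have : a i = 0 := by simpa using hi
      rw [this]; rfl
  · intro m
    obtain ⟨s, x, hx, rfl⟩ := h₂ m
    refine ⟨∑ i ∈ s, DirectSum.of (fun i => gr i) i ⟨x i, hx i⟩, ?_⟩
    simp

theorem isInternal_of'
    (h₁ : ∀ (s : Finset ι) (x : ι → M), (∀ i, x i ∈ gr i) → ∑ i ∈ s, x i = 0 → ∀ i ∈ s, x i = 0)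
    (h₂ : ∀ p : AddSubmonoid M, (∀ i, ∀ x ∈ gr i, x ∈ p) → ∀ m, m ∈ p) :
    DirectSum.IsInternal gr := by
  classical
  refine isInternal_of h₁ fun m => ?_
  have := h₂ (AddMonoidHom.mrange (DirectSum.coeAddMonoidHom gr)) (fun i x hx =>
    ⟨DirectSum.of (fun i => gr i) i ⟨x, hx⟩, DirectSum.coeAddMonoidHom_of _ _ _⟩) m
  obtain ⟨a, rfl⟩ := this
  exact ⟨DFinsupp.support a, fun i => a i, fun i => (a i).2,
    DirectSum.coeAddMonoidHom_eq_dfinsuppSum _ _⟩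

/-- The projection onto the component of degree `i` of an internal direct sum. -/
def proj (h : DirectSum.IsInternal gr) (i : ι) : M →+ M :=
  ((AddSubmonoidClass.subtype (gr i)).comp (DFinsupp.evalAddMonoidHom i)).comp
    (AddEquiv.ofBijective _ h).symm.toAddMonoidHom

theorem proj_mem (h : DirectSum.IsInternal gr) (i : ι) (m : M) : proj h i m ∈ gr i :=
  (((AddEquiv.ofBijective _ h).symm m) i).2

theorem proj_of_mem (h : DirectSum.IsInternal gr) {i j : ι} {m : M} (hm : m ∈ gr j) :
    proj h i m = if i = j then m else 0 := by
  have : (AddEquiv.ofBijective _ h).symm m = DirectSum.of (fun i => gr i) j ⟨m, hm⟩ := by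
    rw [AddEquiv.symm_apply_eq]
    exact (DirectSum.coeAddMonoidHom_of gr j ⟨m, hm⟩).symm
  have h2 : proj h i m = ((DirectSum.of (fun i => gr i) j ⟨m, hm⟩ i : gr i) : M) := by
    rw [← this]; rfl
  rw [h2]
  split_ifs with hij
  · subst hij; simp
  · rw [DirectSum.of_eq_of_ne _ _ _ hij]; rfl

theorem exists_sum_proj (h : DirectSum.IsInternal gr) (m : M) :
    ∃ s : Finset ι, (∀ i, i ∉ s → proj h i m = 0) ∧ ∑ i ∈ s, proj h i m = m := by
  classical
  refine ⟨DFinsupp.support ((AddEquiv.ofBijective _ h).symm m), ?_, ?_⟩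
  · intro i hi
    have : ((AddEquiv.ofBijective _ h).symm m) i = 0 := by simpa using hi
    change (((AddEquiv.ofBijective _ h).symm m) i : M) = 0
    rw [this]; rfl
  · have := DirectSum.coeAddMonoidHom_eq_dfinsuppSum gr ((AddEquiv.ofBijective _ h).symm m)
    have h2 := (AddEquiv.ofBijective _ h).apply_symm_apply m
    exact this.symm.trans h2

theorem proj_sum (h : DirectSum.IsInternal gr) (s : Finset ι) (x : ι → M)
    (hx : ∀ i, x i ∈ gr i) {i : ι} (hi : i ∈ s) : proj h i (∑ j ∈ s, x j) = x i := by
  rw [map_sum, Finset.sum_eq_single i]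
  · rw [proj_of_mem h (hx i), if_pos rfl]
  · intro j _ hj; rw [proj_of_mem h (hx j), if_neg hj.symm]
  · intro h; exact absurd hi h

theorem homogeneous_induction (h : DirectSum.IsInternal gr) {P : M → Prop} (h0 : P 0)
    (hadd : ∀ m n, P m → P n → P (m + n)) (hhom : ∀ i, ∀ m ∈ gr i, P m) (m : M) : P m := by
  obtain ⟨s, _, hs⟩ := exists_sum_proj h m
  rw [← hs]
  exact Finset.sum_induction _ P hadd h0 fun i _ => hhom i _ (proj_mem h i m)

theorem sum_mk {N : Type*} [AddCommGroup N] (s : Finset ι) (a : ι → M) (b : ι → N) :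
    ∑ i ∈ s, (a i, b i) = (∑ i ∈ s, a i, ∑ i ∈ s, b i) :=
  Prod.ext Prod.fst_sum Prod.snd_sum

end Internal

section GrMod

variable {k : Type u} [Field k] {R : Type u} [Ring R] [Algebra k R]

/-- A finitely generated `ℤ`-graded left module over a ring `R` graded by `𝒜`. -/
structure GrMod (𝒜 : ℕ → Submodule k R) where
  carrier : Type u
  [addCommGroup : AddCommGroup carrier]
  [module : Module R carrier]
  /-- the homogeneous component of degree `n` -/
  gr : ℤ → AddSubgroup carrier
  isInternal : DirectSum.IsInternal gr
  smul_mem : ∀ {i : ℕ} {j : ℤ} {r : R} {m : carrier}, r ∈ 𝒜 i → m ∈ gr j → r • m ∈ gr (i + j)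
  finite : Module.Finite R carrier

namespace GrMod

variable {𝒜 : ℕ → Submodule k R}

attribute [instance] GrMod.addCommGroup GrMod.module GrMod.finite

/-- Morphisms of graded modules: `R`-linear maps which are homogeneous of degree `0`. -/
@[ext]
structure Hom (M N : GrMod 𝒜) where
  lin : M.carrier →ₗ[R] N.carrier
  map_mem : ∀ {i : ℤ} {m : M.carrier}, m ∈ M.gr i → lin m ∈ N.gr i

instance : Category (GrMod 𝒜) where
  Hom := Hom
  id M := ⟨LinearMap.id, fun h => h⟩
  comp f g := ⟨g.lin.comp f.lin, fun h => g.map_mem (f.map_mem h)⟩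

@[ext]
theorem hom_ext {M N : GrMod 𝒜} {f g : M ⟶ N} (h : Hom.lin f = Hom.lin g) : f = g :=
  Hom.ext h

@[simp] theorem id_lin (M : GrMod 𝒜) : Hom.lin (𝟙 M) = LinearMap.id := rfl
@[simp] theorem comp_lin {M N L : GrMod 𝒜} (f : M ⟶ N) (g : N ⟶ L) :
    Hom.lin (f ≫ g) = (Hom.lin g).comp (Hom.lin f) := rfl

theorem proj_map {M N : GrMod 𝒜} (f : M ⟶ N) (i : ℤ) (m : M.carrier) :
    proj N.isInternal i (Hom.lin f m) = Hom.lin f (proj M.isInternal i m) := by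
  obtain ⟨s, _, hs⟩ := exists_sum_proj M.isInternal m
  rw [← hs]
  simp only [map_sum]
  refine Finset.sum_congr rfl fun j _ => ?_
  have hj := proj_mem M.isInternal j m
  rw [proj_of_mem N.isInternal (Hom.map_mem f hj), proj_of_mem M.isInternal hj]
  split_ifs <;> simp

section Additive

variable (M N : GrMod 𝒜)

instance : Zero (M ⟶ N) := ⟨⟨0, fun _ => (N.gr _).zero_mem⟩⟩
instance : Add (M ⟶ N) := ⟨fun f g => ⟨Hom.lin f + Hom.lin g, fun h =>
  (N.gr _).add_mem (Hom.map_mem f h) (Hom.map_mem g h)⟩⟩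
instance : Neg (M ⟶ N) := ⟨fun f => ⟨-Hom.lin f, fun h => (N.gr _).neg_mem (Hom.map_mem f h)⟩⟩
instance : Sub (M ⟶ N) := ⟨fun f g => ⟨Hom.lin f - Hom.lin g, fun h =>
  (N.gr _).sub_mem (Hom.map_mem f h) (Hom.map_mem g h)⟩⟩
instance : SMul ℕ (M ⟶ N) := ⟨fun n f => ⟨n • Hom.lin f, fun h =>
  (N.gr _).nsmul_mem (Hom.map_mem f h) n⟩⟩
instance : SMul ℤ (M ⟶ N) := ⟨fun n f => ⟨n • Hom.lin f, fun h =>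
  (N.gr _).zsmul_mem (Hom.map_mem f h) n⟩⟩

instance : AddCommGroup (M ⟶ N) :=
  Function.Injective.addCommGroup (fun f : M ⟶ N => Hom.lin f) (fun _ _ h => hom_ext h)
    rfl (fun _ _ => rfl) (fun _ => rfl) (fun _ _ => rfl) (fun _ _ => rfl) (fun _ _ => rfl)

end Additive

@[simp] theorem zero_lin (M N : GrMod 𝒜) : Hom.lin (0 : M ⟶ N) = 0 := rfl
@[simp] theorem add_lin {M N : GrMod 𝒜} (f g : M ⟶ N) :
    Hom.lin (f + g) = Hom.lin f + Hom.lin g := rfl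

instance : Preadditive (GrMod 𝒜) where
  add_comp _ _ _ f f' g := by ext x; exact map_add (Hom.lin g) _ _
  comp_add _ _ _ f g g' := rfl

/-- A bijective morphism has an inverse. -/
def inv {M N : GrMod 𝒜} (f : M ⟶ N) (hf : Function.Bijective (Hom.lin f)) : N ⟶ M :=
  ⟨(LinearEquiv.ofBijective (Hom.lin f) hf).symm.toLinearMap, fun {i n} hn => by
    obtain ⟨m, rfl⟩ := hf.2 n
    have h1 : (LinearEquiv.ofBijective (Hom.lin f) hf).symm (Hom.lin f m) = m :=
      (LinearEquiv.ofBijective (Hom.lin f) hf).symm_apply_apply m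
    change (LinearEquiv.ofBijective (Hom.lin f) hf).symm (Hom.lin f m) ∈ _
    rw [h1]
    have h2 : Hom.lin f (proj M.isInternal i m) = Hom.lin f m := by
      rw [← proj_map, proj_of_mem _ hn, if_pos rfl]
    rw [← hf.1 h2]
    exact proj_mem _ _ _⟩

theorem inv_comp {M N : GrMod 𝒜} (f : M ⟶ N) (hf : Function.Bijective (Hom.lin f)) :
    inv f hf ≫ f = 𝟙 N := by
  ext n
  exact (LinearEquiv.ofBijective (Hom.lin f) hf).apply_symm_apply n

theorem comp_inv {M N : GrMod 𝒜} (f : M ⟶ N) (hf : Function.Bijective (Hom.lin f)) :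
    f ≫ inv f hf = 𝟙 M := by
  ext n
  exact (LinearEquiv.ofBijective (Hom.lin f) hf).symm_apply_apply n

/-- The direct sum of two graded modules. -/
def directSum (M N : GrMod 𝒜) : GrMod 𝒜 where
  carrier := M.carrier × N.carrier
  gr i := (M.gr i).prod (N.gr i)
  isInternal := by
    classical
    refine isInternal_of ?_ ?_
    · intro s x hx h0 i hi
      have h1 : ∑ i ∈ s, (x i).1 = 0 := by rw [← Prod.fst_sum, h0]; rfl
      have h2 : ∑ i ∈ s, (x i).2 = 0 := by rw [← Prod.snd_sum, h0]; rfl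
      have h3 := proj_sum M.isInternal s (fun i => (x i).1) (fun i => (hx i).1) hi
      have h4 := proj_sum N.isInternal s (fun i => (x i).2) (fun i => (hx i).2) hi
      rw [h1, map_zero] at h3
      rw [h2, map_zero] at h4
      exact Prod.ext h3.symm h4.symm
    · rintro ⟨m, n⟩
      obtain ⟨s, hs, hs'⟩ := exists_sum_proj M.isInternal m
      obtain ⟨t, ht, ht'⟩ := exists_sum_proj N.isInternal n
      refine ⟨s ∪ t, fun i => (proj M.isInternal i m, proj N.isInternal i n),
        fun i => ⟨proj_mem M.isInternal i m, proj_mem N.isInternal i n⟩, ?_⟩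
      have e1 : ∑ i ∈ s ∪ t, proj M.isInternal i m = m := by
        rw [← Finset.sum_subset Finset.subset_union_left (fun i _ h => hs i h), hs']
      have e2 : ∑ i ∈ s ∪ t, proj N.isInternal i n = n := by
        rw [← Finset.sum_subset Finset.subset_union_right (fun i _ h => ht i h), ht']
      rw [sum_mk, e1, e2]
  smul_mem hr hm := ⟨M.smul_mem hr hm.1, N.smul_mem hr hm.2⟩
  finite := inferInstance

/-- The direct sum of two graded modules, as a biproduct. -/
def biproductBicone (M N : GrMod 𝒜) : BinaryBicone M N where
  pt := directSum M N
  fst := ⟨LinearMap.fst R M.carrier N.carrier, fun h => h.1⟩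
  snd := ⟨LinearMap.snd R M.carrier N.carrier, fun h => h.2⟩
  inl := ⟨LinearMap.inl R M.carrier N.carrier, fun h => ⟨h, (N.gr _).zero_mem⟩⟩
  inr := ⟨LinearMap.inr R M.carrier N.carrier, fun h => ⟨(M.gr _).zero_mem, h⟩⟩
  inl_fst := rfl
  inl_snd := rfl
  inr_fst := rfl
  inr_snd := rfl

instance : HasBinaryBiproducts (GrMod 𝒜) where
  has_binary_biproduct M N := hasBinaryBiproduct_of_total (biproductBicone M N) (by
    apply hom_ext
    apply LinearMap.ext
    intro (x : M.carrier × N.carrier)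
    exact Prod.ext (add_zero x.1) (zero_add x.2))

/-- The zero graded module. -/
def zero : GrMod 𝒜 where
  carrier := PUnit
  gr _ := ⊤
  isInternal := isInternal_of (fun _ _ _ _ _ _ => rfl) (fun _ => ⟨∅, fun _ => 0, by simp, rfl⟩)
  smul_mem _ _ := trivial
  finite := inferInstance

theorem isZero_zero : IsZero (zero : GrMod 𝒜) := by
  rw [IsZero.iff_id_eq_zero]; rfl

instance : HasZeroObject (GrMod 𝒜) := ⟨zero, isZero_zero⟩

instance : HasFiniteProducts (GrMod 𝒜) :=
  haveI : HasTerminal (GrMod 𝒜) := isZero_zero.isTerminal.hasTerminal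
  hasFiniteProducts_of_has_binary_and_terminal

variable [IsNoetherianRing R]

/-- The kernel of a morphism of graded modules. -/
def ker {M N : GrMod 𝒜} (f : M ⟶ N) : GrMod 𝒜 where
  carrier := LinearMap.ker (Hom.lin f)
  gr i := (M.gr i).comap (LinearMap.ker (Hom.lin f)).subtype.toAddMonoidHom
  isInternal := by
    refine isInternal_of ?_ ?_
    · intro s x hx h0 i hi
      have h1 := congrArg (LinearMap.ker (Hom.lin f)).subtype h0
      rw [map_sum, map_zero] at h1
      apply Subtype.ext
      have := proj_sum M.isInternal s (fun i => (x i : M.carrier)) hx hi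
      rw [← this]
      change proj M.isInternal i (∑ i ∈ s, (LinearMap.ker (Hom.lin f)).subtype (x i)) = _
      rw [h1, map_zero]; rfl
    · rintro ⟨m, hm⟩
      obtain ⟨s, hs, hs'⟩ := exists_sum_proj M.isInternal m
      refine ⟨s, fun i => ⟨proj M.isInternal i m, ?_⟩, fun i => proj_mem M.isInternal i m, ?_⟩
      · rw [LinearMap.mem_ker, ← proj_map, LinearMap.mem_ker.1 hm, map_zero]
      · apply (LinearMap.ker (Hom.lin f)).subtype_injective
        rw [map_sum]
        exact hs'.symm
  smul_mem hr hm := M.smul_mem hr hm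
  finite := inferInstance

/-- The cokernel of a morphism of graded modules. -/
def coker {M N : GrMod 𝒜} (f : M ⟶ N) : GrMod 𝒜 where
  carrier := N.carrier ⧸ LinearMap.range (Hom.lin f)
  gr i := (N.gr i).map (LinearMap.range (Hom.lin f)).mkQ.toAddMonoidHom
  isInternal := by
    refine isInternal_of ?_ ?_
    · intro s x hx h0 i hi
      choose y hy hxy using hx
      have h1 : (LinearMap.range (Hom.lin f)).mkQ (∑ i ∈ s, y i) = 0 := by
        rw [map_sum, ← h0]
        exact Finset.sum_congr rfl fun i _ => hxy i
      rw [Submodule.mkQ_apply, Submodule.Quotient.mk_eq_zero] at h1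
      obtain ⟨m, hm⟩ := h1
      rw [← hxy i, ← proj_sum N.isInternal s y hy hi, ← hm, proj_map]
      exact (Submodule.Quotient.mk_eq_zero _).2 ⟨_, rfl⟩
    · intro n
      obtain ⟨n, rfl⟩ := (LinearMap.range (Hom.lin f)).mkQ_surjective n
      obtain ⟨s, hs, hs'⟩ := exists_sum_proj N.isInternal n
      refine ⟨s, fun i => (LinearMap.range (Hom.lin f)).mkQ (proj N.isInternal i n),
        fun i => ⟨_, proj_mem _ _ _, rfl⟩, ?_⟩
      rw [← map_sum, hs']
  smul_mem := by
    rintro i j r _ hr ⟨m, hm, rfl⟩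
    exact ⟨r • m, N.smul_mem hr hm, rfl⟩
  finite := inferInstance

/-- The inclusion of the kernel. -/
def kerι {M N : GrMod 𝒜} (f : M ⟶ N) : ker f ⟶ M :=
  ⟨(LinearMap.ker (Hom.lin f)).subtype, fun h => h⟩

/-- The projection onto the cokernel. -/
def cokerπ {M N : GrMod 𝒜} (f : M ⟶ N) : N ⟶ coker f :=
  ⟨(LinearMap.range (Hom.lin f)).mkQ, fun h => ⟨_, h, rfl⟩⟩

theorem kerι_comp {M N : GrMod 𝒜} (f : M ⟶ N) : kerι f ≫ f = 0 := by
  apply hom_ext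
  apply LinearMap.ext
  rintro ⟨m, hm⟩
  exact hm

theorem comp_cokerπ {M N : GrMod 𝒜} (f : M ⟶ N) : f ≫ cokerπ f = 0 := by
  apply hom_ext
  apply LinearMap.ext
  intro m
  exact (Submodule.Quotient.mk_eq_zero _).2 ⟨m, rfl⟩

theorem lin_apply_eq_zero {L M N : GrMod 𝒜} {g : L ⟶ M} {f : M ⟶ N} (h : g ≫ f = 0)
    (x : L.carrier) : Hom.lin f (Hom.lin g x) = 0 :=
  LinearMap.congr_fun (congrArg (fun a : L ⟶ N => Hom.lin a) h) x

/-- Lifting to the kernel. -/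
def kerLift {L M N : GrMod 𝒜} (f : M ⟶ N) (g : L ⟶ M) (h : g ≫ f = 0) : L ⟶ ker f :=
  ⟨(Hom.lin g).codRestrict _ (fun x => lin_apply_eq_zero h x), fun hx => Hom.map_mem g hx⟩

/-- Descending to the cokernel. -/
def cokerDesc {L M N : GrMod 𝒜} (f : M ⟶ N) (g : N ⟶ L) (h : f ≫ g = 0) : coker f ⟶ L :=
  ⟨(LinearMap.range (Hom.lin f)).liftQ (Hom.lin g) (by
    rintro _ ⟨x, rfl⟩
    exact lin_apply_eq_zero h x), by
    rintro i _ ⟨n, hn, rfl⟩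
    exact Hom.map_mem g hn⟩

/-- The kernel is a kernel. -/
def kerIsLimit {M N : GrMod 𝒜} (f : M ⟶ N) :
    IsLimit (KernelFork.ofι (kerι f) (kerι_comp f)) :=
  KernelFork.IsLimit.ofι _ _ (fun g h => kerLift f g h) (fun _ _ => rfl) (fun g h m hm => by
    subst hm; rfl)

/-- The cokernel is a cokernel. -/
def cokerIsColimit {M N : GrMod 𝒜} (f : M ⟶ N) :
    IsColimit (CokernelCofork.ofπ (cokerπ f) (comp_cokerπ f)) :=
  CokernelCofork.IsColimit.ofπ _ _ (fun g h => cokerDesc f g h) (fun _ _ => rfl)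
    (fun g h m hm => by
      subst hm
      apply hom_ext
      apply LinearMap.ext
      intro x
      obtain ⟨x, rfl⟩ := (LinearMap.range (Hom.lin f)).mkQ_surjective x
      rfl)

instance : HasKernels (GrMod 𝒜) := ⟨fun f => ⟨⟨_, kerIsLimit f⟩⟩⟩
instance : HasCokernels (GrMod 𝒜) := ⟨fun f => ⟨⟨_, cokerIsColimit f⟩⟩⟩

theorem injective_of_mono {M N : GrMod 𝒜} (f : M ⟶ N) [Mono f] :
    Function.Injective (Hom.lin f) := by
  have h : kerι f = 0 := by rw [← cancel_mono f, kerι_comp, zero_comp]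
  rw [← LinearMap.ker_eq_bot, eq_bot_iff]
  intro x hx
  exact LinearMap.congr_fun (congrArg (fun a : ker f ⟶ M => Hom.lin a) h) ⟨x, hx⟩

theorem surjective_of_epi {M N : GrMod 𝒜} (f : M ⟶ N) [Epi f] :
    Function.Surjective (Hom.lin f) := by
  have h : cokerπ f = 0 := by rw [← cancel_epi f, comp_cokerπ, comp_zero]
  intro x
  have := LinearMap.congr_fun (congrArg (fun a : N ⟶ coker f => Hom.lin a) h) x
  exact (Submodule.Quotient.mk_eq_zero _).1 this

instance {M N : GrMod 𝒜} (f : M ⟶ N) [Mono f] [Epi f] : IsIso f :=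
  have hf := And.intro (injective_of_mono f) (surjective_of_epi f)
  ⟨inv f hf, comp_inv f hf, inv_comp f hf⟩

theorem kerLift_bijective {M N : GrMod 𝒜} (f : M ⟶ N) [Mono f] :
    Function.Bijective (Hom.lin (kerLift (cokerπ f) f (comp_cokerπ f))) := by
  constructor
  · intro x y h
    exact injective_of_mono f (congrArg Subtype.val h)
  · rintro ⟨y, hy⟩
    obtain ⟨x, rfl⟩ := (Submodule.Quotient.mk_eq_zero _).1 hy
    exact ⟨x, rfl⟩

theorem cokerDesc_bijective {M N : GrMod 𝒜} (f : M ⟶ N) [Epi f] :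
    Function.Bijective (Hom.lin (cokerDesc (kerι f) f (kerι_comp f))) := by
  constructor
  · rw [injective_iff_map_eq_zero]
    intro x hx
    obtain ⟨x, rfl⟩ := (LinearMap.range (Hom.lin (kerι f))).mkQ_surjective x
    exact (Submodule.Quotient.mk_eq_zero _).2 ⟨⟨x, hx⟩, rfl⟩
  · intro y
    obtain ⟨x, rfl⟩ := surjective_of_epi f y
    exact ⟨(LinearMap.range (Hom.lin (kerι f))).mkQ x, rfl⟩

theorem inv_kerLift_comp {M N : GrMod 𝒜} (f : M ⟶ N) [Mono f] :
    inv _ (kerLift_bijective f) ≫ f = kerι (cokerπ f) :=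
  calc inv _ (kerLift_bijective f) ≫ f
      = inv _ (kerLift_bijective f) ≫ kerLift (cokerπ f) f (comp_cokerπ f) ≫ kerι (cokerπ f) := rfl
    _ = kerι (cokerπ f) := by rw [← Category.assoc, inv_comp, Category.id_comp]

theorem comp_inv_cokerDesc {M N : GrMod 𝒜} (f : M ⟶ N) [Epi f] :
    f ≫ inv _ (cokerDesc_bijective f) = cokerπ (kerι f) :=
  calc f ≫ inv _ (cokerDesc_bijective f)
      = (cokerπ (kerι f) ≫ cokerDesc (kerι f) f (kerι_comp f)) ≫ inv _ (cokerDesc_bijective f) :=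
        rfl
    _ = cokerπ (kerι f) := by rw [Category.assoc, comp_inv, Category.comp_id]

instance : IsNormalMonoCategory (GrMod 𝒜) where
  normalMonoOfMono f _ := ⟨{
    Z := coker f
    g := cokerπ f
    w := comp_cokerπ f
    isLimit := KernelFork.IsLimit.ofι _ _
      (fun g h => kerLift (cokerπ f) g h ≫ inv _ (kerLift_bijective f))
      (fun g h => by
        rw [Category.assoc, inv_kerLift_comp]
        rfl)
      (fun g h m hm => by
        rw [← cancel_mono f, hm]
        rw [Category.assoc, inv_kerLift_comp]
        rfl) }⟩

instance : IsNormalEpiCategory (GrMod 𝒜) where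
  normalEpiOfEpi f _ := ⟨{
    W := ker f
    g := kerι f
    w := kerι_comp f
    isColimit := CokernelCofork.IsColimit.ofπ _ _
      (fun g h => inv _ (cokerDesc_bijective f) ≫ cokerDesc (kerι f) g h)
      (fun g h => by
        rw [← Category.assoc, comp_inv_cokerDesc]
        rfl)
      (fun g h m hm => by
        rw [← cancel_epi f, hm]
        rw [← Category.assoc, comp_inv_cokerDesc]
        rfl) }⟩

instance : Abelian (GrMod 𝒜) where


end GrMod

/-- The shift `M(p)` of a graded module, `M(p)_n = M_{n+p}`. -/
def GrMod.shift {𝒜 : ℕ → Submodule k R} (M : GrMod 𝒜) (p : ℤ) : GrMod 𝒜 where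
  carrier := M.carrier
  gr n := M.gr (n + p)
  isInternal := by
    refine isInternal_of' ?_ ?_
    · intro s x hx h0 i hi
      have h1 := proj_sum M.isInternal (s.map (Equiv.addRight p).toEmbedding)
        (fun j => x (j - p)) (fun j => by simpa using hx (j - p))
        (i := i + p) (Finset.mem_map.2 ⟨i, hi, rfl⟩)
      rw [Finset.sum_map] at h1
      simpa [h0] using h1.symm
    · intro q hq m
      obtain ⟨s, _, hs⟩ := exists_sum_proj M.isInternal m
      rw [← hs]
      exact q.sum_mem fun i _ => hq (i - p) _ (by simpa using proj_mem M.isInternal i m)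
  smul_mem hr hm := by
    rw [add_assoc]
    exact M.smul_mem hr hm
  finite := M.finite

/-- An `ℕ`-grading regarded as a `ℤ`-grading. -/
def intGr (𝒜 : ℕ → Submodule k R) : ℤ → Submodule k R
  | Int.ofNat n => 𝒜 n
  | Int.negSucc _ => ⊥

theorem intGr_isInternal (𝒜 : ℕ → Submodule k R) [GradedAlgebra 𝒜] :
    DirectSum.IsInternal (intGr 𝒜) := by
  have h := DirectSum.Decomposition.isInternal 𝒜
  refine isInternal_of' ?_ ?_
  · intro s x hx h0 i hi
    have hneg : ∀ n : ℕ, x (Int.negSucc n) = 0 := fun n => hx (Int.negSucc n)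
    cases i with
    | negSucc n => exact hneg n
    | ofNat n =>
      have h1 := congrArg (proj h n) h0
      rw [map_sum, map_zero, Finset.sum_eq_single (Int.ofNat n)] at h1
      · rwa [proj_of_mem h (hx (Int.ofNat n)), if_pos rfl] at h1
      · rintro (m | m) _ hm
        · rw [proj_of_mem h (hx (Int.ofNat m)), if_neg (by rintro rfl; exact hm rfl)]
        · rw [hneg m, map_zero]
      · intro h; exact absurd hi h
  · intro q hq m
    obtain ⟨s, _, hs⟩ := exists_sum_proj h m
    rw [← hs]
    exact q.sum_mem fun i _ => hq (Int.ofNat i) _ (proj_mem h i m)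

theorem mul_mem_intGr (𝒜 : ℕ → Submodule k R) [GradedAlgebra 𝒜] {i : ℕ} {j : ℤ} {r a : R}
    (hr : r ∈ 𝒜 i) (ha : a ∈ intGr 𝒜 j) : r * a ∈ intGr 𝒜 (i + j) := by
  cases j with
  | ofNat j => exact SetLike.GradedMul.mul_mem (A := 𝒜) hr ha
  | negSucc j =>
    have : a = 0 := ha
    rw [this, mul_zero]
    exact Submodule.zero_mem _

theorem intGr_mul_mem (𝒜 : ℕ → Submodule k R) [GradedAlgebra 𝒜] {i : ℤ} {j : ℕ} {r a : R}
    (hr : r ∈ intGr 𝒜 i) (ha : a ∈ 𝒜 j) : r * a ∈ intGr 𝒜 (i + j) := by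
  cases i with
  | ofNat i => exact SetLike.GradedMul.mul_mem (A := 𝒜) hr ha
  | negSucc j =>
    have : r = 0 := hr
    rw [this, zero_mul]
    exact Submodule.zero_mem _

/-- A graded algebra as a graded module over itself. -/
def GrMod.regular (𝒜 : ℕ → Submodule k R) [GradedAlgebra 𝒜] : GrMod 𝒜 where
  carrier := R
  gr n := (intGr 𝒜 n).toAddSubgroup
  isInternal := intGr_isInternal 𝒜
  smul_mem hr ha := mul_mem_intGr 𝒜 hr ha
  finite := inferInstance

theorem GrMod.proj_smul {𝒜 : ℕ → Submodule k R} (M : GrMod 𝒜) {a : ℕ} {r : R} (hr : r ∈ 𝒜 a)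
    (i : ℤ) (m : M.carrier) :
    proj M.isInternal (a + i) (r • m) = r • proj M.isInternal i m := by
  refine homogeneous_induction M.isInternal (P := fun m =>
    proj M.isInternal (a + i) (r • m) = r • proj M.isInternal i m) ?_ ?_ ?_ m
  · simp
  · intro m n hm hn
    rw [smul_add, map_add, map_add, smul_add, hm, hn]
  · intro j m hm
    rw [proj_of_mem M.isInternal hm, proj_of_mem M.isInternal (M.smul_mem hr hm)]
    simp only [add_right_inj]
    split_ifs <;> simp

theorem GrMod.exists_support {𝒜 : ℕ → Submodule k R} [GradedAlgebra 𝒜] [Module.Finite k R]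
    (M : GrMod 𝒜) : ∃ S : Finset ℤ, ∀ i ∉ S, ∀ m ∈ M.gr i, m = 0 := by
  classical
  let _ : Module k M.carrier := Module.compHom M.carrier (algebraMap k R)
  have : IsScalarTower k R M.carrier := IsScalarTower.of_algebraMap_smul fun _ _ => rfl
  have : Module.Finite k M.carrier := Module.Finite.trans R M.carrier
  obtain ⟨T, hT⟩ := Module.Finite.fg_top (R := k) (M := M.carrier)
  choose s hs hs' using exists_sum_proj M.isInternal
  refine ⟨T.biUnion s, fun i hi m hm => ?_⟩
  have key : ∀ m : M.carrier, proj M.isInternal i m = 0 := by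
    intro m
    have hm : m ∈ Submodule.span k (T : Set M.carrier) := by rw [hT]; trivial
    induction hm using Submodule.span_induction with
    | mem x hx =>
      exact hs x i fun h => hi (Finset.mem_biUnion.2 ⟨x, hx, h⟩)
    | zero => simp
    | add x y _ _ hx hy => rw [map_add, hx, hy, add_zero]
    | smul c x _ hx =>
      have := M.proj_smul (SetLike.algebraMap_mem_graded 𝒜 c) i x
      rw [hx, smul_zero, Nat.cast_zero, zero_add] at this
      exact this
  have := key m
  rwa [proj_of_mem M.isInternal hm, if_pos rfl] at this

/-! ### The `R`-dual of a graded module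

For a graded algebra `R` with a degree preserving anti-endomorphism `σ`, the graded right `R`-module
`Hom_R(M, R)` is regarded as a graded left `R`-module by means of `σ`. -/

section Dual

variable {𝒜 : ℕ → Submodule k R} (σ : R →ₐ[k] Rᵐᵒᵖ)

/-- The abelian group `Hom_R(M, R)`, with the `R`-module structure
`(r • f) m = f m * σ r`. -/
def DualCarrier (_ : R →ₐ[k] Rᵐᵒᵖ) (M : Type u) [AddCommGroup M] [Module R M] : Type u :=
  M →ₗ[R] R

namespace DualCarrier

variable (M : Type u) [AddCommGroup M] [Module R M]

instance : AddCommGroup (DualCarrier σ M) := inferInstanceAs (AddCommGroup (M →ₗ[R] R))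

instance : SMul R (DualCarrier σ M) where
  smul r f := (LinearMap.toSpanSingleton R R (σ r).unop).comp (f : M →ₗ[R] R)

theorem smul_apply (r : R) (f : DualCarrier σ M) (m : M) :
    (show M →ₗ[R] R from r • f) m = (show M →ₗ[R] R from f) m * (σ r).unop := rfl

instance : Module R (DualCarrier σ M) where
  one_smul f := by
    apply LinearMap.ext; intro m
    exact (smul_apply σ M 1 f m).trans (by simp)
  mul_smul r s f := by
    apply LinearMap.ext; intro m
    refine (smul_apply σ M _ f m).trans ?_
    refine Eq.trans ?_ (smul_apply σ M r _ m).symm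
    rw [smul_apply, map_mul, MulOpposite.unop_mul, mul_assoc]
  smul_zero r := by
    apply LinearMap.ext; intro m
    exact (smul_apply σ M r 0 m).trans (zero_mul _)
  smul_add r f g := by
    apply LinearMap.ext; intro m
    exact (smul_apply σ M r (f + g) m).trans (add_mul _ _ _)
  add_smul r s f := by
    apply LinearMap.ext; intro m
    refine (smul_apply σ M _ f m).trans ?_
    rw [map_add, MulOpposite.unop_add, mul_add]; rfl
  zero_smul f := by
    apply LinearMap.ext; intro m
    refine (smul_apply σ M _ f m).trans ?_
    rw [map_zero, MulOpposite.unop_zero, mul_zero]; rfl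

theorem finite [Module.Finite k R] [Module.Finite R M] : Module.Finite R (DualCarrier σ M) := by
  let _ : Module k M := Module.compHom M (algebraMap k R)
  have : IsScalarTower k R M := IsScalarTower.of_algebraMap_smul fun _ _ => rfl
  have : Module.Finite k M := Module.Finite.trans R M
  have : Module.Finite k (M →ₗ[R] R) :=
    Module.Finite.of_injective (LinearMap.restrictScalarsₗ k R M R k)
      (LinearMap.restrictScalars_injective k)
  let _ : Module k (DualCarrier σ M) := inferInstanceAs (Module k (M →ₗ[R] R))
  have : Module.Finite k (DualCarrier σ M) := inferInstanceAs (Module.Finite k (M →ₗ[R] R))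
  have : IsScalarTower k R (DualCarrier σ M) := IsScalarTower.of_algebraMap_smul fun c f => by
    apply LinearMap.ext; intro m
    refine (smul_apply σ M _ f m).trans ?_
    rw [AlgHom.commutes, MulOpposite.algebraMap_apply, MulOpposite.unop_op, ← Algebra.commutes,
      ← Algebra.smul_def]
    rfl
  exact Module.Finite.of_restrictScalars_finite k R _

end DualCarrier

variable [GradedAlgebra 𝒜] [Module.Finite k R]

/-- The component of degree `p` of a linear map between graded modules. -/
theorem GrMod.exists_component (M N : GrMod 𝒜) (f : M.carrier →ₗ[R] N.carrier) (p : ℤ) :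
    ∃ g : M.carrier →ₗ[R] N.carrier,
      ∀ i, ∀ m ∈ M.gr i, g m = proj N.isInternal (i + p) (f m) := by
  obtain ⟨S, hS⟩ := M.exists_support
  let g : M.carrier →+ N.carrier := ∑ i ∈ S,
    (proj N.isInternal (i + p)).comp (f.toAddMonoidHom.comp (proj M.isInternal i))
  have hg : ∀ i, ∀ m ∈ M.gr i, g m = proj N.isInternal (i + p) (f m) := by
    intro i m hm
    by_cases hi : i ∈ S
    · simp only [g, AddMonoidHom.finsetSum_apply, AddMonoidHom.comp_apply]
      rw [Finset.sum_eq_single i]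
      · rw [proj_of_mem M.isInternal hm, if_pos rfl]; rfl
      · intro j _ hj
        rw [proj_of_mem M.isInternal hm, if_neg hj, map_zero, map_zero]
      · intro h; exact absurd hi h
    · rw [hS i hi m hm]; simp
  refine ⟨{ g with map_smul' := ?_ }, hg⟩
  intro r m
  change g (r • m) = r • g m
  refine homogeneous_induction (DirectSum.Decomposition.isInternal 𝒜) (P := fun r =>
    g (r • m) = r • g m) (by simp) (fun r s hr hs => ?_) (fun a r hr => ?_) r
  · rw [add_smul, map_add, hr, hs, add_smul]
  · refine homogeneous_induction M.isInternal (P := fun m => g (r • m) = r • g m) (by simp)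
      (fun m n hm hn => ?_) (fun i m hm => ?_) m
    · rw [smul_add, map_add, hm, hn, map_add, smul_add]
    · rw [hg _ _ (M.smul_mem hr hm), hg _ _ hm, ← N.proj_smul hr, map_smul, add_assoc]

theorem GrMod.exists_sum_component (M N : GrMod 𝒜) (f : M.carrier →ₗ[R] N.carrier) :
    ∃ (s : Finset ℤ) (g : ℤ → M.carrier →ₗ[R] N.carrier),
      (∀ p i, ∀ m ∈ M.gr i, g p m ∈ N.gr (i + p)) ∧ f = ∑ p ∈ s, g p := by
  classical
  obtain ⟨S, hS⟩ := M.exists_support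
  obtain ⟨U, hU⟩ := N.exists_support
  choose g hg using GrMod.exists_component M N f
  refine ⟨(U ×ˢ S).image fun x => x.1 - x.2, g, fun p i m hm => ?_, ?_⟩
  · rw [hg p i m hm]
    exact proj_mem _ _ _
  · apply LinearMap.ext
    intro m
    rw [LinearMap.sum_apply]
    refine homogeneous_induction M.isInternal (P := fun m =>
      f m = ∑ p ∈ (U ×ˢ S).image fun x => x.1 - x.2, g p m)
      (by simp) (fun m n hm hn => ?_) (fun i m hm => ?_) m
    · simp only [map_add, Finset.sum_add_distrib]
      rw [hm, hn]
    · by_cases hi : i ∈ S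
      · have h1 : ∑ p ∈ (U ×ˢ S).image (fun x => x.1 - x.2), g p m =
            ∑ j ∈ U, proj N.isInternal j (f m) := by
          symm
          have e : ∑ j ∈ U, proj N.isInternal j (f m) =
              ∑ p ∈ U.map (Equiv.subRight i).toEmbedding, proj N.isInternal (i + p) (f m) := by
            rw [Finset.sum_map]; simp
          rw [e]
          refine (Finset.sum_subset ?_ ?_).trans
            (Finset.sum_congr rfl fun p _ => (hg p i m hm).symm)
          · intro p hp
            obtain ⟨j, hj, rfl⟩ := Finset.mem_map.1 hp
            exact Finset.mem_image.2 ⟨(j, i), Finset.mem_product.2 ⟨hj, hi⟩, rfl⟩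
          · intro p _ hp
            refine hU _ (fun h => hp ?_) _ (proj_mem N.isInternal (i + p) (f m))
            exact Finset.mem_map.2 ⟨i + p, h, by simp⟩
        rw [h1]
        obtain ⟨s, hs, hs'⟩ := exists_sum_proj N.isInternal (f m)
        rw [← hs']
        conv_rhs => rw [hs']
        rw [Finset.sum_subset (Finset.subset_union_left (s₂ := U)) fun i _ h => hs i h]
        exact (Finset.sum_subset Finset.subset_union_right
          fun i _ h => hU i h _ (proj_mem _ _ _)).symm
      · rw [hS i hi m hm]; simp

/-- The dual `Hom_R(M, R)` of a graded module; its component of degree `p` consists of the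
`R`-linear maps which raise degrees by `p`. -/
def GrMod.dual (hσ : ∀ i, ∀ r ∈ 𝒜 i, (σ r).unop ∈ 𝒜 i) (M : GrMod 𝒜) : GrMod 𝒜 where
  carrier := DualCarrier σ M.carrier
  gr p :=
    { carrier := {f : M.carrier →ₗ[R] R | ∀ (i : ℤ), ∀ m ∈ M.gr i, f m ∈ intGr 𝒜 (i + p)}
      add_mem' := fun hf hg i m hm => Submodule.add_mem _ (hf i m hm) (hg i m hm)
      zero_mem' := fun i m _ => Submodule.zero_mem _
      neg_mem' := fun hf i m hm => Submodule.neg_mem _ (hf i m hm) }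
  isInternal := by
    classical
    refine isInternal_of ?_ ?_
    · intro s x hx h0 p hp
      apply LinearMap.ext
      intro m
      refine homogeneous_induction M.isInternal
        (P := fun m => (show M.carrier →ₗ[R] R from x p) m = 0) (map_zero _)
        (fun m n hm hn => by rw [map_add, hm, hn, add_zero]) (fun i m hm => ?_) m
      have h1 : ∑ q ∈ s, (show M.carrier →ₗ[R] R from x q) m = 0 := by
        have := LinearMap.congr_fun (show (∑ q ∈ s, (show M.carrier →ₗ[R] R from x q)) = 0 from h0) m
        rwa [LinearMap.sum_apply] at this
      have h2 := congrArg (proj (intGr_isInternal 𝒜) (i + p)) h1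
      rw [map_sum, map_zero, Finset.sum_eq_single p] at h2
      · rwa [proj_of_mem _ (hx p i m hm), if_pos rfl] at h2
      · intro q _ hq
        rw [proj_of_mem _ (hx q i m hm), if_neg (by simpa using hq.symm)]
      · intro h; exact absurd hp h
    · intro f
      exact GrMod.exists_sum_component M (GrMod.regular 𝒜) f
  smul_mem := by
    intro i j r f hr hf l m hm
    have := intGr_mul_mem 𝒜 (hf l m hm) (hσ i r hr)
    rwa [add_assoc, add_comm j] at this
  finite := DualCarrier.finite σ M.carrier

/-- The contravariant functor `Hom_R(-, R)` on graded modules. -/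
def GrMod.dualFunctor (hσ : ∀ i, ∀ r ∈ 𝒜 i, (σ r).unop ∈ 𝒜 i) : (GrMod 𝒜)ᵒᵖ ⥤ GrMod 𝒜 where
  obj M := GrMod.dual σ hσ M.unop
  map {M N} f :=
    { lin :=
        { toFun := fun g => LinearMap.comp (show M.unop.carrier →ₗ[R] R from g) (Hom.lin f.unop)
          map_add' := fun _ _ => rfl
          map_smul' := fun _ _ => rfl }
      map_mem := fun {p} g hg i m hm => hg i _ (Hom.map_mem f.unop hm) }
  map_id _ := rfl
  map_comp _ _ := rfl

instance (hσ : ∀ i, ∀ r ∈ 𝒜 i, (σ r).unop ∈ 𝒜 i) : (GrMod.dualFunctor σ hσ).Additive where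
  map_add {M N f g} := by
    apply GrMod.hom_ext
    apply LinearMap.ext
    intro h
    apply LinearMap.ext
    intro m
    exact map_add (show M.unop.carrier →ₗ[R] R from h) _ _

end Dual

end GrMod

/-! ### Graded bimodules -/

section Bimodule

variable {k : Type u} [Field k] {A : Type u} [Ring A] [Algebra k A]

/-- The grading of the enveloping algebra `A ⊗ Aᵒᵖ` of a graded algebra: the component of degree
`n` is `⨁_{i + j = n} A_i ⊗ A_j`. -/
def envGr (𝒜 : ℕ → Submodule k A) (n : ℕ) : Submodule k (A ⊗[k] Aᵐᵒᵖ) :=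
  Submodule.span k {x | ∃ (i j : ℕ) (a b : A), i + j = n ∧ a ∈ 𝒜 i ∧ b ∈ 𝒜 j ∧
    x = a ⊗ₜ[k] MulOpposite.op b}

/-- The projection onto the component of degree `n` of the enveloping algebra. -/
def envProj (𝒜 : ℕ → Submodule k A) [GradedAlgebra 𝒜] (n : ℕ) :
    A ⊗[k] Aᵐᵒᵖ →ₗ[k] A ⊗[k] Aᵐᵒᵖ :=
  ∑ x ∈ Finset.HasAntidiagonal.antidiagonal n, TensorProduct.map (GradedAlgebra.proj 𝒜 x.1)
    ((MulOpposite.opLinearEquiv k).toLinearMap.comp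
      ((GradedAlgebra.proj 𝒜 x.2).comp (MulOpposite.opLinearEquiv k).symm.toLinearMap))

theorem gradedAlgebra_proj_of_mem (𝒜 : ℕ → Submodule k A) [GradedAlgebra 𝒜] {i : ℕ} {a : A}
    (ha : a ∈ 𝒜 i) (j : ℕ) : GradedAlgebra.proj 𝒜 j a = if j = i then a else 0 := by
  rw [GradedAlgebra.proj_apply]
  split_ifs with h
  · subst h; exact DirectSum.decompose_of_mem_same _ ha
  · exact DirectSum.decompose_of_mem_ne _ ha (Ne.symm h)

theorem envProj_of_mem (𝒜 : ℕ → Submodule k A) [GradedAlgebra 𝒜] {n : ℕ} {x : A ⊗[k] Aᵐᵒᵖ}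
    (hx : x ∈ envGr 𝒜 n) (m : ℕ) : envProj 𝒜 m x = if m = n then x else 0 := by
  induction hx using Submodule.span_induction with
  | mem x hx =>
    obtain ⟨i, j, a, b, hij, ha, hb, rfl⟩ := hx
    have h1 : ∀ y ∈ Finset.HasAntidiagonal.antidiagonal m, TensorProduct.map (GradedAlgebra.proj 𝒜 y.1)
        ((MulOpposite.opLinearEquiv k).toLinearMap.comp ((GradedAlgebra.proj 𝒜 y.2).comp
          (MulOpposite.opLinearEquiv k).symm.toLinearMap)) (a ⊗ₜ[k] MulOpposite.op b) =
        if y = (i, j) then a ⊗ₜ[k] MulOpposite.op b else 0 := by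
      rintro ⟨p, q⟩ _
      rw [TensorProduct.map_tmul, gradedAlgebra_proj_of_mem 𝒜 ha]
      simp only [LinearMap.comp_apply, LinearEquiv.coe_coe, MulOpposite.coe_opLinearEquiv_symm,
        MulOpposite.unop_op, gradedAlgebra_proj_of_mem 𝒜 hb, Prod.mk.injEq]
      by_cases hp : p = i <;> by_cases hq : q = j <;> simp [hp, hq]
    rw [envProj, LinearMap.sum_apply, Finset.sum_congr rfl h1, Finset.sum_ite_eq']
    simp only [Finset.HasAntidiagonal.mem_antidiagonal, hij, eq_comm]
  | zero => simp
  | add x y _ _ hx hy => rw [map_add, hx, hy]; split_ifs <;> simp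
  | smul c x _ hx => rw [map_smul, hx]; split_ifs <;> simp

theorem envGr_isInternal (𝒜 : ℕ → Submodule k A) [GradedAlgebra 𝒜] :
    DirectSum.IsInternal (envGr 𝒜) := by
  refine isInternal_of' ?_ ?_
  · intro s x hx h0 i hi
    have h1 := congrArg (envProj 𝒜 i) h0
    rw [map_sum, map_zero, Finset.sum_eq_single i] at h1
    · rwa [envProj_of_mem 𝒜 (hx i), if_pos rfl] at h1
    · intro j _ hj
      rw [envProj_of_mem 𝒜 (hx j), if_neg hj.symm]
    · intro h; exact absurd hi h
  · intro p hp m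
    have h := DirectSum.Decomposition.isInternal 𝒜
    induction m using TensorProduct.induction_on with
    | zero => exact p.zero_mem
    | add x y hx hy => exact p.add_mem hx hy
    | tmul a b =>
      obtain ⟨b, rfl⟩ := MulOpposite.op_surjective b
      refine homogeneous_induction h (P := fun a => a ⊗ₜ[k] MulOpposite.op b ∈ p) ?_ ?_ ?_ a
      · rw [TensorProduct.zero_tmul]; exact p.zero_mem
      · intro a a' ha ha'
        rw [TensorProduct.add_tmul]; exact p.add_mem ha ha'
      · intro i a ha
        refine homogeneous_induction h (P := fun b => a ⊗ₜ[k] MulOpposite.op b ∈ p) ?_ ?_ ?_ b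
        · rw [MulOpposite.op_zero, TensorProduct.tmul_zero]; exact p.zero_mem
        · intro b b' hb hb'
          rw [MulOpposite.op_add, TensorProduct.tmul_add]; exact p.add_mem hb hb'
        · intro j b hb
          exact hp (i + j) _ (Submodule.subset_span ⟨i, j, a, b, rfl, ha, hb, rfl⟩)

instance envGradedAlgebra (𝒜 : ℕ → Submodule k A) [GradedAlgebra 𝒜] :
    GradedAlgebra (envGr 𝒜) where
  one_mem := Submodule.subset_span ⟨0, 0, 1, 1, rfl, SetLike.GradedOne.one_mem,
    SetLike.GradedOne.one_mem, rfl⟩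
  mul_mem := by
    intro m n x y hx hy
    induction hx using Submodule.span_induction with
    | zero => rw [zero_mul]; exact Submodule.zero_mem _
    | add x x' _ _ hx hx' => rw [add_mul]; exact Submodule.add_mem _ hx hx'
    | smul c x _ hx => rw [smul_mul_assoc]; exact Submodule.smul_mem _ _ hx
    | mem x hx =>
      induction hy using Submodule.span_induction with
      | zero => rw [mul_zero]; exact Submodule.zero_mem _
      | add y y' _ _ hy hy' => rw [mul_add]; exact Submodule.add_mem _ hy hy'
      | smul c y _ hy => rw [mul_smul_comm]; exact Submodule.smul_mem _ _ hy
      | mem y hy =>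
        obtain ⟨i, j, a, b, rfl, ha, hb, rfl⟩ := hx
        obtain ⟨i', j', a', b', rfl, ha', hb', rfl⟩ := hy
        refine Submodule.subset_span ⟨i + i', j' + j, a * a', b' * b, by omega,
          SetLike.GradedMul.mul_mem ha ha', SetLike.GradedMul.mul_mem hb' hb, ?_⟩
        rw [Algebra.TensorProduct.tmul_mul_tmul, MulOpposite.op_mul]
  toDecomposition := (envGr_isInternal 𝒜).chooseDecomposition

/-- The anti-automorphism `a ⊗ b ↦ b ⊗ a` of the enveloping algebra. -/
def envSwap (k A : Type u) [Field k] [Ring A] [Algebra k A] :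
    A ⊗[k] Aᵐᵒᵖ →ₐ[k] (A ⊗[k] Aᵐᵒᵖ)ᵐᵒᵖ :=
  Algebra.TensorProduct.lift
    ((AlgHom.op (Algebra.TensorProduct.includeRight : Aᵐᵒᵖ →ₐ[k] A ⊗[k] Aᵐᵒᵖ)).comp
      (AlgEquiv.opOp k A).toAlgHom)
    (AlgHom.op (Algebra.TensorProduct.includeLeft : A →ₐ[k] A ⊗[k] Aᵐᵒᵖ))
    (fun a b => by
      apply MulOpposite.unop_injective
      simp)

theorem envSwap_tmul (a b : A) :
    envSwap k A (a ⊗ₜ MulOpposite.op b) = MulOpposite.op (b ⊗ₜ MulOpposite.op a) := by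
  apply MulOpposite.unop_injective
  rw [envSwap]
  erw [Algebra.TensorProduct.lift_tmul]
  simp

theorem envSwap_mem (𝒜 : ℕ → Submodule k A) [GradedAlgebra 𝒜] (i : ℕ) (r : A ⊗[k] Aᵐᵒᵖ)
    (hr : r ∈ envGr 𝒜 i) : (envSwap k A r).unop ∈ envGr 𝒜 i := by
  induction hr using Submodule.span_induction with
  | zero => simp
  | add x y _ _ hx hy => rw [map_add]; exact Submodule.add_mem _ hx hy
  | smul c x _ hx => rw [map_smul]; exact Submodule.smul_mem _ _ hx
  | mem x hx =>
    obtain ⟨i, j, a, b, rfl, ha, hb, rfl⟩ := hx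
    rw [envSwap_tmul]
    exact Submodule.subset_span ⟨j, i, b, a, add_comm _ _, hb, ha, rfl⟩

variable [Module.Finite k A]

instance : Module.Finite k Aᵐᵒᵖ := Module.Finite.equiv (MulOpposite.opLinearEquiv k)

instance envNoetherian : IsNoetherianRing (A ⊗[k] Aᵐᵒᵖ) :=
  IsNoetherianRing.of_finite k _

attribute [local instance] TensorProduct.Algebra.module

theorem env_smul_tmul (a b m : A) : (a ⊗ₜ[k] MulOpposite.op b) • m = a * (m * b) := rfl

instance : IsScalarTower k (A ⊗[k] Aᵐᵒᵖ) A where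
  smul_assoc c x m := by
    change TensorProduct.Algebra.moduleAux _ _ = _ • TensorProduct.Algebra.moduleAux _ _
    rw [map_smul, LinearMap.smul_apply]

theorem env_smul_mem (𝒜 : ℕ → Submodule k A) [GradedAlgebra 𝒜] {i : ℕ} {j : ℤ}
    {r : A ⊗[k] Aᵐᵒᵖ} {m : A} (hr : r ∈ envGr 𝒜 i) (hm : m ∈ intGr 𝒜 j) :
    r • m ∈ intGr 𝒜 (i + j) := by
  induction hr using Submodule.span_induction with
  | zero =>
    have h : (0 : A ⊗[k] Aᵐᵒᵖ) • m = 0 := by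
      change TensorProduct.Algebra.moduleAux 0 m = 0
      rw [map_zero, LinearMap.zero_apply]
    exact h ▸ Submodule.zero_mem _
  | add x y _ _ hx hy => rw [add_smul]; exact Submodule.add_mem _ hx hy
  | smul c x _ hx => rw [smul_assoc]; exact Submodule.smul_mem _ _ hx
  | mem x hx =>
    obtain ⟨i, j', a, b, rfl, ha, hb, rfl⟩ := hx
    rw [env_smul_tmul]
    have h1 := mul_mem_intGr 𝒜 ha (intGr_mul_mem 𝒜 hm hb)
    have h2 : ((i + j' : ℕ) : ℤ) + j = i + (j + j') := by push_cast; ring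
    rw [h2]
    exact h1

/-- The graded bimodule `A`. -/
def regularBimodule (𝒜 : ℕ → Submodule k A) [GradedAlgebra 𝒜] : GrMod (envGr 𝒜) where
  carrier := A
  gr n := (intGr 𝒜 n).toAddSubgroup
  isInternal := intGr_isInternal 𝒜
  smul_mem hr hm := env_smul_mem 𝒜 hr hm
  finite := Module.Finite.of_restrictScalars_finite k _ _

end Bimodule

/-! ### Derived categories of graded modules -/

section Derived

variable (C : Type*) [Category C] [Abelian C] [HasDerivedCategory C]

/-- The perfect objects of the bounded derived category of `C`: those isomorphic to a bounded
complex of projective objects. -/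
def perf : ObjectProperty (DerivedCategory.Bounded C) := fun X =>
  ∃ K : CochainComplex C ℤ, (∀ n, Projective (K.X n)) ∧
    (∃ a b : ℤ, K.IsStrictlyGE a ∧ K.IsStrictlyLE b) ∧
    Nonempty (DerivedCategory.Q.obj K ≅ X.obj)

/-- The Verdier quotient of the bounded derived category by the perfect objects. -/
abbrev StableDerived := (perf C).trW.Localization

/-- The quotient functor. -/
abbrev stableQ : DerivedCategory.Bounded C ⥤ StableDerived C := (perf C).trW.Q

variable {C}

theorem bounded_single (X : C) :
    (DerivedCategory.TStructure.t (C := C)).bounded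
      ((DerivedCategory.singleFunctor C 0).obj X) :=
  ⟨⟨0, inferInstanceAs (((DerivedCategory.singleFunctor C 0).obj X).IsGE 0)⟩,
    ⟨0, inferInstanceAs (((DerivedCategory.singleFunctor C 0).obj X).IsLE 0)⟩⟩

/-- An object of `C` as an object of the bounded derived category. -/
def toBounded (X : C) : DerivedCategory.Bounded C :=
  ⟨(DerivedCategory.singleFunctor C 0).obj X, bounded_single X⟩

end Derived

section StablyCY

variable {k : Type u} [Field k] {A : Type u} [Ring A] [Algebra k A] [Module.Finite k A]
  (𝒜 : ℕ → Submodule k A) [GradedAlgebra 𝒜]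

/-- The functor `Hom_{Aᵉ}(-, Aᵉ)` on graded bimodules. -/
abbrev bimoduleDual : (GrMod (envGr 𝒜))ᵒᵖ ⥤ GrMod (envGr 𝒜) :=
  GrMod.dualFunctor (envSwap k A) (envSwap_mem 𝒜)

/-- The complex `Hom_{Aᵉ}(P, Aᵉ)` for a projective resolution `P` of a graded bimodule `M`;
it computes `RHom_{Aᵉ}(M, Aᵉ)`. -/
def rHomComplex {M : GrMod (envGr 𝒜)} (P : ProjectiveResolution M) :
    CochainComplex (GrMod (envGr 𝒜)) ℤ :=
  (((bimoduleDual 𝒜).mapHomologicalComplex _).obj P.complex.op).extend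
    ComplexShape.embeddingUpNat

/-- A finite dimensional graded algebra `A` is bimodule stably `(p)`-twisted `d`-Calabi-Yau if
`RHom_{Aᵉ}(A, Aᵉ)[d+1] ≅ A(p)` in `D^b(gr Aᵉ) / gr perf Aᵉ`. -/
def IsBimoduleStablyTwistedCY (p d : ℤ) : Prop :=
  letI := HasDerivedCategory.standard (GrMod (envGr 𝒜))
  ∃ (P : ProjectiveResolution (regularBimodule 𝒜))
    (h : (DerivedCategory.TStructure.t (C := GrMod (envGr 𝒜))).bounded
      (DerivedCategory.Q.obj (rHomComplex 𝒜 P))),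
    Nonempty ((stableQ _).obj ((⟨_, h⟩ : DerivedCategory.Bounded (GrMod (envGr 𝒜)))⟦d + 1⟧) ≅
      (stableQ _).obj (toBounded ((regularBimodule 𝒜).shift p)))

end StablyCY

/-! ### Coinduced modules and the `k`-dual of an algebra -/

section CoInd

variable (k A : Type u) [Field k] [Ring A] [Algebra k A] (V : Type u) [AddCommGroup V] [Module k V]

/-- The `A`-bimodule `Hom_k(A, V)`, with `(a f)(x) = f(x a)` and `(f a)(x) = f(a x)`. -/
def CoInd : Type u := A →ₗ[k] V

namespace CoInd

instance : AddCommGroup (CoInd k A V) := inferInstanceAs (AddCommGroup (A →ₗ[k] V))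
instance : Module k (CoInd k A V) := inferInstanceAs (Module k (A →ₗ[k] V))
instance : FunLike (CoInd k A V) A V := inferInstanceAs (FunLike (A →ₗ[k] V) A V)
instance : LinearMapClass (CoInd k A V) k A V :=
  inferInstanceAs (LinearMapClass (A →ₗ[k] V) k A V)

variable {k A V}

@[ext] theorem ext {f g : CoInd k A V} (h : ∀ x, f x = g x) : f = g := LinearMap.ext h

@[simp] theorem add_apply (f g : CoInd k A V) (x : A) : (f + g) x = f x + g x := rfl
@[simp] theorem zero_apply (x : A) : (0 : CoInd k A V) x = 0 := rfl
@[simp] theorem k_smul_apply (c : k) (f : CoInd k A V) (x : A) : (c • f) x = c • f x := rfl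

instance : SMul A (CoInd k A V) where
  smul a f := LinearMap.comp (show A →ₗ[k] V from f) (LinearMap.mulRight k a)

instance : SMul Aᵐᵒᵖ (CoInd k A V) where
  smul a f := LinearMap.comp (show A →ₗ[k] V from f) (LinearMap.mulLeft k a.unop)

@[simp] theorem smul_apply (a : A) (f : CoInd k A V) (x : A) : (a • f) x = f (x * a) := rfl
@[simp] theorem op_smul_apply (a : Aᵐᵒᵖ) (f : CoInd k A V) (x : A) :
    (a • f) x = f (a.unop * x) := rfl

instance : Module A (CoInd k A V) where
  one_smul f := by ext x; simp
  mul_smul a b f := by ext x; simp [mul_assoc]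
  smul_zero a := by ext x; simp
  smul_add a f g := by ext x; simp
  add_smul a b f := by ext x; simp [mul_add]
  zero_smul f := by ext x; simp

instance : Module Aᵐᵒᵖ (CoInd k A V) where
  one_smul f := by ext x; simp
  mul_smul a b f := by ext x; simp [mul_assoc]
  smul_zero a := by ext x; simp
  smul_add a f g := by ext x; simp
  add_smul a b f := by ext x; simp [add_mul]
  zero_smul f := by ext x; simp

instance : IsScalarTower k A (CoInd k A V) where
  smul_assoc c a f := by ext x; simp

instance : SMulCommClass A Aᵐᵒᵖ (CoInd k A V) where
  smul_comm a b f := by ext x; simp [mul_assoc]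

instance : SMulCommClass A k (CoInd k A V) where
  smul_comm a b f := by ext x; simp

instance [Module.Finite k A] [Module.Finite k V] : Module.Finite k (CoInd k A V) :=
  inferInstanceAs (Module.Finite k (A →ₗ[k] V))

end CoInd

/-- The `k`-linear dual `DA = Hom_k(A, k)` of an algebra `A`, an `A`-bimodule. -/
abbrev KDual : Type u := CoInd k A k

end CoInd

/-! ### The functor `τ₁` -/

section Tau

open scoped ModuleCat

variable (k Λ : Type u) [Field k] [Ring Λ] [Algebra k Λ]

/-- The relations `f a ⊗ m = f ⊗ a m` defining `DΛ ⊗_Λ M` as a quotient of `DΛ ⊗_k M`. -/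
def balancedRel (M : ModuleCat.{u} Λ) : Submodule Λ (KDual k Λ ⊗[k] M) :=
  Submodule.span Λ {x | ∃ (f : KDual k Λ) (a : Λ) (m : M),
    x = (MulOpposite.op a • f) ⊗ₜ[k] m - f ⊗ₜ[k] (a • m)}

/-- The linear map `DΛ ⊗_k M → DΛ ⊗_k N` induced by `M → N`. -/
def dualTensorMap {M N : ModuleCat.{u} Λ} (f : M ⟶ N) :
    KDual k Λ ⊗[k] M →ₗ[Λ] KDual k Λ ⊗[k] N :=
  TensorProduct.AlgebraTensorModule.lTensor Λ (KDual k Λ) (f.hom.restrictScalars k)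

theorem dualTensorMap_mem {M N : ModuleCat.{u} Λ} (f : M ⟶ N) :
    balancedRel k Λ M ≤ (balancedRel k Λ N).comap (dualTensorMap k Λ f) := by
  rw [balancedRel, Submodule.span_le]
  rintro _ ⟨φ, a, m, rfl⟩
  refine Submodule.subset_span ⟨φ, a, f.hom m, ?_⟩
  simp [dualTensorMap]

theorem dualTensorMap_id (M : ModuleCat.{u} Λ) (x : KDual k Λ ⊗[k] M) :
    dualTensorMap k Λ (𝟙 M) x = x := by
  induction x using TensorProduct.induction_on with
  | zero => rw [map_zero]
  | add x y hx hy => rw [map_add, hx, hy]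
  | tmul f m => rfl

theorem dualTensorMap_comp {L M N : ModuleCat.{u} Λ} (f : L ⟶ M) (g : M ⟶ N)
    (x : KDual k Λ ⊗[k] L) :
    dualTensorMap k Λ (f ≫ g) x = dualTensorMap k Λ g (dualTensorMap k Λ f x) := by
  induction x using TensorProduct.induction_on with
  | zero => rw [map_zero, map_zero, map_zero]
  | add x y hx hy => rw [map_add, hx, hy, map_add, map_add]
  | tmul f m => rfl

theorem dualTensorMap_add {M N : ModuleCat.{u} Λ} (f g : M ⟶ N) (x : KDual k Λ ⊗[k] M) :
    dualTensorMap k Λ (f + g) x = dualTensorMap k Λ f x + dualTensorMap k Λ g x := by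
  induction x using TensorProduct.induction_on with
  | zero => simp only [map_zero, add_zero]
  | add x y hx hy => rw [map_add, hx, hy, map_add, map_add]; abel
  | tmul φ m => exact TensorProduct.tmul_add φ (f.hom m) (g.hom m)

/-- The linear map `DΛ ⊗_Λ M → DΛ ⊗_Λ N` induced by `M → N`. -/
def nakayamaMap {M N : ModuleCat.{u} Λ} (f : M ⟶ N) :
    ((KDual k Λ ⊗[k] M) ⧸ balancedRel k Λ M) →ₗ[Λ] ((KDual k Λ ⊗[k] N) ⧸ balancedRel k Λ N) :=
  Submodule.mapQ _ _ (dualTensorMap k Λ f) (dualTensorMap_mem k Λ f)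

theorem nakayamaMap_mk {M N : ModuleCat.{u} Λ} (f : M ⟶ N) (x : KDual k Λ ⊗[k] M) :
    nakayamaMap k Λ f (Submodule.Quotient.mk x) =
      Submodule.Quotient.mk (dualTensorMap k Λ f x) := rfl

theorem nakayamaMap_id (M : ModuleCat.{u} Λ) : nakayamaMap k Λ (𝟙 M) = LinearMap.id := by
  apply LinearMap.ext
  intro x
  obtain ⟨x, rfl⟩ := Submodule.Quotient.mk_surjective _ x
  rw [nakayamaMap_mk, dualTensorMap_id, LinearMap.id_apply]

theorem nakayamaMap_comp {L M N : ModuleCat.{u} Λ} (f : L ⟶ M) (g : M ⟶ N) :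
    nakayamaMap k Λ (f ≫ g) = (nakayamaMap k Λ g).comp (nakayamaMap k Λ f) := by
  apply LinearMap.ext
  intro x
  obtain ⟨x, rfl⟩ := Submodule.Quotient.mk_surjective _ x
  rw [nakayamaMap_mk, dualTensorMap_comp, LinearMap.comp_apply, nakayamaMap_mk, nakayamaMap_mk]

theorem nakayamaMap_add {M N : ModuleCat.{u} Λ} (f g : M ⟶ N) :
    nakayamaMap k Λ (f + g) = nakayamaMap k Λ f + nakayamaMap k Λ g := by
  apply LinearMap.ext
  intro x
  obtain ⟨x, rfl⟩ := Submodule.Quotient.mk_surjective _ x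
  rw [nakayamaMap_mk, dualTensorMap_add, LinearMap.add_apply, nakayamaMap_mk, nakayamaMap_mk,
    Submodule.Quotient.mk_add]

/-- The functor `DΛ ⊗_Λ -` on left `Λ`-modules. -/
def nakayama : ModuleCat.{u} Λ ⥤ ModuleCat.{u} Λ where
  obj M := ModuleCat.of Λ ((KDual k Λ ⊗[k] M) ⧸ balancedRel k Λ M)
  map f := ModuleCat.ofHom (nakayamaMap k Λ f)
  map_id M := ModuleCat.hom_ext (nakayamaMap_id k Λ M)
  map_comp f g := ModuleCat.hom_ext (nakayamaMap_comp k Λ f g)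

instance : (nakayama k Λ).Additive where
  map_add {_ _ f g} := ModuleCat.hom_ext (nakayamaMap_add k Λ f g)

/-- The functor `τ₁ = H⁰(DΛ ⊗ᴸ_Λ -[-1]) = Tor₁^Λ(DΛ, -)`. -/
def tau₁ : ModuleCat.{u} Λ ⥤ ModuleCat.{u} Λ := (nakayama k Λ).leftDerived 1

/-- `Λ` is `τ₁`-finite: the functor `τ₁` is nilpotent on finitely generated modules. -/
def IsTau₁Finite : Prop :=
  ∃ n : ℕ, ∀ M : ModuleCat.{u} Λ, Module.Finite Λ M → IsZero ((tau₁ k Λ).obj^[n] M)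

end Tau

/-! ### The bimodule `Ext¹_Λ(DΛ, Λ)` -/

section ExtBimodule

variable (k Λ : Type u) [Field k] [Ring Λ] [Algebra k Λ]

/-- `Ext¹_Λ(DΛ, Λ)`, for the left modules `DΛ` and `Λ`. -/
def ExtDual : Type u :=
  Abelian.Ext.{u} (ModuleCat.of Λ (KDual k Λ)) (ModuleCat.of Λ Λ) 1

/-- Right multiplication by `a`, as an endomorphism of the left module `Λ`. -/
def rightMul (a : Λ) : ModuleCat.of Λ Λ ⟶ ModuleCat.of Λ Λ :=
  ModuleCat.ofHom (LinearMap.toSpanSingleton Λ Λ a)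

/-- The right action of `a`, as an endomorphism of the left module `DΛ`. -/
def rightMulDual (a : Λ) : ModuleCat.of Λ (KDual k Λ) ⟶ ModuleCat.of Λ (KDual k Λ) :=
  ModuleCat.ofHom
    { toFun := fun f => MulOpposite.op a • f
      map_add' := fun f g => smul_add _ f g
      map_smul' := fun b f => (smul_comm b (MulOpposite.op a) f).symm }

namespace ExtDual

instance : AddCommGroup (ExtDual k Λ) :=
  inferInstanceAs (AddCommGroup (Abelian.Ext.{u} (ModuleCat.of Λ (KDual k Λ)) (ModuleCat.of Λ Λ) 1))

instance : Module k (ExtDual k Λ) :=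
  inferInstanceAs (Module k (Abelian.Ext.{u} (ModuleCat.of Λ (KDual k Λ)) (ModuleCat.of Λ Λ) 1))

/-- The left `Λ`-module structure, induced by the right module structure of `DΛ`. -/
instance : Module Λ (ExtDual k Λ) where
  smul a e := (Abelian.Ext.mk₀ (rightMulDual k Λ a)).comp
    (show Abelian.Ext (ModuleCat.of Λ (KDual k Λ)) (ModuleCat.of Λ Λ) 1 from e) (zero_add 1)
  one_smul e := by
    have : rightMulDual k Λ 1 = 𝟙 _ := by
      apply ModuleCat.hom_ext
      apply LinearMap.ext
      intro f
      exact one_smul Λᵐᵒᵖ f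
    change (Abelian.Ext.mk₀ (rightMulDual k Λ 1)).comp _ _ = _
    rw [this, Abelian.Ext.mk₀_id_comp]
  mul_smul a b e := by
    have : rightMulDual k Λ (a * b) = rightMulDual k Λ a ≫ rightMulDual k Λ b := by
      apply ModuleCat.hom_ext
      apply LinearMap.ext
      intro f
      exact mul_smul (MulOpposite.op b) (MulOpposite.op a) f
    change (Abelian.Ext.mk₀ (rightMulDual k Λ (a * b))).comp _ _ = _
    rw [this, ← Abelian.Ext.mk₀_comp_mk₀_assoc]
    rfl
  smul_zero a := Abelian.Ext.comp_zero _ _ _ _ (zero_add 1)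
  smul_add a e f := Abelian.Ext.comp_add _ _ _ _
  add_smul a b e := by
    have : rightMulDual k Λ (a + b) = rightMulDual k Λ a + rightMulDual k Λ b := by
      apply ModuleCat.hom_ext
      apply LinearMap.ext
      intro f
      exact add_smul (MulOpposite.op a) (MulOpposite.op b) f
    change (Abelian.Ext.mk₀ (rightMulDual k Λ (a + b))).comp _ _ = _
    rw [this, Abelian.Ext.mk₀_add, Abelian.Ext.add_comp]
    rfl
  zero_smul e := by
    have : rightMulDual k Λ 0 = 0 := by
      apply ModuleCat.hom_ext
      apply LinearMap.ext
      intro f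
      exact zero_smul Λᵐᵒᵖ f
    change (Abelian.Ext.mk₀ (rightMulDual k Λ 0)).comp _ _ = _
    rw [this, Abelian.Ext.mk₀_zero, Abelian.Ext.zero_comp]
    rfl

/-- The right `Λ`-module structure, induced by the right module structure of `Λ`. -/
instance : Module Λᵐᵒᵖ (ExtDual k Λ) where
  smul a e := (show Abelian.Ext (ModuleCat.of Λ (KDual k Λ)) (ModuleCat.of Λ Λ) 1 from e).comp
    (Abelian.Ext.mk₀ (rightMul Λ a.unop)) (add_zero 1)
  one_smul e := by
    have : rightMul Λ 1 = 𝟙 _ := by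
      apply ModuleCat.hom_ext
      apply LinearMap.ext
      intro f
      exact mul_one f
    change Abelian.Ext.comp _ (Abelian.Ext.mk₀ (rightMul Λ 1)) _ = _
    rw [this, Abelian.Ext.comp_mk₀_id]
  mul_smul a b e := by
    have : rightMul Λ (b.unop * a.unop) = rightMul Λ b.unop ≫ rightMul Λ a.unop := by
      apply ModuleCat.hom_ext
      apply LinearMap.ext
      intro f
      exact (mul_assoc f _ _).symm
    change Abelian.Ext.comp _ (Abelian.Ext.mk₀ (rightMul Λ (b.unop * a.unop))) _ = _
    rw [this, ← Abelian.Ext.mk₀_comp_mk₀, ← Abelian.Ext.comp_assoc_of_third_deg_zero]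
    rfl
  smul_zero a := Abelian.Ext.zero_comp _ _ _ _ (add_zero 1)
  smul_add a e f := Abelian.Ext.add_comp _ _ _ _
  add_smul a b e := by
    have : rightMul Λ (a.unop + b.unop) = rightMul Λ a.unop + rightMul Λ b.unop := by
      apply ModuleCat.hom_ext
      apply LinearMap.ext
      intro f
      exact mul_add f _ _
    change Abelian.Ext.comp _ (Abelian.Ext.mk₀ (rightMul Λ (a.unop + b.unop))) _ = _
    rw [this, Abelian.Ext.mk₀_add, Abelian.Ext.comp_add]
    rfl
  zero_smul e := by
    have : rightMul Λ 0 = 0 := by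
      apply ModuleCat.hom_ext
      apply LinearMap.ext
      intro f
      exact mul_zero f
    change Abelian.Ext.comp _ (Abelian.Ext.mk₀ (rightMul Λ 0)) _ = _
    rw [this, Abelian.Ext.mk₀_zero, Abelian.Ext.comp_zero]
    rfl

end ExtDual

end ExtBimodule

/-! ### The tensor algebra of a bimodule -/

section TensorAlg

variable (k Λ E : Type u) [Field k] [Ring Λ] [Algebra k Λ] [AddCommGroup E] [Module k E]
  [Module Λ E] [Module Λᵐᵒᵖ E]

/-- The relations presenting the tensor algebra `T_Λ(E)` as a quotient of the tensor algebra of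
the vector space `Λ × E`: the map `Λ → T_Λ(E)` is a morphism of algebras and the map
`E → T_Λ(E)` is a morphism of bimodules. -/
inductive TensorAlgRel : TensorAlgebra k (Λ × E) → TensorAlgebra k (Λ × E) → Prop
  | one : TensorAlgRel (TensorAlgebra.ι k ((1 : Λ), (0 : E))) 1
  | mul (a b : Λ) : TensorAlgRel (TensorAlgebra.ι k (a * b, (0 : E)))
      (TensorAlgebra.ι k (a, (0 : E)) * TensorAlgebra.ι k (b, (0 : E)))
  | smul (a : Λ) (e : E) : TensorAlgRel (TensorAlgebra.ι k ((0 : Λ), a • e))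
      (TensorAlgebra.ι k (a, (0 : E)) * TensorAlgebra.ι k ((0 : Λ), e))
  | op_smul (e : E) (a : Λ) : TensorAlgRel (TensorAlgebra.ι k ((0 : Λ), MulOpposite.op a • e))
      (TensorAlgebra.ι k ((0 : Λ), e) * TensorAlgebra.ι k (a, (0 : E)))

/-- The tensor algebra `T_Λ(E)` of a `Λ`-bimodule `E`. -/
def TensorAlg : Type u := RingQuot (TensorAlgRel k Λ E)

namespace TensorAlg

instance : Ring (TensorAlg k Λ E) := inferInstanceAs (Ring (RingQuot (TensorAlgRel k Λ E)))
instance : Algebra k (TensorAlg k Λ E) :=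
  inferInstanceAs (Algebra k (RingQuot (TensorAlgRel k Λ E)))

/-- The quotient map. -/
def mk : TensorAlgebra k (Λ × E) →ₐ[k] TensorAlg k Λ E := RingQuot.mkAlgHom k (TensorAlgRel k Λ E)

theorem mk_rel {x y : TensorAlgebra k (Λ × E)} (h : TensorAlgRel k Λ E x y) :
    mk k Λ E x = mk k Λ E y := RingQuot.mkAlgHom_rel k h

/-- The canonical map `Λ → T_Λ(E)`. -/
def inl : Λ →ₐ[k] TensorAlg k Λ E :=
  AlgHom.ofLinearMap
    ((mk k Λ E).toLinearMap.comp ((TensorAlgebra.ι k).comp (LinearMap.inl k Λ E)))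
    ((mk_rel k Λ E TensorAlgRel.one).trans (map_one _))
    (fun a b => (mk_rel k Λ E (TensorAlgRel.mul a b)).trans (map_mul _ _ _))

/-- The canonical map `E → T_Λ(E)`. -/
def inr : E →ₗ[k] TensorAlg k Λ E :=
  (mk k Λ E).toLinearMap.comp ((TensorAlgebra.ι k).comp (LinearMap.inr k Λ E))

theorem inr_smul (a : Λ) (e : E) : inr k Λ E (a • e) = inl k Λ E a * inr k Λ E e :=
  (mk_rel k Λ E (TensorAlgRel.smul a e)).trans (map_mul _ _ _)

theorem inr_op_smul (e : E) (a : Λ) :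
    inr k Λ E (MulOpposite.op a • e) = inr k Λ E e * inl k Λ E a :=
  (mk_rel k Λ E (TensorAlgRel.op_smul e a)).trans (map_mul _ _ _)

variable {k Λ E}

/-- The universal property of the tensor algebra: an algebra morphism `f : Λ → B` and a morphism
of bimodules `g : E → B` induce a morphism of algebras `T_Λ(E) → B`. -/
def lift {B : Type*} [Ring B] [Algebra k B] (f : Λ →ₐ[k] B) (g : E →ₗ[k] B)
    (h₁ : ∀ a e, g (a • e) = f a * g e) (h₂ : ∀ e a, g (MulOpposite.op a • e) = g e * f a) :
    TensorAlg k Λ E →ₐ[k] B :=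
  RingQuot.liftAlgHom k ⟨TensorAlgebra.lift k (f.toLinearMap.coprod g), by
    intro x y h
    cases h with
    | one => simp
    | mul a b => simp
    | smul a e => simp [h₁]
    | op_smul e a => simp [h₂]⟩

theorem lift_mk {B : Type*} [Ring B] [Algebra k B] (f : Λ →ₐ[k] B) (g : E →ₗ[k] B)
    (h₁ : ∀ a e, g (a • e) = f a * g e) (h₂ : ∀ e a, g (MulOpposite.op a • e) = g e * f a)
    (x : TensorAlgebra k (Λ × E)) :
    lift f g h₁ h₂ (mk k Λ E x) = TensorAlgebra.lift k (f.toLinearMap.coprod g) x :=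
  RingQuot.liftAlgHom_mkAlgHom_apply _ _ _ _

@[simp] theorem lift_inl {B : Type*} [Ring B] [Algebra k B] (f : Λ →ₐ[k] B) (g : E →ₗ[k] B)
    (h₁ : ∀ a e, g (a • e) = f a * g e) (h₂ : ∀ e a, g (MulOpposite.op a • e) = g e * f a)
    (a : Λ) : lift f g h₁ h₂ (inl k Λ E a) = f a := by
  refine (lift_mk f g h₁ h₂ _).trans ?_
  simp

@[simp] theorem lift_inr {B : Type*} [Ring B] [Algebra k B] (f : Λ →ₐ[k] B) (g : E →ₗ[k] B)
    (h₁ : ∀ a e, g (a • e) = f a * g e) (h₂ : ∀ e a, g (MulOpposite.op a • e) = g e * f a)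
    (e : E) : lift f g h₁ h₂ (inr k Λ E e) = g e := by
  refine (lift_mk f g h₁ h₂ _).trans ?_
  simp

variable (k Λ E)

/-- The component of degree `n` of the tensor algebra, spanned by the products
`a e₁ ⋯ eₙ` with `a ∈ Λ` and `e₁, …, eₙ ∈ E`. -/
def gr (n : ℕ) : Submodule k (TensorAlg k Λ E) :=
  Subalgebra.toSubmodule (inl k Λ E).range * LinearMap.range (inr k Λ E) ^ n

theorem range_inr_mul_le : LinearMap.range (inr k Λ E) * Subalgebra.toSubmodule (inl k Λ E).range ≤
    Subalgebra.toSubmodule (inl k Λ E).range * LinearMap.range (inr k Λ E) := by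
  rw [Submodule.mul_le]
  rintro _ ⟨e, rfl⟩ _ ⟨a, rfl⟩
  change inr k Λ E e * inl k Λ E a ∈ _
  rw [← inr_op_smul, ← one_mul (inr k Λ E _)]
  exact Submodule.mul_mem_mul (one_mem (inl k Λ E).range) ⟨_, rfl⟩

theorem range_inr_pow_mul_le (n : ℕ) :
    LinearMap.range (inr k Λ E) ^ n * Subalgebra.toSubmodule (inl k Λ E).range ≤
    Subalgebra.toSubmodule (inl k Λ E).range * LinearMap.range (inr k Λ E) ^ n := by
  induction n with
  | zero => rw [pow_zero, one_mul, mul_one]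
  | succ n ih =>
    calc LinearMap.range (inr k Λ E) ^ (n + 1) * Subalgebra.toSubmodule (inl k Λ E).range
        = LinearMap.range (inr k Λ E) ^ n *
          (LinearMap.range (inr k Λ E) * Subalgebra.toSubmodule (inl k Λ E).range) := by
          rw [pow_succ, mul_assoc]
      _ ≤ LinearMap.range (inr k Λ E) ^ n *
          (Subalgebra.toSubmodule (inl k Λ E).range * LinearMap.range (inr k Λ E)) :=
          mul_le_mul' le_rfl (range_inr_mul_le k Λ E)
      _ ≤ (Subalgebra.toSubmodule (inl k Λ E).range * LinearMap.range (inr k Λ E) ^ n) *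
          LinearMap.range (inr k Λ E) := by
          rw [← mul_assoc]
          exact mul_le_mul' ih le_rfl
      _ = Subalgebra.toSubmodule (inl k Λ E).range * LinearMap.range (inr k Λ E) ^ (n + 1) := by
          rw [pow_succ, mul_assoc]

theorem gr_mul_le (m n : ℕ) : gr k Λ E m * gr k Λ E n ≤ gr k Λ E (m + n) :=
  calc gr k Λ E m * gr k Λ E n
      = Subalgebra.toSubmodule (inl k Λ E).range * (LinearMap.range (inr k Λ E) ^ m *
          Subalgebra.toSubmodule (inl k Λ E).range) * LinearMap.range (inr k Λ E) ^ n := by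
        simp only [gr, mul_assoc]
    _ ≤ Subalgebra.toSubmodule (inl k Λ E).range * (Subalgebra.toSubmodule (inl k Λ E).range *
          LinearMap.range (inr k Λ E) ^ m) * LinearMap.range (inr k Λ E) ^ n :=
        mul_le_mul' (mul_le_mul' le_rfl (range_inr_pow_mul_le k Λ E m)) le_rfl
    _ = gr k Λ E (m + n) := by
        rw [gr, ← mul_assoc, (Subalgebra.isIdempotentElem_toSubmodule _).eq, pow_add, mul_assoc]

instance gradedMonoid : SetLike.GradedMonoid (gr k Λ E) where
  one_mem := by
    rw [gr, pow_zero, mul_one]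
    exact one_mem (inl k Λ E).range
  mul_mem m n _ _ hx hy := gr_mul_le k Λ E m n (Submodule.mul_mem_mul hx hy)

/-- The morphism `T_Λ(E) → T_Λ(E)[X]` which multiplies elements of degree `n` by `X ^ n`. -/
def coaction : TensorAlg k Λ E →ₐ[k] Polynomial (TensorAlg k Λ E) :=
  lift (Polynomial.CAlgHom.comp (inl k Λ E))
    ((LinearMap.restrictScalars k (Polynomial.monomial (R := TensorAlg k Λ E) 1)).comp
      (inr k Λ E))
    (fun a e => by simp [inr_smul, Polynomial.C_mul_monomial])
    (fun e a => by simp [inr_op_smul, Polynomial.monomial_mul_C])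

theorem coaction_of_mem {n : ℕ} {x : TensorAlg k Λ E} (hx : x ∈ gr k Λ E n) :
    coaction k Λ E x = Polynomial.monomial n x := by
  have hmul : ∀ (m n : ℕ) (x y : TensorAlg k Λ E),
      coaction k Λ E x = Polynomial.monomial m x → coaction k Λ E y = Polynomial.monomial n y →
      coaction k Λ E (x * y) = Polynomial.monomial (m + n) (x * y) := by
    intro m n x y hx hy
    rw [map_mul, hx, hy, Polynomial.monomial_mul_monomial]
  have hpow : ∀ n : ℕ, ∀ x ∈ LinearMap.range (inr k Λ E) ^ n,
      coaction k Λ E x = Polynomial.monomial n x := by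
    intro n
    induction n with
    | zero =>
      intro x hx
      rw [pow_zero] at hx
      obtain ⟨c, rfl⟩ := Submodule.mem_one.1 hx
      rw [AlgHom.commutes]
      rfl
    | succ n ih =>
      intro x hx
      rw [pow_succ] at hx
      induction hx using Submodule.mul_induction_on' with
      | mem_mul_mem y hy z hz =>
        obtain ⟨e, rfl⟩ := hz
        refine hmul n 1 y _ (ih y hy) ?_
        simp [coaction]
      | add x _ y _ hx hy => rw [map_add, hx, hy, map_add]
  induction hx using Submodule.mul_induction_on' with
  | mem_mul_mem y hy z hz =>
    obtain ⟨a, rfl⟩ := hy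
    have h := hmul 0 n (inl k Λ E a) z (by simp [coaction]) (hpow n z hz)
    rw [zero_add] at h
    exact h
  | add x _ y _ hx hy => rw [map_add, hx, hy, map_add]

theorem mem_iSup_gr (x : TensorAlg k Λ E) : x ∈ ⨆ n, gr k Λ E n := by
  have hmul : ∀ x y : TensorAlg k Λ E, x ∈ ⨆ n, gr k Λ E n → y ∈ ⨆ n, gr k Λ E n →
      x * y ∈ ⨆ n, gr k Λ E n := by
    intro x y hx hy
    have : (⨆ n, gr k Λ E n) * (⨆ n, gr k Λ E n) ≤ ⨆ n, gr k Λ E n := by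
      rw [Submodule.iSup_mul, iSup_le_iff]
      intro m
      rw [Submodule.mul_iSup, iSup_le_iff]
      intro n
      exact (gr_mul_le k Λ E m n).trans (le_iSup (gr k Λ E) (m + n))
    exact this (Submodule.mul_mem_mul hx hy)
  obtain ⟨x, rfl⟩ := RingQuot.mkAlgHom_surjective k (TensorAlgRel k Λ E) x
  have hinl : ∀ a, inl k Λ E a ∈ ⨆ n, gr k Λ E n := fun a => by
    refine Submodule.mem_iSup_of_mem 0 ?_
    rw [gr, pow_zero, mul_one]
    exact ⟨a, rfl⟩
  have hinr : ∀ e, inr k Λ E e ∈ ⨆ n, gr k Λ E n := fun e => by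
    refine Submodule.mem_iSup_of_mem 1 ?_
    rw [gr, pow_one, ← one_mul (inr k Λ E e)]
    exact Submodule.mul_mem_mul (one_mem (inl k Λ E).range) ⟨e, rfl⟩
  induction x using TensorAlgebra.induction with
  | algebraMap c =>
    rw [AlgHom.commutes]
    have := hinl (algebraMap k Λ c)
    rwa [AlgHom.commutes] at this
  | ι x =>
    have h : x = LinearMap.inl k Λ E x.1 + LinearMap.inr k Λ E x.2 := by simp
    rw [h, map_add, map_add]
    exact Submodule.add_mem _ (hinl x.1) (hinr x.2)
  | mul x y hx hy => rw [map_mul]; exact hmul _ _ hx hy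
  | add x y hx hy => rw [map_add]; exact Submodule.add_mem _ hx hy

theorem gr_isInternal : DirectSum.IsInternal (gr k Λ E) := by
  refine isInternal_of' ?_ ?_
  · intro s x hx h0 i hi
    have h1 := congrArg (fun y => (coaction k Λ E y).coeff i) h0
    simp only [map_sum, Polynomial.finsetSum_coeff, map_zero, Polynomial.coeff_zero] at h1
    rw [Finset.sum_eq_single i] at h1
    · rwa [coaction_of_mem k Λ E (hx i), Polynomial.coeff_monomial, if_pos rfl] at h1
    · intro j _ hj
      rw [coaction_of_mem k Λ E (hx j), Polynomial.coeff_monomial, if_neg hj]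
    · intro h; exact absurd hi h
  · intro p hp m
    exact Submodule.iSup_induction (gr k Λ E) (motive := fun x => x ∈ p) (mem_iSup_gr k Λ E m)
      hp p.zero_mem fun _ _ => p.add_mem

instance gradedAlgebra : GradedAlgebra (gr k Λ E) where
  toDecomposition := (gr_isInternal k Λ E).chooseDecomposition

end TensorAlg

end TensorAlg

section Preprojective

variable (k Λ : Type u) [Field k] [Ring Λ] [Algebra k Λ]

/-- The `2`-preprojective algebra `Π₂(Λ) = T_Λ Ext¹_Λ(DΛ, Λ)`. -/
abbrev Preprojective₂ : Type u := TensorAlg k Λ (ExtDual k Λ)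

end Preprojective

/-! ### Finite dimensional algebras -/

section Algebras

/-- A primitive idempotent. -/
def IsPrimitiveIdempotent {Λ : Type u} [Ring Λ] (e : Λ) : Prop :=
  IsIdempotentElem e ∧ e ≠ 0 ∧ ∀ f g : Λ, IsIdempotentElem f → IsIdempotentElem g →
    f * g = 0 → g * f = 0 → e = f + g → f = 0 ∨ g = 0

/-- A basic algebra: `1` is a sum of pairwise orthogonal primitive idempotents `eᵢ` such that the
modules `Λ eᵢ` are pairwise non-isomorphic. -/
def IsBasic (Λ : Type u) [Ring Λ] : Prop :=
  ∃ (n : ℕ) (e : Fin n → Λ), CompleteOrthogonalIdempotents e ∧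
    (∀ i, IsPrimitiveIdempotent (e i)) ∧
    ∀ i j, i ≠ j → IsEmpty (Submodule.span Λ {e i} ≃ₗ[Λ] Submodule.span Λ {e j})

/-- The global dimension of `Λ` is at most `n`. -/
def HasGlobalDimensionLE (Λ : Type u) [Ring Λ] (n : ℕ) : Prop :=
  ∀ M : ModuleCat.{u} Λ, HasProjectiveDimensionLE M n

/-- `A` is selfinjective: it is injective as a left and as a right module over itself. -/
def IsSelfinjective (A : Type u) [Ring A] : Prop :=
  Module.Injective A A ∧ Module.Injective Aᵐᵒᵖ A

end Algebras

/-! ### The stable module category -/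

section Stable

open scoped ModuleCat

variable (k A : Type u) [Field k] [Ring A] [Algebra k A]

/-- Two morphisms of finitely generated modules are identified in the stable category if their
difference factors through a finitely generated projective module. -/
def stableRel : HomRel (FGModuleCat.{u} A) := fun X Y f g =>
  ∃ (P : FGModuleCat.{u} A) (_ : Module.Projective A P) (a : X ⟶ P) (b : P ⟶ Y), f - g = a ≫ b

instance : Congruence (stableRel A) where
  equivalence {X Y} :=
    { refl := fun f => ⟨FGModuleCat.of A PUnit, inferInstance, 0, 0, by simp⟩
      symm := by
        rintro f g ⟨P, hP, a, b, h⟩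
        exact ⟨P, hP, a, -b, by rw [Preadditive.comp_neg, ← h, neg_sub]⟩
      trans := by
        rintro f g h ⟨P, hP, a, b, h₁⟩ ⟨P', hP', a', b', h₂⟩
        refine ⟨FGModuleCat.of A (P × P'), inferInstance,
          FGModuleCat.ofHom (a.hom.hom.prod a'.hom.hom),
          FGModuleCat.ofHom (b.hom.hom.coprod b'.hom.hom), ?_⟩
        rw [← sub_add_sub_cancel f g h, h₁, h₂]
        apply FGModuleCat.hom_ext
        apply LinearMap.ext
        intro x
        rfl }
  comp_left := by
    rintro X Y Z f g g' ⟨P, hP, a, b, h⟩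
    exact ⟨P, hP, f ≫ a, b, by rw [← Preadditive.comp_sub, h, Category.assoc]⟩
  comp_right := by
    rintro X Y Z f f' g ⟨P, hP, a, b, h⟩
    exact ⟨P, hP, a, b ≫ g, by rw [← Preadditive.sub_comp, h, Category.assoc]⟩

theorem stableRel_add {X Y : FGModuleCat.{u} A} (f₁ f₂ g₁ g₂ : X ⟶ Y)
    (hf : stableRel A f₁ f₂) (hg : stableRel A g₁ g₂) : stableRel A (f₁ + g₁) (f₂ + g₂) := by
  obtain ⟨P, hP, a, b, h₁⟩ := hf
  obtain ⟨P', hP', a', b', h₂⟩ := hg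
  refine ⟨FGModuleCat.of A (P × P'), inferInstance,
    FGModuleCat.ofHom (a.hom.hom.prod a'.hom.hom),
    FGModuleCat.ofHom (b.hom.hom.coprod b'.hom.hom), ?_⟩
  rw [add_sub_add_comm, h₁, h₂]
  apply FGModuleCat.hom_ext
  apply LinearMap.ext
  intro x
  rfl

theorem stableRel_smul (c : k) {X Y : FGModuleCat.{u} A} (f₁ f₂ : X ⟶ Y)
    (hf : stableRel A f₁ f₂) : stableRel A (c • f₁) (c • f₂) := by
  obtain ⟨P, hP, a, b, h⟩ := hf
  exact ⟨P, hP, c • a, b, by rw [← smul_sub, h, Linear.smul_comp]⟩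

/-- The stable category `stmod A` of finitely generated modules. -/
abbrev StMod : Type (u + 1) := Quotient (stableRel A)

instance : Preadditive (StMod A) := Quotient.preadditive _ (fun _ _ => stableRel_add A)

instance : (Quotient.functor (stableRel A)).Additive :=
  Quotient.functor_additive _ (fun _ _ => stableRel_add A)

instance : Linear k (StMod A) := Quotient.linear k _ (fun c _ _ => stableRel_smul k A c)

variable {A}

/-- The embedding `x ↦ (a ↦ a x)` of a module `X` into the injective module `Hom_k(A, X)`. -/
def coIndUnit (X : ModuleCat.{u} A) : X →ₗ[A] CoInd k A X where
  toFun x := (LinearMap.toSpanSingleton A X x).restrictScalars k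
  map_add' x y := by
    apply CoInd.ext; intro a
    exact smul_add a x y
  map_smul' b x := by
    apply CoInd.ext; intro a
    exact (mul_smul a b x).symm

/-- The map `Hom_k(A, X) → Hom_k(A, Y)` induced by `X → Y`. -/
def coIndMap {X Y : ModuleCat.{u} A} (f : X ⟶ Y) : CoInd k A X →ₗ[A] CoInd k A Y where
  toFun g := (f.hom.restrictScalars k).comp (show A →ₗ[k] X from g)
  map_add' g h := by
    apply CoInd.ext; intro a
    exact map_add f.hom (g a) (h a)
  map_smul' b g := rfl

theorem coIndMap_unit {X Y : ModuleCat.{u} A} (f : X ⟶ Y) (x : X) :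
    coIndMap k f (coIndUnit k X x) = coIndUnit k Y (f.hom x) := by
  apply CoInd.ext; intro a
  exact map_smul f.hom a x

/-- The map `Ω⁻¹X → Ω⁻¹Y` induced by `X → Y`. -/
def cosyzygyMap {X Y : ModuleCat.{u} A} (f : X ⟶ Y) :
    (CoInd k A X ⧸ LinearMap.range (coIndUnit k X)) →ₗ[A]
      (CoInd k A Y ⧸ LinearMap.range (coIndUnit k Y)) :=
  Submodule.mapQ _ _ (coIndMap k f) (by
    rintro _ ⟨x, rfl⟩
    exact ⟨f.hom x, (coIndMap_unit k f x).symm⟩)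

theorem coInd_finite [Module.Finite k A] (X : ModuleCat.{u} A) (hX : Module.Finite A X) :
    Module.Finite A (CoInd k A X) := by
  have : Module.Finite k X := Module.Finite.trans A X
  exact Module.Finite.of_restrictScalars_finite k A _

variable (A)

/-- The cosyzygy functor `Ω⁻¹`, `X ↦ Hom_k(A, X) / X`, on finitely generated modules. -/
def cosyzygy [Module.Finite k A] : FGModuleCat.{u} A ⥤ FGModuleCat.{u} A where
  obj X :=
    have := coInd_finite k X.obj X.property
    FGModuleCat.of A (CoInd k A X.obj ⧸ LinearMap.range (coIndUnit k X.obj))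
  map {X Y} f :=
    have := coInd_finite k X.obj X.property
    have := coInd_finite k Y.obj Y.property
    FGModuleCat.ofHom (cosyzygyMap k f.hom)
  map_id X := by
    apply FGModuleCat.hom_ext
    apply LinearMap.ext
    intro x
    obtain ⟨x, rfl⟩ := Submodule.Quotient.mk_surjective _ x
    rfl
  map_comp f g := by
    apply FGModuleCat.hom_ext
    apply LinearMap.ext
    intro x
    obtain ⟨x, rfl⟩ := Submodule.Quotient.mk_surjective _ x
    rfl

end Stable

/-! ### Calabi-Yau categories -/

section CalabiYau

variable (k : Type u) [Field k] {C : Type*} [Category C]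

/-- The iterates of an endofunctor. -/
def iterateFunctor (S : C ⥤ C) : ℕ → C ⥤ C
  | 0 => 𝟭 C
  | n + 1 => iterateFunctor S n ⋙ S

variable [Preadditive C] [Linear k C]

/-- A `k`-linear category with suspension `S` is `d`-Calabi-Yau if it is `Hom`-finite and there is
an isomorphism `D Hom(X, Y) ≅ Hom(Y, S^d X)` which is natural in `X` and `Y`. -/
def IsCalabiYau (S : C ⥤ C) (d : ℕ) : Prop :=
  (∀ X Y : C, Module.Finite k (X ⟶ Y)) ∧
  ∃ φ : ∀ X Y : C, Module.Dual k (X ⟶ Y) ≃ₗ[k] (Y ⟶ (iterateFunctor S d).obj X),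
    (∀ (X X' Y : C) (f : X ⟶ X') (ξ : Module.Dual k (X ⟶ Y)),
      φ X' Y (ξ ∘ₗ Linear.leftComp k Y f) = φ X Y ξ ≫ (iterateFunctor S d).map f) ∧
    (∀ (X Y Y' : C) (g : Y' ⟶ Y) (ξ : Module.Dual k (X ⟶ Y)),
      φ X Y' (ξ ∘ₗ Linear.rightComp k X g) = g ≫ φ X Y ξ)

/-- The stable category of a finite dimensional selfinjective algebra `A`, with the suspension
induced by the cosyzygy functor `Ω⁻¹`, is `d`-Calabi-Yau. -/
def IsStMod_CalabiYau (A : Type u) [Ring A] [Algebra k A] [Module.Finite k A] (d : ℕ) : Prop :=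
  ∃ S : StMod A ⥤ StMod A,
    Nonempty (Quotient.functor (stableRel A) ⋙ S ≅
      cosyzygy k A ⋙ Quotient.functor (stableRel A)) ∧
    IsCalabiYau k S d

end CalabiYau
end
end Preproj

namespace Preproj
noncomputable section
set_option linter.unusedSectionVars false

/-! ### Primitive idempotents and the radical of a basic algebra -/

section RadicalSplitting

variable {Λ : Type u} [Ring Λ]

/-! Paths are read from left to right, so that an arrow satisfies x_b = e_{src b} x_b e_{tgt b}. The
strategy is to present Π by generators and one relation with a universal property, and then to
deduce the structural statements from a duality between derivations and from a bimodule resolution.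

Presentation. Over an algebraically closed field a basic hereditary algebra is the path algebra of a
quiver (`exists_isPathAlgebra`). For any algebra, Ext¹(Z, W) is the space of derivations in Hom_k(Z,
W) modulo the inner ones, because a derivation is the same thing as a morphism Z → Ω⁻¹W = Hom_k(A,
W)/W (`Der.toHom_surjective`, `Der.extClass_surjective`, `Der.extClass_eq_zero_iff`). A derivation
of a path algebra that kills the vertices is freely prescribed on the arrows, and Hom_k(DΛ, Λ) = Λ ⊗
Λ. Hence the bimodule Ext¹(DΛ, Λ) has one generator ε_b for each arrow, in the opposite direction,
and the single relation ∑ [x_b, ε_b] = 0, which expresses that the derivation defined by ∑ e_i ⊗ e_i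
is inner (`ExtDual.exists_generators`). So Π is the preprojective algebra of the doubled quiver
(`exists_isPreprojective`).

Finiteness. The dual of Tor₁(DΛ, M) is Ext¹(M, Λ). Contracting derivations with the ε_b produces
maps D(τ₁ⁿ DΛ) → Π whose image contains the part of degree n (`exists_dual_iterate_tau₁_map`), so
the nilpotency of τ₁ bounds the degrees of Π.

Duality. For a preprojective algebra A and finite dimensional modules Z, W, the form ∑_b sgn(b)
tr(δ(x_b) δ'(x_{bar b})) pairs derivations in Hom_k(Z, W) with those in Hom_k(W, Z). The
preprojective relation makes it vanish on inner derivations, and it is nondegenerate modulo these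
(`IsPreprojective.derPairing_innerDer`, `IsPreprojective.exists_eq_innerDer`): Ext¹(Z, W) and
Ext¹(W, Z) are dual. Since Ext¹(A, M) = 0, also Ext¹(M, A) = 0, and A is selfinjective. Likewise the
injective modules Hom_k(A, V) with V finite dimensional are projective, so stable morphisms Z → Ω⁻¹W
are derivations modulo inner ones. With Z = Ω⁻¹X, and because Ω⁻¹ is fully faithful on the stable
category, the duality becomes the 2-Calabi–Yau property.

Bimodules. There is an exact sequence of graded bimodules 0 → Hom(A, Aᵉ) → ⨁ Ae_i⊗e_iA → ⨁ Ae_{src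
b}⊗e_{tgt b}A → ⨁ Ae_i⊗e_iA → A(1) → 0 with three projective terms, up to shifts of these
(`IsPreprojective.exists_sequence`). As Aᵉ is selfinjective, RHom(A, Aᵉ) is just Hom(A, Aᵉ), and
three dimension shifts give RHom(A, Aᵉ)[3] ≅ A(1). The twist is the degree of the preprojective
relation. -/

theorem IsPrimitiveIdempotent.nilpotent_or_exists_mul_eq {e : Λ} (he : IsPrimitiveIdempotent e)
    (k : Type u) [Field k] [Algebra k Λ] [Module.Finite k Λ] {x : Λ} (h₁ : e * x = x)
    (h₂ : x * e = x) : IsNilpotent x ∨ ∃ y, y * x = e := by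
  classical
  obtain ⟨p, hp0, hp⟩ := (Algebra.IsIntegral.isIntegral (R := k) x).isAlgebraic
  -- Fitting's lemma in eΛe: an annihilating polynomial is X^m q with q prime to X, and a Bézout
  -- identity separates the nilpotent from the invertible part of x.
  obtain ⟨q, hq, hdvd⟩ := Polynomial.exists_eq_pow_rootMultiplicity_mul_and_not_dvd p hp0 0
  set m := p.rootMultiplicity 0
  rw [Polynomial.C_0, sub_zero] at hq hdvd
  have hcop : IsCoprime (Polynomial.X ^ (m + 1)) q := by
    apply IsCoprime.pow_left
    exact (Polynomial.irreducible_X.coprime_iff_not_dvd).2 hdvd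
  obtain ⟨a, b, hab⟩ := hcop
  have hzero : x ^ (m + 1) * Polynomial.aeval x q = 0 := by
    have : Polynomial.aeval x (Polynomial.X * p) = 0 := by rw [map_mul, hp, mul_zero]
    rw [hq, ← mul_assoc, ← pow_succ', map_mul, map_pow, Polynomial.aeval_X] at this
    exact this
  set A := Polynomial.aeval x a
  set B := Polynomial.aeval x b
  set Q := Polynomial.aeval x q
  have h1 : A * x ^ (m + 1) + B * Q = 1 := by
    have := congrArg (Polynomial.aeval x) hab
    simpa [A, B, Q] using this
  have cA : Commute A x := by
    simpa [A] using (Commute.all a Polynomial.X).map (Polynomial.aeval x)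
  have cQ : Commute Q x := by
    simpa [Q] using (Commute.all q Polynomial.X).map (Polynomial.aeval x)
  have cBQ : Commute B Q := by
    simpa [B, Q] using (Commute.all b q).map (Polynomial.aeval x)
  -- E is idempotent because x^(m+1) Q = 0. The exponent m + 1, instead of m, guarantees a factor x,
  -- so that e acts trivially on E from both sides even if m = 0. Primitivity leaves E = 0 or E = e.
  set E := A * x ^ (m + 1)
  have hE1 : e * E = E := by
    change e * (A * x ^ (m + 1)) = A * x ^ (m + 1)
    rw [(cA.pow_right (m + 1)).eq, pow_succ', mul_assoc, ← mul_assoc e, h₁]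
  have hE2 : E * e = E := by
    change A * x ^ (m + 1) * e = A * x ^ (m + 1)
    rw [pow_succ, mul_assoc, mul_assoc, h₂]
  have hEE : E * E = E := by
    have : E * (B * Q) = 0 := by
      rw [cBQ.eq]
      change A * x ^ (m + 1) * (Q * B) = 0
      rw [mul_assoc, ← mul_assoc _ Q, hzero, zero_mul, mul_zero]
    calc E * E = E * (E + B * Q) := by rw [mul_add, this, add_zero]
      _ = E := by rw [h1, mul_one]
  have := he.2.2 E (e - E) hEE (by
    change (e - E) * (e - E) = e - E
    rw [mul_sub, sub_mul, sub_mul, hE1, hE2, hEE, he.1.eq]; abel) (by rw [mul_sub, hE2, hEE, sub_self])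
    (by rw [sub_mul, hE1, hEE, sub_self]) (by abel)
  rcases this with h | h
  · left
    refine ⟨m + 1, ?_⟩
    rw [h, zero_add] at h1
    calc x ^ (m + 1) = x ^ (m + 1) * (Q * B) := by rw [← cBQ.eq, h1, mul_one]
      _ = 0 := by rw [← mul_assoc, hzero, zero_mul]
  · right
    refine ⟨A * x ^ m, ?_⟩
    rw [mul_assoc, ← pow_succ]
    exact (sub_eq_zero.1 h).symm

/-- Adding 1 to a nilpotent element gives a unit, which is the quasi-regularity criterion for the
radical. -/
theorem mem_jacobson_of_isNilpotent_mul {x : Λ} (h : ∀ z, IsNilpotent (z * x)) :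
    x ∈ Ring.jacobson Λ := by
  rw [← Ideal.jacobson_bot, Ideal.mem_jacobson_iff]
  intro y
  obtain ⟨u, hu⟩ := (h y).isUnit_one_add
  refine ⟨↑u⁻¹, ?_⟩
  have : (↑u⁻¹ : Λ) * y * x + ↑u⁻¹ - 1 = ↑u⁻¹ * (1 + y * x) - 1 := by noncomm_ring
  rw [this, ← hu, Units.inv_mul, sub_self]
  exact zero_mem _

/-- As x = x e, the idempotent can be inserted between consecutive factors: (z x)^(n+1) = z x (e z
x)^n. -/
theorem isNilpotent_mul_of_isNilpotent_mul {e x z : Λ} (h₂ : x * e = x)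
    (h : IsNilpotent (e * z * x)) : IsNilpotent (z * x) := by
  obtain ⟨n, hn⟩ := h
  refine ⟨n + 1, ?_⟩
  have : ∀ n, (z * x) ^ (n + 1) = z * x * (e * z * x) ^ n := by
    intro n
    induction n with
    | zero => simp
    | succ n ih =>
      rw [pow_succ', ih, pow_succ' (e * z * x)]
      simp only [mul_assoc]
      rw [← mul_assoc x e, h₂]
  rw [this, hn, mul_zero]

/-- If all f z x are nilpotent, x is radical. Otherwise Fitting's lemma in fΛf inverts some f z x
and yields w ∈ fΛe with w x = f. Then x w is a nonzero idempotent of eΛe, hence equal to e, and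
right multiplications by x and w are inverse isomorphisms. -/
theorem IsPrimitiveIdempotent.nilpotent_mul_or {e f : Λ} (he : IsPrimitiveIdempotent e)
    (hf : IsPrimitiveIdempotent f) (k : Type u) [Field k] [Algebra k Λ] [Module.Finite k Λ]
    {x : Λ} (h₁ : e * x = x) (h₂ : x * f = x) :
    x ∈ Ring.jacobson Λ ∨
      Nonempty (Submodule.span Λ {e} ≃ₗ[Λ] Submodule.span Λ {f}) := by
  by_cases h : ∀ z, IsNilpotent (f * z * x)
  · exact Or.inl (mem_jacobson_of_isNilpotent_mul fun z =>
      isNilpotent_mul_of_isNilpotent_mul h₂ (h z))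
  · right
    push Not at h
    obtain ⟨z, hz⟩ := h
    obtain ⟨y, hy⟩ := (hf.nilpotent_or_exists_mul_eq k (x := f * z * x)
      (by rw [← mul_assoc, ← mul_assoc, hf.1.eq]) (by rw [mul_assoc, h₂])).resolve_left hz
    obtain ⟨w, hw⟩ : ∃ w, w = f * (y * f * z * e) := ⟨_, rfl⟩
    have hwx : w * x = f := by
      rw [hw]
      have : f * (y * f * z * e) * x = f * (y * (f * z * (e * x))) := by noncomm_ring
      rw [this, h₁, hy, hf.1.eq]
    have hwe : w * e = w := by
      rw [hw, mul_assoc, mul_assoc _ e e, he.1.eq]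
    have hfw : f * w = w := by
      rw [hw, ← mul_assoc, hf.1.eq]
    have hxw1 : IsIdempotentElem (x * w) := by
      change x * w * (x * w) = x * w
      rw [mul_assoc, ← mul_assoc w, hwx, hfw]
    have hxw : x * w = e := by
      have := he.2.2 (x * w) (e - x * w) hxw1 (by
        change (e - x * w) * (e - x * w) = e - x * w
        rw [mul_sub, sub_mul, sub_mul, hxw1.eq, he.1.eq, ← mul_assoc, h₁, mul_assoc x w e, hwe]
        abel) (by rw [mul_sub, hxw1.eq, mul_assoc, hwe, sub_self])
        (by rw [sub_mul, hxw1.eq, ← mul_assoc, h₁, sub_self]) (by abel)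
      rcases this with h0 | h0
      · exfalso
        apply hf.2.1
        rw [← hf.1.eq, ← hwx]
        calc w * x * (w * x) = w * (x * w) * x := by noncomm_ring
          _ = 0 := by rw [h0]; simp
      · exact (sub_eq_zero.1 h0).symm
    have hmap : ∀ (a b c : Λ), c * b = c → ∀ y ∈ Submodule.span Λ {a},
        LinearMap.toSpanSingleton Λ Λ c y ∈ Submodule.span Λ {b} := by
      intro a b c hc y _
      rw [LinearMap.toSpanSingleton_apply, smul_eq_mul, ← hc, ← mul_assoc]
      exact Submodule.smul_mem _ _ (Submodule.mem_span_singleton_self b)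
    have hinv : ∀ (a b c : Λ), b * c = a → IsIdempotentElem a → ∀ y ∈ Submodule.span Λ {a},
        y * b * c = y := by
      intro a b c hbc ha y hy
      obtain ⟨r, rfl⟩ := Submodule.mem_span_singleton.1 hy
      rw [mul_assoc, hbc, smul_eq_mul, mul_assoc, ha.eq]
    exact ⟨LinearEquiv.ofLinearMap ((LinearMap.toSpanSingleton Λ Λ x).restrict (hmap e f x h₂))
      ((LinearMap.toSpanSingleton Λ Λ w).restrict (hmap f e w hwe))
      (by ext ⟨y, hy⟩; exact hinv f w x hwx hf.1 y hy)
      (by ext ⟨y, hy⟩; exact hinv e x w hxw he.1 y hy)⟩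

/-- The scalar c is an eigenvalue of left multiplication by x on eΛ, with eigenvector v. Since x - c
e kills v ≠ 0, no left multiple of it can equal e, so Fitting's lemma makes every e z (x - c e)
nilpotent. -/
theorem IsPrimitiveIdempotent.exists_sub_smul_mem_jacobson {e : Λ} (he : IsPrimitiveIdempotent e)
    (k : Type u) [Field k] [IsAlgClosed k] [Algebra k Λ] [Module.Finite k Λ] {x : Λ}
    (h₁ : e * x = x) (h₂ : x * e = x) : ∃ c : k, x - c • e ∈ Ring.jacobson Λ := by
  let V : Submodule k Λ := LinearMap.range (LinearMap.mulLeft k e)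
  have hV : ∀ y ∈ V, LinearMap.mulLeft k x y ∈ V := by
    rintro _ ⟨y, rfl⟩
    refine ⟨x * y, ?_⟩
    simp only [LinearMap.mulLeft_apply]
    rw [← mul_assoc, ← mul_assoc, h₁, h₂]
  have : Nontrivial V := ⟨⟨⟨e, e, he.1.eq⟩, 0, fun h => he.2.1 (congrArg Subtype.val h)⟩⟩
  obtain ⟨c, hc⟩ := Module.End.exists_eigenvalue ((LinearMap.mulLeft k x).restrict hV)
  obtain ⟨⟨v, hvV⟩, hv, hv0⟩ := hc.exists_hasEigenvector
  rw [Module.End.mem_eigenspace_iff] at hv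
  have hv' : x * v = c • v := congrArg Subtype.val hv
  have hev : e * v = v := by
    obtain ⟨y, rfl⟩ := hvV
    simp only [LinearMap.mulLeft_apply]
    rw [← mul_assoc, he.1.eq]
  refine ⟨c, ?_⟩
  have hy1 : e * (x - c • e) = x - c • e := by
    rw [mul_sub, h₁, mul_smul_comm, he.1.eq]
  have hy2 : (x - c • e) * e = x - c • e := by
    rw [sub_mul, h₂, smul_mul_assoc, he.1.eq]
  have hyv : (x - c • e) * v = 0 := by rw [sub_mul, hv', smul_mul_assoc, hev, sub_self]
  refine mem_jacobson_of_isNilpotent_mul fun z => isNilpotent_mul_of_isNilpotent_mul hy2 ?_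
  refine (he.nilpotent_or_exists_mul_eq k (x := e * z * (x - c • e))
    (by rw [← mul_assoc, ← mul_assoc, he.1.eq]) (by rw [mul_assoc, hy2])).resolve_right ?_
  rintro ⟨y, hy⟩
  apply hv0
  apply Subtype.ext
  change v = 0
  rw [← hev, ← hy, mul_assoc, mul_assoc, hyv, mul_zero, mul_zero]

/-- A basic algebra over an algebraically closed field is the sum of its radical and of the span
of a complete family of orthogonal idempotents. -/
theorem IsBasic.exists_idempotents (k : Type u) [Field k] [IsAlgClosed k] [Algebra k Λ]
    [Module.Finite k Λ] (h : IsBasic Λ) :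
    ∃ (n : ℕ) (e : Fin n → Λ), CompleteOrthogonalIdempotents e ∧
      (∀ i, e i ∉ Ring.jacobson Λ) ∧
      ∀ x, ∃ c : Fin n → k, x - ∑ i, c i • e i ∈ Ring.jacobson Λ := by
  obtain ⟨n, e, he, hp, hb⟩ := h
  refine ⟨n, e, he, fun i hi => ?_, fun x => ?_⟩
  · have : IsArtinianRing Λ := IsArtinianRing.of_finite k Λ
    obtain ⟨m, hm⟩ := IsSemiprimaryRing.isNilpotent (R := Λ)
    have h1 : e i ^ m ∈ Ring.jacobson Λ ^ m := Ideal.pow_mem_pow hi m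
    rw [hm] at h1
    have h2 : e i ^ (m + 1) = 0 := by rw [pow_succ, (show e i ^ m = 0 from h1), zero_mul]
    rw [(he.idem i).pow_succ_eq] at h2
    exact (hp i).2.1 h2
  · have hd : ∀ i, ∃ c : k, e i * x * e i - c • e i ∈ Ring.jacobson Λ := fun i =>
      (hp i).exists_sub_smul_mem_jacobson k (by rw [← mul_assoc, ← mul_assoc, (he.idem i).eq])
        (by rw [mul_assoc, (he.idem i).eq])
    choose c hc using hd
    refine ⟨c, ?_⟩
    -- Peirce decomposition: a diagonal entry is a scalar multiple of e i modulo the radical; an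
    -- off-diagonal entry is radical, since otherwise Λ e i and Λ e j would be isomorphic.
    have hx : x = ∑ i, ∑ j, e i * x * e j := by
      simp_rw [← Finset.mul_sum, he.complete, mul_one, ← Finset.sum_mul, he.complete, one_mul]
    rw [hx, ← Finset.sum_sub_distrib]
    refine Submodule.sum_mem _ fun i _ => ?_
    rw [← Finset.add_sum_erase _ _ (Finset.mem_univ i), add_sub_right_comm]
    refine Submodule.add_mem _ (hc i) (Submodule.sum_mem _ fun j hj => ?_)
    have hij : i ≠ j := (Finset.ne_of_mem_erase hj).symm
    refine ((hp i).nilpotent_mul_or (hp j) k (by rw [← mul_assoc, ← mul_assoc, (he.idem i).eq])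
      (by rw [mul_assoc, (he.idem j).eq])).resolve_right ?_
    rw [not_nonempty_iff]
    exact hb i j hij

end RadicalSplitting

/-! ### Quiver representations in rings and path algebras -/

section Quivers

variable {I Q : Type} [Fintype I] [Fintype Q]

/-- A quiver with vertices `I` and arrows `Q` inside a ring: orthogonal idempotents `eᵢ` and
elements `x_b ∈ e_{src b} A e_{tgt b}`. -/
structure QuiverRep (src tgt : Q → I) (A : Type*) [Ring A] where
  e : I → A
  x : Q → A
  complete : CompleteOrthogonalIdempotents e
  src_mul : ∀ b, e (src b) * x b = x b
  mul_tgt : ∀ b, x b * e (tgt b) = x b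

namespace QuiverRep

variable {src tgt : Q → I} {A : Type*} [Ring A]

/-- The subalgebra generated by the vertices and the arrows. -/
def adjoin (k : Type*) [CommRing k] [Algebra k A] (ρ : QuiverRep src tgt A) : Subalgebra k A :=
  Algebra.adjoin k (Set.range ρ.e ∪ Set.range ρ.x)

theorem e_mem_adjoin (k : Type*) [CommRing k] [Algebra k A] (ρ : QuiverRep src tgt A) (i : I) :
    ρ.e i ∈ ρ.adjoin k := Algebra.subset_adjoin (Or.inl ⟨i, rfl⟩)

theorem x_mem_adjoin (k : Type*) [CommRing k] [Algebra k A] (ρ : QuiverRep src tgt A) (b : Q) :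
    ρ.x b ∈ ρ.adjoin k := Algebra.subset_adjoin (Or.inr ⟨b, rfl⟩)

theorem e_mul_e [DecidableEq I] (ρ : QuiverRep src tgt A) (i j : I) :
    ρ.e i * ρ.e j = if i = j then ρ.e i else 0 := by
  split_ifs with h
  · subst h; exact ρ.complete.idem i
  · exact ρ.complete.ortho h

theorem e_mul_x [DecidableEq I] (ρ : QuiverRep src tgt A) (i : I) (b : Q) :
    ρ.e i * ρ.x b = if i = src b then ρ.x b else 0 := by
  rw [← ρ.src_mul b, ← mul_assoc, e_mul_e]
  split_ifs with h
  · rw [h]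
  · rw [zero_mul]

theorem x_mul_e [DecidableEq I] (ρ : QuiverRep src tgt A) (b : Q) (i : I) :
    ρ.x b * ρ.e i = if tgt b = i then ρ.x b else 0 := by
  rw [← ρ.mul_tgt b, mul_assoc, e_mul_e]
  split_ifs with h
  · rfl
  · rw [mul_zero]

/-- Two representations as a representation in the product ring. -/
def prod {B : Type*} [Ring B] (ρ : QuiverRep src tgt A) (ρ' : QuiverRep src tgt B) :
    QuiverRep src tgt (A × B) where
  e i := (ρ.e i, ρ'.e i)
  x b := (ρ.x b, ρ'.x b)
  complete :=
    { idem := fun i => Prod.ext (ρ.complete.idem i) (ρ'.complete.idem i)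
      ortho := fun i j h => Prod.ext (ρ.complete.ortho h) (ρ'.complete.ortho h)
      complete := Prod.ext (by rw [Prod.fst_sum]; exact ρ.complete.complete)
        (by rw [Prod.snd_sum]; exact ρ'.complete.complete) }
  src_mul b := Prod.ext (ρ.src_mul b) (ρ'.src_mul b)
  mul_tgt b := Prod.ext (ρ.mul_tgt b) (ρ'.mul_tgt b)

end QuiverRep

/-- `A` is the path algebra of a quiver. -/
structure IsPathAlgebra (k : Type u) {A : Type u} [Field k] [Ring A] [Algebra k A]
    {src tgt : Q → I} (ρ : QuiverRep src tgt A) : Prop where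
  adjoin_eq_top : ρ.adjoin k = ⊤
  exists_lift : ∀ (B : Type u) [Ring B] [Algebra k B] (ρ' : QuiverRep src tgt B),
    ∃ f : A →ₐ[k] B, (∀ i, f (ρ.e i) = ρ'.e i) ∧ ∀ b, f (ρ.x b) = ρ'.x b

/-- The linear combinations of paths of length at most `m`. -/
def QuiverRep.IsPathSum (k : Type*) {A : Type*} [Field k] [Ring A] [Algebra k A] {src tgt : Q → I}
    (ρ : QuiverRep src tgt A) : ℕ → A → Prop
  | 0, z => ∃ c : I → k, z = ∑ i, c i • ρ.e i
  | m + 1, z => ∃ (c : I → k) (y : Q → A), (∀ b, ρ.IsPathSum k m (y b)) ∧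
      z = ∑ i, c i • ρ.e i + ∑ b, y b * ρ.x b

namespace QuiverRep.IsPathSum

variable {k : Type*} {A : Type*} [Field k] [Ring A] [Algebra k A] {src tgt : Q → I}
    {ρ : QuiverRep src tgt A}

theorem zero (m : ℕ) : ρ.IsPathSum k m 0 := by
  induction m with
  | zero => exact ⟨0, by simp⟩
  | succ m ih => exact ⟨0, 0, fun _ => ih, by simp⟩

theorem add {m : ℕ} : ∀ {y z : A}, ρ.IsPathSum k m y → ρ.IsPathSum k m z →
    ρ.IsPathSum k m (y + z) := by
  induction m with
  | zero =>
    rintro _ _ ⟨c, rfl⟩ ⟨d, rfl⟩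
    exact ⟨c + d, by simp [add_smul, Finset.sum_add_distrib]⟩
  | succ m ih =>
    rintro _ _ ⟨c, y, hy, rfl⟩ ⟨d, z, hz, rfl⟩
    refine ⟨c + d, y + z, fun b => ih (hy b) (hz b), ?_⟩
    simp only [Pi.add_apply, add_smul, add_mul, Finset.sum_add_distrib]
    abel

theorem smul {m : ℕ} (a : k) : ∀ {z : A}, ρ.IsPathSum k m z → ρ.IsPathSum k m (a • z) := by
  induction m with
  | zero =>
    rintro _ ⟨c, rfl⟩
    exact ⟨a • c, by simp [Finset.smul_sum, mul_smul]⟩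
  | succ m ih =>
    rintro _ ⟨c, y, hy, rfl⟩
    refine ⟨a • c, a • y, fun b => ih (hy b), ?_⟩
    simp [Finset.smul_sum, mul_smul]

theorem mono {m : ℕ} : ∀ {z : A}, ρ.IsPathSum k m z → ρ.IsPathSum k (m + 1) z := by
  induction m with
  | zero =>
    rintro _ ⟨c, rfl⟩
    exact ⟨c, 0, fun _ => zero 0, by simp⟩
  | succ m ih =>
    rintro _ ⟨c, y, hy, rfl⟩
    exact ⟨c, y, fun b => ih (hy b), rfl⟩

theorem mul_e [DecidableEq I] {m : ℕ} {z : A} (hz : ρ.IsPathSum k m z) (j : I) :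
    ρ.IsPathSum k m (z * ρ.e j) := by
  have h1 : ∀ c : I → k, (∑ i, c i • ρ.e i) * ρ.e j = ∑ i, (if i = j then c i else 0) • ρ.e i := by
    intro c
    rw [Finset.sum_mul]
    refine Finset.sum_congr rfl fun i _ => ?_
    rw [smul_mul_assoc, e_mul_e]
    split_ifs <;> simp
  cases m with
  | zero =>
    obtain ⟨c, rfl⟩ := hz
    exact ⟨_, h1 c⟩
  | succ m =>
    obtain ⟨c, y, hy, rfl⟩ := hz
    refine ⟨fun i => if i = j then c i else 0, fun b => if tgt b = j then y b else 0,
      fun b => ?_, ?_⟩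
    rotate_left
    · rw [add_mul, h1, Finset.sum_mul]
      congr 1
      refine Finset.sum_congr rfl fun b _ => ?_
      rw [mul_assoc, x_mul_e]
      by_cases h : tgt b = j <;> simp [h]
    · dsimp only
      split_ifs
      · exact hy b
      · exact zero m

theorem mul_x [DecidableEq Q] {m : ℕ} {z : A} (hz : ρ.IsPathSum k m z) (b : Q) :
    ρ.IsPathSum k (m + 1) (z * ρ.x b) := by
  refine ⟨0, fun a => if a = b then z else 0, fun a => ?_, ?_⟩
  · dsimp only
    split_ifs
    · exact hz
    · exact zero m
  · simp

theorem of_le {m n : ℕ} (h : m ≤ n) {z : A} (hz : ρ.IsPathSum k m z) : ρ.IsPathSum k n z := by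
  induction h with
  | refl => exact hz
  | step _ ih => exact ih.mono

/-- Path sums of bounded length are not closed under multiplication, but right multiplication by a
generator raises the length by at most one. The induction therefore runs over right multiplications,
applied to 1 at the end. -/
theorem exists_of_mem_adjoin [DecidableEq I] [DecidableEq Q] {z : A} (hz : z ∈ ρ.adjoin k) :
    ∃ m, ρ.IsPathSum k m z := by
  have key : ∀ y : A, (∃ m, ρ.IsPathSum k m y) → ∃ m, ρ.IsPathSum k m (y * z) := by
    refine Algebra.adjoin_induction (p := fun z _ => ∀ y : A, (∃ m, ρ.IsPathSum k m y) →
      ∃ m, ρ.IsPathSum k m (y * z)) ?_ ?_ ?_ ?_ hz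
    · rintro _ (⟨i, rfl⟩ | ⟨b, rfl⟩) y ⟨m, hm⟩
      · exact ⟨m, hm.mul_e i⟩
      · exact ⟨m + 1, hm.mul_x b⟩
    · rintro r y ⟨m, hm⟩
      rw [← Algebra.commutes, ← Algebra.smul_def]
      exact ⟨m, hm.smul r⟩
    · intro a b _ _ ha hb y hy
      obtain ⟨m, hm⟩ := ha y hy
      obtain ⟨n, hn⟩ := hb y hy
      rw [mul_add]
      exact ⟨max m n, (hm.of_le (le_max_left m n)).add (hn.of_le (le_max_right m n))⟩
    · intro a b _ _ ha hb y hy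
      rw [← mul_assoc]
      exact hb _ (ha y hy)
  have := key 1 ⟨0, 1, by simp [ρ.complete.complete]⟩
  rwa [one_mul] at this

end QuiverRep.IsPathSum

/-- The subalgebra G of A × B generated by the pairs of generators is the graph of the desired
morphism. By induction on the length of paths, freeness shows that an element of G with first
component 0 vanishes, so G → A is bijective, and the second projection is the lift. -/
theorem IsPathAlgebra.of_free {k A : Type u} [Field k] [Ring A] [Algebra k A]
    {src tgt : Q → I} (ρ : QuiverRep src tgt A) (hgen : ρ.adjoin k = ⊤)
    (hfree : ∀ (c : I → k) (l : Q → A), (∀ b, l b * ρ.e (src b) = l b) →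
      ∑ i, c i • ρ.e i + ∑ b, l b * ρ.x b = 0 → c = 0 ∧ l = 0) : IsPathAlgebra k ρ := by
  classical
  refine ⟨hgen, fun B _ _ ρ' => ?_⟩
  let G := (ρ.prod ρ').adjoin k
  have hinj : ∀ m, ∀ z, (ρ.prod ρ').IsPathSum k m z → z.1 = 0 → z = 0 := by
    intro m
    induction m with
    | zero =>
      rintro _ ⟨c, rfl⟩ h
      have h2 := (hfree c 0 (by simp) (by
        rw [Prod.fst_sum] at h
        simpa [QuiverRep.prod] using h)).1
      simp [h2]
    | succ m ih =>
      rintro _ ⟨c, y, hy, rfl⟩ h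
      -- Freeness only concerns coefficients in A e_{src b}; replacing y b by y b e_{src b} does not
      -- change y b x_b.
      have hy' : ∀ b, (y b * (ρ.prod ρ').e (src b)) * (ρ.prod ρ').x b = y b * (ρ.prod ρ').x b := by
        intro b
        rw [mul_assoc, (ρ.prod ρ').src_mul]
      obtain ⟨h1, h2⟩ := hfree c (fun b => (y b).1 * ρ.e (src b))
        (fun b => by rw [mul_assoc, ρ.complete.idem]) (by
          rw [Prod.fst_add, Prod.fst_sum, Prod.fst_sum] at h
          rw [← h]
          congr 1
          refine Finset.sum_congr rfl fun b _ => ?_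
          rw [mul_assoc, ρ.src_mul]; rfl)
      have h3 : ∀ b, y b * (ρ.prod ρ').e (src b) = 0 := fun b =>
        ih _ ((hy b).mul_e _) (congrFun h2 b)
      rw [h1]
      have : ∀ b, y b * (ρ.prod ρ').x b = 0 := fun b => by rw [← hy', h3, zero_mul]
      simp [this]
  let p : G →ₐ[k] A := (AlgHom.fst k A B).comp G.val
  have hp : Function.Bijective p := by
    constructor
    · rw [injective_iff_map_eq_zero]
      rintro ⟨z, hz⟩ h
      obtain ⟨m, hm⟩ := QuiverRep.IsPathSum.exists_of_mem_adjoin hz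
      exact Subtype.ext (hinj m z hm h)
    · have : p.range = ⊤ := by
        rw [eq_top_iff, ← hgen]
        refine Algebra.adjoin_le ?_
        rintro _ (⟨i, rfl⟩ | ⟨b, rfl⟩)
        · exact ⟨⟨_, (ρ.prod ρ').e_mem_adjoin k i⟩, rfl⟩
        · exact ⟨⟨_, (ρ.prod ρ').x_mem_adjoin k b⟩, rfl⟩
      exact AlgHom.range_eq_top p |>.1 this
  let E := AlgEquiv.ofBijective p hp
  refine ⟨((AlgHom.snd k A B).comp G.val).comp E.symm.toAlgHom, fun i => ?_, fun b => ?_⟩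
  · have : E.symm (ρ.e i) = ⟨_, (ρ.prod ρ').e_mem_adjoin k i⟩ := by
      rw [AlgEquiv.symm_apply_eq]; rfl
    change (E.symm (ρ.e i) : A × B).2 = _
    rw [this]; rfl
  · have : E.symm (ρ.x b) = ⟨_, (ρ.prod ρ').x_mem_adjoin k b⟩ := by
      rw [AlgEquiv.symm_apply_eq]; rfl
    change (E.symm (ρ.x b) : A × B).2 = _
    rw [this]; rfl

end Quivers

/-! ### Hereditary basic algebras are path algebras -/

section Hereditary

variable {Λ : Type u} [Ring Λ]

/-- In an algebra of global dimension at most one, left ideals are projective. -/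
theorem HasGlobalDimensionLE.projective (h : HasGlobalDimensionLE Λ 1) {M : Type u}
    [AddCommGroup M] [Module Λ M] [Module.Projective Λ M] (N : Submodule Λ M) :
    Module.Projective Λ N := by
  let S : ShortComplex (ModuleCat.{u} Λ) := ShortComplex.mk (ModuleCat.ofHom N.subtype)
    (ModuleCat.ofHom N.mkQ) (by ext x; simp)
  have hS : S.ShortExact := 
    { exact := by
        rw [ShortComplex.moduleCat_exact_iff]
        intro x hx
        exact ⟨⟨x, (Submodule.Quotient.mk_eq_zero N).1 hx⟩, rfl⟩
      mono_f := (ModuleCat.mono_iff_injective _).2 N.subtype_injective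
      epi_g := (ModuleCat.epi_iff_surjective _).2 N.mkQ_surjective }
  have h2 : Projective S.X₂ := (IsProjective.iff_projective (R := Λ) M).1 inferInstance
  have h3 : HasProjectiveDimensionLT S.X₃ (1 + 1) := h S.X₃
  have : HasProjectiveDimensionLT S.X₁ 1 :=
    hS.hasProjectiveDimensionLT_X₁ 1 inferInstance h3
  have := (projective_iff_hasProjectiveDimensionLT_one).2 this
  exact (IsProjective.iff_projective (R := Λ) N).2 this

/-- Representatives of a basis of `J / J²` adapted to a family of idempotents. -/
theorem exists_arrows {k : Type u} [Field k] [Algebra k Λ] [Module.Finite k Λ] {I : Type}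
    [Fintype I] {e : I → Λ} (he : CompleteOrthogonalIdempotents e) (J : Ideal Λ) [J.IsTwoSided] :
    ∃ (Q : Type) (_ : Fintype Q) (src tgt : Q → I) (v : Q → Λ),
      (∀ b, e (src b) * v b = v b) ∧ (∀ b, v b * e (tgt b) = v b) ∧ (∀ b, v b ∈ J) ∧
      (∀ x ∈ J, ∃ c : Q → k, x - ∑ b, c b • v b ∈ J ^ 2) ∧
      (∀ c : Q → k, ∑ b, c b • v b ∈ J ^ 2 → c = 0) := by
  classical
  let N : Submodule k Λ := (J ^ 2).restrictScalars k
  have hker : ∀ x, N.mkQ x = 0 → x ∈ J ^ 2 := fun x h => (Submodule.Quotient.mk_eq_zero N).1 h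
  have hker' : ∀ x ∈ J ^ 2, N.mkQ x = 0 := fun x h => (Submodule.Quotient.mk_eq_zero N).2 h
  -- The Peirce components e_i J e_j. Choosing a basis of the image of each in J / J² gives every
  -- basis element a source and a target.
  let M : I × I → Submodule k Λ := fun p =>
    (J.restrictScalars k).map ((LinearMap.mulLeft k (e p.1)).comp (LinearMap.mulRight k (e p.2)))
  let b : ∀ p, Module.Basis (Fin (Module.finrank k ((M p).map N.mkQ))) k ((M p).map N.mkQ) :=
    fun p => Module.finBasis k _
  have hb : ∀ p l, ∃ x ∈ J, N.mkQ (e p.1 * (x * e p.2)) = b p l := by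
    intro p l
    obtain ⟨_, ⟨x, hx, rfl⟩, hy⟩ := (b p l).2
    exact ⟨x, hx, hy⟩
  choose x hxJ hx using hb
  have hmem : ∀ p l, e p.1 * (x p l * e p.2) ∈ J := fun p l =>
    J.mul_mem_left _ (J.mul_mem_right _ (hxJ p l))
  refine ⟨Σ p : I × I, Fin (Module.finrank k ((M p).map N.mkQ)), inferInstance, fun q => q.1.1,
    fun q => q.1.2, fun q => e q.1.1 * (x q.1 q.2 * e q.1.2), fun q => ?_, fun q => ?_,
    fun q => hmem _ _, fun y hy => ?_, fun c hc => ?_⟩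
  · rw [← mul_assoc, (he.idem _).eq]
  · rw [mul_assoc, mul_assoc, (he.idem _).eq]
  · have h1 : ∀ p : I × I, (N.mkQ (e p.1 * (y * e p.2))) ∈ (M p).map N.mkQ := fun p =>
      ⟨_, ⟨y, hy, rfl⟩, rfl⟩
    refine ⟨fun q => (b q.1).repr ⟨_, h1 q.1⟩ q.2, ?_⟩
    refine hker _ ?_
    rw [map_sub, sub_eq_zero, map_sum, Fintype.sum_sigma]
    have h2 : y = ∑ p : I × I, e p.1 * (y * e p.2) := by
      rw [Fintype.sum_prod_type]
      simp_rw [← Finset.mul_sum, he.complete, mul_one, ← Finset.sum_mul, he.complete, one_mul]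
    conv_lhs => rw [h2, map_sum]
    refine Finset.sum_congr rfl fun p _ => ?_
    have h3 := congrArg (Submodule.subtype _) ((b p).sum_repr ⟨_, h1 p⟩)
    rw [map_sum] at h3
    simp only [map_smul, Submodule.subtype_apply] at h3
    rw [← h3]
    exact Finset.sum_congr rfl fun l _ => by rw [map_smul, hx]
  · have h1 : ∀ p : I × I, ∀ l, c ⟨p, l⟩ = 0 := by
      intro p
      have h2 : e p.1 * ((∑ q : Σ p : I × I, Fin (Module.finrank k ((M p).map N.mkQ)),
          c q • (e q.1.1 * (x q.1 q.2 * e q.1.2))) * e p.2) ∈ N :=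
        (J ^ 2).mul_mem_left _ ((J ^ 2).mul_mem_right _ hc)
      rw [Fintype.sum_sigma, Finset.sum_mul, Finset.mul_sum, Finset.sum_eq_single p] at h2
      · have h3 : ∑ l, c ⟨p, l⟩ • b p l = 0 := by
          apply Subtype.ext
          have h2 := hker' _ h2
          rw [Finset.sum_mul, Finset.mul_sum, map_sum] at h2
          rw [← Submodule.subtype_apply, map_sum]
          refine Eq.trans ?_ h2
          refine Finset.sum_congr rfl fun l _ => ?_
          rw [map_smul, Submodule.subtype_apply, ← hx, smul_mul_assoc, mul_smul_comm, map_smul]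
          congr 2
          simp only [mul_assoc, (he.idem p.2).eq]
          rw [← mul_assoc (e p.1) (e p.1), (he.idem p.1).eq]
        exact fun l => Fintype.linearIndependent_iff.1 (b p).linearIndependent _ h3 l
      · intro q _ hq
        rw [Finset.sum_mul, Finset.mul_sum]
        refine Finset.sum_eq_zero fun l _ => ?_
        rw [smul_mul_assoc, mul_smul_comm]
        by_cases h : q.1 = p.1
        · have h' : q.2 ≠ p.2 := fun h' => hq (Prod.ext h h')
          rw [mul_assoc, mul_assoc, he.ortho h']; simp
        · rw [← mul_assoc, ← mul_assoc, he.ortho (Ne.symm h)]; simp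
      · intro h; exact absurd (Finset.mem_univ p) h
    ext ⟨p, l⟩
    exact h1 p l

/-- A basic hereditary finite dimensional algebra over an algebraically closed field is the path
algebra of a quiver. -/
theorem exists_isPathAlgebra {k : Type u} [Field k] [IsAlgClosed k] [Algebra k Λ]
    [Module.Finite k Λ] (hb : IsBasic Λ) (hg : HasGlobalDimensionLE Λ 1) :
    ∃ (I Q : Type) (_ : Fintype I) (_ : Fintype Q) (src tgt : Q → I) (ρ : QuiverRep src tgt Λ),
      IsPathAlgebra k ρ := by
  classical
  obtain ⟨n, e, he, heJ, hsum⟩ := hb.exists_idempotents k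
  set J := Ring.jacobson Λ
  obtain ⟨Q, _, src, tgt, v, hsv, hvt, hvJ, hspan, hind⟩ := exists_arrows (k := k) he J
  have : IsArtinianRing Λ := IsArtinianRing.of_finite k Λ
  obtain ⟨N, hN⟩ := IsSemiprimaryRing.isNilpotent (R := Λ)
  change J ^ N = 0 at hN
  have hJ2 : J ^ 2 = J * J := by rw [Submodule.pow_succ, Submodule.pow_one]
  let ρ : QuiverRep src tgt Λ := ⟨e, v, he, hsv, hvt⟩
  have hcJ : ∀ c : Fin n → k, ∑ i, c i • e i ∈ J → c = 0 := by
    intro c hc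
    ext i
    by_contra hi
    apply heJ i
    have h1 : e i * ∑ i, c i • e i ∈ J := J.mul_mem_left _ hc
    rw [Finset.mul_sum, Finset.sum_eq_single i] at h1
    · rw [mul_smul_comm, (he.idem i).eq] at h1
      have := (J.restrictScalars k).smul_mem (c i)⁻¹ h1
      rwa [smul_smul, inv_mul_cancel₀ hi, one_smul] at this
    · intro j _ hj
      rw [mul_smul_comm, he.ortho hj.symm, smul_zero]
    · intro h; exact absurd (Finset.mem_univ i) h
  -- generation
  have hgen : ρ.adjoin k = ⊤ := by
    -- Successive approximation along the powers of J: scalars on the vertices account for Λ / J,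
    -- and products of the arrows for J^(m+1) / J^(m+2). The nilpotency of J stops the process.
    have key : ∀ m, ∀ x : Λ, ∃ y ∈ ρ.adjoin k, x - y ∈ J ^ (m + 1) := by
      have hS : ∀ c : Fin n → k, ∑ i, c i • e i ∈ ρ.adjoin k := fun c =>
        Subalgebra.sum_mem _ fun i _ => Subalgebra.smul_mem _ (ρ.e_mem_adjoin k i) _
      have hJ : ∀ m, ∀ x ∈ J ^ (m + 1), ∃ y ∈ ρ.adjoin k, x - y ∈ J ^ (m + 2) := by
        intro m
        induction m with
        | zero =>
          intro x hx
          rw [zero_add, Submodule.pow_one] at hx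
          obtain ⟨c, hc⟩ := hspan x hx
          exact ⟨_, Subalgebra.sum_mem _ fun b _ => Subalgebra.smul_mem _ (ρ.x_mem_adjoin k b) _, hc⟩
        | succ m ih =>
          intro x hx
          rw [Submodule.pow_succ] at hx
          refine Submodule.smul_induction_on hx ?_ ?_
          · intro a ha b hb
            obtain ⟨y, hy, hy'⟩ := ih a ha
            obtain ⟨c, hc⟩ := hspan b hb
            refine ⟨y * ∑ b, c b • v b, Subalgebra.mul_mem _ hy (Subalgebra.sum_mem _ fun b _ =>
              Subalgebra.smul_mem _ (ρ.x_mem_adjoin k b) _), ?_⟩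
            have : a • b - y * ∑ b, c b • v b = (a - y) * ∑ b, c b • v b +
                a * (b - ∑ b, c b • v b) := by rw [smul_eq_mul]; noncomm_ring
            rw [this]
            refine Ideal.add_mem _ ?_ ?_
            · rw [show m + 1 + 2 = (m + 2) + 1 from rfl, Submodule.pow_succ]
              exact Ideal.mul_mem_mul hy' (Ideal.sum_mem _ fun b _ =>
                (J.restrictScalars k).smul_mem _ (hvJ b))
            · rw [show m + 1 + 2 = (m + 1) + 1 + 1 from rfl, Submodule.pow_succ, Submodule.pow_succ,
                mul_assoc, ← hJ2]
              exact Ideal.mul_mem_mul ha hc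
          · rintro a b ⟨y, hy, hy'⟩ ⟨z, hz, hz'⟩
            refine ⟨y + z, Subalgebra.add_mem _ hy hz, ?_⟩
            rw [add_sub_add_comm]
            exact Ideal.add_mem _ hy' hz'
      intro m
      induction m with
      | zero =>
        intro x
        obtain ⟨c, hc⟩ := hsum x
        exact ⟨_, hS c, by rwa [zero_add, Submodule.pow_one]⟩
      | succ m ih =>
        intro x
        obtain ⟨y, hy, hy'⟩ := ih x
        obtain ⟨z, hz, hz'⟩ := hJ m _ hy'
        exact ⟨y + z, Subalgebra.add_mem _ hy hz, by rwa [← sub_sub]⟩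
    rw [eq_top_iff]
    intro x _
    obtain ⟨y, hy, hy'⟩ := key N x
    rw [Submodule.pow_succ, hN, Ideal.zero_eq_bot, Ideal.bot_mul] at hy'
    rw [sub_eq_zero.1 hy']
    exact hy
  refine ⟨Fin n, Q, inferInstance, inferInstance, src, tgt, ρ, IsPathAlgebra.of_free ρ hgen ?_⟩
  -- freeness
  let F : Submodule Λ (Q → Λ) :=
    { carrier := {l | ∀ b, l b * e (src b) = l b}
      add_mem' := fun ha hb q => by rw [Pi.add_apply, add_mul, ha q, hb q]
      zero_mem' := fun q => zero_mul _
      smul_mem' := fun c l hl q => by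
        rw [Pi.smul_apply, smul_eq_mul, mul_assoc, hl q] }
  let π₀ : (Q → Λ) →ₗ[Λ] Λ := Fintype.linearCombination Λ v
  have hπ₀ : ∀ l : Q → Λ, π₀ l = ∑ b, l b * v b := fun l => rfl
  -- Here F = ⨁ Λ e_{src b}, and π maps it onto J by nilpotency. As J is projective, π splits.
  -- Injectivity of π is the freeness to be proved.
  let π : F →ₗ[Λ] J := (π₀.comp F.subtype).codRestrict J fun l => by
    change ∑ b, _ • _ ∈ J
    exact Ideal.sum_mem _ fun b _ => J.mul_mem_left _ (hvJ b)
  have hgF : ∀ (a : Λ) b, Pi.single b (a * e (src b)) ∈ F := by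
    intro a b q
    by_cases h : q = b
    · subst h
      rw [Pi.single_eq_same, mul_assoc, (he.idem _).eq]
    · rw [Pi.single_eq_of_ne h, zero_mul]
  have hπs : Function.Surjective π := by
    have h1 : ∀ m, ∀ x ∈ J, ∃ l ∈ F, x - π₀ l ∈ J ^ (m + 1) := by
      have hstep : ∀ m, ∀ y ∈ J ^ (m + 1), ∃ l ∈ F, y - π₀ l ∈ J ^ (m + 2) := by
        intro m y hy
        rw [Submodule.pow_succ] at hy
        refine Submodule.smul_induction_on hy ?_ ?_
        · intro a ha y hy
          obtain ⟨c, hc⟩ := hspan y hy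
          refine ⟨fun q => c q • a * e (src q), fun q => by
            rw [mul_assoc, (he.idem _).eq], ?_⟩
          have : a • y - π₀ (fun q => c q • a * e (src q)) = a * (y - ∑ b, c b • v b) := by
            simp only [hπ₀, mul_assoc, hsv, smul_eq_mul, mul_sub, Finset.mul_sum, smul_mul_assoc,
              mul_smul_comm]
          rw [this, show m + 2 = m + 1 + 1 from rfl, Submodule.pow_succ, Submodule.pow_succ,
            mul_assoc, ← hJ2]
          exact Ideal.mul_mem_mul ha hc
        · rintro y z ⟨l, hl, hl'⟩ ⟨l', hl1, hl1'⟩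
          refine ⟨l + l', F.add_mem hl hl1, ?_⟩
          rw [map_add, add_sub_add_comm]
          exact Ideal.add_mem _ hl' hl1'
      intro m
      induction m with
      | zero => exact fun x hx => ⟨0, F.zero_mem, by rwa [map_zero, sub_zero, Submodule.pow_one]⟩
      | succ m ih =>
        intro x hx
        obtain ⟨l, hl, hl'⟩ := ih x hx
        obtain ⟨l', hl1, hl1'⟩ := hstep m _ hl'
        exact ⟨l + l', F.add_mem hl hl1, by rwa [map_add, ← sub_sub]⟩
    rintro ⟨x, hx⟩
    obtain ⟨l, hl, h⟩ := h1 N x hx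
    rw [Submodule.pow_succ, hN, Ideal.zero_eq_bot, Ideal.bot_mul] at h
    exact ⟨⟨l, hl⟩, Subtype.ext (sub_eq_zero.1 h).symm⟩
  have hproj : Module.Projective Λ J := hg.projective J
  obtain ⟨σ, hσ⟩ := Module.projective_lifting_property π LinearMap.id hπs
  have hσ' : ∀ y, π (σ y) = y := fun y => LinearMap.congr_fun hσ y
  -- elements of the kernel have coefficients in the radical
  have hker : ∀ l ∈ F, π₀ l = 0 → ∀ b, l b ∈ J := by
    intro l hl hl0
    choose c hc using fun b => hsum (l b)
    have h1 : ∀ b, l b - c b (src b) • e (src b) ∈ J := by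
      intro b
      have := J.mul_mem_right (e (src b)) (hc b)
      rw [sub_mul, hl b, Finset.sum_mul, Finset.sum_eq_single (src b)] at this
      · rwa [smul_mul_assoc, (he.idem _).eq] at this
      · intro j _ hj
        rw [smul_mul_assoc, he.ortho hj, smul_zero]
      · intro h; exact absurd (Finset.mem_univ _) h
    have h2 : (fun b => c b (src b)) = 0 := by
      apply hind
      have : ∑ b, c b (src b) • v b = -∑ b, (l b - c b (src b) • e (src b)) * v b := by
        simp only [sub_mul, Finset.sum_sub_distrib, smul_mul_assoc, hsv]
        rw [← hπ₀, hl0, zero_sub, neg_neg]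
      rw [this, hJ2]
      exact Ideal.neg_mem_iff _ |>.2 (Ideal.sum_mem _ fun b _ => Ideal.mul_mem_mul (h1 b) (hvJ b))
    intro b
    have := h1 b
    rwa [show c b (src b) = 0 from congrFun h2 b, zero_smul, sub_zero] at this
  -- Nakayama argument: p = 1 - σπ projects onto the kernel, so l = ∑ l_q p(g_q), and p(g_q) has
  -- coefficients in J. Coefficients of l in J^m are therefore in J^(m+1).
  have hker0 : ∀ l ∈ F, π₀ l = 0 → l = 0 := by
    intro l hl hl0
    have h1 : ∀ m, ∀ b, l b ∈ J ^ m := by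
      intro m
      induction m with
      | zero => intro b; rw [Submodule.pow_zero, Ideal.one_eq_top]; trivial
      | succ m ih =>
        intro b
        let g : Q → F := fun q => ⟨Pi.single q (1 * e (src q)), hgF 1 q⟩
        let p : F → F := fun y => y - σ (π y)
        have hl1 : (⟨l, hl⟩ : F) = ∑ q, l q • p (g q) := by
          have h3 : (⟨l, hl⟩ : F) = ∑ q, l q • g q := by
            apply Subtype.ext
            rw [← F.subtype_apply, ← F.subtype_apply, map_sum]
            ext b
            rw [Finset.sum_apply, Finset.sum_eq_single b]
            · simp [g, hl b]
            · intro q _ hq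
              simp [g, Pi.single_eq_of_ne hq.symm]
            · intro h; exact absurd (Finset.mem_univ _) h
          have h4 : π ⟨l, hl⟩ = 0 := Subtype.ext hl0
          calc (⟨l, hl⟩ : F) = ⟨l, hl⟩ - σ (π ⟨l, hl⟩) := by rw [h4, map_zero, sub_zero]
            _ = _ := by
              rw [h3, map_sum, map_sum, ← Finset.sum_sub_distrib]
              refine Finset.sum_congr rfl fun q _ => ?_
              rw [map_smul, map_smul]
              exact (smul_sub _ _ _).symm
        have h5 : l b = ∑ q, l q * (p (g q) : Q → Λ) b := by
          have := congrFun (congrArg F.subtype hl1) b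
          rw [map_sum, Finset.sum_apply] at this
          exact this
        rw [h5, Submodule.pow_succ]
        refine Ideal.sum_mem _ fun q _ => Ideal.mul_mem_mul (ih q) ?_
        refine hker _ (p (g q)).2 ?_ b
        have : π (p (g q)) = 0 := by
          change π (g q - σ (π (g q))) = 0
          rw [map_sub, hσ', sub_self]
        exact congrArg Subtype.val this
    ext b
    have := h1 N b
    rwa [hN] at this
  intro c l hl h
  have hc : c = 0 := by
    apply hcJ
    rw [eq_neg_of_add_eq_zero_left h]
    exact Ideal.neg_mem_iff _ |>.2 (Ideal.sum_mem _ fun b _ => J.mul_mem_left _ (hvJ b))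
  refine ⟨hc, hker0 l hl ?_⟩
  rw [hc] at h
  simpa [hπ₀] using h

end Hereditary

/-! ### Derivations of an algebra in Hom_k(Z, W) -/

section Derivations

variable (k : Type*) {A Z W : Type*} [Field k] [Ring A] [Algebra k A]
  [AddCommGroup Z] [Module k Z] [Module A Z] [IsScalarTower k A Z]
  [AddCommGroup W] [Module k W] [Module A W] [IsScalarTower k A W]

variable (A Z W) in
/-- The derivations of `A` in the bimodule `Hom_k(Z, W)`. -/
def Der : Submodule k (A →ₗ[k] Z →ₗ[k] W) where
  carrier := {δ | ∀ p q z, δ (p * q) z = p • δ q z + δ p (q • z)}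
  add_mem' {δ δ'} hδ hδ' p q z := by
    simp only [LinearMap.add_apply]
    rw [hδ, hδ', smul_add]; abel
  zero_mem' p q z := by simp
  smul_mem' c δ hδ p q z := by
    simp only [LinearMap.smul_apply]
    rw [hδ, smul_add, smul_comm]

/-- The inner derivation defined by a `k`-linear map. -/
def innerDer : (Z →ₗ[k] W) →ₗ[k] A →ₗ[k] Z →ₗ[k] W where
  toFun T := (LinearMap.llcomp k Z W W).flip T ∘ₗ (Algebra.lsmul k k W).toLinearMap -
    (LinearMap.llcomp k Z Z W T) ∘ₗ (Algebra.lsmul k k Z).toLinearMap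
  map_add' S T := by
    ext p z
    simp [add_sub_add_comm]
  map_smul' c T := by
    ext p z
    simp [smul_sub]

@[simp] theorem innerDer_apply (T : Z →ₗ[k] W) (p : A) (z : Z) :
    innerDer k T p z = p • T z - T (p • z) := rfl

theorem innerDer_mem (T : Z →ₗ[k] W) : innerDer k T ∈ Der k A Z W := by
  intro p q z
  simp only [innerDer_apply, mul_smul, smul_sub]
  abel

variable {k}

theorem Der.apply_one {δ : A →ₗ[k] Z →ₗ[k] W} (hδ : δ ∈ Der k A Z W) : δ 1 = 0 := by
  ext z
  have := hδ 1 1 z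
  simpa using this

variable {I Q : Type} [Fintype I] [Fintype Q] {src tgt : Q → I}

/-- Derivations are determined by their values on generators. -/
theorem Der.ext_of_adjoin {ρ : QuiverRep src tgt A} (hρ : ρ.adjoin k = ⊤)
    {δ δ' : A →ₗ[k] Z →ₗ[k] W} (hδ : δ ∈ Der k A Z W) (hδ' : δ' ∈ Der k A Z W)
    (he : ∀ i, δ (ρ.e i) = δ' (ρ.e i)) (hx : ∀ b, δ (ρ.x b) = δ' (ρ.x b)) : δ = δ' := by
  ext1 p
  have hp : p ∈ ρ.adjoin k := hρ ▸ Algebra.mem_top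
  induction hp using Algebra.adjoin_induction with
  | mem p hp =>
    rcases hp with ⟨i, rfl⟩ | ⟨b, rfl⟩
    · exact he i
    · exact hx b
  | algebraMap r =>
    rw [Algebra.algebraMap_eq_smul_one, map_smul, map_smul, Der.apply_one hδ, Der.apply_one hδ']
  | add p q _ _ hp hq => rw [map_add, map_add, hp, hq]
  | mul p q _ _ hp hq =>
    ext z
    rw [hδ, hδ', hp, hq]

/-- Up to inner derivations, a derivation kills the vertices. -/
theorem Der.exists_normalized (ρ : QuiverRep src tgt A) {δ : A →ₗ[k] Z →ₗ[k] W}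
    (hδ : δ ∈ Der k A Z W) : ∃ T : Z →ₗ[k] W, ∀ i, δ (ρ.e i) + innerDer k T (ρ.e i) = 0 := by
  classical
  -- The span of the vertices is a separable algebra; its separability element ∑ e_i ⊗ e_i yields
  -- this T.
  refine ⟨∑ i, δ (ρ.e i) ∘ₗ (Algebra.lsmul k k Z (ρ.e i)), fun j => ?_⟩
  ext z
  have h1 : ∀ i, ρ.e j • δ (ρ.e i) (ρ.e i • z) =
      (if i = j then δ (ρ.e j) (ρ.e j • z) else 0) - δ (ρ.e j) (ρ.e i • z) := by
    intro i
    have := hδ (ρ.e j) (ρ.e i) (ρ.e i • z)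
    rw [ρ.e_mul_e, ← mul_smul, (ρ.complete.idem i).eq] at this
    rw [eq_sub_iff_add_eq, ← this]
    by_cases h : j = i
    · subst h; simp
    · rw [if_neg h, if_neg (Ne.symm h), map_zero, LinearMap.zero_apply]
  have h2 : ∑ i, δ (ρ.e j) (ρ.e i • z) = δ (ρ.e j) z := by
    rw [← map_sum, ← Finset.sum_smul, ρ.complete.complete, one_smul]
  have h3 : ∑ i, δ (ρ.e i) (ρ.e i • ρ.e j • z) = δ (ρ.e j) (ρ.e j • z) := by
    rw [Finset.sum_eq_single j]
    · rw [← mul_smul, (ρ.complete.idem j).eq]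
    · intro i _ hij
      rw [← mul_smul, ρ.complete.ortho hij, zero_smul, map_zero]
    · intro h; exact absurd (Finset.mem_univ j) h
  simp only [LinearMap.add_apply, innerDer_apply, LinearMap.sum_apply, LinearMap.comp_apply,
    Algebra.lsmul_coe, LinearMap.zero_apply, Finset.smul_sum]
  rw [h3, Finset.sum_congr rfl fun i _ => h1 i, Finset.sum_sub_distrib, h2]
  simp

variable (k) in
/-- The endomorphism of `W × Z` defined by `p` and an off-diagonal entry. -/
def triangular (p : A) (ξ : Z →ₗ[k] W) : Module.End k (W × Z) :=
  ((Algebra.lsmul k k W p).coprod ξ).prod ((Algebra.lsmul k k Z p) ∘ₗ LinearMap.snd k W Z)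

@[simp] theorem triangular_apply (p : A) (ξ : Z →ₗ[k] W) (y : W × Z) :
    triangular k p ξ y = (p • y.1 + ξ y.2, p • y.2) := rfl

theorem triangular_mul (p q : A) (ξ ξ' : Z →ₗ[k] W) :
    triangular k p ξ * triangular k q ξ' = triangular k (p * q)
      (Algebra.lsmul k k W p ∘ₗ ξ' + ξ ∘ₗ Algebra.lsmul k k Z q) := by
  refine LinearMap.ext fun y => ?_
  rw [Module.End.mul_apply]
  simp only [triangular_apply]
  ext
  · simp [mul_smul, add_assoc]
  · simp [mul_smul]

theorem triangular_sum {ι : Type*} (s : Finset ι) (p : ι → A) (ξ : ι → Z →ₗ[k] W) :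
    ∑ i ∈ s, triangular k (p i) (ξ i) = triangular k (∑ i ∈ s, p i) (∑ i ∈ s, ξ i) := by
  refine LinearMap.ext fun y => ?_
  rw [LinearMap.sum_apply]
  ext
  · simp [Prod.fst_sum, Finset.sum_add_distrib, Finset.sum_smul]
  · simp [Prod.snd_sum, Finset.sum_smul]

theorem smul_triangular (c : k) (p : A) (ξ : Z →ₗ[k] W) :
    c • triangular k p ξ = triangular k (c • p) (c • ξ) := by
  refine LinearMap.ext fun y => ?_
  ext <;> simp

theorem triangular_zero : triangular k (0 : A) (0 : Z →ₗ[k] W) = 0 := by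
  refine LinearMap.ext fun y => ?_
  ext <;> simp

theorem triangular_one : triangular k (1 : A) (0 : Z →ₗ[k] W) = 1 := by
  refine LinearMap.ext fun y => ?_
  ext <;> simp

/-- The representation by triangular matrices defined by values of a derivation. -/
def QuiverRep.triangular (ρ : QuiverRep src tgt A) (ξ : Q → Z →ₗ[k] W)
    (h₁ : ∀ b z, ρ.e (src b) • ξ b z = ξ b z) (h₂ : ∀ b z, ξ b (ρ.e (tgt b) • z) = ξ b z) :
    QuiverRep src tgt (Module.End k (W × Z)) where
  e i := Preproj.triangular k (ρ.e i) 0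
  x b := Preproj.triangular k (ρ.x b) (ξ b)
  complete :=
    { idem := fun i => by
        change Preproj.triangular k _ _ * Preproj.triangular k _ _ = _
        rw [triangular_mul, (ρ.complete.idem i).eq, LinearMap.comp_zero, LinearMap.zero_comp,
          add_zero]
      ortho := fun i j h => by
        change Preproj.triangular k _ _ * Preproj.triangular k _ _ = _
        rw [triangular_mul, ρ.complete.ortho h, LinearMap.comp_zero, LinearMap.zero_comp,
          add_zero, triangular_zero]
      complete := by
        rw [triangular_sum, ρ.complete.complete, Finset.sum_const_zero, triangular_one] }
  src_mul b := by
    rw [triangular_mul, ρ.src_mul]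
    congr 1
    ext z
    simp [h₁]
  mul_tgt b := by
    rw [triangular_mul, ρ.mul_tgt]
    congr 1
    ext z
    simp [h₂]

/-- The corner of a morphism A → End(W ⊕ Z) into block triangular matrices, with the two actions on
the diagonal, is a derivation. Triangular values on generators force triangular values everywhere.
-/
theorem Der.exists_of_triangular (ρ : QuiverRep src tgt A) (hρ : ρ.adjoin k = ⊤)
    (ξ : Q → Z →ₗ[k] W) (f : A →ₐ[k] Module.End k (W × Z))
    (he : ∀ i, f (ρ.e i) = Preproj.triangular k (ρ.e i) 0)
    (hx : ∀ b, f (ρ.x b) = Preproj.triangular k (ρ.x b) (ξ b)) :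
    ∃ δ ∈ Der k A Z W, (∀ i, δ (ρ.e i) = 0) ∧ ∀ b, δ (ρ.x b) = ξ b := by
  have key : ∀ p, ∃ ζ : Z →ₗ[k] W, f p = triangular k p ζ := by
    intro p
    have hp : p ∈ ρ.adjoin k := hρ ▸ Algebra.mem_top
    induction hp using Algebra.adjoin_induction with
    | mem p hp =>
      rcases hp with ⟨i, rfl⟩ | ⟨b, rfl⟩
      · exact ⟨0, he i⟩
      · exact ⟨ξ b, hx b⟩
    | algebraMap r =>
      refine ⟨0, ?_⟩
      rw [AlgHom.commutes, Algebra.algebraMap_eq_smul_one, Algebra.algebraMap_eq_smul_one,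
        ← triangular_one (A := A), smul_triangular, smul_zero]
    | add p q _ _ hp hq =>
      obtain ⟨ζ, hζ⟩ := hp
      obtain ⟨ζ', hζ'⟩ := hq
      refine ⟨ζ + ζ', ?_⟩
      rw [map_add, hζ, hζ']
      refine LinearMap.ext fun y => ?_
      ext
      · simp [add_smul]; abel
      · simp [add_smul]
    | mul p q _ _ hp hq =>
      obtain ⟨ζ, hζ⟩ := hp
      obtain ⟨ζ', hζ'⟩ := hq
      exact ⟨_, by rw [map_mul, hζ, hζ', triangular_mul]⟩
  let δ : A →ₗ[k] Z →ₗ[k] W :=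
    { toFun := fun p => LinearMap.fst k W Z ∘ₗ f p ∘ₗ LinearMap.inr k W Z
      map_add' := fun p q => by ext z; simp
      map_smul' := fun c p => by ext z; simp }
  have hδ : ∀ p ζ, f p = triangular k p ζ → δ p = ζ := by
    intro p ζ h
    ext z
    change (f p (0, z)).1 = ζ z
    simp [h]
  refine ⟨δ, fun p q z => ?_, fun i => hδ _ _ (he i), fun b => hδ _ _ (hx b)⟩
  obtain ⟨ζ, hζ⟩ := key p
  obtain ⟨ζ', hζ'⟩ := key q
  rw [hδ _ _ hζ, hδ _ _ hζ', hδ (p * q) _ (by rw [map_mul, hζ, hζ', triangular_mul])]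
  simp

end Derivations

section PathAlgebraDerivations

variable {k : Type u} {A Z W : Type u} [Field k] [Ring A] [Algebra k A]
  [AddCommGroup Z] [Module k Z] [Module A Z] [IsScalarTower k A Z]
  [AddCommGroup W] [Module k W] [Module A W] [IsScalarTower k A W]
  {I Q : Type} [Fintype I] [Fintype Q] {src tgt : Q → I}

theorem IsPathAlgebra.exists_der {ρ : QuiverRep src tgt A} (hρ : IsPathAlgebra k ρ)
    (ξ : Q → Z →ₗ[k] W) (h₁ : ∀ b z, ρ.e (src b) • ξ b z = ξ b z)
    (h₂ : ∀ b z, ξ b (ρ.e (tgt b) • z) = ξ b z) :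
    ∃ δ ∈ Der k A Z W, (∀ i, δ (ρ.e i) = 0) ∧ ∀ b, δ (ρ.x b) = ξ b := by
  obtain ⟨f, he, hx⟩ := hρ.exists_lift _ (ρ.triangular ξ h₁ h₂)
  exact Der.exists_of_triangular ρ hρ.adjoin_eq_top ξ f he hx

end PathAlgebraDerivations

/-! ### Derivations, morphisms to the cosyzygy, and Ext¹ -/

section Cosyzygy

open scoped ModuleCat

variable (k : Type u) {A : Type u} [Field k] [Ring A] [Algebra k A]

/-- Evaluation at 1 identifies Hom_A(X, Hom_k(A, V)) with Hom_k(X, V), and k-linear maps extend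
along injections of vector spaces. -/
theorem CoInd.injective (V : Type u) [AddCommGroup V] [Module k V] :
    Module.Injective A (CoInd k A V) where
  out X Y _ _ _ _ f hf g := by
    let _ : Module k X := Module.compHom X (algebraMap k A)
    let _ : Module k Y := Module.compHom Y (algebraMap k A)
    have : IsScalarTower k A X := IsScalarTower.of_algebraMap_smul fun _ _ => rfl
    have : IsScalarTower k A Y := IsScalarTower.of_algebraMap_smul fun _ _ => rfl
    obtain ⟨r, hr⟩ := (f.restrictScalars k).exists_leftInverse_of_injective
      (LinearMap.ker_eq_bot.2 hf)
    let g₁ : X →ₗ[k] V :=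
      { toFun := fun x => g x 1
        map_add' := fun x y => by rw [map_add]; rfl
        map_smul' := fun c x => by
          rw [LinearMap.map_smul_of_tower]; rfl }
    let h : Y →ₗ[k] V := g₁ ∘ₗ r
    refine ⟨{ toFun := fun y => (h ∘ₗ (LinearMap.toSpanSingleton A Y y).restrictScalars k :)
              map_add' := fun y z => by
                apply CoInd.ext; intro a
                exact (congrArg h (smul_add a y z)).trans (map_add h _ _)
              map_smul' := fun b y => by
                apply CoInd.ext; intro a
                exact congrArg h (mul_smul a b y).symm }, fun x => ?_⟩
    apply CoInd.ext; intro a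
    change g (r (a • f x)) 1 = g x a
    have h1 : r (f (a • x)) = a • x := LinearMap.congr_fun hr (a • x)
    rw [← map_smul, h1, map_smul, CoInd.smul_apply, one_mul]

/-- The cosyzygy of a module as a quotient of a coinduced module. -/
abbrev Cosyz (W : ModuleCat.{u} A) : Type u := CoInd k A W ⧸ LinearMap.range (coIndUnit k W)

variable {k}

theorem coIndUnit_apply (W : ModuleCat.{u} A) (w : W) (a : A) : coIndUnit k W w a = a • w := rfl

theorem Cosyz.mk_eq_iff {W : ModuleCat.{u} A} (g g' : CoInd k A W) :
    (Submodule.Quotient.mk g : Cosyz k W) = Submodule.Quotient.mk g' ↔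
      ∃ w : W, ∀ a, g a = a • w + g' a := by
  rw [Submodule.Quotient.eq]
  constructor
  · rintro ⟨w, hw⟩
    refine ⟨w, fun a => ?_⟩
    have : coIndUnit k W w a = g a - g' a := by rw [hw]; rfl
    rw [← coIndUnit_apply (k := k), this, sub_add_cancel]
  · rintro ⟨w, hw⟩
    refine ⟨w, CoInd.ext fun a => ?_⟩
    change a • w = g a - g' a
    rw [hw, add_sub_cancel_right]

variable {Z W : ModuleCat.{u} A}

/-- The morphism `Z → Ω⁻¹W` defined by a derivation of `A` in `Hom_k(Z, W)`. -/
def Der.toHom (δ : Der k A Z W) : Z →ₗ[A] Cosyz k W where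
  toFun z := Submodule.Quotient.mk (show CoInd k A W from δ.1.flip z)
  map_add' y z := by rw [map_add]; rfl
  map_smul' a z := by
    refine (Cosyz.mk_eq_iff _ _).2 ⟨-δ.1 a z, fun p => ?_⟩
    change δ.1 p (a • z) = p • -δ.1 a z + δ.1 (p * a) z
    rw [δ.2, smul_neg, neg_add_cancel_left]

/-- Derivations vanish at 1, whereas the element a ↦ a w of the image of W takes the value w there.
-/
theorem Der.toHom_injective : Function.Injective (Der.toHom : Der k A Z W → _) := by
  intro δ δ' h
  apply Subtype.ext
  ext p z
  obtain ⟨w, hw⟩ := (Cosyz.mk_eq_iff _ _).1 (LinearMap.congr_fun h z)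
  have hw : ∀ a, δ.1 a z = a • w + δ'.1 a z := hw
  have h1 := hw 1
  rw [Der.apply_one δ.2, Der.apply_one δ'.2, one_smul, LinearMap.zero_apply, add_zero] at h1
  rw [hw, ← h1, smul_zero, zero_add]

/-- Every class in Ω⁻¹W has a unique representative vanishing at 1. Taking it for each f z gives a
k-linear family, and the A-linearity of f, rewritten for normalised representatives, is the Leibniz
rule. -/
theorem Der.toHom_surjective : Function.Surjective (Der.toHom : Der k A Z W → _) := by
  intro f
  have h1 : ∀ z, ∃ g : CoInd k A W, Submodule.Quotient.mk g = f z ∧ g 1 = 0 := by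
    intro z
    obtain ⟨g, hg⟩ := Submodule.Quotient.mk_surjective _ (f z)
    refine ⟨g - coIndUnit k W (g 1), ?_, ?_⟩
    · rw [← hg]
      refine (Cosyz.mk_eq_iff _ _).2 ⟨-g 1, fun a => ?_⟩
      change g a - a • g 1 = _
      rw [smul_neg]; abel
    · change g 1 - (1 : A) • g 1 = 0
      rw [one_smul, sub_self]
  have huniq : ∀ g g' : CoInd k A W, g 1 = 0 → g' 1 = 0 →
      (Submodule.Quotient.mk g : Cosyz k W) = Submodule.Quotient.mk g' → g = g' := by
    intro g g' hg hg' h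
    obtain ⟨w, hw⟩ := (Cosyz.mk_eq_iff _ _).1 h
    have h1 := hw 1
    rw [hg, hg', one_smul, add_zero] at h1
    ext a
    rw [hw, ← h1, smul_zero, zero_add]
  choose g hg hg1 using h1
  let G : Z →ₗ[k] A →ₗ[k] W :=
    { toFun := g
      map_add' := fun y z => huniq _ _ (hg1 _)
        (by change g y 1 + g z 1 = 0; rw [hg1, hg1, add_zero])
        (by rw [hg, map_add, ← hg, ← hg]; rfl)
      map_smul' := fun c z => huniq _ _ (hg1 _)
        (by change c • g z 1 = 0; rw [hg1, smul_zero])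
        (by
          have h2 : (RingHom.id k c • g z : CoInd k A W) = algebraMap k A c • g z :=
            (algebraMap_smul A c (g z)).symm
          rw [hg, ← algebraMap_smul A c z, map_smul, ← hg]
          exact congrArg Submodule.Quotient.mk h2.symm) }
  refine ⟨⟨G.flip, fun p q z => ?_⟩, ?_⟩
  · change g z (p * q) = p • g z q + g (q • z) p
    have h2 : f (q • z) = q • f z := map_smul f q z
    rw [← hg, ← hg] at h2
    obtain ⟨w, hw⟩ := (Cosyz.mk_eq_iff (g (q • z)) (q • g z)).1 h2
    have h3 := hw 1
    rw [hg1, one_smul, CoInd.smul_apply, one_mul] at h3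
    rw [hw, CoInd.smul_apply, eq_neg_of_add_eq_zero_left h3.symm, smul_neg]
    abel
  · ext z
    exact hg z

/-- The term p • T z of an inner derivation lies in the image of W and disappears in the quotient;
the remaining term -T(p • z) depends A-linearly on z. -/
theorem Der.toHom_innerDer (T : Z →ₗ[k] W) :
    Der.toHom ⟨innerDer k T, innerDer_mem k T⟩ =
      (LinearMap.range (coIndUnit k W)).mkQ ∘ₗ
        { toFun := fun z => (show CoInd k A W from
            -(T ∘ₗ (LinearMap.toSpanSingleton A Z z).restrictScalars k))
          map_add' := fun y z => CoInd.ext fun a => by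
            change -T (a • (y + z)) = -T (a • y) + -T (a • z)
            rw [smul_add, map_add, neg_add]
          map_smul' := fun b z => CoInd.ext fun a => by
            change -T (a • b • z) = -T ((a * b) • z)
            rw [mul_smul] } := by
  ext z
  refine (Cosyz.mk_eq_iff _ _).2 ⟨T z, fun a => ?_⟩
  exact sub_eq_add_neg _ _

/-- A-linear maps F : Z → Hom_k(A, W) correspond to k-linear maps T by T z = -F z 1. Inner
derivations are thus exactly the morphisms to Ω⁻¹W that lift to the coinduced module. -/
theorem Der.exists_eq_innerDer_iff (δ : Der k A Z W) :
    (∃ T : Z →ₗ[k] W, δ.1 = innerDer k T) ↔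
      ∃ F : Z →ₗ[A] CoInd k A W, Der.toHom δ = (LinearMap.range (coIndUnit k W)).mkQ ∘ₗ F := by
  constructor
  · rintro ⟨T, hT⟩
    have : δ = ⟨innerDer k T, innerDer_mem k T⟩ := Subtype.ext hT
    exact ⟨_, this ▸ Der.toHom_innerDer T⟩
  · rintro ⟨F, hF⟩
    let T : Z →ₗ[k] W :=
      { toFun := fun z => -F z 1
        map_add' := fun y z => by rw [map_add]; exact neg_add _ _
        map_smul' := fun c z => by
          rw [LinearMap.map_smul_of_tower]; exact (smul_neg _ _).symm }
    refine ⟨T, congrArg Subtype.val (Der.toHom_injective (a₁ := δ)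
      (a₂ := ⟨innerDer k T, innerDer_mem k T⟩) ?_)⟩
    rw [hF, Der.toHom_innerDer]
    congr 1
    refine LinearMap.ext fun z => CoInd.ext fun a => ?_
    change F z a = -(-F (a • z) 1)
    rw [map_smul, neg_neg, CoInd.smul_apply, one_mul]

variable (k)

/-- The cosyzygy of a module. -/
def cosyzObj (W : ModuleCat.{u} A) : ModuleCat.{u} A := ModuleCat.of A (Cosyz k W)

/-- The projection of the coinduced module onto the cosyzygy. -/
def cosyzProj (W : ModuleCat.{u} A) : ModuleCat.of A (CoInd k A W) ⟶ cosyzObj k W :=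
  ModuleCat.ofHom (LinearMap.range (coIndUnit k W)).mkQ

/-- The short exact sequence `0 → W → Hom_k(A, W) → Ω⁻¹W → 0`. -/
abbrev cosyzSequence (W : ModuleCat.{u} A) : ShortComplex (ModuleCat.{u} A) :=
  ShortComplex.mk (ModuleCat.ofHom (coIndUnit k W))
    (cosyzProj k W) (by
      ext w
      exact (Submodule.Quotient.mk_eq_zero _).2 ⟨w, rfl⟩)

theorem coIndUnit_injective (W : ModuleCat.{u} A) : Function.Injective (coIndUnit k W) := by
  intro w w' h
  have h1 : coIndUnit k W w 1 = coIndUnit k W w' 1 := by rw [h]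
  simpa [coIndUnit_apply] using h1

theorem cosyzSequence_shortExact (W : ModuleCat.{u} A) : (cosyzSequence k W).ShortExact where
  exact := by
    rw [ShortComplex.moduleCat_exact_iff]
    intro x hx
    exact (Submodule.Quotient.mk_eq_zero _).1 hx
  mono_f := (ModuleCat.mono_iff_injective _).2 (coIndUnit_injective k W)
  epi_g := (ModuleCat.epi_iff_surjective _).2 (Submodule.mkQ_surjective _)

instance (W : ModuleCat.{u} A) : Injective (cosyzSequence k W).X₂ :=
  have := CoInd.injective k (A := A) W
  Module.injective_object_of_injective_module A (CoInd k A W)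

variable {k}

/-- The morphism `Z → Ω⁻¹W` defined by a derivation, in the category of modules. -/
def Der.toMor (δ : Der k A Z W) : Z ⟶ cosyzObj k W := ModuleCat.ofHom (Der.toHom δ)

theorem Der.toMor_add (δ δ' : Der k A Z W) :
    Der.toMor (δ + δ') = Der.toMor δ + Der.toMor δ' := rfl

theorem Der.toMor_smul (c : k) (δ : Der k A Z W) :
    Der.toMor (c • δ) = c • Der.toMor δ := by
  ext z
  refine (Eq.trans ?_ (algebraMap_smul A c (show cosyzObj k W from Der.toHom δ z)).symm)
  refine (Cosyz.mk_eq_iff _ _).2 ⟨0, fun a => ?_⟩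
  have h : δ.1 (a * algebraMap k A c) z = c • δ.1 a z := by
    rw [← Algebra.commutes, ← Algebra.smul_def, map_smul, LinearMap.smul_apply]
  refine Eq.trans ?_ (congrArg (a • (0 : W) + ·) h).symm
  rw [smul_zero, zero_add]
  rfl
/-- The class in `Ext¹(Z, W)` of a derivation of `A` in `Hom_k(Z, W)`. -/
def Der.extClass (Z W : ModuleCat.{u} A) : Der k A Z W →ₗ[k] Abelian.Ext.{u} Z W 1 where
  toFun δ := (Abelian.Ext.mk₀ (Der.toMor δ)).comp
    (cosyzSequence_shortExact k W).extClass (zero_add 1)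
  map_add' δ δ' := by
    rw [Der.toMor_add, Abelian.Ext.mk₀_add, Abelian.Ext.add_comp]
  map_smul' c δ := by
    rw [Der.toMor_smul, Abelian.Ext.mk₀_smul, Abelian.Ext.smul_comp, RingHom.id_apply]

theorem Der.extClass_apply (δ : Der k A Z W) : Der.extClass Z W δ =
    (Abelian.Ext.mk₀ (Der.toMor δ)).comp
      (cosyzSequence_shortExact k W).extClass (zero_add 1) := rfl

/-- The coinduced module is injective, so the connecting map Hom(Z, Ω⁻¹W) → Ext¹(Z, W) is onto. -/
theorem Der.extClass_surjective : Function.Surjective (Der.extClass (k := k) Z W) := by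
  intro x
  obtain ⟨f, hf⟩ := Abelian.Ext.covariant_sequence_exact₁ Z (cosyzSequence_shortExact k W) x
    (Abelian.Ext.eq_zero_of_injective _) (zero_add 1)
  obtain ⟨f, rfl⟩ := (Abelian.Ext.mk₀_bijective _ _).2 f
  obtain ⟨δ, hδ⟩ := Der.toHom_surjective (k := k) (Z := Z) (W := W) f.hom
  have : Der.toMor δ = f := ModuleCat.hom_ext hδ
  exact ⟨δ, by rw [Der.extClass_apply, this]; exact hf⟩

/-- The kernel of the connecting map consists of the morphisms that lift to the coinduced module. -/
theorem Der.extClass_eq_zero_iff (δ : Der k A Z W) :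
    Der.extClass Z W δ = 0 ↔ ∃ T : Z →ₗ[k] W, δ.1 = innerDer k T := by
  rw [Der.exists_eq_innerDer_iff]
  constructor
  · intro h
    obtain ⟨F, hF⟩ := Abelian.Ext.covariant_sequence_exact₃ Z (cosyzSequence_shortExact k W) _ (zero_add 1) h
    obtain ⟨F, rfl⟩ := (Abelian.Ext.mk₀_bijective _ _).2 F
    rw [Abelian.Ext.mk₀_comp_mk₀] at hF
    have := (Abelian.Ext.mk₀_bijective _ _).1 hF
    exact ⟨F.hom, (congrArg ModuleCat.Hom.hom this).symm⟩
  · rintro ⟨F, hF⟩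
    let F' : Z ⟶ (cosyzSequence k W).X₂ := ModuleCat.ofHom F
    have : Der.toMor δ = F' ≫ (cosyzSequence k W).g := ModuleCat.hom_ext hF
    rw [Der.extClass_apply, this, ← Abelian.Ext.mk₀_comp_mk₀_assoc,
      (cosyzSequence_shortExact k W).comp_extClass, Abelian.Ext.comp_zero]

/-- The composite of a derivation in `Hom_k(Z, W)` with a morphism `Z' → Z`. -/
def Der.precomp {Z' : ModuleCat.{u} A} (f : Z' ⟶ Z) (δ : Der k A Z W) : Der k A Z' W :=
  ⟨(LinearMap.llcomp k Z' Z W).flip (f.hom.restrictScalars k) ∘ₗ δ.1, fun p q z => by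
    change δ.1 (p * q) (f.hom z) = p • δ.1 q (f.hom z) + δ.1 p (f.hom (q • z))
    rw [δ.2, map_smul f.hom]⟩

/-- The composite of a derivation in `Hom_k(Z, W)` with a morphism `W → W'`. -/
def Der.postcomp {W' : ModuleCat.{u} A} (δ : Der k A Z W) (f : W ⟶ W') : Der k A Z W' :=
  ⟨LinearMap.llcomp k Z W W' (f.hom.restrictScalars k) ∘ₗ δ.1, fun p q z => by
    change f.hom (δ.1 (p * q) z) = p • f.hom (δ.1 q z) + f.hom (δ.1 p (q • z))
    rw [δ.2, map_add, map_smul]⟩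

@[simp] theorem Der.precomp_apply {Z' : ModuleCat.{u} A} (f : Z' ⟶ Z) (δ : Der k A Z W) (p : A)
    (z : Z') : (Der.precomp f δ).1 p z = δ.1 p (f.hom z) := rfl

@[simp] theorem Der.postcomp_apply {W' : ModuleCat.{u} A} (δ : Der k A Z W) (f : W ⟶ W') (p : A)
    (z : Z) : (Der.postcomp δ f).1 p z = f.hom (δ.1 p z) := rfl

theorem Der.mk₀_comp_extClass {Z' : ModuleCat.{u} A} (f : Z' ⟶ Z) (δ : Der k A Z W) :
    (Abelian.Ext.mk₀ f).comp (Der.extClass Z W δ) (zero_add 1) =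
      Der.extClass Z' W (Der.precomp f δ) := by
  rw [Der.extClass_apply, Der.extClass_apply, Abelian.Ext.mk₀_comp_mk₀_assoc]
  rfl

/-- This rests on the functoriality in W of the sequence 0 → W → Hom_k(A, W) → Ω⁻¹W → 0 and the
naturality of its extension class. -/
theorem Der.extClass_comp_mk₀ {W' : ModuleCat.{u} A} (δ : Der k A Z W) (f : W ⟶ W') :
    (Der.extClass Z W δ).comp (Abelian.Ext.mk₀ f) (add_zero 1) =
      Der.extClass Z W' (Der.postcomp δ f) := by
  let φ : cosyzSequence k W ⟶ cosyzSequence k W' :=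
    { τ₁ := f
      τ₂ := ModuleCat.ofHom (coIndMap k f)
      τ₃ := ModuleCat.ofHom (cosyzygyMap k f)
      comm₁₂ := ModuleCat.hom_ext (LinearMap.ext fun w => (coIndMap_unit k f w).symm)
      comm₂₃ := rfl }
  have h := ShortComplex.ShortExact.extClass_naturality (cosyzSequence_shortExact k W)
    (cosyzSequence_shortExact k W') φ
  rw [Der.extClass_apply, Der.extClass_apply,
    Abelian.Ext.comp_assoc _ _ _ (zero_add 1) (add_zero 1) (by simp)]
  change _ = (Abelian.Ext.mk₀ (Der.toMor δ ≫ φ.τ₃)).comp _ _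
  rw [← Abelian.Ext.mk₀_comp_mk₀_assoc, ← h]

end Cosyzygy

section DerMaps

variable {k A Z W N : Type*} [Field k] [Ring A] [Algebra k A]
  [AddCommGroup Z] [Module k Z] [Module A Z] [IsScalarTower k A Z]
  [AddCommGroup W] [Module k W] [Module A W] [IsScalarTower k A W] [AddCommGroup N] [Module k N]

theorem Der.map_sub (G : Der k A Z W →ₗ[k] N) (x y : Der k A Z W) : G (x - y) = G x - G y :=
  _root_.map_sub G x y

theorem Der.map_neg (G : Der k A Z W →ₗ[k] N) (x : Der k A Z W) : G (-x) = -G x :=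
  _root_.map_neg G x

end DerMaps

/-! ### Contracting derivations against elements of an algebra -/

section Contraction

variable {k M Y B : Type*} [Field k] [AddCommGroup M] [Module k M] [Module.Finite k M]
  [AddCommGroup Y] [Module k Y] [Ring B] [Algebra k B]

theorem linearMap_eq_sum_smulRight (h : M →ₗ[k] Y) :
    h = ∑ j, ((Module.finBasis k M).coord j).smulRight (h (Module.finBasis k M j)) := by
  refine (Module.finBasis k M).ext fun i => ?_
  rw [LinearMap.sum_apply, Finset.sum_eq_single i]
  · simp
  · intro j _ hj
    simp [Finsupp.single_eq_of_ne hj]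
  · simp

theorem linearMap_hom_ext {N : Type*} [AddCommGroup N] [Module k N] {g g' : (M →ₗ[k] Y) →ₗ[k] N}
    (h : ∀ (F : Module.Dual k M) y, g (F.smulRight y) = g' (F.smulRight y)) : g = g' := by
  refine LinearMap.ext fun T => ?_
  rw [linearMap_eq_sum_smulRight T, map_sum, map_sum]
  exact Finset.sum_congr rfl fun j _ => h _ _

/-- The linear map `F ⊗ y ↦ q(F) x f(y)` on `Hom_k(M, Y) = DM ⊗ Y`. -/
def contraction (q : Module.Dual k M →ₗ[k] B) (f : Y →ₗ[k] B) (x : B) : (M →ₗ[k] Y) →ₗ[k] B :=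
  ∑ j, (LinearMap.mulLeft k (q ((Module.finBasis k M).coord j) * x)) ∘ₗ f ∘ₗ
    LinearMap.applyₗ (Module.finBasis k M j)

theorem contraction_smulRight (q : Module.Dual k M →ₗ[k] B) (f : Y →ₗ[k] B) (x : B)
    (F : Module.Dual k M) (y : Y) : contraction q f x (F.smulRight y) = q F * x * f y := by
  have h : F = ∑ j, F (Module.finBasis k M j) • (Module.finBasis k M).coord j :=
    (Module.Basis.sum_dual_apply_smul_coord _ _).symm
  conv_rhs => rw [h, map_sum, Finset.sum_mul, Finset.sum_mul]
  simp [contraction, mul_assoc]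

/-- This and the three following rules transport operators through a contraction and are checked on
rank one maps. An operator acting on the inner side of q or f is absorbed in the middle factor x;
one acting on the outer side comes out as a factor. -/
theorem contraction_comp (q : Module.Dual k M →ₗ[k] B) (f : Y →ₗ[k] B) (x : B) {R : M →ₗ[k] M}
    {c : B} (hq : ∀ F : Module.Dual k M, q (F ∘ₗ R) = q F * c) (h : M →ₗ[k] Y) :
    contraction q f x (h ∘ₗ R) = contraction q f (c * x) h := by
  refine LinearMap.congr_fun (f := contraction q f x ∘ₗ LinearMap.lcomp k Y R)
    (g := contraction q f (c * x)) (linearMap_hom_ext fun F y => ?_) h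
  have : (F.smulRight y) ∘ₗ R = (F ∘ₗ R).smulRight y := rfl
  change contraction q f x ((F.smulRight y) ∘ₗ R) = _
  rw [this, contraction_smulRight, contraction_smulRight, hq, mul_assoc (q F)]

theorem contraction_comp' (q : Module.Dual k M →ₗ[k] B) (f : Y →ₗ[k] B) (x : B) {R : M →ₗ[k] M}
    {c : B} (hq : ∀ F : Module.Dual k M, q (F ∘ₗ R) = c * q F) (h : M →ₗ[k] Y) :
    contraction q f x (h ∘ₗ R) = c * contraction q f x h := by
  refine LinearMap.congr_fun (f := contraction q f x ∘ₗ LinearMap.lcomp k Y R)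
    (g := LinearMap.mulLeft k c ∘ₗ contraction q f x) (linearMap_hom_ext fun F y => ?_) h
  have : (F.smulRight y) ∘ₗ R = (F ∘ₗ R).smulRight y := rfl
  change contraction q f x ((F.smulRight y) ∘ₗ R) = c * contraction q f x (F.smulRight y)
  rw [this, contraction_smulRight, contraction_smulRight, hq]
  simp only [mul_assoc]

theorem comp_contraction (q : Module.Dual k M →ₗ[k] B) (f : Y →ₗ[k] B) (x : B) {R : Y →ₗ[k] Y}
    {c : B} (hf : ∀ y, f (R y) = c * f y) (h : M →ₗ[k] Y) :
    contraction q f x (R ∘ₗ h) = contraction q f (x * c) h := by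
  refine LinearMap.congr_fun (f := contraction q f x ∘ₗ LinearMap.compRight k R)
    (g := contraction q f (x * c)) (linearMap_hom_ext fun F y => ?_) h
  have : R ∘ₗ (F.smulRight y) = F.smulRight (R y) := by ext; simp
  change contraction q f x (R ∘ₗ (F.smulRight y)) = _
  rw [this, contraction_smulRight, contraction_smulRight, hf]
  simp only [mul_assoc]

theorem comp_contraction' (q : Module.Dual k M →ₗ[k] B) (f : Y →ₗ[k] B) (x : B) {R : Y →ₗ[k] Y}
    {c : B} (hf : ∀ y, f (R y) = f y * c) (h : M →ₗ[k] Y) :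
    contraction q f x (R ∘ₗ h) = contraction q f x h * c := by
  refine LinearMap.congr_fun (f := contraction q f x ∘ₗ LinearMap.compRight k R)
    (g := LinearMap.mulRight k c ∘ₗ contraction q f x) (linearMap_hom_ext fun F y => ?_) h
  have : R ∘ₗ (F.smulRight y) = F.smulRight (R y) := by ext; simp
  change contraction q f x (R ∘ₗ (F.smulRight y)) = contraction q f x (F.smulRight y) * c
  rw [this, contraction_smulRight, contraction_smulRight, hf]
  simp only [mul_assoc]

variable {A : Type*} [Ring A] [Algebra k A] [Module A M] [IsScalarTower k A M]
  [Module A Y] [IsScalarTower k A Y]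
  {I Q : Type} [Fintype I] [Fintype Q] {src tgt : Q → I}

/-- The linear map `δ ↦ ∑_b contraction_{w b} (δ (x_b))`. -/
def derContraction (ρ : QuiverRep src tgt A) (q : Module.Dual k M →ₗ[k] B) (f : Y →ₗ[k] B)
    (w : Q → B) : (A →ₗ[k] M →ₗ[k] Y) →ₗ[k] B :=
  ∑ b, contraction q f (w b) ∘ₗ LinearMap.applyₗ (ρ.x b)

theorem derContraction_apply (ρ : QuiverRep src tgt A) (q : Module.Dual k M →ₗ[k] B)
    (f : Y →ₗ[k] B) (w : Q → B) (δ : A →ₗ[k] M →ₗ[k] Y) :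
    derContraction ρ q f w δ = ∑ b, contraction q f (w b) (δ (ρ.x b)) := by
  simp [derContraction]

/-- On T = F ⊗ y the arrow b contributes q(F) (w_b φ(x_b) - φ(x_b) w_b) f(y), so the sum vanishes by
the commutator relation `hw`. This is where the preprojective relation originates. -/
theorem derContraction_innerDer (ρ : QuiverRep src tgt A) {φ : A →ₐ[k] B}
    {q : Module.Dual k M →ₗ[k] B}
    {f : Y →ₗ[k] B} {w : Q → B}
    (hq : ∀ (F : Module.Dual k M) a, q (F ∘ₗ Algebra.lsmul k k M a) = q F * φ a)
    (hf : ∀ a y, f (a • y) = φ a * f y)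
    (hw : ∑ b, (φ (ρ.x b) * w b - w b * φ (ρ.x b)) = 0) (T : M →ₗ[k] Y) :
    derContraction ρ q f w (innerDer k T) = 0 := by
  have key : ∀ b, contraction q f (w b) (innerDer k T (ρ.x b)) =
      -contraction q f (φ (ρ.x b) * w b - w b * φ (ρ.x b)) T := by
    intro b
    have h1 : innerDer k T (ρ.x b) =
        Algebra.lsmul k k Y (ρ.x b) ∘ₗ T - T ∘ₗ Algebra.lsmul k k M (ρ.x b) := rfl
    rw [h1, map_sub, comp_contraction q f (w b) (hf (ρ.x b)), contraction_comp q f (w b)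
      (fun F => hq F (ρ.x b))]
    refine LinearMap.congr_fun (f := contraction q f (w b * φ (ρ.x b)) -
      contraction q f (φ (ρ.x b) * w b))
      (g := -contraction q f (φ (ρ.x b) * w b - w b * φ (ρ.x b)))
      (linearMap_hom_ext fun F y => ?_) T
    simp only [LinearMap.sub_apply, LinearMap.neg_apply, contraction_smulRight]
    rw [mul_sub, sub_mul]; abel
  rw [derContraction_apply, Finset.sum_congr rfl fun b _ => key b, Finset.sum_neg_distrib]
  have h2 : ∑ b, contraction q f (φ (ρ.x b) * w b - w b * φ (ρ.x b)) =
      contraction q f (∑ b, (φ (ρ.x b) * w b - w b * φ (ρ.x b))) := by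
    refine linearMap_hom_ext fun F y => ?_
    simp only [LinearMap.sum_apply, contraction_smulRight]
    rw [Finset.mul_sum, Finset.sum_mul]
  have h3 := LinearMap.congr_fun h2 T
  rw [LinearMap.sum_apply] at h3
  rw [h3, hw]
  have h4 : contraction q f 0 = 0 := linearMap_hom_ext fun F y => by
    simp [contraction_smulRight]
  rw [h4, LinearMap.zero_apply, neg_zero]

end Contraction

/-! ### Generators and the relation of the bimodule Ext¹(DΛ, Λ) -/

section ExtDualPresentation

open scoped ModuleCat

variable (k Λ : Type u) [Field k] [Ring Λ] [Algebra k Λ]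

/-- The left module `DΛ`. -/
def dualObj : ModuleCat.{u} Λ := ModuleCat.of Λ (KDual k Λ)

/-- The left module `Λ`. -/
def regObj : ModuleCat.{u} Λ := ModuleCat.of Λ Λ

/-- The `k`-linear form on the module `DΛ` given by evaluation at an element. -/
def dualObj.eval : Λ →ₗ[k] Module.Dual k (dualObj k Λ) where
  toFun a :=
    { toFun := fun g => (show KDual k Λ from g) a
      map_add' := fun _ _ => rfl
      map_smul' := fun c g => by
        change (show KDual k Λ from g) (a * algebraMap k Λ c) = c • (show KDual k Λ from g) a
        rw [← Algebra.commutes, ← Algebra.smul_def, map_smul] }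
  map_add' a b := by
    ext g
    exact map_add (show KDual k Λ from g) a b
  map_smul' c a := by
    ext g
    exact map_smul (show KDual k Λ from g) c a

variable {k Λ}

theorem dualObj.eval_smul (a b : Λ) (g : dualObj k Λ) :
    dualObj.eval k Λ a (b • g) = dualObj.eval k Λ (a * b) g := rfl

/-- An object of the category of Λ-modules carries the k-structure induced through Λ; on DΛ it has
to be compared with the pointwise one. -/
theorem dualObj.k_smul (c : k) (g : KDual k Λ) :
    (show KDual k Λ from c • (show dualObj k Λ from g)) = c • g := by
  ext a
  exact LinearMap.map_smul (dualObj.eval k Λ a) c g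

variable (k) in
theorem regObj.k_smul (c : k) (a : Λ) :
    (show Λ from c • (show regObj Λ from a)) = c • a := by
  change algebraMap k Λ c * a = c • a
  exact (Algebra.smul_def c a).symm

/-- The identity as a `k`-linear map. -/
def regObj.toRing : regObj Λ →ₗ[k] Λ where
  toFun a := a
  map_add' _ _ := rfl
  map_smul' c a := regObj.k_smul k (Λ := Λ) c a

variable (k) in
/-- The identity as a `k`-linear map. -/
def regObj.ofRing : Λ →ₗ[k] regObj Λ where
  toFun a := a
  map_add' _ _ := rfl
  map_smul' c a := (regObj.k_smul k (Λ := Λ) c a).symm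

variable [Module.Finite k Λ]

instance dualObj.finite : Module.Finite k (dualObj k Λ) := by
  let f : KDual k Λ →ₗ[k] dualObj k Λ :=
    { toFun := fun g => g
      map_add' := fun _ _ => rfl
      map_smul' := fun c g => (dualObj.k_smul c g).symm }
  exact Module.Finite.of_surjective f fun g => ⟨g, rfl⟩

theorem dualObj.eval_bijective : Function.Bijective (dualObj.eval k Λ) := by
  constructor
  · rw [injective_iff_map_eq_zero]
    intro a ha
    refine (Module.forall_dual_apply_eq_zero_iff k a).1 fun g => ?_
    exact LinearMap.congr_fun ha g
  · intro F
    let F' : Module.Dual k (Module.Dual k Λ) :=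
      { toFun := fun g => F g
        map_add' := fun g h => map_add F g h
        map_smul' := fun c g => (congrArg F (dualObj.k_smul c g).symm).trans
          (LinearMap.map_smul F c (show dualObj k Λ from g)) }
    obtain ⟨a, ha⟩ := (Module.evalEquiv k Λ).surjective F'
    refine ⟨a, LinearMap.ext fun g => ?_⟩
    exact LinearMap.congr_fun ha g

variable (k Λ) in
/-- The identification of `D(DΛ)` with `Λ`. -/
def dualObj.evalEquiv : Λ ≃ₗ[k] Module.Dual k (dualObj k Λ) :=
  LinearEquiv.ofBijective (dualObj.eval k Λ) dualObj.eval_bijective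

theorem dualObj.evalEquiv_apply (a : Λ) : dualObj.evalEquiv k Λ a = dualObj.eval k Λ a := rfl


variable {I Q : Type} [Fintype I] [Fintype Q] {src tgt : Q → I}

variable (k) in
/-- The class in `Ext¹(DΛ, Λ)` of a derivation. -/
def ExtDual.ofDer : Der k Λ (dualObj k Λ) (regObj Λ) →ₗ[k] ExtDual k Λ :=
  Der.extClass (dualObj k Λ) (regObj Λ)

theorem ExtDual.ofDer_surjective : Function.Surjective (ExtDual.ofDer k (Λ := Λ)) :=
  Der.extClass_surjective

theorem ExtDual.ofDer_eq_zero_iff (δ : Der k Λ (dualObj k Λ) (regObj Λ)) :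
    ExtDual.ofDer k δ = 0 ↔ ∃ T : dualObj k Λ →ₗ[k] regObj Λ, δ.1 = innerDer k T :=
  Der.extClass_eq_zero_iff δ

/-- The right action on the left module `DΛ`. -/
def dualObj.rightAction (a : Λ) : dualObj k Λ ⟶ dualObj k Λ := rightMulDual k Λ a

/-- The right action on the left module `Λ`. -/
def regObj.rightAction (a : Λ) : regObj Λ ⟶ regObj Λ := rightMul Λ a

theorem dualObj.eval_rightAction (a b : Λ) (g : dualObj k Λ) :
    dualObj.eval k Λ a ((dualObj.rightAction b).hom g) = dualObj.eval k Λ (b * a) g := rfl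

theorem ExtDual.smul_ofDer (a : Λ) (δ : Der k Λ (dualObj k Λ) (regObj Λ)) :
    a • ExtDual.ofDer k δ = ExtDual.ofDer k (Der.precomp (dualObj.rightAction a) δ) :=
  Der.mk₀_comp_extClass _ _

theorem ExtDual.op_smul_ofDer (a : Λ) (δ : Der k Λ (dualObj k Λ) (regObj Λ)) :
    MulOpposite.op a • ExtDual.ofDer k δ =
      ExtDual.ofDer k (Der.postcomp δ (regObj.rightAction a)) :=
  Der.extClass_comp_mk₀ _ _

/-- The universal property of the bimodule `Ext¹(DΛ, Λ)`. -/
theorem ExtDual.exists_lift (ρ : QuiverRep src tgt Λ) {B : Type*} [Ring B] [Algebra k B]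
    (φ : Λ →ₐ[k] B) (w : Q → B) (hw : ∑ b, (φ (ρ.x b) * w b - w b * φ (ρ.x b)) = 0) :
    ∃ g : ExtDual k Λ →ₗ[k] B, (∀ a e, g (a • e) = φ a * g e) ∧
      (∀ e a, g (MulOpposite.op a • e) = g e * φ a) ∧
      ∀ δ : Der k Λ (dualObj k Λ) (regObj Λ), g (ExtDual.ofDer k δ) =
        derContraction ρ (φ.toLinearMap ∘ₗ (dualObj.evalEquiv k Λ).symm.toLinearMap)
          (φ.toLinearMap ∘ₗ regObj.toRing) w δ.1 := by
  let q : Module.Dual k (dualObj k Λ) →ₗ[k] B :=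
    φ.toLinearMap ∘ₗ (dualObj.evalEquiv k Λ).symm.toLinearMap
  let f : regObj Λ →ₗ[k] B := φ.toLinearMap ∘ₗ regObj.toRing
  have hqe : ∀ a, q (dualObj.eval k Λ a) = φ a := fun a =>
    congrArg φ ((dualObj.evalEquiv k Λ).symm_apply_apply a)
  have hq : ∀ (F : Module.Dual k (dualObj k Λ)) a,
      q (F ∘ₗ Algebra.lsmul k k (dualObj k Λ) a) = q F * φ a := by
    intro F a
    obtain ⟨μ, rfl⟩ := dualObj.eval_bijective.2 F
    have : dualObj.eval k Λ μ ∘ₗ Algebra.lsmul k k (dualObj k Λ) a = dualObj.eval k Λ (μ * a) :=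
      LinearMap.ext fun g => dualObj.eval_smul μ a g
    rw [this, hqe, hqe, map_mul]
  have hq' : ∀ (F : Module.Dual k (dualObj k Λ)) a,
      q (F ∘ₗ (dualObj.rightAction a).hom.restrictScalars k) = φ a * q F := by
    intro F a
    obtain ⟨μ, rfl⟩ := dualObj.eval_bijective.2 F
    have : dualObj.eval k Λ μ ∘ₗ (dualObj.rightAction a).hom.restrictScalars k =
        dualObj.eval k Λ (a * μ) :=
      LinearMap.ext fun g => dualObj.eval_rightAction μ a g
    rw [this, hqe, hqe, map_mul]
  have hf : ∀ a y, f (a • y) = φ a * f y := fun a y => map_mul φ a (regObj.toRing (k := k) y)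
  have hf' : ∀ a y, f ((regObj.rightAction a).hom y) = f y * φ a := fun a y =>
    map_mul φ (regObj.toRing (k := k) y) a
  let G : Der k Λ (dualObj k Λ) (regObj Λ) →ₗ[k] B := derContraction ρ q f w ∘ₗ Submodule.subtype _
  -- A linear section takes the place of a descent to the quotient: G kills inner derivations, so G
  -- ∘ s is independent of s.
  obtain ⟨s, hs⟩ := (ExtDual.ofDer k (Λ := Λ)).exists_rightInverse_of_surjective
    (LinearMap.range_eq_top.2 ExtDual.ofDer_surjective)
  have key : ∀ δ, G (s (ExtDual.ofDer k δ)) = G δ := by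
    intro δ
    have h1 : ExtDual.ofDer k (s (ExtDual.ofDer k δ) - δ) = 0 := by
      rw [Der.map_sub, sub_eq_zero]
      exact LinearMap.congr_fun hs _
    obtain ⟨T, hT⟩ := (ExtDual.ofDer_eq_zero_iff _).1 h1
    have h2 : G (s (ExtDual.ofDer k δ) - δ) = 0 := by
      change derContraction ρ q f w (s (ExtDual.ofDer k δ) - δ).1 = 0
      rw [hT, derContraction_innerDer ρ hq hf hw]
    rwa [Der.map_sub, sub_eq_zero] at h2
  refine ⟨G ∘ₗ s, fun a e => ?_, fun e a => ?_, key⟩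
  · obtain ⟨δ, rfl⟩ := ExtDual.ofDer_surjective e
    rw [ExtDual.smul_ofDer, LinearMap.comp_apply G s, LinearMap.comp_apply G s, key, key]
    change derContraction ρ q f w _ = φ a * derContraction ρ q f w _
    rw [derContraction_apply, derContraction_apply, Finset.mul_sum]
    exact Finset.sum_congr rfl fun b _ => contraction_comp' q f (w b) (fun F => hq' F a) _
  · obtain ⟨δ, rfl⟩ := ExtDual.ofDer_surjective e
    rw [ExtDual.op_smul_ofDer, LinearMap.comp_apply G s, LinearMap.comp_apply G s, key, key]
    change derContraction ρ q f w _ = derContraction ρ q f w _ * φ a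
    rw [derContraction_apply, derContraction_apply, Finset.sum_mul]
    exact Finset.sum_congr rfl fun b _ => comp_contraction' q f (w b)
      (R := (regObj.rightAction a).hom.restrictScalars k) (fun y => hf' a y) _

/-- Generators and relations of the bimodule `Ext¹(DΛ, Λ)` of a path algebra `Λ`. -/
theorem ExtDual.exists_generators {ρ : QuiverRep src tgt Λ} (hρ : IsPathAlgebra k ρ) :
    ∃ ε : Q → ExtDual k Λ, (∀ b, ρ.e (tgt b) • ε b = ε b) ∧
      (∀ b, MulOpposite.op (ρ.e (src b)) • ε b = ε b) ∧
      ∑ b, (ρ.x b • ε b - MulOpposite.op (ρ.x b) • ε b) = 0 ∧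
      (∀ P : Submodule k (ExtDual k Λ), (∀ a : Λ, ∀ e ∈ P, a • e ∈ P) →
        (∀ a : Λ, ∀ e ∈ P, MulOpposite.op a • e ∈ P) → (∀ b, ε b ∈ P) → P = ⊤) ∧
      ∀ (B : Type u) [Ring B] [Algebra k B] (φ : Λ →ₐ[k] B) (w : Q → B),
        (∀ b, φ (ρ.e (tgt b)) * w b = w b) → (∀ b, w b * φ (ρ.e (src b)) = w b) →
        ∑ b, (φ (ρ.x b) * w b - w b * φ (ρ.x b)) = 0 →
        ∃ g : ExtDual k Λ →ₗ[k] B, (∀ a e, g (a • e) = φ a * g e) ∧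
          (∀ e a, g (MulOpposite.op a • e) = g e * φ a) ∧ ∀ b, g (ε b) = w b := by
  classical
  -- Under Hom_k(DΛ, Λ) = Λ ⊗ Λ this is e_{tgt b} ⊗ e_{src b}. The generator ε_b will be the class
  -- of the derivation that sends x_b to it and kills the vertices and the other arrows.
  let ξ : Q → dualObj k Λ →ₗ[k] regObj Λ := fun b =>
    (dualObj.eval k Λ (ρ.e (tgt b))).smulRight (regObj.ofRing k (ρ.e (src b)))
  have hξ : ∀ b z, ξ b z = dualObj.eval k Λ (ρ.e (tgt b)) z • regObj.ofRing k (ρ.e (src b)) :=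
    fun _ _ => rfl
  have hmul : ∀ a c : Λ, a • regObj.ofRing k c = regObj.ofRing k (a * c) := fun _ _ => rfl
  have hact : ∀ a c : Λ, (regObj.rightAction a).hom (regObj.ofRing k c) =
      regObj.ofRing k (c * a) := fun _ _ => rfl
  have hex : ∀ a, ∃ δ : Der k Λ (dualObj k Λ) (regObj Λ), (∀ i, δ.1 (ρ.e i) = 0) ∧
      ∀ b, δ.1 (ρ.x b) = if b = a then ξ a else 0 := by
    intro a
    obtain ⟨δ, hδ, h1, h2⟩ := hρ.exists_der (Z := dualObj k Λ) (W := regObj Λ)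
      (fun b => if b = a then ξ a else 0)
      (fun b z => by
        split_ifs with h
        · subst h
          rw [hξ, smul_comm, hmul, (ρ.complete.idem _).eq]
        · rw [LinearMap.zero_apply, smul_zero])
      (fun b z => by
        split_ifs with h
        · subst h
          rw [hξ, hξ, dualObj.eval_smul, (ρ.complete.idem _).eq]
        · rw [LinearMap.zero_apply, LinearMap.zero_apply])
    exact ⟨⟨δ, hδ⟩, h1, h2⟩
  choose δ hδe hδx using hex
  have hext : ∀ d d' : Der k Λ (dualObj k Λ) (regObj Λ), (∀ i, d.1 (ρ.e i) = d'.1 (ρ.e i)) →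
      (∀ b, d.1 (ρ.x b) = d'.1 (ρ.x b)) → d = d' := fun d d' h1 h2 =>
    Subtype.ext (Der.ext_of_adjoin hρ.adjoin_eq_top d.2 d'.2 h1 h2)
  refine ⟨fun a => ExtDual.ofDer k (δ a), fun a => ?_, fun a => ?_, ?_, ?_, ?_⟩
  · rw [ExtDual.smul_ofDer]
    congr 1
    refine hext _ _ (fun i => LinearMap.ext fun z => ?_) (fun b => LinearMap.ext fun z => ?_)
    · rw [Der.precomp_apply, hδe]; rfl
    · rw [Der.precomp_apply, hδx]
      split_ifs with h
      · rw [hξ, hξ, dualObj.eval_rightAction, (ρ.complete.idem _).eq]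
      · rfl
  · rw [ExtDual.op_smul_ofDer]
    congr 1
    refine hext _ _ (fun i => LinearMap.ext fun z => ?_) (fun b => LinearMap.ext fun z => ?_)
    · rw [Der.postcomp_apply, hδe, LinearMap.zero_apply, map_zero]
    · rw [Der.postcomp_apply, hδx]
      split_ifs with h
      · rw [hξ, LinearMap.map_smul_of_tower, hact, (ρ.complete.idem _).eq]
      · rw [LinearMap.zero_apply, map_zero]
  -- T is the element ∑ e_i ⊗ e_i; its inner derivation kills the vertices and sends x_b to minus
  -- the value of ∑ [x_c, δ_c], so the commutator sum is zero in Ext¹.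
  · let T : dualObj k Λ →ₗ[k] regObj Λ :=
      ∑ i, (dualObj.eval k Λ (ρ.e i)).smulRight (regObj.ofRing k (ρ.e i))
    have hT : ∀ z, T z = ∑ i, dualObj.eval k Λ (ρ.e i) z • regObj.ofRing k (ρ.e i) := fun z => by
      simp [T]
    have h : ∑ b, (Der.precomp (dualObj.rightAction (ρ.x b)) (δ b) -
        Der.postcomp (δ b) (regObj.rightAction (ρ.x b))) =
        -⟨innerDer k T, innerDer_mem k T⟩ := by
      refine hext _ _ (fun i => LinearMap.ext fun z => ?_) (fun b => LinearMap.ext fun z => ?_)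
      · have h1 : (∑ b, (Der.precomp (dualObj.rightAction (ρ.x b)) (δ b) -
            Der.postcomp (δ b) (regObj.rightAction (ρ.x b)))).1 (ρ.e i) z = 0 := by
          rw [Submodule.coe_sum, LinearMap.sum_apply, LinearMap.sum_apply]
          refine Finset.sum_eq_zero fun b _ => ?_
          change (δ b).1 (ρ.e i) _ - (regObj.rightAction _).hom ((δ b).1 (ρ.e i) z) = 0
          rw [hδe, LinearMap.zero_apply, LinearMap.zero_apply, map_zero, sub_zero]
        rw [h1]
        change 0 = -(ρ.e i • T z - T (ρ.e i • z))
        rw [hT, hT, Finset.smul_sum, ← Finset.sum_sub_distrib, Finset.sum_eq_zero, neg_zero]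
        intro j _
        rw [smul_comm, hmul, dualObj.eval_smul, ρ.e_mul_e, ρ.e_mul_e]
        by_cases hij : i = j
        · subst hij; simp
        · rw [if_neg hij, if_neg (Ne.symm hij)]; simp
      · have h1 : (∑ b, (Der.precomp (dualObj.rightAction (ρ.x b)) (δ b) -
            Der.postcomp (δ b) (regObj.rightAction (ρ.x b)))).1 (ρ.x b) z =
            dualObj.eval k Λ (ρ.x b) z • regObj.ofRing k (ρ.e (src b)) -
            dualObj.eval k Λ (ρ.e (tgt b)) z • regObj.ofRing k (ρ.x b) := by
          rw [Submodule.coe_sum, LinearMap.sum_apply, LinearMap.sum_apply, Finset.sum_eq_single b]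
          · change (δ b).1 (ρ.x b) _ - (regObj.rightAction _).hom ((δ b).1 (ρ.x b) z) = _
            rw [hδx, if_pos rfl]
            change ξ b ((dualObj.rightAction (ρ.x b)).hom z) - _ = _
            rw [hξ, hξ, dualObj.eval_rightAction, LinearMap.map_smul_of_tower, hact, ρ.mul_tgt, ρ.src_mul]
          · intro c _ hc
            change (δ c).1 (ρ.x b) _ - (regObj.rightAction _).hom ((δ c).1 (ρ.x b) z) = _
            rw [hδx, if_neg hc.symm, LinearMap.zero_apply, LinearMap.zero_apply, map_zero, sub_zero]
          · simp
        rw [h1]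
        change _ = -(ρ.x b • T z - T (ρ.x b • z))
        rw [hT, hT, neg_sub, Finset.smul_sum]
        congr 1
        · rw [Finset.sum_eq_single (src b)]
          · rw [dualObj.eval_smul, ρ.src_mul]
          · intro j _ hj
            rw [dualObj.eval_smul, ρ.e_mul_x, if_neg hj, map_zero]; simp
          · simp
        · rw [Finset.sum_eq_single (tgt b)]
          · rw [smul_comm, hmul, ρ.mul_tgt]
          · intro j _ hj
            rw [smul_comm, hmul, ρ.x_mul_e, if_neg (Ne.symm hj), map_zero, smul_zero]
          · simp
    have h2 : ∑ b, (ρ.x b • ExtDual.ofDer k (δ b) -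
        MulOpposite.op (ρ.x b) • ExtDual.ofDer k (δ b)) =
        ExtDual.ofDer k (∑ b, (Der.precomp (dualObj.rightAction (ρ.x b)) (δ b) -
        Der.postcomp (δ b) (regObj.rightAction (ρ.x b)))) := by
      rw [map_sum]
      refine Finset.sum_congr rfl fun b _ => ?_
      rw [Der.map_sub, ExtDual.smul_ofDer, ExtDual.op_smul_ofDer]
    rw [h2, h, Der.map_neg, neg_eq_zero, ExtDual.ofDer_eq_zero_iff]
    exact ⟨T, rfl⟩
  · intro P hl hr hε
    rw [eq_top_iff]
    rintro e -
    obtain ⟨d, rfl⟩ := ExtDual.ofDer_surjective e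
    obtain ⟨T, hT⟩ := Der.exists_normalized (k := k) ρ d.2
    obtain ⟨d', hd', hd'e⟩ : ∃ d' : Der k Λ (dualObj k Λ) (regObj Λ),
        ExtDual.ofDer k d = ExtDual.ofDer k d' ∧ ∀ i, d'.1 (ρ.e i) = 0 := by
      refine ⟨d + ⟨innerDer k T, innerDer_mem k T⟩, ?_, hT⟩
      have h1 : ExtDual.ofDer k (⟨innerDer k T, innerDer_mem k T⟩ :
          Der k Λ (dualObj k Λ) (regObj Λ)) = 0 := (ExtDual.ofDer_eq_zero_iff _).2 ⟨T, rfl⟩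
      rw [map_add, h1, add_zero]
    -- Once d' kills the vertices, d'(x_b) lies between e_{src b} and e_{tgt b}. Expanding it in a
    -- basis of DΛ writes it as ∑_j λ_j ξ_b y_j, where λ_j ∈ Λ represents the j-th dual basis vector
    -- and y_j is the value on the j-th basis vector.
    have hsum : d' = ∑ b, ∑ j, Der.postcomp (Der.precomp (dualObj.rightAction
        ((dualObj.evalEquiv k Λ).symm ((Module.finBasis k (dualObj k Λ)).coord j))) (δ b))
        (regObj.rightAction (regObj.toRing (k := k)
          (d'.1 (ρ.x b) (Module.finBasis k (dualObj k Λ) j)))) := by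
      have hval : ∀ (p : Λ) z, (∑ b, ∑ j, Der.postcomp (Der.precomp (dualObj.rightAction
        ((dualObj.evalEquiv k Λ).symm ((Module.finBasis k (dualObj k Λ)).coord j))) (δ b))
        (regObj.rightAction (regObj.toRing (k := k)
          (d'.1 (ρ.x b) (Module.finBasis k (dualObj k Λ) j))))).1 p z =
          ∑ b, ∑ j, (regObj.rightAction (regObj.toRing (k := k)
          (d'.1 (ρ.x b) (Module.finBasis k (dualObj k Λ) j)))).hom ((δ b).1 p
          ((dualObj.rightAction ((dualObj.evalEquiv k Λ).symm
            ((Module.finBasis k (dualObj k Λ)).coord j))).hom z)) := by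
        intro p z
        simp only [Submodule.coe_sum, LinearMap.sum_apply, Der.postcomp_apply, Der.precomp_apply]
      refine hext _ _ (fun i => LinearMap.ext fun z => ?_) (fun b => LinearMap.ext fun z => ?_)
      · rw [hval, hd'e, LinearMap.zero_apply]
        refine (Finset.sum_eq_zero fun b _ => Finset.sum_eq_zero fun j _ => ?_).symm
        rw [hδe, LinearMap.zero_apply, map_zero]
      · rw [hval, Finset.sum_eq_single b]
        · have h1 : ∀ z, d'.1 (ρ.x b) z = d'.1 (ρ.x b) (ρ.e (tgt b) • z) := by
            intro z
            conv_lhs => rw [← ρ.mul_tgt b, d'.2, hd'e, LinearMap.zero_apply, smul_zero, zero_add]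
          have h2 : ∀ z, ρ.e (src b) • d'.1 (ρ.x b) z = d'.1 (ρ.x b) z := by
            intro z
            conv_rhs => rw [← ρ.src_mul b, d'.2, hd'e, LinearMap.zero_apply, add_zero]
          rw [h1]
          conv_lhs => rw [linearMap_eq_sum_smulRight (d'.1 (ρ.x b)), LinearMap.sum_apply]
          refine Finset.sum_congr rfl fun j _ => ?_
          rw [hδx, if_pos rfl]
          rw [hξ]
          obtain ⟨μ, hμ⟩ := (dualObj.evalEquiv k Λ).surjective
            ((Module.finBasis k (dualObj k Λ)).coord j)
          rw [← hμ, LinearEquiv.symm_apply_apply, dualObj.eval_rightAction,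
            LinearMap.map_smul_of_tower (regObj.rightAction _).hom, hact]
          rw [LinearMap.smulRight_apply, dualObj.evalEquiv_apply, dualObj.eval_smul]
          congr 1
          exact (h2 _).symm
        · intro c _ hc
          refine Finset.sum_eq_zero fun j _ => ?_
          rw [hδx, if_neg hc.symm, LinearMap.zero_apply, map_zero]
        · simp
    rw [hd', hsum, map_sum]
    refine P.sum_mem fun b _ => ?_
    rw [map_sum]
    refine P.sum_mem fun j _ => ?_
    rw [← ExtDual.op_smul_ofDer, ← ExtDual.smul_ofDer]
    exact hr _ _ (hl _ _ (hε b))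
  · intro B _ _ φ w h1 h2 hw
    obtain ⟨g, hg1, hg2, hg⟩ := ExtDual.exists_lift ρ φ w hw
    refine ⟨g, hg1, hg2, fun a => ?_⟩
    rw [hg, derContraction_apply, Finset.sum_eq_single a]
    · rw [hδx, if_pos rfl, contraction_smulRight]
      change φ ((dualObj.evalEquiv k Λ).symm (dualObj.evalEquiv k Λ (ρ.e (tgt a)))) * w a *
        φ (ρ.e (src a)) = w a
      rw [LinearEquiv.symm_apply_apply, h1, h2]
    · intro b _ hb
      rw [hδx, if_neg hb, map_zero]
    · simp

end ExtDualPresentation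

/-! ### The dual of τ₁M and derivations in Hom_k(M, Λ) -/

section TauDual

open scoped ModuleCat

variable (k : Type u) {Λ : Type u} [Field k] [Ring Λ] [Algebra k Λ]

/-- The element `f ⊗ m` of `DΛ ⊗_Λ M`. -/
def nakayamaTmul {M : ModuleCat.{u} Λ} (f : KDual k Λ) (m : M) : (nakayama k Λ).obj M :=
  Submodule.Quotient.mk (f ⊗ₜ[k] m)

variable {k} {L M N : ModuleCat.{u} Λ}

theorem nakayamaTmul_add_left (f g : KDual k Λ) (m : M) :
    nakayamaTmul k (f + g) m = nakayamaTmul k f m + nakayamaTmul k g m :=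
  congrArg Submodule.Quotient.mk (TensorProduct.add_tmul f g m)

theorem nakayamaTmul_add_right (f : KDual k Λ) (m m' : M) :
    nakayamaTmul k f (m + m') = nakayamaTmul k f m + nakayamaTmul k f m' :=
  congrArg Submodule.Quotient.mk (TensorProduct.tmul_add f m m')

theorem nakayamaTmul_smul_left (a : Λ) (f : KDual k Λ) (m : M) :
    nakayamaTmul k (a • f) m = a • nakayamaTmul k f m := rfl

theorem nakayamaTmul_op_smul (a : Λ) (f : KDual k Λ) (m : M) :
    nakayamaTmul k (MulOpposite.op a • f) m = nakayamaTmul k f (a • m) :=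
  (Submodule.Quotient.eq _).2 (Submodule.subset_span ⟨f, a, m, rfl⟩)

theorem nakayama_map_tmul (φ : M ⟶ N) (f : KDual k Λ) (m : M) :
    ((nakayama k Λ).map φ).hom (nakayamaTmul k f m) = nakayamaTmul k f (φ.hom m) := rfl

theorem nakayama_induction {P : (nakayama k Λ).obj M → Prop}
    (htmul : ∀ f m, P (nakayamaTmul k f m)) (hadd : ∀ x y, P x → P y → P (x + y)) (x) : P x := by
  obtain ⟨x, rfl⟩ := Submodule.Quotient.mk_surjective _ x
  induction x using TensorProduct.induction_on with
  | zero =>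
    have := htmul 0 0
    rwa [nakayamaTmul, TensorProduct.zero_tmul] at this
  | tmul f m => exact htmul f m
  | add x y hx hy => exact hadd _ _ hx hy

theorem regObj.toRing_smul (a : Λ) (y : regObj Λ) :
    regObj.toRing (k := k) (a • y) = a * regObj.toRing (k := k) y := rfl

/-- The morphism `DΛ ⊗_Λ M → DΛ ⊗_Λ Λ = DΛ` induced by a morphism `M → Λ`. -/
def nakayamaToDual (h : M ⟶ regObj Λ) : (nakayama k Λ).obj M ⟶ dualObj k Λ :=
  ModuleCat.ofHom <| Submodule.liftQ (balancedRel k Λ M)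
    (TensorProduct.AlgebraTensorModule.lift
      { toFun := fun f =>
          { toFun := fun m => (MulOpposite.op (regObj.toRing (k := k) (h.hom m)) • f : KDual k Λ)
            map_add' := fun m m' => by
              rw [map_add, map_add, MulOpposite.op_add, add_smul]
            map_smul' := fun c m => by
              rw [LinearMap.map_smul_of_tower, map_smul]
              refine CoInd.ext fun a => ?_
              change f (c • regObj.toRing (k := k) (h.hom m) * a) = _
              rw [smul_mul_assoc, map_smul]; rfl }
        map_add' := fun f g => LinearMap.ext fun m => smul_add _ f g
        map_smul' := fun a f => LinearMap.ext fun m =>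
          (smul_comm a (MulOpposite.op (regObj.toRing (k := k) (h.hom m))) f).symm }) (by
    rw [balancedRel, Submodule.span_le]
    rintro _ ⟨f, a, m, rfl⟩
    rw [SetLike.mem_coe, LinearMap.mem_ker, map_sub, sub_eq_zero]
    change MulOpposite.op (regObj.toRing (k := k) (h.hom m)) • MulOpposite.op a • f =
      MulOpposite.op (regObj.toRing (k := k) (h.hom (a • m))) • f
    rw [← mul_smul, ← MulOpposite.op_mul, map_smul h.hom, regObj.toRing_smul])

/-- The `k`-linear form on `DΛ ⊗_Λ M` defined by a morphism `M → Λ`. -/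
def nakayamaForm (h : M ⟶ regObj Λ) : (nakayama k Λ).obj M →ₗ[k] k :=
  dualObj.eval k Λ 1 ∘ₗ (nakayamaToDual h).hom.restrictScalars k

theorem nakayamaForm_tmul (h : M ⟶ regObj Λ) (f : KDual k Λ) (m : M) :
    nakayamaForm h (nakayamaTmul k f m) = f (regObj.toRing (k := k) (h.hom m)) := by
  change f (regObj.toRing (k := k) (h.hom m) * 1) = _
  rw [mul_one]

theorem nakayamaForm_comp (φ : M ⟶ N) (h : N ⟶ regObj Λ) (z : (nakayama k Λ).obj M) :
    nakayamaForm (φ ≫ h) z = nakayamaForm h (((nakayama k Λ).map φ).hom z) := by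
  induction z using nakayama_induction with
  | htmul f m => rw [nakayama_map_tmul, nakayamaForm_tmul, nakayamaForm_tmul]; rfl
  | hadd x y hx hy => rw [map_add, map_add, map_add, hx, hy]

theorem nakayamaForm_rightAction (h : M ⟶ regObj Λ) (a : Λ) (z : (nakayama k Λ).obj M) :
    nakayamaForm (h ≫ regObj.rightAction a) z = nakayamaForm h (a • z) := by
  induction z using nakayama_induction with
  | htmul f m => rw [← nakayamaTmul_smul_left, nakayamaForm_tmul, nakayamaForm_tmul]; rfl
  | hadd x y hx hy => rw [map_add, smul_add, map_add, hx, hy]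

theorem nakayamaForm_add (h h' : M ⟶ regObj Λ) (z : (nakayama k Λ).obj M) :
    nakayamaForm (k := k) (h + h') z = nakayamaForm h z + nakayamaForm h' z := by
  induction z using nakayama_induction with
  | htmul f m =>
    rw [nakayamaForm_tmul, nakayamaForm_tmul, nakayamaForm_tmul, ← map_add, ← map_add]; rfl
  | hadd x y hx hy => simp only [map_add]; rw [hx, hy]; abel

theorem nakayamaForm_smul (c : k) (h : M ⟶ regObj Λ) (z : (nakayama k Λ).obj M) :
    nakayamaForm (k := k) (c • h) z = c * nakayamaForm h z := by
  induction z using nakayama_induction with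
  | htmul f m =>
    rw [nakayamaForm_tmul, nakayamaForm_tmul]
    have : (c • h).hom m = c • h.hom m := rfl
    rw [this, map_smul, map_smul]; rfl
  | hadd x y hx hy => simp only [map_add]; rw [hx, hy]; ring

variable [Module.Finite k Λ]

theorem regObj.toRing_injective : Function.Injective (regObj.toRing (k := k) (Λ := Λ)) :=
  fun _ _ h => h

theorem eq_of_nakayamaForm {h h' : M ⟶ regObj Λ}
    (H : ∀ (f : KDual k Λ) (m : M), f (regObj.toRing (k := k) (h.hom m)) =
      f (regObj.toRing (k := k) (h'.hom m))) :
    h = h' := by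
  refine ModuleCat.hom_ext (LinearMap.ext fun m => regObj.toRing_injective (k := k) ?_)
  rw [← sub_eq_zero, ← Module.forall_dual_apply_eq_zero_iff k]
  intro f
  rw [map_sub, sub_eq_zero]
  exact H f m

/-- The dual of DΛ ⊗_Λ M is Hom_Λ(M, D(DΛ)) by adjunction, and D(DΛ) = Λ because Λ is finite
dimensional. -/
theorem exists_nakayamaForm_eq (ψ : (nakayama k Λ).obj M →ₗ[k] k) :
    ∃ h : M ⟶ regObj Λ, nakayamaForm h = ψ := by
  let F : M → Module.Dual k (dualObj k Λ) := fun m =>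
    { toFun := fun f => ψ (nakayamaTmul k f m)
      map_add' := fun f g =>
        (congrArg ψ (nakayamaTmul_add_left f g m)).trans (map_add ψ _ _)
      map_smul' := fun c f => (LinearMap.map_smul ψ c (nakayamaTmul k f m)) }
  let h : M → Λ := fun m => (dualObj.evalEquiv k Λ).symm (F m)
  have hh : ∀ m (f : KDual k Λ), f (h m) = ψ (nakayamaTmul k f m) := fun m f =>
    LinearMap.congr_fun ((dualObj.evalEquiv k Λ).apply_symm_apply (F m)) f
  have huniq : ∀ a b : Λ, (∀ f : KDual k Λ, f a = f b) → a = b := by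
    intro a b H
    rw [← sub_eq_zero, ← Module.forall_dual_apply_eq_zero_iff k]
    intro f
    rw [map_sub, sub_eq_zero]
    exact H f
  let h' : M →ₗ[Λ] regObj Λ :=
    { toFun := h
      map_add' := fun m m' => huniq _ _ fun f => by
        change f (h (m + m')) = f (h m + h m')
        rw [map_add, hh, hh, hh, nakayamaTmul_add_right, map_add]
      map_smul' := fun a m => huniq _ _ fun f => by
        change f (h (a • m)) = (MulOpposite.op a • f) (h m)
        rw [hh, hh, nakayamaTmul_op_smul] }
  refine ⟨ModuleCat.ofHom h', LinearMap.ext fun z => ?_⟩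
  induction z using nakayama_induction with
  | htmul f m => exact (nakayamaForm_tmul _ f m).trans (hh m f)
  | hadd x y hx hy => rw [map_add, map_add, hx, hy]


theorem exists_homology_presentation (S : ShortComplex (ModuleCat.{u} Λ)) {T : ModuleCat.{u} Λ}
    (e : S.homology ≅ T) : ∃ π : LinearMap.ker S.g.hom →ₗ[Λ] T, Function.Surjective π ∧
      ∀ z, π z = 0 ↔ ∃ y, S.f.hom y = z := by
  let e' : S.moduleCatLeftHomologyData.H ≅ T := S.moduleCatHomologyIso.symm ≪≫ e
  have he : Function.Bijective e'.hom.hom := ConcreteCategory.bijective_of_isIso e'.hom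
  refine ⟨e'.hom.hom ∘ₗ (LinearMap.range S.moduleCatToCycles).mkQ,
    he.2.comp (Submodule.mkQ_surjective _), fun z => ⟨fun h => ?_, ?_⟩⟩
  · have h1 : (LinearMap.range S.moduleCatToCycles).mkQ z = 0 :=
      he.1 (h.trans (map_zero e'.hom.hom).symm)
    obtain ⟨y, hy⟩ := (Submodule.Quotient.mk_eq_zero _).1 h1
    exact ⟨y, congrArg Subtype.val hy⟩
  · rintro ⟨y, hy⟩
    have h1 : (LinearMap.range S.moduleCatToCycles).mkQ z = 0 :=
      (Submodule.Quotient.mk_eq_zero _).2 ⟨y, Subtype.ext hy⟩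
    exact (congrArg e'.hom.hom h1).trans (map_zero e'.hom.hom)

/-- A projective resolution is kept only in degrees 0, 1, 2; π presents τ₁M as cycles modulo
boundaries. -/
theorem exists_tau₁_presentation (M : ModuleCat.{u} Λ) :
    ∃ (P₀ P₁ P₂ : ModuleCat.{u} Λ) (d₂ : P₂ ⟶ P₁) (d₁ : P₁ ⟶ P₀) (ε : P₀ ⟶ M)
      (π : LinearMap.ker ((nakayama k Λ).map d₁).hom →ₗ[Λ] (tau₁ k Λ).obj M),
      Projective P₀ ∧ Function.Surjective ε.hom ∧ Function.Exact d₁.hom ε.hom ∧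
      Function.Exact d₂.hom d₁.hom ∧ Function.Surjective π ∧
      ∀ z, π z = 0 ↔ ∃ y, ((nakayama k Λ).map d₂).hom y = z := by
  obtain ⟨P⟩ := HasProjectiveResolution.out (Z := M)
  let K := ((nakayama k Λ).mapHomologicalComplex _).obj P.complex
  obtain ⟨π, hπ, hπ0⟩ := exists_homology_presentation (K.sc' 2 1 0)
    ((K.homologyIsoSc' 2 1 0 (by simp) (by simp)).symm ≪≫
      (P.isoLeftDerivedObj (nakayama k Λ) 1).symm)
  have h₀ : Epi (P.π.f 0) := inferInstance
  have h₁ := ShortComplex.exact_of_g_is_cokernel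
    (ShortComplex.mk _ _ P.complex_d_comp_π_f_zero) P.isColimitCokernelCofork
  exact ⟨P.complex.X 0, P.complex.X 1, P.complex.X 2, P.complex.d 2 1, P.complex.d 1 0, P.π.f 0,
    π, P.projective 0, (ModuleCat.epi_iff_surjective _).1 h₀,
    (ShortComplex.ShortExact.moduleCat_exact_iff_function_exact _).1 h₁,
    (ShortComplex.ShortExact.moduleCat_exact_iff_function_exact _).1 (P.exact_succ 0), hπ, hπ0⟩

theorem Der.exists_innerDer_of_projective {P W : ModuleCat.{u} Λ} [Projective P]
    (δ : Der k Λ P W) : ∃ T : P →ₗ[k] W, δ.1 = innerDer k T :=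
  (Der.extClass_eq_zero_iff δ).1 (Abelian.Ext.eq_zero_of_projective _)

/-- The dual of `τ₁M` is the space of derivations of `Λ` in `Hom_k(M, Λ)` modulo the inner ones. -/
theorem exists_tau₁_relation (M : ModuleCat.{u} Λ) :
    ∃ D : Submodule k (Der k Λ M (regObj Λ) × Module.Dual k ((tau₁ k Λ).obj M)),
      (∀ F, ∃ δ, (δ, F) ∈ D) ∧
      (∀ δ : Der k Λ M (regObj Λ), ∃ δ' F, (δ', F) ∈ D ∧
        ∃ T : M →ₗ[k] regObj Λ, δ'.1 = δ.1 + innerDer k T) ∧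
      (∀ δ, (δ, 0) ∈ D → ∃ T : M →ₗ[k] regObj Λ, δ.1 = innerDer k T) ∧
      (∀ δ F a, (δ, F) ∈ D → (Der.postcomp δ (regObj.rightAction a),
        F ∘ₗ Algebra.lsmul k k ((tau₁ k Λ).obj M) a) ∈ D) ∧
      ∀ δ F, (δ, F) ∈ D → (∃ T : M →ₗ[k] regObj Λ, δ.1 = innerDer k T) → F = 0 := by
  obtain ⟨P₀, P₁, P₂, d₂, d₁, ε, π, hP₀, hε, h₁, h₂, hπ, hπ0⟩ := exists_tau₁_presentation (k := k) M
  obtain ⟨s, hs⟩ := (ε.hom.restrictScalars k).exists_rightInverse_of_surjective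
    (LinearMap.range_eq_top.2 hε)
  have hs : ∀ m, ε.hom (s m) = m := fun m => LinearMap.congr_fun hs m
  -- κ is a k-linear partial homotopy, d₁κ = 1 - sε, for the resolution.
  obtain ⟨κ, hκ⟩ : ∃ κ : P₀ →ₗ[k] P₁, ∀ x, d₁.hom (κ x) = x - s (ε.hom x) := by
    obtain ⟨c, hc⟩ := (d₁.hom.restrictScalars k).rangeRestrict.exists_rightInverse_of_surjective
      (LinearMap.range_rangeRestrict _)
    let r : P₀ →ₗ[k] P₀ := LinearMap.id - s ∘ₗ ε.hom.restrictScalars k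
    have hx : ∀ x, r x ∈
        LinearMap.range (d₁.hom.restrictScalars k) := by
      intro x
      have : ε.hom (x - s (ε.hom x)) = 0 := by rw [map_sub, hs, sub_self]
      exact (h₁ _).1 this
    refine ⟨c ∘ₗ r.codRestrict _ hx, fun x => ?_⟩
    exact congrArg Subtype.val (LinearMap.congr_fun hc ⟨_, hx x⟩)
  have hd : ∀ y, ε.hom (d₁.hom y) = 0 := fun y => (h₁ _).2 ⟨y, rfl⟩
  have hκs : ∀ p m, d₁.hom (κ (p • s m)) = p • s m - s (p • m) := fun p m => by
    rw [hκ, map_smul ε.hom, hs]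
  have heq : ∀ h : P₁ ⟶ regObj Λ, d₂ ≫ h = 0 → ∀ x y, d₁.hom x = d₁.hom y → h.hom x = h.hom y := by
    intro h hh x y hxy
    have : d₁.hom (x - y) = 0 := by rw [map_sub, hxy, sub_self]
    obtain ⟨w, hw⟩ := (h₂ _).1 this
    rw [← sub_eq_zero, ← map_sub, ← hw]
    exact LinearMap.congr_fun (congrArg ModuleCat.Hom.hom hh) w
  -- The failure p s(m) - s(p m) of s to be Λ-linear lies in the kernel of ε and is lifted to P₁ by
  -- κ; applying a 1-cocycle h gives the derivation representing its class.
  let derOf : (P₁ ⟶ regObj Λ) → Λ →ₗ[k] M →ₗ[k] regObj Λ := fun h =>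
    LinearMap.mk₂ k (fun p m => h.hom (κ (p • s m)))
      (fun p q m => by rw [add_smul, map_add, map_add])
      (fun c p m => by
        rw [smul_assoc, map_smul, LinearMap.map_smul_of_tower])
      (fun p m n => by rw [map_add, smul_add, map_add, map_add])
      (fun c p m => by
        rw [map_smul s, smul_comm p c, map_smul κ, LinearMap.map_smul_of_tower])
  have derOf_apply : ∀ h p m, derOf h p m = h.hom (κ (p • s m)) := fun h p m => rfl
  have derOf_mem : ∀ h, d₂ ≫ h = 0 → derOf h ∈ Der k Λ M (regObj Λ) := by
    intro h hh p q m
    rw [derOf_apply, derOf_apply, derOf_apply, ← map_smul h.hom, ← map_add h.hom]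
    refine heq h hh _ _ ?_
    rw [map_add, map_smul d₁.hom, hκs, hκs, hκs, smul_sub, mul_smul, mul_smul]
    abel
  have hF : ∀ h, d₂ ≫ h = 0 → ∃ F : Module.Dual k ((tau₁ k Λ).obj M),
      ∀ z, F (π z) = nakayamaForm h z.1 := by
    intro h hh
    obtain ⟨σ, hσ⟩ := (π.restrictScalars k).exists_rightInverse_of_surjective
      (LinearMap.range_eq_top.2 hπ)
    have hσ : ∀ t, π (σ t) = t := fun t => LinearMap.congr_fun hσ t
    refine ⟨nakayamaForm h ∘ₗ (Submodule.subtype _).restrictScalars k ∘ₗ σ, fun z => ?_⟩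
    change nakayamaForm h (σ (π z)).1 = _
    have h0 : π (σ (π z) - z) = 0 := by rw [map_sub, hσ, sub_self]
    obtain ⟨y, hy⟩ := (hπ0 _).1 h0
    rw [← sub_eq_zero, ← map_sub]
    have h3 : nakayamaForm h (((nakayama k Λ).map d₂).hom y) = 0 := by
      rw [← nakayamaForm_comp, hh]
      have := nakayamaForm_smul (0 : k) (0 : P₂ ⟶ regObj Λ) y
      rwa [zero_smul, zero_mul] at this
    rw [hy] at h3
    exact h3
  -- The isomorphism D Tor₁(DΛ, M) ≅ Ext¹(M, Λ) is recorded as a relation: δ and F are related when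
  -- both come from the same cocycle h : P₁ → Λ.
  let D : Submodule k (Der k Λ M (regObj Λ) × Module.Dual k ((tau₁ k Λ).obj M)) :=
    { carrier := {x | ∃ h : P₁ ⟶ regObj Λ, d₂ ≫ h = 0 ∧ (∀ z, x.2 (π z) = nakayamaForm h z.1) ∧
        x.1.1 = derOf h}
      add_mem' := by
        rintro x y ⟨h, h1, h2, h3⟩ ⟨h', h1', h2', h3'⟩
        refine ⟨h + h', by rw [Preadditive.comp_add, h1, h1', add_zero], fun z => ?_, ?_⟩
        · rw [nakayamaForm_add, ← h2, ← h2']; rfl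
        · change x.1.1 + y.1.1 = _
          rw [h3, h3']; rfl
      zero_mem' := by
        refine ⟨0, comp_zero, fun z => ?_, rfl⟩
        have := nakayamaForm_smul (0 : k) (0 : P₁ ⟶ regObj Λ) z.1
        rw [zero_smul, zero_mul] at this
        exact this.symm
      smul_mem' := by
        rintro c x ⟨h, h1, h2, h3⟩
        refine ⟨c • h, by rw [Linear.comp_smul, h1, smul_zero], fun z => ?_, ?_⟩
        · rw [nakayamaForm_smul, ← h2]; rfl
        · change c • x.1.1 = _
          rw [h3]; rfl }
  have hD : ∀ δ F, (δ, F) ∈ D ↔ ∃ h : P₁ ⟶ regObj Λ, d₂ ≫ h = 0 ∧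
      (∀ z, F (π z) = nakayamaForm h z.1) ∧ δ.1 = derOf h := fun _ _ => Iff.rfl
  refine ⟨D, fun F => ?_, fun δ => ?_, fun δ h => ?_, fun δ F a h => ?_, fun δ F h hT => ?_⟩
  -- A form on τ₁M, extended from the cycles to all of DΛ ⊗ P₁, is given by some h; it kills
  -- boundaries, which makes h a cocycle.
  · obtain ⟨ψ, hψ⟩ := LinearMap.exists_extend
      (p := (LinearMap.ker ((nakayama k Λ).map d₁).hom).restrictScalars k)
      (F ∘ₗ π.restrictScalars k)
    obtain ⟨h, rfl⟩ := exists_nakayamaForm_eq ψ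
    have h1 : ∀ z, F (π z) = nakayamaForm h z.1 := fun z => (LinearMap.congr_fun hψ z).symm
    have hz : d₂ ≫ h = 0 := by
      refine eq_of_nakayamaForm (k := k) fun f m => ?_
      rw [← nakayamaForm_tmul, ← nakayamaForm_tmul, nakayamaForm_comp]
      have hc : (nakayama k Λ).map d₂ ≫ (nakayama k Λ).map d₁ = 0 := by
        rw [← Functor.map_comp]
        have : d₂ ≫ d₁ = 0 := ModuleCat.hom_ext (LinearMap.ext fun y => (h₂ _).2 ⟨y, rfl⟩)
        rw [this, Functor.map_zero]
      have hk : ((nakayama k Λ).map d₂).hom (nakayamaTmul k f m) ∈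
          LinearMap.ker ((nakayama k Λ).map d₁).hom :=
        LinearMap.congr_fun (congrArg ModuleCat.Hom.hom hc) (nakayamaTmul k f m)
      have h2 := h1 ⟨_, hk⟩
      rw [(hπ0 ⟨_, hk⟩).2 ⟨_, rfl⟩, map_zero] at h2
      rw [← h2]
      have := nakayamaForm_smul (0 : k) (0 : P₂ ⟶ regObj Λ) (nakayamaTmul k f m)
      rw [zero_smul, zero_mul] at this
      exact this.symm
    exact ⟨⟨derOf h, derOf_mem h hz⟩, h, hz, h1, rfl⟩
  -- Pulled back to the projective module P₀, the derivation becomes inner. Its primitive T is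
  -- Λ-linear on the image of d₁, since ε vanishes there, and -T d₁ is the cocycle sought.
  · obtain ⟨T, hT⟩ := Der.exists_innerDer_of_projective (Der.precomp ε δ)
    have hT : ∀ p x, δ.1 p (ε.hom x) = p • T x - T (p • x) := fun p x =>
      LinearMap.congr_fun (LinearMap.congr_fun hT p) x
    let h : P₁ ⟶ regObj Λ := ModuleCat.ofHom
      { toFun := fun y => -T (d₁.hom y)
        map_add' := fun x y => by
          change -T (d₁.hom (x + y)) = -T (d₁.hom x) + -T (d₁.hom y)
          rw [map_add, map_add, neg_add]
        map_smul' := fun p y => by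
          have := hT p (d₁.hom y)
          rw [hd, map_zero, eq_comm, sub_eq_zero] at this
          change -T (d₁.hom (p • y)) = p • -T (d₁.hom y)
          rw [map_smul, ← this, smul_neg] }
    have hz : d₂ ≫ h = 0 := ModuleCat.hom_ext (LinearMap.ext fun y => by
      change -T (d₁.hom (d₂.hom y)) = 0
      rw [(h₂ (d₂.hom y)).2 ⟨y, rfl⟩, map_zero, neg_zero])
    obtain ⟨F, hF⟩ := hF h hz
    refine ⟨⟨derOf h, derOf_mem h hz⟩, F, ⟨h, hz, hF, rfl⟩, -(T ∘ₗ s), ?_⟩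
    refine LinearMap.ext fun p => LinearMap.ext fun m => ?_
    change -T (d₁.hom (κ (p • s m))) = δ.1 p m + (p • -T (s m) - -T (s (p • m)))
    have := hT p (s m)
    rw [hs] at this
    rw [hκs, map_sub, this, smul_neg]
    abel
  -- With F = 0 the form of h vanishes on cycles, so it factors through the map induced by d₁. Hence
  -- h = d₁ ≫ g is a coboundary, and g ∘ s is the primitive.
  · obtain ⟨h, hz, h1, h2⟩ := (hD _ _).1 h
    have hker : LinearMap.ker (((nakayama k Λ).map d₁).hom.restrictScalars k) ≤
        LinearMap.ker (nakayamaForm (k := k) h) := by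
      intro z hz
      exact (h1 ⟨z, hz⟩).symm
    obtain ⟨θ, hθ⟩ : ∃ θ : (nakayama k Λ).obj P₀ →ₗ[k] k,
        θ ∘ₗ ((nakayama k Λ).map d₁).hom.restrictScalars k = nakayamaForm h := by
      have : nakayamaForm h ∈ (LinearMap.ker
          (((nakayama k Λ).map d₁).hom.restrictScalars k)).dualAnnihilator :=
        (Submodule.mem_dualAnnihilator _).2 fun z hz => hker hz
      rw [← LinearMap.range_dualMap_eq_dualAnnihilator_ker] at this
      exact this
    obtain ⟨g, rfl⟩ := exists_nakayamaForm_eq θ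
    have hg : h = d₁ ≫ g := by
      refine eq_of_nakayamaForm (k := k) fun f m => ?_
      rw [← nakayamaForm_tmul, ← nakayamaForm_tmul, nakayamaForm_comp, ← hθ]
      rfl
    refine ⟨g.hom.restrictScalars k ∘ₗ s, ?_⟩
    rw [h2]
    refine LinearMap.ext fun p => LinearMap.ext fun m => ?_
    rw [derOf_apply, hg]
    change g.hom (d₁.hom (κ (p • s m))) = p • g.hom (s m) - g.hom (s (p • m))
    rw [hκs, map_sub, map_smul]
  · obtain ⟨h, hz, h1, h2⟩ := (hD _ _).1 h
    refine ⟨h ≫ regObj.rightAction a, by rw [← Category.assoc, hz, zero_comp], fun z => ?_, ?_⟩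
    · rw [nakayamaForm_rightAction]
      change F (a • π z) = _
      rw [← map_smul, h1]; rfl
    · refine LinearMap.ext fun p => LinearMap.ext fun m => ?_
      rw [Der.postcomp_apply, h2]; rfl
  · obtain ⟨h, hz, h1, h2⟩ := (hD _ _).1 h
    obtain ⟨T, hT⟩ := hT
    have hT : ∀ p m, h.hom (κ (p • s m)) = p • T m - T (p • m) := fun p m => by
      rw [← derOf_apply, ← h2, hT, innerDer_apply]
    -- Conversely, a primitive T of the derivation corrects h ∘ κ to a Λ-linear map g with h = d₁ ≫
    -- g, and the form of such an h vanishes on cycles.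
    let g : P₀ ⟶ regObj Λ := ModuleCat.ofHom
      { toFun := fun x => h.hom (κ x) + T (ε.hom x)
        map_add' := fun x y => by
          rw [map_add κ, map_add h.hom, map_add ε.hom, map_add T]; abel
        map_smul' := fun p x => by
          have h3 : h.hom (κ (p • x)) = h.hom (p • κ x + κ (p • s (ε.hom x))) := by
            refine heq h hz _ _ ?_
            rw [map_add, map_smul d₁.hom, hκ, hκ, hκs, map_smul ε.hom, smul_sub]
            abel
          change h.hom (κ (p • x)) + T (ε.hom (p • x)) = p • (h.hom (κ x) + T (ε.hom x))
          rw [h3, map_add h.hom, map_smul h.hom, hT, map_smul ε.hom, smul_add]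
          abel }
    have hg : h = d₁ ≫ g := by
      refine ModuleCat.hom_ext (LinearMap.ext fun y => ?_)
      change h.hom y = h.hom (κ (d₁.hom y)) + T (ε.hom (d₁.hom y))
      rw [hd, map_zero, add_zero]
      refine heq h hz _ _ ?_
      rw [hκ, hd, map_zero, sub_zero]
    refine LinearMap.ext fun t => ?_
    obtain ⟨z, rfl⟩ := hπ t
    rw [h1, hg, nakayamaForm_comp, LinearMap.mem_ker.1 z.2, map_zero, LinearMap.zero_apply]

end TauDual

/-! ### Π₂(Λ) as the preprojective algebra of the doubled quiver -/

section PreprojectivePresentation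

variable {I Q : Type} [Fintype I] [Fintype Q]

/-- `A` is the preprojective algebra of a doubled quiver with involution `bar` and signs `sgn`. -/
structure IsPreprojective (k : Type u) {A : Type u} [Field k] [Ring A] [Algebra k A]
    {src tgt : Q → I} (ρ : QuiverRep src tgt A) (bar : Q → Q) (sgn : Q → k) : Prop where
  bar_bar : ∀ b, bar (bar b) = b
  src_bar : ∀ b, src (bar b) = tgt b
  sgn_bar : ∀ b, sgn (bar b) = -sgn b
  sgn_mul_self : ∀ b, sgn b * sgn b = 1
  adjoin_eq_top : ρ.adjoin k = ⊤
  rel : ∑ b, sgn b • (ρ.x b * ρ.x (bar b)) = 0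
  exists_lift : ∀ (B : Type u) [Ring B] [Algebra k B] (ρ' : QuiverRep src tgt B),
    ∑ b, sgn b • (ρ'.x b * ρ'.x (bar b)) = 0 →
    ∃ f : A →ₐ[k] B, (∀ i, f (ρ.e i) = ρ'.e i) ∧ ∀ b, f (ρ.x b) = ρ'.x b

theorem IsPreprojective.tgt_bar {k A : Type u} [Field k] [Ring A] [Algebra k A]
    {src tgt : Q → I} {ρ : QuiverRep src tgt A} {bar : Q → Q} {sgn : Q → k}
    (hρ : IsPreprojective k ρ bar sgn) (b : Q) : tgt (bar b) = src b := by
  rw [← hρ.src_bar, hρ.bar_bar]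

/-- The representation of the opposite quiver in the opposite ring. -/
def QuiverRep.op {src tgt : Q → I} {A : Type*} [Ring A] (ρ : QuiverRep src tgt A) :
    QuiverRep tgt src Aᵐᵒᵖ where
  e i := MulOpposite.op (ρ.e i)
  x b := MulOpposite.op (ρ.x b)
  complete :=
    { idem := fun i => congrArg MulOpposite.op (ρ.complete.idem i)
      ortho := fun i j h => congrArg MulOpposite.op (ρ.complete.ortho h.symm)
      complete := by
        rw [← MulOpposite.op_one, ← ρ.complete.complete, Finset.op_sum] }
  src_mul b := congrArg MulOpposite.op (ρ.mul_tgt b)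
  mul_tgt b := congrArg MulOpposite.op (ρ.src_mul b)

/-- The representation of the opposite of a doubled quiver, as a representation of the quiver. -/
def QuiverRep.barRep {src tgt : Q → I} {A : Type*} [Ring A] (ρ : QuiverRep tgt src A) (bar : Q → Q)
    (h₁ : ∀ b, src (bar b) = tgt b) (h₂ : ∀ b, tgt (bar b) = src b) : QuiverRep src tgt A where
  e := ρ.e
  x b := ρ.x (bar b)
  complete := ρ.complete
  src_mul b := by rw [← h₂]; exact ρ.src_mul _
  mul_tgt b := by rw [← h₁]; exact ρ.mul_tgt _

/-- The opposite of a preprojective algebra is a preprojective algebra. -/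
theorem IsPreprojective.op {k A : Type u} [Field k] [Ring A] [Algebra k A]
    {src tgt : Q → I} {ρ : QuiverRep src tgt A} {bar : Q → Q} {sgn : Q → k}
    (hρ : IsPreprojective k ρ bar sgn) :
    IsPreprojective k (ρ.op.barRep bar hρ.src_bar hρ.tgt_bar) bar sgn where
  bar_bar := hρ.bar_bar
  src_bar := hρ.src_bar
  sgn_bar := hρ.sgn_bar
  sgn_mul_self := hρ.sgn_mul_self
  adjoin_eq_top := by
    rw [eq_top_iff]
    rintro a -
    obtain ⟨a, rfl⟩ := MulOpposite.op_surjective a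
    have ha : a ∈ ρ.adjoin k := hρ.adjoin_eq_top ▸ Algebra.mem_top
    induction ha using Algebra.adjoin_induction with
    | mem p hp =>
      rcases hp with ⟨i, rfl⟩ | ⟨b, rfl⟩
      · exact QuiverRep.e_mem_adjoin k (ρ.op.barRep bar hρ.src_bar hρ.tgt_bar) i
      · have := QuiverRep.x_mem_adjoin k (ρ.op.barRep bar hρ.src_bar hρ.tgt_bar) (bar b)
        change MulOpposite.op (ρ.x (bar (bar b))) ∈ _ at this
        rwa [hρ.bar_bar] at this
    | algebraMap r => exact Subalgebra.algebraMap_mem _ r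
    | add p q _ _ hp hq => exact Subalgebra.add_mem _ hp hq
    | mul p q _ _ hp hq => exact Subalgebra.mul_mem _ hq hp
  rel := by
    have := congrArg MulOpposite.op hρ.rel
    rw [Finset.op_sum, MulOpposite.op_zero] at this
    rw [← this]
    refine Finset.sum_congr rfl fun b _ => ?_
    change sgn b • (MulOpposite.op (ρ.x (bar b)) * MulOpposite.op (ρ.x (bar (bar b)))) = _
    rw [hρ.bar_bar]; rfl
  exists_lift B _ _ ρ' hrel := by
    obtain ⟨f, hf, hf'⟩ := hρ.exists_lift Bᵐᵒᵖ (ρ'.op.barRep bar hρ.src_bar hρ.tgt_bar) (by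
      have := congrArg MulOpposite.op hrel
      rw [Finset.op_sum, MulOpposite.op_zero] at this
      rw [← this]
      refine Finset.sum_congr rfl fun b _ => ?_
      change sgn b • (MulOpposite.op (ρ'.x (bar b)) * MulOpposite.op (ρ'.x (bar (bar b)))) = _
      rw [hρ.bar_bar]; rfl)
    refine ⟨(AlgEquiv.opOp k B).symm.toAlgHom.comp (AlgHom.op f), fun i => ?_, fun b => ?_⟩
    · change (f (ρ.e i)).unop = _
      rw [hf]; rfl
    · change (f (ρ.x (bar b))).unop = _
      rw [hf']
      change ρ'.x (bar (bar b)) = _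
      rw [hρ.bar_bar]

/-- The universal property determines the subalgebra generated by the image. -/
theorem TensorAlg.adjoin_eq_top (k Λ E : Type u) [Field k] [Ring Λ] [Algebra k Λ] [AddCommGroup E]
    [Module k E] [Module Λ E] [Module Λᵐᵒᵖ E] (S : Subalgebra k (TensorAlg k Λ E))
    (h₁ : ∀ a, TensorAlg.inl k Λ E a ∈ S) (h₂ : ∀ e, TensorAlg.inr k Λ E e ∈ S) : S = ⊤ := by
  rw [eq_top_iff]
  rintro x -
  obtain ⟨x, rfl⟩ := RingQuot.mkAlgHom_surjective k (TensorAlgRel k Λ E) x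
  induction x using TensorAlgebra.induction with
  | algebraMap c => rw [AlgHom.commutes]; exact Subalgebra.algebraMap_mem _ c
  | ι x =>
    have h : x = LinearMap.inl k Λ E x.1 + LinearMap.inr k Λ E x.2 := by simp
    rw [h, map_add, map_add]
    exact Subalgebra.add_mem _ (h₁ x.1) (h₂ x.2)
  | mul x y hx hy => rw [map_mul]; exact Subalgebra.mul_mem _ hx hy
  | add x y hx hy => rw [map_add]; exact Subalgebra.add_mem _ hx hy

variable {k Λ : Type u} [Field k] [Ring Λ] [Algebra k Λ] [Module.Finite k Λ]

/-- A representation of a quiver and elements in the opposite direction define a representation of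
the doubled quiver. -/
def QuiverRep.double {src tgt : Q → I} {A : Type*} [Ring A] (ρ : QuiverRep src tgt A) (w : Q → A)
    (h₁ : ∀ b, ρ.e (tgt b) * w b = w b) (h₂ : ∀ b, w b * ρ.e (src b) = w b) :
    QuiverRep (Sum.elim src tgt) (Sum.elim tgt src) A where
  e := ρ.e
  x := Sum.elim ρ.x w
  complete := ρ.complete
  src_mul b := by
    cases b with
    | inl b => exact ρ.src_mul b
    | inr b => exact h₁ b
  mul_tgt b := by
    cases b with
    | inl b => exact ρ.mul_tgt b
    | inr b => exact h₂ b

/-- The image of a representation under a morphism. -/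
def QuiverRep.map {src tgt : Q → I} {A B : Type*} [Ring A] [Ring B] (ρ : QuiverRep src tgt A)
    (f : A →+* B) : QuiverRep src tgt B where
  e i := f (ρ.e i)
  x b := f (ρ.x b)
  complete :=
    { idem := fun i => by
        change f _ * f _ = _
        rw [← map_mul, (ρ.complete.idem i).eq]
      ortho := fun i j h => by
        change f _ * f _ = _
        rw [← map_mul, ρ.complete.ortho h, map_zero]
      complete := by rw [← map_sum, ρ.complete.complete, map_one] }
  src_mul b := by rw [← map_mul, ρ.src_mul]
  mul_tgt b := by rw [← map_mul, ρ.mul_tgt]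

/-- The `2`-preprojective algebra of a path algebra is the preprojective algebra of the double
quiver. The vertices and arrows of the quiver have degree `0` and the new arrows have degree `1`. -/
theorem exists_isPreprojective {src tgt : Q → I} {ρ : QuiverRep src tgt Λ}
    (hρ : IsPathAlgebra k ρ) :
    ∃ (ρ' : QuiverRep (Sum.elim src tgt) (Sum.elim tgt src) (Preprojective₂ k Λ)),
      IsPreprojective k ρ' Sum.swap (Sum.elim (fun _ => 1) (fun _ => -1)) ∧
      (∀ i, ρ'.e i ∈ TensorAlg.gr k Λ (ExtDual k Λ) 0) ∧
      (∀ b, ρ'.x (Sum.inl b) ∈ TensorAlg.gr k Λ (ExtDual k Λ) 0) ∧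
      (∀ b, ρ'.x (Sum.inr b) ∈ TensorAlg.gr k Λ (ExtDual k Λ) 1) := by
  obtain ⟨ε, hε₁, hε₂, hε₃, hε₄, hε₅⟩ := ExtDual.exists_generators hρ
  have hinl : ∀ a, TensorAlg.inl k Λ (ExtDual k Λ) a ∈ TensorAlg.gr k Λ (ExtDual k Λ) 0 := by
    intro a
    rw [TensorAlg.gr, pow_zero, mul_one]
    exact ⟨a, rfl⟩
  have hinr : ∀ e, TensorAlg.inr k Λ (ExtDual k Λ) e ∈ TensorAlg.gr k Λ (ExtDual k Λ) 1 := by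
    intro e
    rw [TensorAlg.gr, pow_one, ← one_mul (TensorAlg.inr k Λ (ExtDual k Λ) e)]
    exact Submodule.mul_mem_mul (one_mem (TensorAlg.inl k Λ (ExtDual k Λ)).range) ⟨e, rfl⟩
  -- The second copy of b is the element ε b of degree 1, running from tgt b to src b. With sign +1
  -- on the old and -1 on the new arrows, ∑ [x_b, ε_b] = 0 is the preprojective relation.
  let ρ' : QuiverRep (Sum.elim src tgt) (Sum.elim tgt src) (Preprojective₂ k Λ) :=
    (ρ.map (TensorAlg.inl k Λ (ExtDual k Λ)).toRingHom).double
      (fun b => TensorAlg.inr k Λ (ExtDual k Λ) (ε b))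
      (fun b => by
        change TensorAlg.inl k Λ (ExtDual k Λ) _ * _ = _
        rw [← TensorAlg.inr_smul, hε₁])
      (fun b => by
        change _ * TensorAlg.inl k Λ (ExtDual k Λ) _ = _
        rw [← TensorAlg.inr_op_smul, hε₂])
  refine ⟨ρ', ?_, fun i => hinl _, fun b => hinl _, fun b => hinr _⟩
  refine ⟨Sum.swap_swap, ?_, ?_, ?_, ?_, ?_, ?_⟩
  · rintro (b | b) <;> rfl
  · rintro (b | b) <;> simp
  · rintro (b | b) <;> simp
  · have h₁ : ∀ a, TensorAlg.inl k Λ (ExtDual k Λ) a ∈ ρ'.adjoin k := by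
      intro a
      have ha : a ∈ ρ.adjoin k := hρ.adjoin_eq_top ▸ Algebra.mem_top
      induction ha using Algebra.adjoin_induction with
      | mem p hp =>
        rcases hp with ⟨i, rfl⟩ | ⟨b, rfl⟩
        · exact QuiverRep.e_mem_adjoin k ρ' i
        · exact QuiverRep.x_mem_adjoin k ρ' (Sum.inl b)
      | algebraMap r => rw [AlgHom.commutes]; exact Subalgebra.algebraMap_mem _ r
      | add p q _ _ hp hq => rw [map_add]; exact Subalgebra.add_mem _ hp hq
      | mul p q _ _ hp hq => rw [map_mul]; exact Subalgebra.mul_mem _ hp hq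
    refine TensorAlg.adjoin_eq_top k Λ _ _ h₁ fun e => ?_
    have htop := hε₄ ((Subalgebra.toSubmodule (ρ'.adjoin k)).comap
      (TensorAlg.inr k Λ (ExtDual k Λ)))
      (fun a e he => by
        change TensorAlg.inr k Λ (ExtDual k Λ) (a • e) ∈ ρ'.adjoin k
        rw [TensorAlg.inr_smul]
        exact Subalgebra.mul_mem _ (h₁ a) he)
      (fun a e he => by
        change TensorAlg.inr k Λ (ExtDual k Λ) (MulOpposite.op a • e) ∈ ρ'.adjoin k
        rw [TensorAlg.inr_op_smul]
        exact Subalgebra.mul_mem _ he (h₁ a))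
      (fun b => QuiverRep.x_mem_adjoin k ρ' (Sum.inr b))
    have : e ∈ (Subalgebra.toSubmodule (ρ'.adjoin k)).comap (TensorAlg.inr k Λ (ExtDual k Λ)) := by
      rw [htop]; trivial
    exact this
  · have h := congrArg (TensorAlg.inr k Λ (ExtDual k Λ)) hε₃
    rw [map_zero, map_sum] at h
    rw [Fintype.sum_sum_type, ← h, ← Finset.sum_add_distrib]
    refine Finset.sum_congr rfl fun b _ => ?_
    rw [map_sub, TensorAlg.inr_smul, TensorAlg.inr_op_smul, Sum.elim_inl, Sum.elim_inr, one_smul,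
      neg_one_smul, ← sub_eq_add_neg]
    rfl
  · intro B _ _ σ hσ
    obtain ⟨f, hf, hf'⟩ := hρ.exists_lift B
      { e := σ.e
        x := fun b => σ.x (Sum.inl b)
        complete := σ.complete
        src_mul := fun b => σ.src_mul (Sum.inl b)
        mul_tgt := fun b => σ.mul_tgt (Sum.inl b) }
    obtain ⟨g, hg₁, hg₂, hg₃⟩ := hε₅ B f (fun b => σ.x (Sum.inr b))
      (fun b => by rw [hf]; exact σ.src_mul (Sum.inr b))
      (fun b => by rw [hf]; exact σ.mul_tgt (Sum.inr b))
      (by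
        rw [← hσ, Fintype.sum_sum_type, ← Finset.sum_add_distrib]
        refine Finset.sum_congr rfl fun b _ => ?_
        rw [hf', Sum.elim_inl, Sum.elim_inr, one_smul, neg_one_smul, ← sub_eq_add_neg]
        rfl)
    refine ⟨TensorAlg.lift f g hg₁ hg₂, fun i => ?_, ?_⟩
    · exact (TensorAlg.lift_inl f g hg₁ hg₂ _).trans (hf i)
    · rintro (b | b)
      · exact (TensorAlg.lift_inl f g hg₁ hg₂ _).trans (hf' b)
      · exact (TensorAlg.lift_inr f g hg₁ hg₂ _).trans (hg₃ b)

end PreprojectivePresentation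

/-! ### Finite dimensionality of Π₂(Λ) -/

section FiniteDimensional

open scoped ModuleCat

variable {k Λ : Type u} [Field k] [Ring Λ] [Algebra k Λ] [Module.Finite k Λ]
  {I Q : Type} [Fintype I] [Fintype Q] {src tgt : Q → I}

theorem TensorAlg.gr_succ (k Λ E : Type u) [Field k] [Ring Λ] [Algebra k Λ] [AddCommGroup E]
    [Module k E] [Module Λ E] [Module Λᵐᵒᵖ E] (n : ℕ) : TensorAlg.gr k Λ E (n + 1) =
      TensorAlg.gr k Λ E n * LinearMap.range (TensorAlg.inr k Λ E) := by
  rw [TensorAlg.gr, TensorAlg.gr, pow_succ, mul_assoc]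

/-- By `exists_tau₁_relation` the dual of τ₁M embeds into the k-linear maps Λ → Hom_k(M, Λ) modulo
inner derivations, a finite dimensional space. -/
theorem finite_tau₁ (M : ModuleCat.{u} Λ) [Module.Finite k M] :
    Module.Finite k ((tau₁ k Λ).obj M) := by
  obtain ⟨D, h₁, -, -, -, h₅⟩ := exists_tau₁_relation (k := k) M
  obtain ⟨σ, hσ⟩ := (LinearMap.snd k _ _ ∘ₗ D.subtype).exists_rightInverse_of_surjective
    (LinearMap.range_eq_top.2 fun F => by
      obtain ⟨δ, hδ⟩ := h₁ F
      exact ⟨⟨_, hδ⟩, rfl⟩)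
  have hσ : ∀ F, (σ F).1.2 = F := fun F => LinearMap.congr_fun hσ F
  have : Module.Finite k (regObj Λ) :=
    Module.Finite.of_surjective (regObj.ofRing k (Λ := Λ)) fun x => ⟨x, rfl⟩
  let g : Module.Dual k ((tau₁ k Λ).obj M) →ₗ[k]
      (Λ →ₗ[k] M →ₗ[k] regObj Λ) ⧸ LinearMap.range (innerDer k (A := Λ)) :=
    Submodule.mkQ _ ∘ₗ Submodule.subtype _ ∘ₗ LinearMap.fst k _ _ ∘ₗ D.subtype ∘ₗ σ
  have hg : Function.Injective g := by
    rw [injective_iff_map_eq_zero]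
    intro F hF
    obtain ⟨T, hT⟩ := (Submodule.Quotient.mk_eq_zero _).1 hF
    have h2 : (σ F).1 = ((σ F).1.1, F) := Prod.ext rfl (hσ F)
    exact h₅ (σ F).1.1 F (h2 ▸ (σ F).2) ⟨T, hT.symm⟩
  have : Module.Finite k (Module.Dual k ((tau₁ k Λ).obj M)) := Module.Finite.of_injective g hg
  exact Module.finite_dual_iff k |>.1 this


theorem add_neg_one_smul_zero_mem {k V W : Type*} [Ring k] [AddCommMonoid V] [AddCommMonoid W]
    [Module k V] [Module k W] (D : Submodule k (V × W)) {a b : V} {f : W} (ha : (a, f) ∈ D)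
    (hb : (b, f) ∈ D) : (a + (-1 : k) • b, 0) ∈ D := by
  have h := D.add_mem ha (D.smul_mem (-1 : k) hb)
  have h2 : f + (-1 : k) • f = 0 := by
    conv_lhs => rw [← one_smul k f, smul_smul, mul_one, ← add_smul, add_neg_cancel, zero_smul]
  rwa [Prod.smul_mk, Prod.mk_add_mk, h2] at h

/-- An element of D(τ₁M) is represented by a derivation δ in Hom_k(M, Λ), and q' contracts it: a
value F ⊗ y on x_b contributes q(F) ε_b y. This is independent of δ because ∑ [x_b, ε_b] = 0. The
product q(F) ε_b is reached by a derivation concentrated on x_b, and the ε_b generate the bimodule,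
so all of degree n + 1 is reached. -/
theorem exists_dual_tau₁_map {ρ : QuiverRep src tgt Λ} (hρ : IsPathAlgebra k ρ)
    (M : ModuleCat.{u} Λ) [Module.Finite k M] (n : ℕ)
    (q : Module.Dual k M →ₗ[k] Preprojective₂ k Λ)
    (hq : ∀ (F : Module.Dual k M) a, q (F ∘ₗ Algebra.lsmul k k M a) =
      q F * TensorAlg.inl k Λ (ExtDual k Λ) a)
    (hn : TensorAlg.gr k Λ (ExtDual k Λ) n ≤ LinearMap.range q) :
    ∃ q' : Module.Dual k ((tau₁ k Λ).obj M) →ₗ[k] Preprojective₂ k Λ,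
      (∀ (F : Module.Dual k ((tau₁ k Λ).obj M)) a,
        q' (F ∘ₗ Algebra.lsmul k k ((tau₁ k Λ).obj M) a) =
        q' F * TensorAlg.inl k Λ (ExtDual k Λ) a) ∧
      TensorAlg.gr k Λ (ExtDual k Λ) (n + 1) ≤ LinearMap.range q' := by
  classical
  obtain ⟨ε, hε₁, hε₂, hε₃, hε₄, -⟩ := ExtDual.exists_generators hρ
  obtain ⟨D, h₁, h₂, h₃, h₄, h₅⟩ := exists_tau₁_relation (k := k) M
  obtain ⟨σ, hσ⟩ := (LinearMap.snd k _ _ ∘ₗ D.subtype).exists_rightInverse_of_surjective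
    (LinearMap.range_eq_top.2 fun F => by
      obtain ⟨δ, hδ⟩ := h₁ F
      exact ⟨⟨_, hδ⟩, rfl⟩)
  have hσ : ∀ F, (σ F).1.2 = F := fun F => LinearMap.congr_fun hσ F
  let φ := TensorAlg.inl k Λ (ExtDual k Λ)
  let w : Q → Preprojective₂ k Λ := fun b => TensorAlg.inr k Λ (ExtDual k Λ) (ε b)
  have hw₁ : ∀ b, φ (ρ.e (tgt b)) * w b = w b := fun b => by
    rw [← TensorAlg.inr_smul, hε₁]
  have hw₂ : ∀ b, w b * φ (ρ.e (src b)) = w b := fun b => by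
    rw [← TensorAlg.inr_op_smul, hε₂]
  have hw : ∑ b, (φ (ρ.x b) * w b - w b * φ (ρ.x b)) = 0 := by
    have h := congrArg (TensorAlg.inr k Λ (ExtDual k Λ)) hε₃
    rw [map_zero, map_sum] at h
    rw [← h]
    refine Finset.sum_congr rfl fun b _ => ?_
    rw [map_sub, TensorAlg.inr_smul, TensorAlg.inr_op_smul]
  let f : regObj Λ →ₗ[k] Preprojective₂ k Λ := φ.toLinearMap ∘ₗ regObj.toRing
  have hf : ∀ a y, f (a • y) = φ a * f y := fun a y => map_mul φ a (regObj.toRing (k := k) y)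
  have hf' : ∀ a y, f ((regObj.rightAction a).hom y) = f y * φ a := fun a y =>
    map_mul φ (regObj.toRing (k := k) y) a
  let G : Der k Λ M (regObj Λ) →ₗ[k] Preprojective₂ k Λ :=
    derContraction ρ q f w ∘ₗ Submodule.subtype _
  have hG : ∀ δ, G δ = ∑ b, contraction q f (w b) (δ.1 (ρ.x b)) := fun δ =>
    derContraction_apply ρ q f w δ.1
  have hG0 : ∀ T : M →ₗ[k] regObj Λ, derContraction ρ q f w (innerDer k T) = 0 := fun T =>
    derContraction_innerDer ρ hq hf hw T
  let q' : Module.Dual k ((tau₁ k Λ).obj M) →ₗ[k] Preprojective₂ k Λ :=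
    G ∘ₗ LinearMap.fst k _ _ ∘ₗ D.subtype ∘ₗ σ
  have hq' : ∀ δ F, (δ, F) ∈ D → q' F = G δ := by
    intro δ F h
    have h2 : ((σ F).1.1, F) ∈ D := by
      have h4 : (σ F).1 = ((σ F).1.1, F) := Prod.ext rfl (hσ F)
      rw [← h4]
      exact (σ F).2
    obtain ⟨T, hT⟩ := h₃ _ (add_neg_one_smul_zero_mem D h2 h)
    have h5 : G ((σ F).1.1 + (-1 : k) • δ) = 0 := by
      change derContraction ρ q f w _ = 0
      rw [← hG0 T, ← hT]
      rfl
    rw [LinearMap.map_add, LinearMap.map_smul, neg_one_smul, ← sub_eq_add_neg, sub_eq_zero] at h5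
    exact h5
  have hright : ∀ (F : Module.Dual k ((tau₁ k Λ).obj M)) a,
      q' (F ∘ₗ Algebra.lsmul k k ((tau₁ k Λ).obj M) a) = q' F * φ a := by
    intro F a
    obtain ⟨δ, hδ⟩ := h₁ F
    rw [hq' _ _ hδ, hq' _ _ (h₄ _ _ a hδ), hG, hG, Finset.sum_mul]
    exact Finset.sum_congr rfl fun b _ => comp_contraction' q f (w b)
      (R := (regObj.rightAction a).hom.restrictScalars k) (fun y => hf' a y) _
  refine ⟨q', hright, ?_⟩
  rw [TensorAlg.gr_succ, Submodule.mul_le]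
  rintro y hy _ ⟨e, rfl⟩
  let P : Submodule k (ExtDual k Λ) :=
    { carrier := {e | ∀ y ∈ TensorAlg.gr k Λ (ExtDual k Λ) n,
        y * TensorAlg.inr k Λ (ExtDual k Λ) e ∈ LinearMap.range q'}
      add_mem' := fun he he' y hy => by
        rw [map_add, mul_add]; exact Submodule.add_mem _ (he y hy) (he' y hy)
      zero_mem' := fun y hy => by
        rw [map_zero, mul_zero]; exact Submodule.zero_mem _
      smul_mem' := fun c e he y hy => by
        rw [map_smul, mul_smul_comm]; exact Submodule.smul_mem _ c (he y hy) }
  have hP : P = ⊤ := by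
    refine hε₄ P (fun a e he y hy => ?_) (fun a e he y hy => ?_) (fun b y hy => ?_)
    · rw [TensorAlg.inr_smul, ← mul_assoc]
      refine he _ ?_
      have h0 : TensorAlg.inl k Λ (ExtDual k Λ) a ∈ TensorAlg.gr k Λ (ExtDual k Λ) 0 := by
        rw [TensorAlg.gr, pow_zero, mul_one]
        exact ⟨a, rfl⟩
      exact TensorAlg.gr_mul_le k Λ (ExtDual k Λ) n 0 (Submodule.mul_mem_mul hy h0)
    · rw [TensorAlg.inr_op_smul, ← mul_assoc]
      obtain ⟨F, hF⟩ := he y hy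
      exact ⟨_, (hright F a).trans (congrArg (· * φ a) hF)⟩
    -- The derivation with value (F e_{tgt b}) ⊗ e_{src b} on x_b, and 0 on the other arrows,
    -- contracts to q(F) ε_b.
    · obtain ⟨F, rfl⟩ := hn hy
      let ξ : M →ₗ[k] regObj Λ := (F ∘ₗ Algebra.lsmul k k M (ρ.e (tgt b))).smulRight
        (regObj.ofRing k (ρ.e (src b)))
      have hξ : ∀ z, ξ z = F (ρ.e (tgt b) • z) • regObj.ofRing k (ρ.e (src b)) := fun _ => rfl
      obtain ⟨δ, hδ, hδe, hδx⟩ := hρ.exists_der (Z := M) (W := regObj Λ)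
        (fun c => if c = b then ξ else 0)
        (fun c z => by
          split_ifs with h
          · subst h
            have : ∀ a c : Λ, a • regObj.ofRing k c = regObj.ofRing k (a * c) := fun _ _ => rfl
            rw [hξ, smul_comm, this, (ρ.complete.idem _).eq]
          · rw [LinearMap.zero_apply, smul_zero])
        (fun c z => by
          split_ifs with h
          · subst h
            rw [hξ, hξ, ← mul_smul, (ρ.complete.idem _).eq]
          · rw [LinearMap.zero_apply, LinearMap.zero_apply])
      obtain ⟨δ', F', hD, T, hT⟩ := h₂ ⟨δ, hδ⟩
      refine ⟨F', ?_⟩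
      have h7 : G δ' = derContraction ρ q f w (δ + innerDer k T) := congrArg _ hT
      rw [hq' _ _ hD, h7, map_add, hG0, add_zero, derContraction_apply,
        Finset.sum_eq_single b]
      · rw [hδx, if_pos rfl, contraction_smulRight, hq]
        change q F * φ (ρ.e (tgt b)) * w b * φ (ρ.e (src b)) = q F * w b
        rw [mul_assoc (q F), hw₁, mul_assoc, hw₂]
      · intro c _ hc
        rw [hδx, if_neg hc, map_zero]
      · simp
  have he : e ∈ P := hP ▸ Submodule.mem_top
  exact he y hy

/-- The induction starts from D(DΛ) = Λ, which is the degree 0 part, and proceeds by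
`exists_dual_tau₁_map`. -/
theorem exists_dual_iterate_tau₁_map {ρ : QuiverRep src tgt Λ} (hρ : IsPathAlgebra k ρ) (n : ℕ) :
    Module.Finite k ((tau₁ k Λ).obj^[n] (dualObj k Λ)) ∧
    ∃ q : Module.Dual k ((tau₁ k Λ).obj^[n] (dualObj k Λ)) →ₗ[k] Preprojective₂ k Λ,
      (∀ (F : Module.Dual k ((tau₁ k Λ).obj^[n] (dualObj k Λ))) a,
        q (F ∘ₗ Algebra.lsmul k k ((tau₁ k Λ).obj^[n] (dualObj k Λ)) a) =
        q F * TensorAlg.inl k Λ (ExtDual k Λ) a) ∧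
      TensorAlg.gr k Λ (ExtDual k Λ) n ≤ LinearMap.range q := by
  induction n with
  | zero =>
    refine ⟨dualObj.finite, (TensorAlg.inl k Λ (ExtDual k Λ)).toLinearMap ∘ₗ
      (dualObj.evalEquiv k Λ).symm.toLinearMap, ?_, ?_⟩
    · intro F a
      obtain ⟨μ, rfl⟩ := (dualObj.evalEquiv k Λ).surjective F
      have : dualObj.evalEquiv k Λ μ ∘ₗ Algebra.lsmul k k (dualObj k Λ) a =
          dualObj.evalEquiv k Λ (μ * a) := LinearMap.ext fun g => dualObj.eval_smul μ a g
      refine (congrArg (fun F => TensorAlg.inl k Λ (ExtDual k Λ)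
        ((dualObj.evalEquiv k Λ).symm F)) this).trans ?_
      change TensorAlg.inl k Λ (ExtDual k Λ) ((dualObj.evalEquiv k Λ).symm _) =
        TensorAlg.inl k Λ (ExtDual k Λ) ((dualObj.evalEquiv k Λ).symm _) * _
      rw [LinearEquiv.symm_apply_apply, LinearEquiv.symm_apply_apply, map_mul]
    · rw [TensorAlg.gr, pow_zero, mul_one]
      rintro _ ⟨a, rfl⟩
      refine ⟨dualObj.evalEquiv k Λ a, ?_⟩
      change TensorAlg.inl k Λ (ExtDual k Λ) ((dualObj.evalEquiv k Λ).symm _) = _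
      rw [LinearEquiv.symm_apply_apply]; rfl
  | succ n ih =>
    obtain ⟨hfin, q, hq, hn⟩ := ih
    rw [Function.iterate_succ_apply']
    exact ⟨finite_tau₁ _, exists_dual_tau₁_map hρ _ n q hq hn⟩

/-- The preprojective algebra of a `τ₁`-finite path algebra is finite dimensional. -/
theorem finite_preprojective {ρ : QuiverRep src tgt Λ} (hρ : IsPathAlgebra k ρ)
    (hτ : IsTau₁Finite k Λ) : Module.Finite k (Preprojective₂ k Λ) := by
  obtain ⟨N, hN⟩ := hτ
  have hfin : Module.Finite Λ (dualObj k Λ) := Module.Finite.of_restrictScalars_finite k Λ _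
  -- DΛ is finitely generated, so τ₁^N(DΛ) = 0 and degree N vanishes. Higher degrees are multiples
  -- of degree N and vanish with it.
  have hzero : TensorAlg.gr k Λ (ExtDual k Λ) N = ⊥ := by
    obtain ⟨-, q, -, hq⟩ := exists_dual_iterate_tau₁_map hρ N
    have : Subsingleton ((tau₁ k Λ).obj^[N] (dualObj k Λ)) :=
      ModuleCat.subsingleton_of_isZero (hN _ hfin)
    rw [eq_bot_iff]
    refine hq.trans ?_
    rintro _ ⟨F, rfl⟩
    have : F = 0 := LinearMap.ext fun z => by rw [Subsingleton.elim z 0, map_zero, map_zero]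
    rw [this, map_zero]
    exact Submodule.zero_mem _
  have hzero' : ∀ m, TensorAlg.gr k Λ (ExtDual k Λ) (N + m) = ⊥ := by
    intro m
    induction m with
    | zero => exact hzero
    | succ m ih => rw [← add_assoc, TensorAlg.gr_succ, ih, Submodule.bot_mul]
  have hfg : ∀ n, (TensorAlg.gr k Λ (ExtDual k Λ) n).FG := by
    intro n
    obtain ⟨hfin, q, -, hq⟩ := exists_dual_iterate_tau₁_map hρ n
    have := Submodule.finiteDimensional_of_le hq
    exact Module.Finite.iff_fg.1 this
  have htop : ⨆ n ∈ Finset.range N, TensorAlg.gr k Λ (ExtDual k Λ) n = ⊤ := by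
    rw [eq_top_iff]
    rintro x -
    have hle : ⨆ n, TensorAlg.gr k Λ (ExtDual k Λ) n ≤
        ⨆ n ∈ Finset.range N, TensorAlg.gr k Λ (ExtDual k Λ) n := by
      refine iSup_le fun n => ?_
      rcases lt_or_ge n N with h | h
      · exact le_iSup₂_of_le n (Finset.mem_range.2 h) le_rfl
      · obtain ⟨m, rfl⟩ := Nat.exists_eq_add_of_le h
        rw [hzero']
        exact bot_le
    exact hle (TensorAlg.mem_iSup_gr k Λ (ExtDual k Λ) x)
  exact ⟨htop ▸ Submodule.fg_biSup _ _ fun n _ => hfg n⟩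

end FiniteDimensional

/-! ### The trace duality between Hom_k(Z, W) and Hom_k(W, Z) -/

section TracePairing

variable {k Z W : Type*} [Field k] [AddCommGroup Z] [Module k Z] [AddCommGroup W] [Module k W]
  [Module.Finite k Z] [Module.Finite k W]

theorem trace_comp_smulRight (T : Z →ₗ[k] W) (F : Module.Dual k W) (z : Z) :
    LinearMap.trace k W (T ∘ₗ F.smulRight z) = F (T z) := by
  have h : T ∘ₗ F.smulRight z = (LinearMap.toSpanSingleton k W (T z)) ∘ₗ F := by
    ext w; simp
  rw [h, LinearMap.trace_comp_comm']
  have h2 : F ∘ₗ LinearMap.toSpanSingleton k W (T z) = F (T z) • LinearMap.id := by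
    ext; simp
  rw [h2]
  simp

/-- Linear forms on `Hom_k(W, Z)` are represented by `Hom_k(Z, W)`. -/
theorem exists_trace_comp_eq (θ : (W →ₗ[k] Z) →ₗ[k] k) :
    ∃ T : Z →ₗ[k] W, ∀ S, θ S = LinearMap.trace k W (T ∘ₗ S) := by
  let T : Z →ₗ[k] W := (Module.evalEquiv k W).symm.toLinearMap ∘ₗ
    { toFun := fun z => θ ∘ₗ
        { toFun := fun F => F.smulRight z
          map_add' := fun F G => by ext w; simp [add_smul]
          map_smul' := fun c F => by ext w; simp [mul_smul] }
      map_add' := fun y z => by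
        ext F
        change θ (F.smulRight (y + z)) = θ (F.smulRight y) + θ (F.smulRight z)
        rw [← map_add]
        congr 1
        ext w
        simp
      map_smul' := fun c z => by
        ext F
        change θ (F.smulRight (c • z)) = c • θ (F.smulRight z)
        rw [← map_smul]
        congr 1
        ext w
        simp [smul_comm c] }
  have hT : ∀ (F : Module.Dual k W) z, F (T z) = θ (F.smulRight z) := by
    intro F z
    have : Module.Dual.eval k W (T z) F = θ (F.smulRight z) := by
      rw [← Module.evalEquiv_toLinearMap]
      change (Module.evalEquiv k W) ((Module.evalEquiv k W).symm _) F = _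
      rw [LinearEquiv.apply_symm_apply]
      rfl
    exact this
  refine ⟨T, fun S => ?_⟩
  refine LinearMap.congr_fun (f := θ) (g := LinearMap.trace k W ∘ₗ LinearMap.compRight k T)
    (linearMap_hom_ext fun F z => ?_) S
  rw [← hT]
  exact (trace_comp_smulRight T F z).symm

theorem eq_zero_of_trace_comp {T : Z →ₗ[k] W}
    (h : ∀ S : W →ₗ[k] Z, LinearMap.trace k W (T ∘ₗ S) = 0) : T = 0 := by
  ext z
  rw [LinearMap.zero_apply, ← Module.forall_dual_apply_eq_zero_iff k]
  intro F
  rw [← trace_comp_smulRight, h]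

end TracePairing

/-! ### The pairing of derivations of a preprojective algebra -/

section DerivationPairing

variable {I Q : Type} [Fintype I] [Fintype Q] {src tgt : Q → I}
  {k A Z W : Type u} [Field k] [Ring A] [Algebra k A]
  {ρ : QuiverRep src tgt A} {bar : Q → Q} {sgn : Q → k}
  [AddCommGroup Z] [Module k Z] [Module A Z] [IsScalarTower k A Z]
  [AddCommGroup W] [Module k W] [Module A W] [IsScalarTower k A W]

/-- The relation for the triangular representation has `hξ` as its corner and the relation of A on
the diagonal, so the universal property of A provides the derivation. -/
theorem IsPreprojective.exists_der (hρ : IsPreprojective k ρ bar sgn) (ξ : Q → Z →ₗ[k] W)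
    (h₁ : ∀ b z, ρ.e (src b) • ξ b z = ξ b z) (h₂ : ∀ b z, ξ b (ρ.e (tgt b) • z) = ξ b z)
    (hξ : ∀ z, ∑ b, sgn b • (ξ b (ρ.x (bar b) • z) + ρ.x b • ξ (bar b) z) = 0) :
    ∃ δ ∈ Der k A Z W, (∀ i, δ (ρ.e i) = 0) ∧ ∀ b, δ (ρ.x b) = ξ b := by
  obtain ⟨f, he, hx⟩ := hρ.exists_lift _ (ρ.triangular ξ h₁ h₂) (by
    change ∑ b, sgn b • (triangular k (ρ.x b) (ξ b) * triangular k (ρ.x (bar b)) (ξ (bar b))) = 0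
    simp_rw [triangular_mul, smul_triangular]
    rw [triangular_sum, hρ.rel, ← triangular_zero (A := A) (Z := Z) (W := W)]
    congr 1
    ext z
    rw [LinearMap.zero_apply, ← hξ z, LinearMap.sum_apply]
    refine Finset.sum_congr rfl fun b _ => ?_
    rw [LinearMap.smul_apply, LinearMap.add_apply, add_comm]
    rfl)
  exact Der.exists_of_triangular ρ hρ.adjoin_eq_top ξ f he hx

theorem IsPreprojective.der_rel (hρ : IsPreprojective k ρ bar sgn) {δ : A →ₗ[k] Z →ₗ[k] W}
    (hδ : δ ∈ Der k A Z W) (z : Z) :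
    ∑ b, sgn b • (δ (ρ.x b) (ρ.x (bar b) • z) + ρ.x b • δ (ρ.x (bar b)) z) = 0 := by
  have h := congrArg (fun p => δ p z) hρ.rel
  simp only [map_sum, map_smul, LinearMap.sum_apply, LinearMap.smul_apply, map_zero,
    LinearMap.zero_apply] at h
  rw [← h]
  refine Finset.sum_congr rfl fun b _ => ?_
  rw [hδ, add_comm]

theorem IsPreprojective.sum_bar (hρ : IsPreprojective k ρ bar sgn) {M : Type*} [AddCommMonoid M]
    (f : Q → M) : ∑ b, f (bar b) = ∑ b, f b :=
  Equiv.sum_comp (Function.Involutive.toPerm bar hρ.bar_bar) f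

variable [Module.Finite k Z] [Module.Finite k W]

/-- The pairing of `Hom_k(Z, W)`-valued and `Hom_k(W, Z)`-valued derivations. -/
def derPairing (ρ : QuiverRep src tgt A) (bar : Q → Q) (sgn : Q → k) :
    (A →ₗ[k] Z →ₗ[k] W) →ₗ[k] (A →ₗ[k] W →ₗ[k] Z) →ₗ[k] k :=
  LinearMap.mk₂ k (fun δ δ' =>
      ∑ b, sgn b * LinearMap.trace k W (δ (ρ.x b) ∘ₗ δ' (ρ.x (bar b))))
    (fun δ₁ δ₂ δ' => by
      simp only [LinearMap.add_apply, LinearMap.add_comp, map_add, mul_add,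
        Finset.sum_add_distrib])
    (fun c δ δ' => by
      simp only [LinearMap.smul_apply, LinearMap.smul_comp, map_smul, smul_eq_mul, Finset.mul_sum,
        mul_left_comm])
    (fun δ δ₁ δ₂ => by
      simp only [LinearMap.add_apply, LinearMap.comp_add, map_add, mul_add,
        Finset.sum_add_distrib])
    (fun c δ δ' => by
      simp only [LinearMap.smul_apply, LinearMap.comp_smul, map_smul, smul_eq_mul, Finset.mul_sum,
        mul_left_comm])

theorem derPairing_apply (δ : A →ₗ[k] Z →ₗ[k] W) (δ' : A →ₗ[k] W →ₗ[k] Z) :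
    derPairing ρ bar sgn δ δ' =
      ∑ b, sgn b * LinearMap.trace k W (δ (ρ.x b) ∘ₗ δ' (ρ.x (bar b))) := rfl

/-- Reindexing by bar changes the sign, and the trace is symmetric. -/
theorem IsPreprojective.derPairing_comm (hρ : IsPreprojective k ρ bar sgn)
    (δ : A →ₗ[k] Z →ₗ[k] W) (δ' : A →ₗ[k] W →ₗ[k] Z) :
    derPairing ρ bar sgn δ δ' = -derPairing ρ bar sgn δ' δ := by
  rw [derPairing_apply, derPairing_apply, ← hρ.sum_bar, ← Finset.sum_neg_distrib]
  refine Finset.sum_congr rfl fun b _ => ?_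
  rw [hρ.bar_bar, hρ.sgn_bar, LinearMap.trace_comp_comm', neg_mul]

/-- Cyclicity of the trace and reindexing by bar turn the pairing into the trace of the Leibniz
expansion of the preprojective relation, composed with T. That expansion is zero by
`IsPreprojective.der_rel`. -/
theorem IsPreprojective.derPairing_innerDer (hρ : IsPreprojective k ρ bar sgn)
    {δ : A →ₗ[k] Z →ₗ[k] W} (hδ : δ ∈ Der k A Z W) (T : W →ₗ[k] Z) :
    derPairing ρ bar sgn δ (innerDer k T) = 0 := by
  have h1 : ∀ p q : A, LinearMap.trace k W (δ p ∘ₗ innerDer k T q) =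
      LinearMap.trace k W (δ p ∘ₗ Algebra.lsmul k k Z q ∘ₗ T) -
        LinearMap.trace k W (Algebra.lsmul k k W q ∘ₗ δ p ∘ₗ T) := by
    intro p q
    have : innerDer k T q = Algebra.lsmul k k Z q ∘ₗ T - T ∘ₗ Algebra.lsmul k k W q := rfl
    rw [this, LinearMap.comp_sub, map_sub]
    congr 1
    rw [← LinearMap.comp_assoc, LinearMap.trace_comp_comm']
  have h2 : ∑ b, sgn b • (δ (ρ.x b) ∘ₗ Algebra.lsmul k k Z (ρ.x (bar b)) ∘ₗ T +
      Algebra.lsmul k k W (ρ.x b) ∘ₗ δ (ρ.x (bar b)) ∘ₗ T) = 0 := by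
    refine LinearMap.ext fun w => ?_
    rw [LinearMap.sum_apply, LinearMap.zero_apply, ← hρ.der_rel hδ (T w)]
    rfl
  rw [derPairing_apply]
  simp_rw [h1, mul_sub]
  rw [Finset.sum_sub_distrib, sub_eq_add_neg, ← Finset.sum_neg_distrib,
    ← hρ.sum_bar (fun b => -(sgn b * _)), ← Finset.sum_add_distrib]
  have h3 := congrArg (LinearMap.trace k W) h2
  rw [map_sum, map_zero] at h3
  rw [← h3]
  refine Finset.sum_congr rfl fun b _ => ?_
  rw [hρ.sgn_bar, hρ.bar_bar, map_smul, map_add, smul_eq_mul]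
  ring

theorem IsPreprojective.innerDer_derPairing (hρ : IsPreprojective k ρ bar sgn)
    {δ : A →ₗ[k] W →ₗ[k] Z} (hδ : δ ∈ Der k A W Z) (T : Z →ₗ[k] W) :
    derPairing ρ bar sgn (innerDer k T) δ = 0 := by
  rw [hρ.derPairing_comm, hρ.derPairing_innerDer hδ, neg_zero]

/-- The pairing is nondegenerate modulo inner derivations. -/
theorem IsPreprojective.exists_eq_innerDer (hρ : IsPreprojective k ρ bar sgn)
    {δ : A →ₗ[k] Z →ₗ[k] W} (hδ : δ ∈ Der k A Z W)
    (h : ∀ δ' ∈ Der k A W Z, derPairing ρ bar sgn δ δ' = 0) : ∃ T, δ = innerDer k T := by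
  classical
  obtain ⟨T₀, hT₀⟩ := Der.exists_normalized ρ hδ
  set η := δ + innerDer k T₀ with hη
  have hηD : η ∈ Der k A Z W := Submodule.add_mem _ hδ (innerDer_mem k T₀)
  have hηe : ∀ i, η (ρ.e i) = 0 := hT₀
  have hη0 : ∀ δ' ∈ Der k A W Z, derPairing ρ bar sgn η δ' = 0 := fun δ' hδ' => by
    rw [hη, map_add, LinearMap.add_apply, h δ' hδ', hρ.innerDer_derPairing hδ', add_zero]
  let lZ : A → Z →ₗ[k] Z := fun p => Algebra.lsmul k k Z p
  let lW : A → W →ₗ[k] W := fun p => Algebra.lsmul k k W p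
  have hlW : ∀ p q, lW (p * q) = lW p ∘ₗ lW q := fun p q => map_mul (Algebra.lsmul k k W) p q
  have hlZ : ∀ p q, lZ (p * q) = lZ p ∘ₗ lZ q := fun p q => map_mul (Algebra.lsmul k k Z) p q
  -- P cuts a tuple down to admissible values on the arrows. The kernel of L below is the space of
  -- tuples whose cut satisfies the relation, that is, extends to a derivation; Φ is the pairing
  -- with η.
  let P : (Q → W →ₗ[k] Z) → Q → W →ₗ[k] Z := fun ξ b =>
    lZ (ρ.e (src b)) ∘ₗ ξ b ∘ₗ lW (ρ.e (tgt b))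
  have hPadd : ∀ ξ ξ' b, P (ξ + ξ') b = P ξ b + P ξ' b := fun ξ ξ' b => by
    simp only [P, Pi.add_apply, LinearMap.add_comp, LinearMap.comp_add]
  have hPsmul : ∀ (c : k) ξ b, P (c • ξ) b = c • P ξ b := fun c ξ b => by
    simp only [P, Pi.smul_apply, LinearMap.smul_comp, LinearMap.comp_smul]
  let L : (Q → W →ₗ[k] Z) →ₗ[k] W →ₗ[k] Z :=
    { toFun := fun ξ => ∑ b, sgn b • (P ξ b ∘ₗ lW (ρ.x (bar b)) + lZ (ρ.x b) ∘ₗ P ξ (bar b))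
      map_add' := fun ξ ξ' => by
        rw [← Finset.sum_add_distrib]
        refine Finset.sum_congr rfl fun b _ => ?_
        rw [hPadd, hPadd, LinearMap.add_comp, LinearMap.comp_add, ← smul_add]
        congr 1
        abel
      map_smul' := fun c ξ => by
        rw [RingHom.id_apply, Finset.smul_sum]
        refine Finset.sum_congr rfl fun b _ => ?_
        rw [hPsmul, hPsmul, LinearMap.smul_comp, LinearMap.comp_smul, ← smul_add, smul_comm] }
  let Φ : (Q → W →ₗ[k] Z) →ₗ[k] k :=
    { toFun := fun ξ => ∑ b, sgn b * LinearMap.trace k W (η (ρ.x b) ∘ₗ P ξ (bar b))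
      map_add' := fun ξ ξ' => by
        rw [← Finset.sum_add_distrib]
        refine Finset.sum_congr rfl fun b _ => ?_
        rw [hPadd, LinearMap.comp_add, map_add, mul_add]
      map_smul' := fun c ξ => by
        rw [RingHom.id_apply, Finset.smul_sum]
        refine Finset.sum_congr rfl fun b _ => ?_
        rw [hPsmul, LinearMap.comp_smul, map_smul, smul_eq_mul, smul_eq_mul, mul_left_comm] }
  have hker : LinearMap.ker L ≤ LinearMap.ker Φ := by
    intro ξ hξ
    obtain ⟨δ', hδ', -, hx⟩ := hρ.exists_der (P ξ)
      (fun b z => by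
        change ρ.e (src b) • ρ.e (src b) • ξ b _ = ρ.e (src b) • ξ b _
        rw [← mul_smul, (ρ.complete.idem _).eq])
      (fun b z => by
        change ρ.e (src b) • ξ b (ρ.e (tgt b) • ρ.e (tgt b) • z) = _
        rw [← mul_smul, (ρ.complete.idem _).eq]
        rfl)
      (fun z => by
        have := LinearMap.congr_fun (LinearMap.mem_ker.1 hξ) z
        rw [LinearMap.zero_apply] at this
        rw [← this]
        change _ = (∑ b, sgn b • (P ξ b ∘ₗ lW (ρ.x (bar b)) + lZ (ρ.x b) ∘ₗ P ξ (bar b))) z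
        rw [LinearMap.sum_apply]
        rfl)
    have h1 := hη0 δ' hδ'
    rw [derPairing_apply] at h1
    simp_rw [hx] at h1
    exact h1
  -- Since η is orthogonal to all derivations, Φ vanishes on ker L and factors through L. The form θ
  -- is the trace against some T, and transposing L shows that Φ is minus the pairing with the inner
  -- derivation of T.
  obtain ⟨θ, hθ⟩ : ∃ θ : (W →ₗ[k] Z) →ₗ[k] k, θ ∘ₗ L = Φ := by
    have : Φ ∈ (LinearMap.ker L).dualAnnihilator :=
      (Submodule.mem_dualAnnihilator _).2 fun z hz => hker hz
    rw [← LinearMap.range_dualMap_eq_dualAnnihilator_ker] at this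
    exact this
  obtain ⟨T, hT⟩ := exists_trace_comp_eq θ
  have hζ : ∀ ξ, ∑ b, sgn b * LinearMap.trace k W ((η (ρ.x b) +
      (lW (ρ.x b) ∘ₗ T - T ∘ₗ lZ (ρ.x b))) ∘ₗ P ξ (bar b)) = 0 := by
    intro ξ
    have h1 : LinearMap.trace k W (T ∘ₗ L ξ) = Φ ξ := by rw [← hT, ← hθ]; rfl
    change LinearMap.trace k W (T ∘ₗ ∑ b, sgn b • (P ξ b ∘ₗ lW (ρ.x (bar b)) +
      lZ (ρ.x b) ∘ₗ P ξ (bar b))) =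
      ∑ b, sgn b * LinearMap.trace k W (η (ρ.x b) ∘ₗ P ξ (bar b)) at h1
    have h2 : T ∘ₗ ∑ b, sgn b • (P ξ b ∘ₗ lW (ρ.x (bar b)) + lZ (ρ.x b) ∘ₗ P ξ (bar b)) =
        ∑ b, sgn b • (T ∘ₗ P ξ b ∘ₗ lW (ρ.x (bar b))) +
        ∑ b, sgn b • (T ∘ₗ lZ (ρ.x b) ∘ₗ P ξ (bar b)) := by
      rw [← Finset.sum_add_distrib]
      ext w
      simp only [LinearMap.comp_apply, LinearMap.sum_apply, LinearMap.add_apply,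
        LinearMap.smul_apply, map_sum, map_smul, map_add, smul_add]
    rw [h2, map_add, map_sum, map_sum, ← hρ.sum_bar (fun b => LinearMap.trace k W (sgn b • _)),
      ← Finset.sum_add_distrib] at h1
    rw [← sub_eq_zero.2 h1.symm, ← Finset.sum_sub_distrib]
    refine Finset.sum_congr rfl fun b _ => ?_
    rw [hρ.bar_bar, hρ.sgn_bar, LinearMap.add_comp, LinearMap.sub_comp, map_add, map_sub, map_smul,
      map_smul, smul_eq_mul, smul_eq_mul, ← LinearMap.comp_assoc _ (P ξ (bar b)) T,
      LinearMap.comp_assoc _ T (lW (ρ.x b)), LinearMap.trace_comp_comm' (lW (ρ.x b)),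
      LinearMap.comp_assoc _ (lZ (ρ.x b)) T]
    ring
  -- The trace form is nondegenerate, so testing on tuples supported at bar b isolates the value at
  -- b.
  have hζ0 : ∀ b, lW (ρ.e (src b)) ∘ₗ (η (ρ.x b) +
      (lW (ρ.x b) ∘ₗ T - T ∘ₗ lZ (ρ.x b))) ∘ₗ lZ (ρ.e (tgt b)) = 0 := by
    intro b
    refine eq_zero_of_trace_comp fun S => ?_
    have h1 := hζ (Pi.single (bar b) S)
    rw [Finset.sum_eq_single b] at h1
    · have h2 : P (Pi.single (bar b) S) (bar b) = lZ (ρ.e (tgt b)) ∘ₗ S ∘ₗ lW (ρ.e (src b)) := by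
        simp only [P, Pi.single_eq_same, hρ.src_bar, hρ.tgt_bar]
      rw [h2] at h1
      have h3 := congrArg (sgn b * ·) h1
      simp only [mul_zero, ← mul_assoc, hρ.sgn_mul_self, one_mul] at h3
      rw [← h3, LinearMap.comp_assoc, LinearMap.trace_comp_comm']
      simp only [LinearMap.comp_assoc]
    · intro c _ hc
      have h2 : P (Pi.single (bar b) S) (bar c) = 0 := by
        have : bar c ≠ bar b := fun h => hc (by rw [← hρ.bar_bar c, h, hρ.bar_bar])
        simp only [P, Pi.single_eq_of_ne this, LinearMap.zero_comp, LinearMap.comp_zero]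
      rw [h2, LinearMap.comp_zero, map_zero, mul_zero]
    · intro h; exact absurd (Finset.mem_univ b) h
  -- Only the diagonal blocks of T are kept, so that the inner derivation kills the vertices, as η
  -- does. On the arrows this does not change its admissible part.
  let T' : Z →ₗ[k] W := ∑ i, lW (ρ.e i) ∘ₗ T ∘ₗ lZ (ρ.e i)
  have hT' : η = innerDer k (-T') := by
    have hT'l : ∀ i z, ρ.e i • T' z = ρ.e i • T (ρ.e i • z) := by
      intro i z
      change ρ.e i • (∑ j, lW (ρ.e j) ∘ₗ T ∘ₗ lZ (ρ.e j)) z = _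
      rw [LinearMap.sum_apply, Finset.smul_sum, Finset.sum_eq_single i]
      · change ρ.e i • ρ.e i • T (ρ.e i • z) = _
        rw [← mul_smul, (ρ.complete.idem _).eq]
      · intro j _ hj
        change ρ.e i • ρ.e j • T (ρ.e j • z) = _
        rw [← mul_smul, ρ.complete.ortho hj.symm, zero_smul]
      · intro h; exact absurd (Finset.mem_univ i) h
    have hT'r : ∀ i z, T' (ρ.e i • z) = ρ.e i • T (ρ.e i • z) := by
      intro i z
      change (∑ j, lW (ρ.e j) ∘ₗ T ∘ₗ lZ (ρ.e j)) (ρ.e i • z) = _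
      rw [LinearMap.sum_apply, Finset.sum_eq_single i]
      · change ρ.e i • T (ρ.e i • ρ.e i • z) = _
        rw [← mul_smul, (ρ.complete.idem _).eq]
      · intro j _ hj
        change ρ.e j • T (ρ.e j • ρ.e i • z) = _
        rw [← mul_smul, ρ.complete.ortho hj, zero_smul, map_zero, smul_zero]
      · intro h; exact absurd (Finset.mem_univ i) h
    refine Der.ext_of_adjoin hρ.adjoin_eq_top hηD (innerDer_mem k _) (fun i => ?_) fun b => ?_
    · rw [hηe]
      ext z
      change (0 : W) = ρ.e i • -T' z - -T' (ρ.e i • z)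
      rw [smul_neg, hT'l, hT'r, sub_neg_eq_add, neg_add_cancel]
    · ext z
      have h1 := LinearMap.congr_fun (hζ0 b) z
      change ρ.e (src b) • (η (ρ.x b) (ρ.e (tgt b) • z) + (ρ.x b • T (ρ.e (tgt b) • z) -
        T (ρ.x b • ρ.e (tgt b) • z))) = 0 at h1
      have h2 : ρ.e (src b) • η (ρ.x b) (ρ.e (tgt b) • z) = η (ρ.x b) z := by
        have h3 := hηD (ρ.e (src b)) (ρ.x b) (ρ.e (tgt b) • z)
        rw [hηe, LinearMap.zero_apply, add_zero, ρ.src_mul] at h3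
        have h4 := hηD (ρ.x b) (ρ.e (tgt b)) z
        rw [hηe, LinearMap.zero_apply, smul_zero, zero_add, ρ.mul_tgt] at h4
        rw [← h3, ← h4]
      rw [smul_add, h2, smul_sub, ← mul_smul, ρ.src_mul, ← mul_smul, ρ.mul_tgt] at h1
      rw [eq_neg_of_add_eq_zero_left h1]
      change -(ρ.x b • T (ρ.e (tgt b) • z) - ρ.e (src b) • T (ρ.x b • z)) =
        ρ.x b • -T' z - -T' (ρ.x b • z)
      have h5 : ρ.x b • T' z = ρ.x b • T (ρ.e (tgt b) • z) := by
        conv_lhs => rw [← ρ.mul_tgt, mul_smul, hT'l, ← mul_smul, ρ.mul_tgt]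
      have h6 : T' (ρ.x b • z) = ρ.e (src b) • T (ρ.x b • z) := by
        conv_lhs => rw [← ρ.src_mul, mul_smul, hT'r, ← mul_smul, ρ.src_mul]
      rw [smul_neg, h5, h6]
      abel
  refine ⟨-T' - T₀, ?_⟩
  rw [map_sub, ← hT', hη, add_sub_cancel_right]

end DerivationPairing

/-! ### Selfinjectivity -/

section Selfinjective

variable {I Q : Type} [Fintype I] [Fintype Q] {src tgt : Q → I}
  {k A : Type u} [Field k] [Ring A] [Algebra k A]
  {ρ : QuiverRep src tgt A} {bar : Q → Q} {sgn : Q → k}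

/-- Derivations of `A` in `Hom_k(A, M)` are inner. -/
theorem Der.exists_innerDer_of_regular {M : Type u} [AddCommGroup M] [Module k M] [Module A M]
    [IsScalarTower k A M] {δ : A →ₗ[k] A →ₗ[k] M} (hδ : δ ∈ Der k A A M) :
    ∃ T, δ = innerDer k T := by
  refine ⟨-δ.flip 1, ?_⟩
  ext p q
  have := hδ p q 1
  rw [smul_eq_mul, mul_one] at this
  change δ p q = p • -δ q 1 - -δ (p • q) 1
  rw [smul_eq_mul, this, smul_neg]
  abel

variable [Module.Finite k A]

/-- Derivations of a preprojective algebra `A` in `Hom_k(M, A)` are inner. -/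
theorem IsPreprojective.exists_innerDer_of_regular (hρ : IsPreprojective k ρ bar sgn)
    {M : Type u} [AddCommGroup M] [Module k M] [Module A M] [IsScalarTower k A M]
    [Module.Finite k M] {δ : A →ₗ[k] M →ₗ[k] A} (hδ : δ ∈ Der k A M A) :
    ∃ T, δ = innerDer k T :=
  hρ.exists_eq_innerDer hδ fun δ' hδ' => by
    obtain ⟨T, hT⟩ := Der.exists_innerDer_of_regular (k := k) (A := A) (M := M) hδ'
    rw [hT]
    exact hρ.derPairing_innerDer (Z := M) (W := A) hδ T

/-- Baer's criterion: extend the map g on a left ideal J to a k-linear map F on A. The inner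
derivation of F vanishes on J and descends to a derivation in Hom_k(A/J, A), which is inner by
`IsPreprojective.exists_innerDer_of_regular`. Subtracting its primitive from F gives an A-linear
extension of g. -/
theorem IsPreprojective.injective (hρ : IsPreprojective k ρ bar sgn) : Module.Injective A A := by
  refine Module.Baer.injective fun J g => ?_
  obtain ⟨F, hF⟩ := LinearMap.exists_extend (p := J.restrictScalars k) (g.restrictScalars k)
  have hF : ∀ x (hx : x ∈ J), F x = g ⟨x, hx⟩ := fun x hx => LinearMap.congr_fun hF ⟨x, hx⟩
  have hJ : ∀ p : A, J.restrictScalars k ≤ LinearMap.ker (innerDer k F p) := by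
    intro p x hx
    change p • F x - F (p • x) = 0
    rw [hF x hx, hF _ (J.smul_mem p hx), ← map_smul, sub_eq_zero]
    rfl
  let π : A →ₗ[A] A ⧸ J := J.mkQ
  let δ : A →ₗ[k] (A ⧸ J) →ₗ[k] A :=
    { toFun := fun p => (J.restrictScalars k).liftQ (innerDer k F p) (hJ p)
      map_add' := fun p q => by
        refine LinearMap.ext fun x => ?_
        obtain ⟨x, rfl⟩ := J.mkQ_surjective x
        change innerDer k F (p + q) x = innerDer k F p x + innerDer k F q x
        rw [map_add, LinearMap.add_apply]
      map_smul' := fun c p => by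
        refine LinearMap.ext fun x => ?_
        obtain ⟨x, rfl⟩ := J.mkQ_surjective x
        change innerDer k F (c • p) x = c • innerDer k F p x
        rw [map_smul, LinearMap.smul_apply] }
  have hδ : ∀ p x, δ p (π x) = p • F x - F (p • x) := fun p x => rfl
  have hfin : Module.Finite k (A ⧸ J) := Module.Finite.of_surjective (π.restrictScalars k)
    J.mkQ_surjective
  obtain ⟨T, hT⟩ := hρ.exists_innerDer_of_regular (δ := δ) (fun p q x => by
    obtain ⟨x, rfl⟩ := J.mkQ_surjective x
    change innerDer k F (p * q) x = p • innerDer k F q x + innerDer k F p (q • x)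
    exact innerDer_mem k F p q x)
  refine ⟨{ toFun := fun x => F x - T (π x), map_add' := fun x y => ?_,
            map_smul' := fun p x => ?_ }, fun x hx => ?_⟩
  · rw [map_add, map_add, map_add]; abel
  · have h1 := hδ p x
    rw [hT, innerDer_apply, ← map_smul π] at h1
    rw [RingHom.id_apply, smul_sub, sub_eq_sub_iff_sub_eq_sub, ← neg_inj, neg_sub, ← h1, neg_sub]
  · have : π x = 0 := (Submodule.Quotient.mk_eq_zero J).2 hx
    change F x - T (π x) = _
    rw [this, map_zero, sub_zero, hF x hx]

/-- Finite dimensional preprojective algebras are selfinjective. -/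
theorem IsPreprojective.isSelfinjective (hρ : IsPreprojective k ρ bar sgn) : IsSelfinjective A :=
  ⟨hρ.injective, by
    let e : Aᵐᵒᵖ ≃ₗ[Aᵐᵒᵖ] A :=
      { (MulOpposite.opAddEquiv (α := A)).symm with map_smul' := fun _ _ => rfl }
    have := hρ.op.injective
    exact Module.Injective.of_ringEquiv (RingEquiv.refl Aᵐᵒᵖ) e⟩

end Selfinjective

/-! ### The stable category and its suspension -/

section StableCategory

open scoped ModuleCat

variable {I Q : Type} [Fintype I] [Fintype Q] {src tgt : Q → I}
  {k A : Type u} [Field k] [Ring A] [Algebra k A] [Module.Finite k A]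
  {ρ : QuiverRep src tgt A} {bar : Q → Q} {sgn : Q → k}

theorem finite_of_fg (Z : FGModuleCat.{u} A) : Module.Finite k Z.obj :=
  have : Module.Finite A Z.obj := Z.property
  Module.Finite.trans A Z.obj

/-- Derivations of `A` in `Hom_k(M, Hom_k(A, V))` are inner. -/
theorem Der.exists_innerDer_of_coInd {M V : Type u} [AddCommGroup M] [Module k M] [Module A M]
    [IsScalarTower k A M] [AddCommGroup V] [Module k V]
    {δ : A →ₗ[k] M →ₗ[k] CoInd k A V} (hδ : δ ∈ Der k A M (CoInd k A V)) :
    ∃ T, δ = innerDer k T := by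
  let T : M →ₗ[k] CoInd k A V :=
    { toFun := fun m => (show A →ₗ[k] V from
        { toFun := fun p => δ p m 1
          map_add' := fun p q => by rw [map_add]; rfl
          map_smul' := fun c p => by rw [map_smul]; rfl })
      map_add' := fun m n => CoInd.ext fun p => by
        change δ p (m + n) 1 = δ p m 1 + δ p n 1
        rw [map_add]; rfl
      map_smul' := fun c m => CoInd.ext fun p => by
        change δ p (c • m) 1 = c • δ p m 1
        rw [map_smul]; rfl }
  refine ⟨T, ?_⟩
  ext p m a
  change δ p m a = δ (a * p) m 1 - δ a (p • m) 1
  rw [hδ, CoInd.add_apply, CoInd.smul_apply, one_mul, add_sub_cancel_right]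

/-- Take a free cover π with kernel M and a k-linear section s. Its failure to be A-linear is a
derivation with values in M. It is orthogonal to all derivations in Hom_k(M, Hom_k(A, V)), which are
inner, and so it is inner itself. Correcting s by a primitive splits π. -/
theorem IsPreprojective.projective_coInd (hρ : IsPreprojective k ρ bar sgn) (V : Type u)
    [AddCommGroup V] [Module k V] [Module.Finite k V] : Module.Projective A (CoInd k A V) := by
  have hfin : Module.Finite A (CoInd k A V) := Module.Finite.of_restrictScalars_finite k A _
  obtain ⟨n, π, hπ⟩ := Module.Finite.exists_fin' A (CoInd k A V)
  obtain ⟨s, hs⟩ := (π.restrictScalars k).exists_rightInverse_of_surjective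
    (LinearMap.range_eq_top.2 hπ)
  have hs : ∀ z, π (s z) = z := fun z => LinearMap.congr_fun hs z
  let M := LinearMap.ker π
  have hM : Module.Finite k M := Module.Finite.of_injective (M.subtype.restrictScalars k)
    M.injective_subtype
  let δ : A →ₗ[k] CoInd k A V →ₗ[k] M := LinearMap.mk₂ k
    (fun p z => (⟨innerDer k s p z, by
      rw [LinearMap.mem_ker, innerDer_apply, map_sub, map_smul, hs, hs, sub_self]⟩ : M))
    (fun p q z => Subtype.ext (by
      change innerDer k s (p + q) z = innerDer k s p z + innerDer k s q z
      rw [map_add, LinearMap.add_apply]))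
    (fun c p z => Subtype.ext (by
      change innerDer k s (c • p) z = c • innerDer k s p z
      rw [map_smul, LinearMap.smul_apply]))
    (fun p y z => Subtype.ext (by
      change innerDer k s p (y + z) = innerDer k s p y + innerDer k s p z
      rw [map_add]))
    (fun c p z => Subtype.ext (by
      change innerDer k s p (c • z) = c • innerDer k s p z
      rw [map_smul]))
  have hδ : δ ∈ Der k A (CoInd k A V) M := fun p q z => Subtype.ext (innerDer_mem k s p q z)
  obtain ⟨T, hT⟩ := hρ.exists_eq_innerDer hδ fun δ' hδ' => by
    obtain ⟨T, hT⟩ := Der.exists_innerDer_of_coInd (k := k) (A := A) (M := M) (V := V) hδ'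
    rw [hT]
    exact hρ.derPairing_innerDer (Z := CoInd k A V) (W := M) hδ T
  refine Module.Projective.of_split
    ({ toFun := fun z => s z - (T z : Fin n → A)
       map_add' := fun y z => by rw [map_add, map_add, Submodule.coe_add]; abel
       map_smul' := fun p z => ?_ } : CoInd k A V →ₗ[A] Fin n → A) π ?_
  · have h1 : p • s z - s (p • z) = p • (T z : Fin n → A) - (T (p • z) : Fin n → A) := by
      have := congrArg Subtype.val (LinearMap.congr_fun (LinearMap.congr_fun hT p) z)
      exact this
    rw [RingHom.id_apply, smul_sub]
    rw [sub_eq_sub_iff_sub_eq_sub, ← neg_inj, neg_sub, h1, neg_sub]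
  · ext z : 1
    change π (s z - (T z : Fin n → A)) = z
    rw [map_sub, hs, LinearMap.mem_ker.1 (T z).2, sub_zero]

/-- The coinduced module of a finitely generated module. -/
def coIndFG (k : Type u) [Field k] [Algebra k A] [Module.Finite k A] (W : FGModuleCat.{u} A) :
    FGModuleCat.{u} A :=
  have := coInd_finite k W.obj W.property
  FGModuleCat.of A (CoInd k A W.obj)

theorem IsPreprojective.projective_coIndFG (hρ : IsPreprojective k ρ bar sgn)
    (W : FGModuleCat.{u} A) : Module.Projective A (coIndFG k W) :=
  have := finite_of_fg (k := k) W
  hρ.projective_coInd W.obj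

variable {Z W : FGModuleCat.{u} A}

/-- The morphism `Z → Ω⁻¹W` defined by a derivation. -/
def Der.toFG (δ : Der k A Z.obj W.obj) : Z ⟶ (cosyzygy k A).obj W :=
  ObjectProperty.homMk (Der.toMor δ)

theorem Der.exists_toFG (h : Z ⟶ (cosyzygy k A).obj W) :
    ∃ δ : Der k A Z.obj W.obj, Der.toFG δ = h := by
  obtain ⟨δ, hδ⟩ := Der.toHom_surjective (k := k) (Z := Z.obj) (W := W.obj) h.hom.hom
  exact ⟨δ, FGModuleCat.hom_ext hδ⟩

/-- The unit `W → Hom_k(A, W)`. -/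
def unitFG (k : Type u) [Field k] [Algebra k A] [Module.Finite k A] (W : FGModuleCat.{u} A) :
    W ⟶ coIndFG k W := ObjectProperty.homMk (ModuleCat.ofHom (coIndUnit k W.obj))

/-- The projection `Hom_k(A, W) → Ω⁻¹W`. -/
def projFG (k : Type u) [Field k] [Algebra k A] [Module.Finite k A] (W : FGModuleCat.{u} A) :
    coIndFG k W ⟶ (cosyzygy k A).obj W := ObjectProperty.homMk (cosyzProj k W.obj)

/-- The functoriality of the coinduced module. -/
def coIndFGMap (k : Type u) [Field k] [Algebra k A] [Module.Finite k A] (f : Z ⟶ W) :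
    coIndFG k Z ⟶ coIndFG k W := ObjectProperty.homMk (ModuleCat.ofHom (coIndMap k f.hom))

theorem unitFG_coIndFGMap (f : Z ⟶ W) : unitFG k Z ≫ coIndFGMap k f = f ≫ unitFG k W :=
  FGModuleCat.hom_ext (LinearMap.ext fun z => coIndMap_unit k f.hom z)

theorem coIndFGMap_projFG (f : Z ⟶ W) :
    coIndFGMap k f ≫ projFG k W = projFG k Z ≫ (cosyzygy k A).map f := rfl

theorem projFG_surjective (W : FGModuleCat.{u} A) :
    Function.Surjective (projFG k W).hom.hom := Submodule.mkQ_surjective _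

theorem unitFG_projFG (W : FGModuleCat.{u} A) : unitFG k W ≫ projFG k W = 0 :=
  FGModuleCat.hom_ext (LinearMap.ext fun w => (Submodule.Quotient.mk_eq_zero _).2 ⟨w, rfl⟩)

theorem exists_comp_unitFG {f : Z ⟶ coIndFG k W} (h : f ≫ projFG k W = 0) :
    ∃ g : Z ⟶ W, f = g ≫ unitFG k W := by
  have h1 : ∀ z, ∃ w, coIndUnit k W.obj w = f.hom.hom z := fun z => by
    have := LinearMap.congr_fun (congrArg (fun a => a.hom.hom) h) z
    exact (Submodule.Quotient.mk_eq_zero _).1 this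
  choose g hg using h1
  have hi := coIndUnit_injective k W.obj
  refine ⟨ObjectProperty.homMk (ModuleCat.ofHom
    { toFun := g
      map_add' := fun y z => hi (by rw [hg, map_add, map_add, hg, hg]; rfl)
      map_smul' := fun a z => hi (by rw [hg, map_smul, RingHom.id_apply, map_smul, hg]; rfl) }),
    FGModuleCat.hom_ext (LinearMap.ext fun z => (hg z).symm)⟩

theorem exists_projFG_comp {f : coIndFG k W ⟶ Z} (h : unitFG k W ≫ f = 0) :
    ∃ g : (cosyzygy k A).obj W ⟶ Z, f = projFG k W ≫ g := by
  refine ⟨ObjectProperty.homMk (ModuleCat.ofHom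
    ((LinearMap.range (coIndUnit k W.obj)).liftQ f.hom.hom ?_)), ?_⟩
  · rintro _ ⟨w, rfl⟩
    exact LinearMap.congr_fun (congrArg (fun a => a.hom.hom) h) w
  · exact FGModuleCat.hom_ext (LinearMap.ext fun z => rfl)

theorem projFG_cancel {f g : (cosyzygy k A).obj W ⟶ Z} (h : projFG k W ≫ f = projFG k W ≫ g) :
    f = g := by
  refine FGModuleCat.hom_ext (LinearMap.ext fun z => ?_)
  obtain ⟨z, rfl⟩ := projFG_surjective W z
  exact LinearMap.congr_fun (congrArg (fun a => a.hom.hom) h) z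

theorem unitFG_cancel {f g : Z ⟶ W} (h : f ≫ unitFG k W = g ≫ unitFG k W) : f = g :=
  FGModuleCat.hom_ext (LinearMap.ext fun z => coIndUnit_injective k W.obj
    (LinearMap.congr_fun (congrArg (fun a => a.hom.hom) h) z))

theorem exists_lift_projFG {P : FGModuleCat.{u} A} (hP : Module.Projective A P)
    (f : P ⟶ (cosyzygy k A).obj W) : ∃ g : P ⟶ coIndFG k W, f = g ≫ projFG k W := by
  obtain ⟨g, hg⟩ := Module.projective_lifting_property (projFG k W).hom.hom f.hom.hom
    (projFG_surjective W)
  exact ⟨ObjectProperty.homMk (ModuleCat.ofHom g), FGModuleCat.hom_ext hg.symm⟩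

variable (A) in
/-- The quotient functor to the stable category. -/
abbrev stFunctor : FGModuleCat.{u} A ⥤ StMod A := Quotient.functor (stableRel A)

theorem stFunctor_map_eq_iff {X Y : FGModuleCat.{u} A} (f g : X ⟶ Y) :
    (stFunctor A).map f = (stFunctor A).map g ↔ stableRel A f g :=
  Quotient.functor_map_eq_iff _ _ _

theorem stFunctor_map_eq_zero_iff {X Y : FGModuleCat.{u} A} (f : X ⟶ Y) :
    (stFunctor A).map f = 0 ↔ ∃ (P : FGModuleCat.{u} A) (_ : Module.Projective A P) (a : X ⟶ P)
      (b : P ⟶ Y), f = a ≫ b := by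
  have := stFunctor_map_eq_iff f 0
  rw [Functor.map_zero] at this
  rw [this]
  simp only [stableRel, sub_zero]

/-- A map from a projective module to Ω⁻¹W lifts to the coinduced module, which is projective
itself. Factoring through a projective is therefore the same as lifting to it, hence the same as
being inner. -/
theorem IsPreprojective.stFunctor_map_toFG_eq_zero_iff (hρ : IsPreprojective k ρ bar sgn)
    (δ : Der k A Z.obj W.obj) :
    (stFunctor A).map (Der.toFG δ) = 0 ↔ ∃ T : Z.obj →ₗ[k] W.obj, δ.1 = innerDer k T := by
  rw [Der.exists_eq_innerDer_iff, stFunctor_map_eq_zero_iff]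
  constructor
  · rintro ⟨P, hP, a, b, h⟩
    obtain ⟨g, rfl⟩ := exists_lift_projFG hP b
    exact ⟨(a ≫ g).hom.hom, congrArg (fun a => a.hom.hom) h⟩
  · rintro ⟨F, hF⟩
    exact ⟨coIndFG k W, hρ.projective_coIndFG W, ObjectProperty.homMk (ModuleCat.ofHom F),
      projFG k W, FGModuleCat.hom_ext hF⟩

/-- By duality, Ext¹(Z, P) vanishes along with Ext¹(P, Z). This makes Ω⁻¹ well defined on the stable
category. -/
theorem IsPreprojective.exists_innerDer_of_projective_right (hρ : IsPreprojective k ρ bar sgn)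
    {P : FGModuleCat.{u} A} (hP : Module.Projective A P) (δ : Der k A Z.obj P.obj) :
    ∃ T : Z.obj →ₗ[k] P.obj, δ.1 = innerDer k T := by
  have := finite_of_fg (k := k) Z
  have := finite_of_fg (k := k) P
  have hP' : Module.Projective A P.obj := hP
  have : Projective P.obj := (IsProjective.iff_projective (R := A) P.obj).1 hP'
  refine hρ.exists_eq_innerDer δ.2 fun δ' hδ' => ?_
  obtain ⟨T, hT⟩ := Der.exists_innerDer_of_projective (W := Z.obj) ⟨δ', hδ'⟩
  rw [show δ' = innerDer k T from hT]
  exact hρ.derPairing_innerDer (Z := Z.obj) (W := P.obj) δ.2 T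

theorem cosyzygy_map_sub {X Y : FGModuleCat.{u} A} (f g : X ⟶ Y) :
    (cosyzygy k A).map (f - g) = (cosyzygy k A).map f - (cosyzygy k A).map g := by
  refine FGModuleCat.hom_ext (LinearMap.ext fun x => ?_)
  obtain ⟨x, rfl⟩ := projFG_surjective X x
  rfl

/-- The suspension of the stable category. -/
def IsPreprojective.suspension (hρ : IsPreprojective k ρ bar sgn) : StMod A ⥤ StMod A :=
  CategoryTheory.Quotient.lift (stableRel A) (cosyzygy k A ⋙ stFunctor A) (by
    rintro X Y f g ⟨P, hP, a, b, h⟩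
    rw [← sub_eq_zero, Functor.comp_map, Functor.comp_map, ← Functor.map_sub, ← cosyzygy_map_sub, h,
      Functor.map_comp, Functor.map_comp]
    obtain ⟨δ, hδ⟩ := Der.exists_toFG ((cosyzygy k A).map a)
    rw [← hδ, (hρ.stFunctor_map_toFG_eq_zero_iff δ).2
      (hρ.exists_innerDer_of_projective_right hP δ), zero_comp])

/-- Lift the factorisation of Ω⁻¹f to coinduced modules. Its difference with the map induced by f
lands in Y, and restricting this difference to X recovers f, which thus factors through the
coinduced module of X. -/
theorem IsPreprojective.suspension_map_eq_zero (hρ : IsPreprojective k ρ bar sgn)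
    {X Y : FGModuleCat.{u} A} (f : X ⟶ Y)
    (h : hρ.suspension.map ((stFunctor A).map f) = 0) : (stFunctor A).map f = 0 := by
  have h : (stFunctor A).map ((cosyzygy k A).map f) = 0 := h
  rw [stFunctor_map_eq_zero_iff] at h
  obtain ⟨P, hP, a, b, h⟩ := h
  obtain ⟨g, rfl⟩ := exists_lift_projFG hP b
  obtain ⟨G, hG⟩ := exists_comp_unitFG (k := k)
    (f := coIndFGMap k f - projFG k X ≫ a ≫ g) (W := Y) (by
      rw [Preadditive.sub_comp, coIndFGMap_projFG, h]
      simp only [Category.assoc, sub_self])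
  rw [stFunctor_map_eq_zero_iff]
  refine ⟨coIndFG k X, hρ.projective_coIndFG X, unitFG k X, G, unitFG_cancel (k := k) ?_⟩
  rw [Category.assoc, ← hG, Preadditive.comp_sub, ← Category.assoc (unitFG k X) (projFG k X),
    unitFG_projFG, zero_comp, sub_zero, unitFG_coIndFGMap]

/-- Lift h to a map H of coinduced modules and let f be its restriction to X. Then H minus the map
induced by f vanishes on X, so h - Ω⁻¹f factors through the coinduced module of Y. -/
theorem IsPreprojective.suspension_map_surjective (hρ : IsPreprojective k ρ bar sgn)
    {X Y : FGModuleCat.{u} A} (h : (cosyzygy k A).obj X ⟶ (cosyzygy k A).obj Y) :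
    ∃ f : X ⟶ Y, hρ.suspension.map ((stFunctor A).map f) = (stFunctor A).map h := by
  obtain ⟨H, hH⟩ := exists_lift_projFG (hρ.projective_coIndFG X) (projFG k X ≫ h)
  obtain ⟨f, hf⟩ := exists_comp_unitFG (k := k) (f := unitFG k X ≫ H) (W := Y) (by
    rw [Category.assoc, ← hH, ← Category.assoc, unitFG_projFG, zero_comp])
  obtain ⟨F, hF⟩ := exists_projFG_comp (k := k) (f := H - coIndFGMap k f) (W := X) (by
    rw [Preadditive.comp_sub, hf, unitFG_coIndFGMap, sub_self])
  refine ⟨f, ?_⟩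
  change (stFunctor A).map ((cosyzygy k A).map f) = (stFunctor A).map h
  rw [eq_comm, ← sub_eq_zero, ← Functor.map_sub, stFunctor_map_eq_zero_iff]
  refine ⟨coIndFG k Y, hρ.projective_coIndFG Y, F, projFG k Y, projFG_cancel ?_⟩
  rw [Preadditive.comp_sub, hH, ← coIndFGMap_projFG, ← Preadditive.sub_comp, hF, Category.assoc]

end StableCategory

/-! ### The stable category is 2-Calabi–Yau -/

section StableCalabiYau

open scoped ModuleCat

variable {I Q : Type} [Fintype I] [Fintype Q] {src tgt : Q → I}
  {k A : Type u} [Field k] [Ring A] [Algebra k A] [Module.Finite k A]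
  {ρ : QuiverRep src tgt A} {bar : Q → Q} {sgn : Q → k}

theorem cosyzygy_map_smul (c : k) {X Y : FGModuleCat.{u} A} (f : X ⟶ Y) :
    (cosyzygy k A).map (c • f) = c • (cosyzygy k A).map f := by
  refine FGModuleCat.hom_ext (LinearMap.ext fun x => ?_)
  obtain ⟨x, rfl⟩ := projFG_surjective X x
  refine (Cosyz.mk_eq_iff _ _).2 ⟨0, fun a => ?_⟩
  have h : (coIndMap k f.hom x) (a * algebraMap k A c) =
      c • f.hom.hom ((show CoInd k A X.obj from x) a) := by
    rw [← Algebra.commutes, ← Algebra.smul_def, map_smul]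
    rfl
  refine Eq.trans ?_ (congrArg (a • (0 : Y.obj) + ·) h).symm
  rw [smul_zero, zero_add]
  rfl

/-- The stable morphism `Z → Ω⁻¹W` defined by a derivation. -/
def Der.stClass (Z W : FGModuleCat.{u} A) : Der k A Z.obj W.obj →ₗ[k]
    ((stFunctor A).obj Z ⟶ (stFunctor A).obj ((cosyzygy k A).obj W)) where
  toFun δ := (stFunctor A).map (Der.toFG δ)
  map_add' δ δ' := by
    rw [← Functor.map_add]; rfl
  map_smul' c δ := by
    have : Der.toFG (c • δ) = c • Der.toFG δ :=
      FGModuleCat.hom_ext (congrArg ModuleCat.Hom.hom (Der.toMor_smul c δ))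
    rw [this]
    rfl

theorem Der.stClass_surjective (Z W : FGModuleCat.{u} A) :
    Function.Surjective (Der.stClass (k := k) Z W) := by
  intro x
  obtain ⟨f, rfl⟩ := (stFunctor A).map_surjective x
  obtain ⟨δ, rfl⟩ := Der.exists_toFG f
  exact ⟨δ, rfl⟩

theorem Der.comp_stClass {Z Z' W : FGModuleCat.{u} A} (f : Z' ⟶ Z) (δ : Der k A Z.obj W.obj) :
    (stFunctor A).map f ≫ Der.stClass Z W δ = Der.stClass Z' W (Der.precomp f.hom δ) :=
  ((stFunctor A).map_comp _ _).symm

theorem Der.stClass_comp {Z W W' : FGModuleCat.{u} A} (f : W ⟶ W') (δ : Der k A Z.obj W.obj) :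
    Der.stClass Z W δ ≫ (stFunctor A).map ((cosyzygy k A).map f) =
      Der.stClass Z W' (Der.postcomp δ f.hom) :=
  ((stFunctor A).map_comp _ _).symm

theorem finite_stHom (Z W : FGModuleCat.{u} A) :
    Module.Finite k ((stFunctor A).obj Z ⟶ (stFunctor A).obj ((cosyzygy k A).obj W)) := by
  have := finite_of_fg (k := k) Z
  have := finite_of_fg (k := k) W
  exact Module.Finite.of_surjective _ (Der.stClass_surjective (k := k) Z W)

theorem IsPreprojective.stClass_eq_zero_iff (hρ : IsPreprojective k ρ bar sgn)
    {Z W : FGModuleCat.{u} A} (δ : Der k A Z.obj W.obj) :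
    Der.stClass Z W δ = 0 ↔ ∃ T : Z.obj →ₗ[k] W.obj, δ.1 = innerDer k T :=
  hρ.stFunctor_map_toFG_eq_zero_iff δ

/-- The pairing of stable morphism spaces `(Z, Ω⁻¹W)` and `(W, Ω⁻¹Z)`. -/
theorem IsPreprojective.exists_stPairing (hρ : IsPreprojective k ρ bar sgn)
    (Z W : FGModuleCat.{u} A) :
    ∃ β : ((stFunctor A).obj Z ⟶ (stFunctor A).obj ((cosyzygy k A).obj W)) →ₗ[k]
        ((stFunctor A).obj W ⟶ (stFunctor A).obj ((cosyzygy k A).obj Z)) →ₗ[k] k,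
      ∀ δ δ', β (Der.stClass Z W δ) (Der.stClass W Z δ') =
        (have := finite_of_fg (k := k) W; derPairing ρ bar sgn δ.1 δ'.1) := by
  have := finite_of_fg (k := k) Z
  have := finite_of_fg (k := k) W
  obtain ⟨σ, hσ⟩ := (Der.stClass (k := k) Z W).exists_rightInverse_of_surjective
    (LinearMap.range_eq_top.2 (Der.stClass_surjective Z W))
  obtain ⟨σ', hσ'⟩ := (Der.stClass (k := k) W Z).exists_rightInverse_of_surjective
    (LinearMap.range_eq_top.2 (Der.stClass_surjective W Z))
  let B : Der k A Z.obj W.obj →ₗ[k] Der k A W.obj Z.obj →ₗ[k] k :=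
    (derPairing ρ bar sgn).domRestrict₁₂ _ _
  have h1 : ∀ δ : Der k A Z.obj W.obj, Der.stClass Z W δ = 0 → ∀ δ', B δ δ' = 0 := by
    intro δ h δ'
    obtain ⟨T, hT⟩ := (hρ.stClass_eq_zero_iff δ).1 h
    change derPairing ρ bar sgn δ.1 δ'.1 = 0
    rw [hT, hρ.innerDer_derPairing δ'.2]
  have h2 : ∀ δ' : Der k A W.obj Z.obj, Der.stClass W Z δ' = 0 → ∀ δ, B δ δ' = 0 := by
    intro δ' h δ
    obtain ⟨T, hT⟩ := (hρ.stClass_eq_zero_iff δ').1 h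
    change derPairing ρ bar sgn δ.1 δ'.1 = 0
    rw [hT, hρ.derPairing_innerDer δ.2]
  refine ⟨B.compl₁₂ σ σ', fun δ δ' => ?_⟩
  change B (σ (Der.stClass Z W δ)) (σ' (Der.stClass W Z δ')) = B δ δ'
  have h3 : Der.stClass Z W (σ (Der.stClass Z W δ) - δ) = 0 := by
    rw [Der.map_sub, sub_eq_zero]
    exact LinearMap.congr_fun hσ _
  have h4 : Der.stClass W Z (σ' (Der.stClass W Z δ') - δ') = 0 := by
    rw [Der.map_sub, sub_eq_zero]
    exact LinearMap.congr_fun hσ' _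
  have h5 := h1 _ h3 (σ' (Der.stClass W Z δ'))
  have h6 := h2 _ h4 δ
  rw [Der.map_sub B, LinearMap.sub_apply, sub_eq_zero] at h5
  rw [Der.map_sub (B δ), sub_eq_zero] at h6
  rw [h5, h6]

/-- The stable category of a finite dimensional preprojective algebra is `2`-Calabi-Yau. -/
theorem IsPreprojective.isStMod_calabiYau (hρ : IsPreprojective k ρ bar sgn) :
    IsStMod_CalabiYau k A 2 := by
  let S := hρ.suspension
  let O : FGModuleCat.{u} A → StMod A := (stFunctor A).obj
  let Ω : FGModuleCat.{u} A → FGModuleCat.{u} A := (cosyzygy k A).obj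
  choose β hβ using hρ.exists_stPairing
  have hβl : ∀ Z W (x : O Z ⟶ O (Ω W)), (∀ y, β Z W x y = 0) → x = 0 := by
    intro Z W x h
    have := finite_of_fg (k := k) Z
    have := finite_of_fg (k := k) W
    obtain ⟨δ, rfl⟩ := Der.stClass_surjective (k := k) Z W x
    refine (hρ.stClass_eq_zero_iff δ).2 (hρ.exists_eq_innerDer δ.2 fun δ' hδ' => ?_)
    rw [← h (Der.stClass W Z ⟨δ', hδ'⟩), hβ]
  have hβr : ∀ Z W (y : O W ⟶ O (Ω Z)), (∀ x, β Z W x y = 0) → y = 0 := by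
    intro Z W y h
    have := finite_of_fg (k := k) Z
    have := finite_of_fg (k := k) W
    obtain ⟨δ, rfl⟩ := Der.stClass_surjective (k := k) W Z y
    refine (hρ.stClass_eq_zero_iff δ).2 (hρ.exists_eq_innerDer δ.2 fun δ' hδ' => ?_)
    have h1 := h (Der.stClass Z W ⟨δ', hδ'⟩)
    rw [hβ] at h1
    rw [hρ.derPairing_comm]
    exact neg_eq_zero.2 h1
  have hN₁ : ∀ Z Z' W (h : Z ⟶ Z') (y : O Z' ⟶ O (Ω W)) (η : O W ⟶ O (Ω Z)),
      β Z W ((stFunctor A).map h ≫ y) η =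
        β Z' W y (η ≫ (stFunctor A).map ((cosyzygy k A).map h)) := by
    intro Z Z' W h y η
    obtain ⟨δ, rfl⟩ := Der.stClass_surjective (k := k) Z' W y
    obtain ⟨δ', rfl⟩ := Der.stClass_surjective (k := k) W Z η
    rw [Der.comp_stClass, Der.stClass_comp, hβ, hβ]
    rfl
  -- Unlike the previous compatibility, which holds by definition, this one moves g around the
  -- trace.
  have hN₂ : ∀ Z W' W (g : W' ⟶ W) (y : O Z ⟶ O (Ω W')) (η : O W ⟶ O (Ω Z)),
      β Z W (y ≫ (stFunctor A).map ((cosyzygy k A).map g)) η =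
        β Z W' y ((stFunctor A).map g ≫ η) := by
    intro Z W' W g y η
    have := finite_of_fg (k := k) Z
    have := finite_of_fg (k := k) W'
    have := finite_of_fg (k := k) W
    obtain ⟨δ, rfl⟩ := Der.stClass_surjective (k := k) Z W' y
    obtain ⟨δ', rfl⟩ := Der.stClass_surjective (k := k) W Z η
    rw [Der.comp_stClass, Der.stClass_comp, hβ, hβ, derPairing_apply, derPairing_apply]
    refine Finset.sum_congr rfl fun b _ => congrArg (sgn b * ·) ?_
    exact LinearMap.trace_comp_comm' (δ.1 (ρ.x b) ∘ₗ δ'.1 (ρ.x (bar b)))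
      (g.hom.hom.restrictScalars k)
  let Slin : ∀ X Y, (O X ⟶ O Y) →ₗ[k] (O (Ω X) ⟶ O (Ω Y)) := fun X Y =>
    { toFun := fun f => S.map f
      map_add' := fun f g => by
        obtain ⟨f, rfl⟩ := (stFunctor A).map_surjective f
        obtain ⟨g, rfl⟩ := (stFunctor A).map_surjective g
        rw [← Functor.map_add]
        change (stFunctor A).map ((cosyzygy k A).map (f + g)) =
          (stFunctor A).map ((cosyzygy k A).map f) + (stFunctor A).map ((cosyzygy k A).map g)
        rw [← Functor.map_add]
        congr 1
        have h := cosyzygy_map_sub (k := k) (f + g) g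
        rwa [add_sub_cancel_right, eq_sub_iff_add_eq, eq_comm] at h
      map_smul' := fun c f => by
        obtain ⟨f, rfl⟩ := (stFunctor A).map_surjective f
        change (stFunctor A).map ((cosyzygy k A).map (c • f)) =
          c • (stFunctor A).map ((cosyzygy k A).map f)
        rw [cosyzygy_map_smul]
        rfl }
  have hSi : ∀ X Y, Function.Injective (Slin X Y) := fun X Y => by
    rw [injective_iff_map_eq_zero]
    intro f hf
    obtain ⟨f, rfl⟩ := (stFunctor A).map_surjective f
    exact hρ.suspension_map_eq_zero f hf
  have hSs : ∀ X Y, Function.Surjective (Slin X Y) := fun X Y h => by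
    obtain ⟨h, rfl⟩ := (stFunctor A).map_surjective h
    obtain ⟨f, hf⟩ := hρ.suspension_map_surjective h
    exact ⟨(stFunctor A).map f, hf⟩
  have hfin : ∀ X Y, Module.Finite k (O X ⟶ O Y) := fun X Y =>
    have := finite_stHom (k := k) (Ω X) Y
    Module.Finite.of_injective (Slin X Y) (hSi X Y)
  -- The pairing is used for Z = Ω⁻¹X and W = Y, between stable maps Ω⁻¹X → Ω⁻¹Y and Y → Ω⁻²X; the
  -- first space is identified with the stable maps X → Y by the full faithfulness of Ω⁻¹.
  let ψ : ∀ X Y, (O Y ⟶ O (Ω (Ω X))) →ₗ[k] Module.Dual k (O X ⟶ O Y) := fun X Y =>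
    (Slin X Y).dualMap ∘ₗ (β (Ω X) Y).flip
  have hψ : ∀ X Y η f, ψ X Y η f = β (Ω X) Y (Slin X Y f) η := fun X Y η f => rfl
  have hψi : ∀ X Y, Function.Injective (ψ X Y) := fun X Y => by
    rw [injective_iff_map_eq_zero]
    intro η h
    refine hβr _ _ η fun y => ?_
    obtain ⟨f, rfl⟩ := hSs X Y y
    rw [← hψ, h, LinearMap.zero_apply]
  -- Both maps defined by the pairing are injective, so the two finite dimensional spaces have equal
  -- dimension.
  have hψs : ∀ X Y, Function.Surjective (ψ X Y) := fun X Y => by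
    have h1 : Function.Injective (β (Ω X) Y) := by
      rw [injective_iff_map_eq_zero]
      intro x h
      exact hβl _ _ x fun y => by rw [h, LinearMap.zero_apply]
    have h2 : Module.finrank k (O X ⟶ O Y) ≤ Module.finrank k (O Y ⟶ O (Ω (Ω X))) := by
      have := LinearMap.finrank_le_finrank_of_injective (f := β (Ω X) Y ∘ₗ Slin X Y)
        (h1.comp (hSi X Y))
      rwa [Subspace.dual_finrank_eq] at this
    have h3 := LinearMap.finrank_le_finrank_of_injective (hψi X Y)
    rw [Subspace.dual_finrank_eq] at h3
    exact (LinearMap.injective_iff_surjective_of_finrank_eq_finrank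
      (by rw [Subspace.dual_finrank_eq]; exact le_antisymm h3 h2)).1 (hψi X Y)
  let φ : ∀ X Y, (O Y ⟶ O (Ω (Ω X))) ≃ₗ[k] Module.Dual k (O X ⟶ O Y) := fun X Y =>
    LinearEquiv.ofBijective (ψ X Y) ⟨hψi X Y, hψs X Y⟩
  refine ⟨S, ⟨CategoryTheory.Quotient.lift.isLift _ _ _⟩, fun X Y => hfin X.as Y.as,
    fun X Y => (φ X.as Y.as).symm, fun X X' Y f ξ => ?_, fun X Y Y' g ξ => ?_⟩
  · obtain ⟨η, rfl⟩ := (φ X.as Y.as).surjective ξ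
    obtain ⟨h, rfl⟩ := (stFunctor A).map_surjective (X := X.as) (Y := X'.as) f
    change (φ X'.as Y.as).symm _ = (φ X.as Y.as).symm (φ X.as Y.as η) ≫ _
    rw [LinearEquiv.symm_apply_apply, LinearEquiv.symm_apply_eq]
    refine LinearMap.ext fun y => ?_
    have h1 := hN₁ (Ω X.as) (Ω X'.as) Y.as ((cosyzygy k A).map h) (Slin X'.as Y.as y) η
    refine Eq.trans ?_ h1
    change β (Ω X.as) Y.as (S.map ((stFunctor A).map h ≫ y)) η = _
    rw [S.map_comp]
    rfl
  · obtain ⟨η, rfl⟩ := (φ X.as Y.as).surjective ξ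
    obtain ⟨h, rfl⟩ := (stFunctor A).map_surjective (X := Y'.as) (Y := Y.as) g
    change (φ X.as Y'.as).symm _ = _ ≫ (φ X.as Y.as).symm (φ X.as Y.as η)
    rw [LinearEquiv.symm_apply_apply, LinearEquiv.symm_apply_eq]
    refine LinearMap.ext fun y => ?_
    have h1 := hN₂ (Ω X.as) Y'.as Y.as h (Slin X.as Y'.as y) η
    refine Eq.trans ?_ h1
    change β (Ω X.as) Y.as (S.map (y ≫ (stFunctor A).map h)) η = _
    rw [S.map_comp]
    rfl

end StableCalabiYau

/-! ### Tensor products of selfinjective algebras -/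

section InjectiveTensor

variable {k B B' : Type u} [Field k] [Ring B] [Algebra k B] [Ring B'] [Algebra k B']

theorem injective_of_retract {M N : Type u} [AddCommGroup M] [Module B M] [AddCommGroup N]
    [Module B N] (i : M →ₗ[B] N) (r : N →ₗ[B] M) (hr : ∀ x, r (i x) = x)
    (h : Module.Injective B N) : Module.Injective B M where
  out X Y _ _ _ _ f hf g := by
    obtain ⟨F, hF⟩ := h.out f hf (i ∘ₗ g)
    refine ⟨r ∘ₗ F, fun x => ?_⟩
    rw [LinearMap.comp_apply, hF, LinearMap.comp_apply, hr]

/-- Right multiplications embed B in Hom_k(B, B), with 1 going to the identity, and injectivity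
splits this embedding. Selfinjectivity is thereby encoded in one map sending the identity to 1, a
form that passes to tensor products. -/
theorem exists_coInd_retraction (h : Module.Injective B B) :
    ∃ r : CoInd k B B →ₗ[B] B, r (LinearMap.id : B →ₗ[k] B) = 1 := by
  let i : B →ₗ[B] CoInd k B B :=
    { toFun := fun x => LinearMap.mulRight k x
      map_add' := fun x y => CoInd.ext fun a => mul_add a x y
      map_smul' := fun b x => CoInd.ext fun a => (mul_assoc a b x).symm }
  have hi : Function.Injective i := fun x y h => by
    have h1 : i x 1 = i y 1 := by rw [h]
    have h2 : ∀ z, i z 1 = z := fun z => one_mul z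
    rwa [h2, h2] at h1
  obtain ⟨r, hr⟩ := h.out i hi LinearMap.id
  refine ⟨r, ?_⟩
  have h1 : i 1 = (LinearMap.id : B →ₗ[k] B) := CoInd.ext fun a => mul_one a
  rw [← h1, hr]
  rfl

theorem injective_of_coInd_retraction (r : CoInd k B B →ₗ[B] B)
    (hr : r (LinearMap.id : B →ₗ[k] B) = 1) : Module.Injective B B := by
  refine injective_of_retract (LinearMap.toSpanSingleton B (CoInd k B B)
    (show CoInd k B B from LinearMap.id)) r (fun x => ?_) (CoInd.injective k B)
  refine (map_smul r x (show CoInd k B B from LinearMap.id)).trans ?_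
  refine (congrArg (x • ·) hr).trans ?_
  rw [smul_eq_mul, mul_one]

/-- In finite dimension End_k(B ⊗ B') = End_k B ⊗ End_k B', and the tensor product of the two
retractions is a retraction. -/
theorem injective_tensorProduct [Module.Finite k B] [Module.Finite k B']
    (h : Module.Injective B B) (h' : Module.Injective B' B') :
    Module.Injective (B ⊗[k] B') (B ⊗[k] B') := by
  obtain ⟨r, hr⟩ := exists_coInd_retraction (k := k) h
  obtain ⟨r', hr'⟩ := exists_coInd_retraction (k := k) h'
  let r₁ : (B →ₗ[k] B) →ₗ[k] B := r.restrictScalars k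
  let r₁' : (B' →ₗ[k] B') →ₗ[k] B' := r'.restrictScalars k
  have hr₁ : ∀ b (f : B →ₗ[k] B), r₁ (f ∘ₗ LinearMap.mulRight k b) = b * r₁ f :=
    fun b f => map_smul r b (show CoInd k B B from f)
  have hr₁' : ∀ b (f : B' →ₗ[k] B'), r₁' (f ∘ₗ LinearMap.mulRight k b) = b * r₁' f :=
    fun b f => map_smul r' b (show CoInd k B' B' from f)
  let e := homTensorHomEquiv k B B' B B'
  let ρ : (B ⊗[k] B' →ₗ[k] B ⊗[k] B') →ₗ[k] B ⊗[k] B' :=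
    TensorProduct.map r₁ r₁' ∘ₗ e.symm.toLinearMap
  have hρ : ∀ f g, ρ (TensorProduct.map f g) = r₁ f ⊗ₜ r₁' g := by
    intro f g
    have : e (f ⊗ₜ g) = TensorProduct.map f g := homTensorHomEquiv_apply _
    change TensorProduct.map r₁ r₁' (e.symm _) = _
    rw [← this, LinearEquiv.symm_apply_apply, TensorProduct.map_tmul]
  have hlin : ∀ (s : B ⊗[k] B') (F : B ⊗[k] B' →ₗ[k] B ⊗[k] B'),
      ρ (F ∘ₗ LinearMap.mulRight k s) = s * ρ F := by
    intro s F
    obtain ⟨t, rfl⟩ := e.surjective F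
    induction t using TensorProduct.induction_on with
    | zero => rw [map_zero, LinearMap.zero_comp, map_zero, mul_zero]
    | add t t' h h' => rw [map_add, LinearMap.add_comp, map_add, h, h', map_add, mul_add]
    | tmul f g =>
      have h1 : e (f ⊗ₜ g) = TensorProduct.map f g := homTensorHomEquiv_apply _
      rw [h1]
      induction s using TensorProduct.induction_on with
      | zero => rw [LinearMap.mulRight_zero_eq_zero, LinearMap.comp_zero, map_zero, zero_mul]
      | add s s' h h' =>
        have h2 : LinearMap.mulRight k (s + s') =
            LinearMap.mulRight k s + LinearMap.mulRight k s' := by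
          ext; simp [mul_add]
        rw [h2, LinearMap.comp_add, map_add, h, h', add_mul]
      | tmul b b' =>
        have h2 : TensorProduct.map f g ∘ₗ LinearMap.mulRight k (b ⊗ₜ[k] b') =
            TensorProduct.map (f ∘ₗ LinearMap.mulRight k b) (g ∘ₗ LinearMap.mulRight k b') := by
          ext x y
          simp
        rw [h2, hρ, hρ, hr₁, hr₁', Algebra.TensorProduct.tmul_mul_tmul]
  refine injective_of_coInd_retraction (k := k)
    { toFun := ρ
      map_add' := map_add ρ
      map_smul' := fun s F => hlin s F } ?_
  have h1 : (LinearMap.id : B ⊗[k] B' →ₗ[k] B ⊗[k] B') =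
      TensorProduct.map LinearMap.id LinearMap.id := TensorProduct.map_id.symm
  change ρ LinearMap.id = 1
  rw [h1, hρ]
  change r _ ⊗ₜ r' _ = 1
  rw [hr, hr']
  rfl

end InjectiveTensor

/-! ### Graded projective modules -/

namespace GrMod

variable {k : Type u} [Field k] {R : Type u} [Ring R] [Algebra k R] [Module.Finite k R]
  {𝒜 : ℕ → Submodule k R} [GradedAlgebra 𝒜] {ι : Type} [Fintype ι]

/-- The submodule of the tuples `f` with `f i ∈ R ε_i`. -/
def freeSubmodule (ε : ι → R) : Submodule R (ι → R) where
  carrier := {f | ∀ i, f i * ε i = f i}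
  add_mem' hf hg i := by rw [Pi.add_apply, add_mul, hf, hg]
  zero_mem' i := zero_mul _
  smul_mem' r f hf i := by
    rw [Pi.smul_apply, smul_eq_mul, mul_assoc, hf]

theorem mul_mem_intGr_of_zero {n : ℤ} {r a : R} (hr : r ∈ intGr 𝒜 n) (ha : a ∈ 𝒜 0) :
    r * a ∈ intGr 𝒜 n := by
  have := intGr_mul_mem 𝒜 hr ha
  rwa [Nat.cast_zero, add_zero] at this

theorem single_mem_freeSubmodule [DecidableEq ι] {ε : ι → R} {i : ι} {r : R} (h : r * ε i = r) :
    Pi.single i r ∈ freeSubmodule ε := by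
  intro j
  rcases eq_or_ne j i with rfl | hj
  · rwa [Pi.single_eq_same]
  · rw [Pi.single_eq_of_ne hj, zero_mul]

/-- The module `⨁ R ε_i`. -/
def FreeMod (ε : ι → R) : Type u := freeSubmodule ε

instance (ε : ι → R) : AddCommGroup (FreeMod ε) := inferInstanceAs (AddCommGroup (freeSubmodule ε))
instance (ε : ι → R) : Module R (FreeMod ε) := inferInstanceAs (Module R (freeSubmodule ε))

theorem FreeMod.coe_sum {α : Type*} {ε : ι → R} (s : Finset α) (f : α → FreeMod ε) (i : ι) :
    (∑ a ∈ s, f a).1 i = ∑ a ∈ s, (f a).1 i :=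
  map_sum (AddMonoidHom.mk' (fun f : FreeMod ε => f.1 i) fun _ _ => rfl) f s

/-- The graded projective module `⨁ R ε_i` with generators `ε_i` of degrees `d i`. -/
def free (ε : ι → R) (hε : ∀ i, IsIdempotentElem (ε i)) (hε' : ∀ i, ε i ∈ 𝒜 0) (d : ι → ℤ) :
    GrMod 𝒜 where
  carrier := FreeMod ε
  gr n :=
    { carrier := {f | ∀ i, f.1 i ∈ intGr 𝒜 (n - d i)}
      add_mem' := fun hf hg i => Submodule.add_mem _ (hf i) (hg i)
      zero_mem' := fun i => Submodule.zero_mem _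
      neg_mem' := fun hf i => Submodule.neg_mem _ (hf i) }
  isInternal := by
    classical
    have hint := intGr_isInternal 𝒜
    refine isInternal_of' ?_ ?_
    · intro s x hx h0 n hn
      apply Subtype.ext
      funext i
      have h1 : ∑ m ∈ s, (x m).1 i = 0 := by
        have := congrArg (fun f : FreeMod ε => f.1 i) h0
        simp only [FreeMod.coe_sum] at this
        exact this
      have h2 := congrArg (proj hint (n - d i)) h1
      rw [map_sum, map_zero, Finset.sum_eq_single n] at h2
      · rwa [proj_of_mem hint (hx n i), if_pos rfl] at h2
      · intro m _ hm
        rw [proj_of_mem hint (hx m i), if_neg (by simpa using hm.symm)]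
      · intro h; exact absurd hn h
    · intro p hp f
      have h1 : f = ∑ i, (⟨Pi.single i (f.1 i), single_mem_freeSubmodule (f.2 i)⟩ :
          FreeMod ε) := by
        apply Subtype.ext
        funext j
        rw [Submodule.coe_sum, Finset.sum_apply]
        rw [Finset.sum_eq_single j]
        · exact (Pi.single_eq_same (M := fun _ : ι => R) j (f.1 j)).symm
        · intro i _ hi
          exact Pi.single_eq_of_ne (M := fun _ : ι => R) hi.symm (f.1 i)
        · intro h; exact absurd (Finset.mem_univ j) h
      rw [h1]
      refine p.sum_mem fun i _ => ?_
      obtain ⟨s, -, hs⟩ := exists_sum_proj hint (f.1 i)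
      have h2 : (⟨Pi.single i (f.1 i), single_mem_freeSubmodule (f.2 i)⟩ : FreeMod ε) =
          ∑ n ∈ s, ⟨Pi.single i (proj hint n (f.1 i) * ε i), single_mem_freeSubmodule
            (by rw [mul_assoc, (hε i).eq])⟩ := by
        apply Subtype.ext
        rw [Submodule.coe_sum]
        change (Pi.single i (f.1 i) : ι → R) =
          ∑ n ∈ s, (Pi.single i (proj hint n (f.1 i) * ε i) : ι → R)
        conv_lhs => rw [← f.2 i, ← hs, Finset.sum_mul]
        exact map_sum (AddMonoidHom.single (fun _ : ι => R) i) _ _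
      rw [h2]
      refine p.sum_mem fun n _ => hp (n + d i) _ fun j => ?_
      change (Pi.single i (proj hint n (f.1 i) * ε i) : ι → R) j ∈ intGr 𝒜 (n + d i - d j)
      rcases eq_or_ne j i with rfl | hj
      · rw [Pi.single_eq_same, add_sub_cancel_right]
        exact mul_mem_intGr_of_zero (proj_mem hint n _) (hε' j)
      · rw [Pi.single_eq_of_ne hj]
        exact Submodule.zero_mem _
  smul_mem := by
    intro i j r f hr hf l
    have := mul_mem_intGr 𝒜 hr (hf l)
    rwa [← add_sub_assoc] at this
  finite := by
    have : IsNoetherianRing R := IsNoetherianRing.of_finite k R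
    exact inferInstanceAs (Module.Finite R (freeSubmodule ε))

section Free

variable {ε : ι → R} (hε : ∀ i, IsIdempotentElem (ε i)) (hε' : ∀ i, ε i ∈ 𝒜 0) (d : ι → ℤ)

/-- The linear map from the sum of the `R ε_i` which is determined by elements of a module. -/
def freeLin (ε : ι → R) {M : Type*} [AddCommGroup M] [Module R M] (m : ι → M) :
    FreeMod ε →ₗ[R] M where
  toFun f := ∑ i, f.1 i • m i
  map_add' f g := by
    rw [← Finset.sum_add_distrib]
    exact Finset.sum_congr rfl fun i _ => add_smul _ _ _
  map_smul' r f := by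
    rw [RingHom.id_apply, Finset.smul_sum]
    exact Finset.sum_congr rfl fun i _ => mul_smul _ _ _

theorem smul_mem_of_mem_intGr (M : GrMod 𝒜) {i j : ℤ} {r : R} {m : M.carrier}
    (hr : r ∈ intGr 𝒜 i) (hm : m ∈ M.gr j) : r • m ∈ M.gr (i + j) := by
  cases i with
  | ofNat i => exact M.smul_mem hr hm
  | negSucc i =>
    have : r = 0 := hr
    rw [this, zero_smul]
    exact (M.gr _).zero_mem

/-- The morphism from a graded projective module which is determined by homogeneous elements. -/
def freeDesc (M : GrMod 𝒜) (m : ι → M.carrier) (hm : ∀ i, m i ∈ M.gr (d i)) :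
    free ε hε hε' d ⟶ M where
  lin := freeLin ε m
  map_mem {n f} hf := (M.gr n).sum_mem fun i _ => by
    have := smul_mem_of_mem_intGr M (hf i) (hm i)
    rwa [sub_add_cancel] at this

theorem eq_sum_single [DecidableEq ι] (f : FreeMod ε) :
    f = ∑ i, f.1 i • (⟨Pi.single i (ε i), single_mem_freeSubmodule (hε i)⟩ :
      FreeMod ε) := by
  apply Subtype.ext
  funext j
  rw [Submodule.coe_sum, Finset.sum_apply, Finset.sum_eq_single j]
  · change _ = f.1 j * (Pi.single j (ε j) : ι → R) j
    rw [Pi.single_eq_same, f.2]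
  · intro i _ hi
    change f.1 i * (Pi.single i (ε i) : ι → R) j = 0
    rw [Pi.single_eq_of_ne hi.symm, mul_zero]
  · intro h; exact absurd (Finset.mem_univ j) h

theorem single_mem_gr [DecidableEq ι] (i : ι) {n : ℤ} {r : R} (hr : r * ε i = r)
    (h : r ∈ intGr 𝒜 (n - d i)) :
    (⟨Pi.single i r, single_mem_freeSubmodule hr⟩ : FreeMod ε) ∈
      (free ε hε hε' d).gr n := by
  intro j
  change (Pi.single i r : ι → R) j ∈ intGr 𝒜 (n - d j)
  rcases eq_or_ne j i with rfl | hj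
  · rwa [Pi.single_eq_same]
  · rw [Pi.single_eq_of_ne hj]
    exact Submodule.zero_mem _

instance [IsNoetherianRing R] : Projective (free ε hε hε' d) where
  factors {Y X} f e _ := by
    classical
    let g : ι → FreeMod ε := fun i =>
      ⟨Pi.single i (ε i), single_mem_freeSubmodule (hε i)⟩
    have hg : ∀ i, g i ∈ (free ε hε hε' d).gr (d i) := fun i =>
      single_mem_gr hε hε' d i (hε i) (by rw [sub_self]; exact hε' i)
    have hεg : ∀ i, ε i • g i = g i := fun i => by
      apply Subtype.ext
      funext j
      change ε i * (Pi.single i (ε i) : ι → R) j = (Pi.single i (ε i) : ι → R) j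
      rcases eq_or_ne j i with rfl | hj
      · rw [Pi.single_eq_same, (hε j).eq]
      · rw [Pi.single_eq_of_ne hj, mul_zero]
    -- A preimage of a generator need not be homogeneous, nor fixed by ε i. Its component of degree
    -- d i, multiplied by ε i, has both properties and is still a preimage.
    choose x hx using fun i => surjective_of_epi e (Hom.lin f (g i))
    have hx' : ∀ i, Hom.lin e (ε i • proj Y.isInternal (d i) (x i)) = Hom.lin f (g i) := by
      intro i
      rw [map_smul, ← proj_map, hx, proj_of_mem X.isInternal (Hom.map_mem f (hg i)), if_pos rfl]
      exact (map_smul (Hom.lin f) (ε i) (g i)).symm.trans (congrArg (Hom.lin f) (hεg i))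
    refine ⟨freeDesc hε hε' d Y (fun i => ε i • proj Y.isInternal (d i) (x i)) (fun i => ?_), ?_⟩
    · have := Y.smul_mem (hε' i) (proj_mem Y.isInternal (d i) (x i))
      rwa [Nat.cast_zero, zero_add] at this
    · apply hom_ext
      apply LinearMap.ext
      intro (v : FreeMod ε)
      refine Eq.trans ?_ (congrArg (Hom.lin f) (eq_sum_single hε v)).symm
      refine (map_sum (Hom.lin e) (fun i => v.1 i • ε i • proj Y.isInternal (d i) (x i))
        Finset.univ).trans (Eq.trans ?_ (map_sum (Hom.lin f) (fun i => v.1 i • g i) _).symm)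
      refine Finset.sum_congr rfl fun i _ => ?_
      rw [map_smul, hx']
      exact (map_smul (Hom.lin f) (v.1 i) (g i)).symm

end Free

theorem epi_of_surjective {M N : GrMod 𝒜} (f : M ⟶ N) (h : Function.Surjective (Hom.lin f)) :
    Epi f where
  left_cancellation g g' hg := by
    apply hom_ext
    apply LinearMap.ext
    intro y
    obtain ⟨x, rfl⟩ := h y
    exact LinearMap.congr_fun (congrArg (fun a : M ⟶ _ => Hom.lin a) hg) x

theorem mono_of_injective {M N : GrMod 𝒜} (f : M ⟶ N) (h : Function.Injective (Hom.lin f)) :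
    Mono f where
  right_cancellation g g' hg := by
    apply hom_ext
    apply LinearMap.ext
    intro x
    exact h (LinearMap.congr_fun (congrArg (fun a : _ ⟶ N => Hom.lin a) hg) x)

/-- Graded modules are generated by finitely many homogeneous elements. -/
theorem exists_homogeneous_generators (M : GrMod 𝒜) :
    ∃ (n : ℕ) (m : Fin n → M.carrier) (d : Fin n → ℤ), (∀ i, m i ∈ M.gr (d i)) ∧
      Submodule.span R (Set.range m) = ⊤ := by
  classical
  obtain ⟨T, hT⟩ := Module.Finite.fg_top (R := R) (M := M.carrier)
  choose s _ hs using exists_sum_proj M.isInternal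
  let U : Finset (M.carrier × ℤ) := T.biUnion fun t => (s t).image fun n => (t, n)
  let e := U.equivFin
  let y : Fin U.card → M.carrier × ℤ := fun i => (e.symm i).1
  refine ⟨U.card, fun i => proj M.isInternal (y i).2 (y i).1, fun i => (y i).2,
    fun i => proj_mem _ _ _, ?_⟩
  rw [eq_top_iff, ← hT, Submodule.span_le]
  intro t ht
  rw [← hs t]
  refine Submodule.sum_mem _ fun n hn => Submodule.subset_span ?_
  have hU : (t, n) ∈ U := Finset.mem_biUnion.2 ⟨t, ht, Finset.mem_image.2 ⟨n, hn, rfl⟩⟩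
  refine ⟨e ⟨_, hU⟩, ?_⟩
  simp only [y, Equiv.symm_apply_apply]

instance [IsNoetherianRing R] : EnoughProjectives (GrMod 𝒜) where
  presentation M := by
    obtain ⟨n, m, d, hm, hspan⟩ := exists_homogeneous_generators M
    have hε : ∀ i : Fin n, IsIdempotentElem (1 : R) := fun _ => one_mul 1
    have hε' : ∀ i : Fin n, (1 : R) ∈ 𝒜 0 := fun _ => SetLike.GradedOne.one_mem
    have hepi : Epi (freeDesc (ε := fun _ : Fin n => 1) hε hε' d M m hm) := by
      refine epi_of_surjective _ fun x => ?_
      have hx : x ∈ Submodule.span R (Set.range m) := hspan ▸ trivial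
      obtain ⟨c, hc⟩ := (Submodule.mem_span_range_iff_exists_fun R).1 hx
      exact ⟨(⟨c, fun i => mul_one _⟩ : freeSubmodule _), hc⟩
    exact ⟨{ p := _, f := freeDesc (ε := fun _ : Fin n => 1) hε hε' d M m hm }⟩

end GrMod

namespace GrMod

variable {k : Type u} [Field k] {R : Type u} [Ring R] [Algebra k R] [Module.Finite k R]
  {𝒜 : ℕ → Submodule k R} [GradedAlgebra 𝒜] {ι : Type} [Fintype ι]
  {ε : ι → R} (hε : ∀ i, IsIdempotentElem (ε i))

open Classical in
/-- The generators of `⨁ R ε_i`. -/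
def freeGen (i : ι) : FreeMod ε :=
  ⟨Pi.single i (ε i), single_mem_freeSubmodule (hε i)⟩

theorem freeGen_same (i : ι) : (freeGen hε i).1 i = ε i := by
  classical exact Pi.single_eq_same (M := fun _ : ι => R) i (ε i)

theorem freeGen_ne {i j : ι} (h : j ≠ i) : (freeGen hε i).1 j = 0 := by
  classical exact Pi.single_eq_of_ne (M := fun _ : ι => R) h (ε i)

theorem eq_sum_freeGen (f : FreeMod ε) : f = ∑ i, f.1 i • freeGen hε i := by
  classical
  exact eq_sum_single hε f

theorem smul_freeGen (i : ι) : ε i • freeGen hε i = freeGen hε i := by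
  apply Subtype.ext
  funext j
  change ε i * (freeGen hε i).1 j = (freeGen hε i).1 j
  rcases eq_or_ne j i with rfl | hj
  · rw [freeGen_same, (hε j).eq]
  · rw [freeGen_ne hε hj, mul_zero]

theorem freeGen_mem_gr (hε' : ∀ i, ε i ∈ 𝒜 0) (d : ι → ℤ) (i : ι) :
    freeGen hε i ∈ (free ε hε hε' d).gr (d i) := by
  classical
  exact single_mem_gr hε hε' d i (hε i) (by rw [sub_self]; exact hε' i)

theorem sum_freeGen_apply (i : ι) : (∑ j, freeGen hε j).1 i = ε i := by
  rw [FreeMod.coe_sum, Finset.sum_eq_single i]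
  · exact freeGen_same hε i
  · intro j _ hj
    exact freeGen_ne hε hj.symm
  · intro h; exact absurd (Finset.mem_univ i) h

end GrMod

/-! ### The bimodule resolution over an abstract enveloping algebra -/

section Enveloping

variable {I Q : Type} [Fintype I] [Fintype Q] {src tgt : Q → I}
  {k A R : Type u} [Field k] [Ring A] [Algebra k A] [Ring R] [Algebra k R]
  {ρ : QuiverRep src tgt A} {bar : Q → Q} {sgn : Q → k}

/-- `R` is the enveloping algebra of `A`, with the maps `a ↦ a ⊗ 1` and `a ↦ 1 ⊗ a`. -/
structure IsEnveloping (l : A →ₐ[k] R) (r : Aᵐᵒᵖ →ₐ[k] R) : Prop where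
  comm : ∀ a b, l a * r b = r b * l a
  induction : ∀ N : AddSubmonoid R, (∀ p q, l p * r (MulOpposite.op q) ∈ N) → ∀ x, x ∈ N
  exists_lift : ∀ {M : Type u} [AddCommGroup M] [Module k M] (f : A →ₗ[k] A →ₗ[k] M),
    ∃ μ : R →ₗ[k] M, ∀ p q, μ (l p * r (MulOpposite.op q)) = f p q

variable {l : A →ₐ[k] R} {r : Aᵐᵒᵖ →ₐ[k] R}

theorem IsEnveloping.commute (h : IsEnveloping l r) (a : A) (b : Aᵐᵒᵖ) : Commute (l a) (r b) :=
  h.comm a b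

/-- An element which commutes with the generators commutes with the whole algebra. -/
theorem IsEnveloping.sub_mem (h : IsEnveloping l r) (hρ : ρ.adjoin k = ⊤) {M : Type*}
    [AddCommGroup M] [Module R M] (N : Submodule R M) (g : M)
    (he : ∀ i, l (ρ.e i) • g - r (MulOpposite.op (ρ.e i)) • g ∈ N)
    (hx : ∀ b, l (ρ.x b) • g - r (MulOpposite.op (ρ.x b)) • g ∈ N) (a : A) :
    l a • g - r (MulOpposite.op a) • g ∈ N := by
  have ha : a ∈ ρ.adjoin k := hρ ▸ Algebra.mem_top
  induction ha using Algebra.adjoin_induction with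
  | mem p hp =>
    rcases hp with ⟨i, rfl⟩ | ⟨b, rfl⟩
    · exact he i
    · exact hx b
  | algebraMap c =>
    rw [← MulOpposite.algebraMap_apply, AlgHom.commutes, AlgHom.commutes, sub_self]
    exact N.zero_mem
  | add p q _ _ hp hq =>
    rw [MulOpposite.op_add, map_add, map_add, add_smul, add_smul, add_sub_add_comm]
    exact N.add_mem hp hq
  | mul p q _ _ hp hq =>
    have h : l (p * q) • g - r (MulOpposite.op (p * q)) • g =
        l p • (l q • g - r (MulOpposite.op q) • g) +
          r (MulOpposite.op q) • (l p • g - r (MulOpposite.op p) • g) := by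
      rw [smul_sub, smul_sub, ← mul_smul, ← mul_smul, ← mul_smul, ← mul_smul, MulOpposite.op_mul,
        map_mul, map_mul, h.comm p]
      abel
    rw [h]
    exact N.add_mem (N.smul_mem _ hq) (N.smul_mem _ hp)

/-- The elements `e ⊗ f` for idempotents `e` and `f`. -/
theorem IsEnveloping.idem (h : IsEnveloping l r) {e f : A} (he : IsIdempotentElem e)
    (hf : IsIdempotentElem f) : IsIdempotentElem (l e * r (MulOpposite.op f)) := by
  change _ * _ = _
  rw [(h.commute e (MulOpposite.op f)).symm.mul_mul_mul_comm, ← map_mul, ← map_mul, he.eq,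
    ← MulOpposite.op_mul, hf.eq]

variable (ρ l r) in
/-- The idempotents `e_i ⊗ e_i` of the enveloping algebra. -/
def envVertex (i : I) : R := l (ρ.e i) * r (MulOpposite.op (ρ.e i))

variable (ρ l r) in
/-- The idempotents `e_{src b} ⊗ e_{tgt b}` of the enveloping algebra. -/
def envArrow (b : Q) : R := l (ρ.e (src b)) * r (MulOpposite.op (ρ.e (tgt b)))

theorem IsEnveloping.vertex_idem (h : IsEnveloping l r) (i : I) :
    IsIdempotentElem (envVertex ρ l r i) := h.idem (ρ.complete.idem i) (ρ.complete.idem i)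

theorem IsEnveloping.arrow_idem (h : IsEnveloping l r) (b : Q) :
    IsIdempotentElem (envArrow ρ l r b) := h.idem (ρ.complete.idem _) (ρ.complete.idem _)

theorem IsEnveloping.vertex_mul [DecidableEq I] (h : IsEnveloping l r) (i j : I) :
    envVertex ρ l r i * envVertex ρ l r j = if i = j then envVertex ρ l r i else 0 := by
  rw [envVertex, envVertex, (h.commute (ρ.e j) (MulOpposite.op (ρ.e i))).symm.mul_mul_mul_comm,
    ← map_mul, ← map_mul, ← MulOpposite.op_mul, ρ.e_mul_e, ρ.e_mul_e]
  by_cases h : i = j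
  · subst h; simp
  · rw [if_neg h, if_neg h, map_zero, zero_mul]

/-- The generator of `⨁ A e_i ⊗ e_i A` as a bimodule. -/
def IsEnveloping.vertexGen (h : IsEnveloping l r) (ρ : QuiverRep src tgt A) :
    GrMod.FreeMod (envVertex ρ l r) :=
  ∑ i, GrMod.freeGen h.vertex_idem i

theorem IsEnveloping.vertexGen_apply (h : IsEnveloping l r) (i : I) :
    (h.vertexGen ρ).1 i = envVertex ρ l r i :=
  GrMod.sum_freeGen_apply _ i

/-- The vertex idempotents are orthogonal, so ⨁ Ae_i⊗e_iA is cyclic on the sum of its generators.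
The computations below thus involve one generator g, subject to e_j g = g e_j. -/
theorem IsEnveloping.eq_sum_smul_vertexGen (h : IsEnveloping l r)
    (f : GrMod.FreeMod (envVertex ρ l r)) :
    f = (∑ i, f.1 i) • h.vertexGen ρ := by
  classical
  apply Subtype.ext
  funext i
  change f.1 i = (∑ j, f.1 j) * (h.vertexGen ρ).1 i
  rw [h.vertexGen_apply, Finset.sum_mul, Finset.sum_eq_single i]
  · exact (f.2 i).symm
  · intro j _ hj
    rw [← f.2 j, mul_assoc, h.vertex_mul, if_neg hj, mul_zero]
  · intro h; exact absurd (Finset.mem_univ i) h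

theorem IsEnveloping.e_smul_vertexGen (h : IsEnveloping l r) (j : I) :
    l (ρ.e j) • h.vertexGen ρ = r (MulOpposite.op (ρ.e j)) • h.vertexGen ρ := by
  classical
  apply Subtype.ext
  funext i
  change l (ρ.e j) * (h.vertexGen ρ).1 i = r (MulOpposite.op (ρ.e j)) * (h.vertexGen ρ).1 i
  have h1 : l (ρ.e j) * envVertex ρ l r i = l (ρ.e j * ρ.e i) * r (MulOpposite.op (ρ.e i)) := by
    rw [envVertex, ← mul_assoc, ← map_mul]
  have h2 : r (MulOpposite.op (ρ.e j)) * envVertex ρ l r i =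
      l (ρ.e i) * r (MulOpposite.op (ρ.e i * ρ.e j)) := by
    rw [envVertex, ← mul_assoc, ← h.comm, mul_assoc, ← map_mul, ← MulOpposite.op_mul]
  rw [h.vertexGen_apply, h1, h2, ρ.e_mul_e, ρ.e_mul_e]
  by_cases h : j = i
  · subst h; simp
  · rw [if_neg h, if_neg (Ne.symm h), map_zero, MulOpposite.op_zero, map_zero, mul_zero, zero_mul]

section

variable {M : Type*} [AddCommGroup M] [Module R M] {g : M}

/-- As g commutes with the vertices, x_b g - g x_b starts at src b and ends at tgt b. -/
theorem IsEnveloping.arrow_smul (h : IsEnveloping l r)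
    (hg : ∀ j, l (ρ.e j) • g = r (MulOpposite.op (ρ.e j)) • g) (b : Q) :
    envArrow ρ l r b • (l (ρ.x b) • g - r (MulOpposite.op (ρ.x b)) • g) =
      l (ρ.x b) • g - r (MulOpposite.op (ρ.x b)) • g := by
  have h1 : envArrow ρ l r b * l (ρ.x b) =
      l (ρ.x b) * r (MulOpposite.op (ρ.e (tgt b))) := by
    rw [envArrow, mul_assoc, ← h.comm, ← mul_assoc, ← map_mul, ρ.src_mul]
  have h2 : envArrow ρ l r b * r (MulOpposite.op (ρ.x b)) =
      r (MulOpposite.op (ρ.x b)) * l (ρ.e (src b)) := by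
    rw [envArrow, mul_assoc, ← map_mul, ← MulOpposite.op_mul, ρ.mul_tgt, h.comm]
  rw [smul_sub, ← mul_smul, ← mul_smul, h1, h2, mul_smul, ← hg, ← mul_smul,
    ← map_mul, ρ.mul_tgt, mul_smul, hg, ← mul_smul, ← map_mul,
    ← MulOpposite.op_mul, ρ.src_mul]

/-- The terms x_b g x_{bar b} cancel, leaving the commutator of g with the preprojective relation.
-/
theorem IsEnveloping.sum_rel (h : IsEnveloping l r) (hρ : IsPreprojective k ρ bar sgn) :
    ∑ b, algebraMap k R (sgn b) • (r (MulOpposite.op (ρ.x (bar b))) •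
        (l (ρ.x b) • g - r (MulOpposite.op (ρ.x b)) • g) +
      l (ρ.x b) • (l (ρ.x (bar b)) • g - r (MulOpposite.op (ρ.x (bar b))) • g)) = 0 := by
  have h1 : ∀ b, algebraMap k R (sgn b) • (r (MulOpposite.op (ρ.x (bar b))) •
        (l (ρ.x b) • g - r (MulOpposite.op (ρ.x b)) • g) +
      l (ρ.x b) • (l (ρ.x (bar b)) • g - r (MulOpposite.op (ρ.x (bar b))) • g)) =
      (l (sgn b • (ρ.x b * ρ.x (bar b))) -
        r (MulOpposite.op (sgn b • (ρ.x b * ρ.x (bar b))))) • g := by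
    intro b
    rw [MulOpposite.op_smul, map_smul, map_smul, ← smul_sub, Algebra.smul_def, mul_smul, sub_smul,
      smul_sub, smul_sub, MulOpposite.op_mul, map_mul, map_mul, mul_smul, mul_smul, ← mul_smul _ _ g,
      ← mul_smul (l (ρ.x b)) (r _) g, h.comm (ρ.x b)]
    abel_nf
  rw [Finset.sum_congr rfl fun b _ => h1 b, ← Finset.sum_smul, Finset.sum_sub_distrib, ← map_sum,
    ← map_sum, ← Finset.op_sum, hρ.rel, map_zero, MulOpposite.op_zero, map_zero, sub_zero, zero_smul]

/-- The crossed homomorphism `A → M` determined by its values on the arrows. -/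
theorem IsEnveloping.exists_crossed {M : Type u} [AddCommGroup M] [Module R M] [Module k M]
    [IsScalarTower k R M] (h : IsEnveloping l r) (hρ : IsPreprojective k ρ bar sgn) (g : Q → M)
    (hg : ∀ b, envArrow ρ l r b • g b = g b)
    (hrel : ∑ b, sgn b • (r (MulOpposite.op (ρ.x (bar b))) • g b + l (ρ.x b) • g (bar b)) = 0) :
    ∃ D : A →ₗ[k] M, (∀ p q, D (p * q) = l p • D q + r (MulOpposite.op q) • D p) ∧
      (∀ i, D (ρ.e i) = 0) ∧ ∀ b, D (ρ.x b) = g b := by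
  let _ : Module A M := Module.compHom M l.toRingHom
  have hl : ∀ (p : A) (m : M), p • m = l p • m := fun _ _ => rfl
  have : IsScalarTower k A M := ⟨fun c p m => by
    rw [hl, hl, map_smul, smul_assoc]⟩
  have hsmul : ∀ (c : k) (x : R) (m : M), x • c • m = c • x • m := fun c x m => by
    rw [← algebraMap_smul R c m, ← algebraMap_smul R c (x • m), ← mul_smul, ← mul_smul,
      Algebra.commutes]
  -- A bimodule derivation D : A → M is viewed as the derivation δ(p)(z) = D(p) z in Hom_k(A, M).
  -- The right linearity of δ(p), proved in `key`, spreads from generators, and D is recovered at z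
  -- = 1.
  let ξ : Q → A →ₗ[k] M := fun b =>
    { toFun := fun z => r (MulOpposite.op z) • g b
      map_add' := fun y z => by rw [MulOpposite.op_add, map_add, add_smul]
      map_smul' := fun c z => by rw [MulOpposite.op_smul, map_smul, smul_assoc, RingHom.id_apply] }
  have hξ : ∀ b z, ξ b z = r (MulOpposite.op z) • g b := fun _ _ => rfl
  have hrr : ∀ (p q : A) (m : M), r (MulOpposite.op q) • r (MulOpposite.op p) • m =
      r (MulOpposite.op (p * q)) • m := fun p q m => by
    rw [← mul_smul, ← map_mul, ← MulOpposite.op_mul]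
  have hlr : ∀ (p q : A) (m : M), l p • r (MulOpposite.op q) • m =
      r (MulOpposite.op q) • l p • m := fun p q m => by
    rw [← mul_smul, h.comm, mul_smul]
  have hgl : ∀ b, l (ρ.e (src b)) • g b = g b := fun b => by
    rw [← hg b, ← mul_smul, envArrow, ← mul_assoc, ← map_mul, (ρ.complete.idem _).eq]
  have hgr : ∀ b, r (MulOpposite.op (ρ.e (tgt b))) • g b = g b := fun b => by
    conv_rhs => rw [← hg b]
    conv_lhs => rw [← hg b]
    rw [envArrow, mul_smul, hlr, hrr, (ρ.complete.idem _).eq]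
  obtain ⟨δ, hδ, he, hx⟩ := hρ.exists_der (Z := A) (W := M) ξ
    (fun b z => by rw [hl, hξ, hlr, hgl])
    (fun b z => by rw [hξ, hξ, smul_eq_mul, ← hrr, hgr])
    (fun z => by
      have h1 := congrArg (r (MulOpposite.op z) • ·) hrel
      simp only [smul_zero, Finset.smul_sum] at h1
      rw [← h1]
      refine Finset.sum_congr rfl fun b _ => ?_
      rw [hξ, hξ, hl, hsmul, smul_add (r (MulOpposite.op z)), hrr, smul_eq_mul, hlr])
  have key : ∀ p z, δ p z = r (MulOpposite.op z) • δ p 1 := by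
    intro p
    have hp : p ∈ ρ.adjoin k := hρ.adjoin_eq_top ▸ Algebra.mem_top
    induction hp using Algebra.adjoin_induction with
    | mem p hp =>
      rcases hp with ⟨i, rfl⟩ | ⟨b, rfl⟩
      · intro z; rw [he]; simp
      · intro z
        rw [hx, hξ, hξ, MulOpposite.op_one, map_one, one_smul]
    | algebraMap c =>
      intro z
      have h1 : δ 1 = 0 := by
        ext z
        have := hδ 1 1 z
        rwa [one_mul, one_smul, one_smul, left_eq_add] at this
      rw [Algebra.algebraMap_eq_smul_one, map_smul, h1]
      simp
    | add p q _ _ hp hq =>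
      intro z
      rw [map_add, LinearMap.add_apply, LinearMap.add_apply, hp, hq, smul_add]
    | mul p q _ _ hp hq =>
      intro z
      rw [hδ, hδ, hq z, hp (q • z), hp (q • 1), smul_add, hl, hl, hlr, hrr, smul_eq_mul,
        smul_eq_mul, mul_one]
  refine ⟨δ.flip 1, fun p q => ?_, fun i => ?_, fun b => ?_⟩
  · change δ (p * q) 1 = l p • δ q 1 + _ • δ p 1
    rw [hδ, hl, key p, smul_eq_mul, mul_one]
  · change δ (ρ.e i) 1 = 0
    rw [he]; rfl
  · change δ (ρ.x b) 1 = g b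
    rw [hx, hξ, MulOpposite.op_one, map_one, one_smul]

end

/-- The differential `⨁ A e_{src b} ⊗ e_{tgt b} A → ⨁ A e_i ⊗ e_i A`. -/
def IsEnveloping.arrowDiff (h : IsEnveloping l r) (ρ : QuiverRep src tgt A) :
    GrMod.FreeMod (envArrow ρ l r) →ₗ[R] GrMod.FreeMod (envVertex ρ l r) :=
  GrMod.freeLin _ fun b =>
    l (ρ.x b) • h.vertexGen ρ - r (MulOpposite.op (ρ.x b)) • h.vertexGen ρ

theorem IsEnveloping.arrowDiff_apply (h : IsEnveloping l r)
    (f : GrMod.FreeMod (envArrow ρ l r)) : h.arrowDiff ρ f =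
    ∑ b, f.1 b • (l (ρ.x b) • h.vertexGen ρ - r (MulOpposite.op (ρ.x b)) • h.vertexGen ρ) :=
  rfl

theorem IsEnveloping.arrowDiff_freeGen (h : IsEnveloping l r) (b : Q) :
    h.arrowDiff ρ (GrMod.freeGen h.arrow_idem b) =
      l (ρ.x b) • h.vertexGen ρ - r (MulOpposite.op (ρ.x b)) • h.vertexGen ρ := by
  rw [arrowDiff_apply, Finset.sum_eq_single b]
  · rw [GrMod.freeGen_same, h.arrow_smul h.e_smul_vertexGen]
  · intro c _ hc
    rw [GrMod.freeGen_ne _ hc, zero_smul]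
  · intro h; exact absurd (Finset.mem_univ b) h

theorem IsEnveloping.sub_vertexGen_mem_range (h : IsEnveloping l r) (hρ : ρ.adjoin k = ⊤) (a : A) :
    l a • h.vertexGen ρ - r (MulOpposite.op a) • h.vertexGen ρ ∈
      LinearMap.range (h.arrowDiff ρ) := by
  refine h.sub_mem hρ _ _ (fun i => ?_) (fun b => ?_) a
  · rw [h.e_smul_vertexGen, sub_self]
    exact Submodule.zero_mem _
  · exact ⟨_, h.arrowDiff_freeGen b⟩

/-- Exactness of `⨁ A e_{src b} ⊗ e_{tgt b} A → ⨁ A e_i ⊗ e_i A → A`. -/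
theorem IsEnveloping.exists_arrowDiff_eq (h : IsEnveloping l r) (hρ : ρ.adjoin k = ⊤) [Module R A]
    (hA : ∀ p q m : A, (l p * r (MulOpposite.op q)) • m = p * (m * q))
    (f : GrMod.FreeMod (envVertex ρ l r)) (hf : ∑ i, f.1 i • ρ.e i = 0) :
    ∃ g, h.arrowDiff ρ g = f := by
  -- Modulo the image of the differential g commutes with A, so right multiplications move to the
  -- left and x g depends only on x • 1.
  have h1 : ∀ x : R, x • h.vertexGen ρ - l (x • (1 : A)) • h.vertexGen ρ ∈
      LinearMap.range (h.arrowDiff ρ) := by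
    intro x
    refine h.induction
      { carrier := {x : R | x • h.vertexGen ρ - l (x • (1 : A)) • h.vertexGen ρ ∈
          LinearMap.range (h.arrowDiff ρ)}
        zero_mem' := by
          change (0 : R) • h.vertexGen ρ - l ((0 : R) • (1 : A)) • h.vertexGen ρ ∈
            LinearMap.range (h.arrowDiff ρ)
          rw [zero_smul, zero_smul, map_zero, zero_smul, sub_self]
          exact Submodule.zero_mem _
        add_mem' := fun {x y} hx hy => by
          change (x + y) • h.vertexGen ρ - l ((x + y) • (1 : A)) • h.vertexGen ρ ∈
            LinearMap.range (h.arrowDiff ρ)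
          rw [add_smul, add_smul, map_add, add_smul, add_sub_add_comm]
          exact Submodule.add_mem _ hx hy } (fun p q => ?_) x
    change (l p * r (MulOpposite.op q)) • h.vertexGen ρ -
      l ((l p * r (MulOpposite.op q)) • (1 : A)) • h.vertexGen ρ ∈
            LinearMap.range (h.arrowDiff ρ)
    rw [hA, one_mul, map_mul, mul_smul, mul_smul, ← smul_sub, ← neg_sub, smul_neg]
    exact Submodule.neg_mem _ (Submodule.smul_mem _ _ (h.sub_vertexGen_mem_range hρ q))
  have h2 : (∑ i, f.1 i) • (1 : A) = 0 := by
    rw [← hf, Finset.sum_smul]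
    refine Finset.sum_congr rfl fun i _ => ?_
    conv_lhs => rw [← f.2 i, envVertex, mul_smul, hA, one_mul, (ρ.complete.idem i).eq]
  have h3 := h1 (∑ i, f.1 i)
  rw [h2, map_zero, zero_smul, sub_zero, ← h.eq_sum_smul_vertexGen] at h3
  exact h3

end Enveloping

section Enveloping

variable {I Q : Type} [Fintype I] [Fintype Q] {src tgt : Q → I}
  {k A R : Type u} [Field k] [Ring A] [Algebra k A] [Ring R] [Algebra k R]
  {ρ : QuiverRep src tgt A} {bar : Q → Q} {sgn : Q → k}
  {l : A →ₐ[k] R} {r : Aᵐᵒᵖ →ₐ[k] R}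

theorem sum_envVertex_smul {M : Type*} [AddCommGroup M]
    [Module R M] {g : M} (hg : ∀ j, l (ρ.e j) • g = r (MulOpposite.op (ρ.e j)) • g) :
    ∑ i, envVertex ρ l r i • g = g := by
  have h1 : ∀ i, envVertex ρ l r i • g = l (ρ.e i) • g := fun i => by
    rw [envVertex, mul_smul, ← hg, ← mul_smul, ← map_mul, (ρ.complete.idem i).eq]
  rw [Finset.sum_congr rfl fun i _ => h1 i, ← Finset.sum_smul, ← map_sum, ρ.complete.complete,
    map_one, one_smul]

/-- The element of `⨁ A e_{src b} ⊗ e_{tgt b} A` given by the preprojective relation. -/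
def IsEnveloping.relGen (h : IsEnveloping l r) (ρ : QuiverRep src tgt A) (bar : Q → Q)
    (sgn : Q → k) : GrMod.FreeMod (envArrow ρ l r) :=
  ∑ b, algebraMap k R (sgn b) •
    (r (MulOpposite.op (ρ.x (bar b))) • GrMod.freeGen h.arrow_idem b +
      l (ρ.x b) • GrMod.freeGen h.arrow_idem (bar b))

theorem IsEnveloping.arrowDiff_relGen (h : IsEnveloping l r) (hρ : IsPreprojective k ρ bar sgn) :
    h.arrowDiff ρ (h.relGen ρ bar sgn) = 0 := by
  rw [← h.sum_rel hρ (g := h.vertexGen ρ), relGen, map_sum]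
  refine Finset.sum_congr rfl fun b _ => ?_
  rw [map_smul, map_add, map_smul, map_smul, h.arrowDiff_freeGen, h.arrowDiff_freeGen]

/-- Both terms for b start and end at src b, so the two actions of a vertex agree. -/
theorem IsEnveloping.e_smul_relGen (h : IsEnveloping l r) (hρ : IsPreprojective k ρ bar sgn)
    (j : I) : l (ρ.e j) • h.relGen ρ bar sgn =
      r (MulOpposite.op (ρ.e j)) • h.relGen ρ bar sgn := by
  classical
  have hlr : ∀ (p q : A) (m : GrMod.FreeMod (envArrow ρ l r)),
      l p • r (MulOpposite.op q) • m = r (MulOpposite.op q) • l p • m := fun p q m => by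
    rw [← mul_smul, h.comm, mul_smul]
  have hc : ∀ (c : k) (x : R) (m : GrMod.FreeMod (envArrow ρ l r)),
      x • algebraMap k R c • m = algebraMap k R c • x • m := fun c x m => by
    rw [← mul_smul, ← mul_smul, Algebra.commutes]
  have hgl : ∀ b, l (ρ.e j) • GrMod.freeGen h.arrow_idem b =
      if j = src b then GrMod.freeGen h.arrow_idem b else 0 := fun b => by
    have h1 : l (ρ.e j) * envArrow ρ l r b = if j = src b then envArrow ρ l r b else 0 := by
      rw [envArrow, ← mul_assoc, ← map_mul, ρ.e_mul_e]
      split_ifs with hj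
      · rw [hj]
      · rw [map_zero, zero_mul]
    conv_lhs => rw [← GrMod.smul_freeGen, ← mul_smul, h1]
    split_ifs
    · exact GrMod.smul_freeGen _ _
    · rw [zero_smul]
  have hgr : ∀ b, r (MulOpposite.op (ρ.e j)) • GrMod.freeGen h.arrow_idem b =
      if j = tgt b then GrMod.freeGen h.arrow_idem b else 0 := fun b => by
    have h1 : r (MulOpposite.op (ρ.e j)) * envArrow ρ l r b =
        if j = tgt b then envArrow ρ l r b else 0 := by
      rw [envArrow, h.comm, ← mul_assoc, ← map_mul, ← MulOpposite.op_mul, ρ.e_mul_e]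
      by_cases hj : j = tgt b
      · rw [if_pos hj.symm, if_pos hj]
      · rw [if_neg (Ne.symm hj), if_neg hj, MulOpposite.op_zero, map_zero, zero_mul]
    conv_lhs => rw [← GrMod.smul_freeGen, ← mul_smul, h1]
    split_ifs
    · exact GrMod.smul_freeGen _ _
    · rw [zero_smul]
  have hxl : ∀ b, ρ.e j * ρ.x b = if j = src b then ρ.x b else 0 := fun b => by
    rw [← ρ.src_mul, ← mul_assoc, ρ.e_mul_e]
    split_ifs with hj
    · rw [hj]
    · rw [zero_mul]
  have hxr : ∀ b, ρ.x b * ρ.e j = if j = tgt b then ρ.x b else 0 := fun b => by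
    rw [← ρ.mul_tgt, mul_assoc, ρ.e_mul_e]
    by_cases hj : j = tgt b
    · rw [if_pos hj.symm, if_pos hj]
    · rw [if_neg (Ne.symm hj), if_neg hj, mul_zero]
  rw [relGen, Finset.smul_sum, Finset.smul_sum]
  refine Finset.sum_congr rfl fun b _ => ?_
  rw [hc, hc, smul_add, smul_add, smul_add, smul_add, hlr, hgl, ← mul_smul (l (ρ.e j)), ← map_mul,
    hxl, ← mul_smul (r (MulOpposite.op (ρ.e j))), ← map_mul, ← MulOpposite.op_mul, hxr, ← hlr, hgr,
    hρ.tgt_bar]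
  split_ifs
  · rfl
  · simp

/-- The differential `⨁ A e_i ⊗ e_i A → ⨁ A e_{src b} ⊗ e_{tgt b} A`. -/
def IsEnveloping.relDiff (h : IsEnveloping l r) (ρ : QuiverRep src tgt A) (bar : Q → Q)
    (sgn : Q → k) : GrMod.FreeMod (envVertex ρ l r) →ₗ[R] GrMod.FreeMod (envArrow ρ l r) :=
  GrMod.freeLin _ fun _ => h.relGen ρ bar sgn

theorem IsEnveloping.relDiff_apply (h : IsEnveloping l r) (f : GrMod.FreeMod (envVertex ρ l r)) :
    h.relDiff ρ bar sgn f = (∑ i, f.1 i) • h.relGen ρ bar sgn :=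
  (Finset.sum_smul (f := fun i => f.1 i)).symm

theorem IsEnveloping.arrowDiff_relDiff (h : IsEnveloping l r) (hρ : IsPreprojective k ρ bar sgn)
    (f : GrMod.FreeMod (envVertex ρ l r)) : h.arrowDiff ρ (h.relDiff ρ bar sgn f) = 0 := by
  rw [relDiff_apply, map_smul, h.arrowDiff_relGen hρ, smul_zero]

theorem IsEnveloping.relGen_mem_range (h : IsEnveloping l r) (hρ : IsPreprojective k ρ bar sgn) :
    h.relGen ρ bar sgn ∈ LinearMap.range (h.relDiff ρ bar sgn) := by
  refine ⟨h.vertexGen ρ, ?_⟩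
  rw [relDiff_apply, Finset.sum_congr rfl fun i _ => h.vertexGen_apply i, Finset.sum_smul]
  exact sum_envVertex_smul (h.e_smul_relGen hρ)

/-- Exactness in the middle of `⨁ A e_i ⊗ e_i A → ⨁ A e_{src b} ⊗ e_{tgt b} A → ⨁ A e_i ⊗ e_i A`. -/
theorem IsEnveloping.exists_relDiff_eq (h : IsEnveloping l r) (hρ : IsPreprojective k ρ bar sgn)
    (v : GrMod.FreeMod (envArrow ρ l r)) (hv : h.arrowDiff ρ v = 0) :
    ∃ f, h.relDiff ρ bar sgn f = v := by
  let N := LinearMap.range (h.relDiff ρ bar sgn)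
  let _ : Module k (GrMod.FreeMod (envArrow ρ l r) ⧸ N) := Module.compHom _ (algebraMap k R)
  have hk : ∀ (c : k) (m : GrMod.FreeMod (envArrow ρ l r) ⧸ N), c • m = algebraMap k R c • m :=
    fun _ _ => rfl
  have : IsScalarTower k R (GrMod.FreeMod (envArrow ρ l r) ⧸ N) := ⟨fun c x m => by
    rw [hk, ← mul_smul, Algebra.smul_def]⟩
  have hc : ∀ (c : k) (x : R) (m : GrMod.FreeMod (envArrow ρ l r) ⧸ N),
      x • c • m = c • x • m := fun c x m => by
    rw [hk, hk, ← mul_smul, ← mul_smul, Algebra.commutes]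
  -- In the cokernel of `relDiff` the preprojective relation holds for the classes of the
  -- generators, so a crossed homomorphism D sends x_b to the class of the generator b.
  obtain ⟨D, hD, hDe, hDx⟩ := h.exists_crossed hρ
    (fun b => N.mkQ (GrMod.freeGen h.arrow_idem b))
    (fun b => by rw [← map_smul, GrMod.smul_freeGen])
    (by
      have h1 : N.mkQ (h.relGen ρ bar sgn) = 0 :=
        (Submodule.Quotient.mk_eq_zero _).2 (h.relGen_mem_range hρ)
      rw [← h1, relGen, map_sum]
      refine Finset.sum_congr rfl fun b _ => ?_
      rw [hk, map_smul, map_add, map_smul, map_smul])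
  -- The map p ⊗ q ↦ p D(q) serves as a contracting homotopy: by `hX` it sends x (x_b ⊗ 1 - 1 ⊗ x_b)
  -- to minus the class of x times the generator b.
  obtain ⟨μ, hμ⟩ := h.exists_lift (M := GrMod.FreeMod (envArrow ρ l r) ⧸ N)
    (LinearMap.mk₂ k (fun p q => l p • D q)
      (fun p p' q => by rw [map_add, add_smul]) (fun c p q => by rw [map_smul, smul_assoc])
      (fun p q q' => by rw [map_add, smul_add]) (fun c p q => by rw [map_smul, hc]))
  have hμ' : ∀ p q, μ (l p * r (MulOpposite.op q)) = l p • D q := hμ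
  have hE : ∀ x, μ (x * ∑ i, envVertex ρ l r i) = μ x := by
    refine h.induction
      { carrier := {x | μ (x * ∑ i, envVertex ρ l r i) = μ x}
        zero_mem' := by
          change μ (0 * _) = μ 0
          rw [zero_mul]
        add_mem' := fun {x y} hx hy => by
          change μ ((x + y) * _) = μ (x + y)
          rw [add_mul, map_add, map_add]
          exact congrArg₂ _ hx hy } (fun p q => ?_)
    change μ (l p * r (MulOpposite.op q) * _) = μ (l p * r (MulOpposite.op q))
    have h1 : ∀ i, l p * r (MulOpposite.op q) * envVertex ρ l r i =
        l (p * ρ.e i) * r (MulOpposite.op (ρ.e i * q)) := fun i => by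
      rw [envVertex, (h.commute _ _).symm.mul_mul_mul_comm, ← map_mul, ← map_mul,
        ← MulOpposite.op_mul]
    have h2 : ∀ i, l (p * ρ.e i) • D (ρ.e i * q) = l (p * ρ.e i) • D q := fun i => by
      rw [hD, hDe, smul_zero, add_zero, ← mul_smul, ← map_mul, mul_assoc, (ρ.complete.idem i).eq]
    rw [Finset.mul_sum, map_sum, Finset.sum_congr rfl fun i _ => (congrArg μ (h1 i)).trans
      ((hμ' _ _).trans (h2 i)), ← Finset.sum_smul, ← map_sum, ← Finset.mul_sum,
      ρ.complete.complete, mul_one, hμ']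
  have hX : ∀ b x, μ (x * (l (ρ.x b) - r (MulOpposite.op (ρ.x b)))) =
      -(x • N.mkQ (GrMod.freeGen h.arrow_idem b)) := by
    intro b
    refine h.induction
      { carrier := {x | μ (x * (l (ρ.x b) - r (MulOpposite.op (ρ.x b)))) =
          -(x • N.mkQ (GrMod.freeGen h.arrow_idem b))}
        zero_mem' := by
          change μ (0 * _) = -((0 : R) • _)
          rw [zero_mul, zero_smul, neg_zero, map_zero]
        add_mem' := fun {x y} hx hy => by
          change μ ((x + y) * _) = -((x + y) • _)
          rw [add_mul, map_add, add_smul, neg_add]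
          exact congrArg₂ _ hx hy } (fun p q => ?_)
    change μ (l p * r (MulOpposite.op q) * _) = -((l p * r (MulOpposite.op q)) • _)
    have h1 : l p * r (MulOpposite.op q) * (l (ρ.x b) - r (MulOpposite.op (ρ.x b))) =
        l (p * ρ.x b) * r (MulOpposite.op q) - l p * r (MulOpposite.op (ρ.x b * q)) := by
      rw [mul_sub, mul_assoc, ← h.comm, ← mul_assoc, ← map_mul, mul_assoc (l p), ← map_mul,
        ← MulOpposite.op_mul]
    rw [h1, map_sub, hμ', hμ', hD, hDx, map_mul, mul_smul, smul_add, sub_add_cancel_left, mul_smul]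
  have h3 : ∀ i, ∑ b, v.1 b * (l (ρ.x b) - r (MulOpposite.op (ρ.x b))) * envVertex ρ l r i = 0 := by
    intro i
    have h4 := congrArg (fun f : GrMod.FreeMod (envVertex ρ l r) => f.1 i) hv
    simp only [arrowDiff_apply, GrMod.FreeMod.coe_sum] at h4
    refine Eq.trans (Finset.sum_congr rfl fun b _ => ?_) h4
    change _ = v.1 b * (l (ρ.x b) * (h.vertexGen ρ).1 i -
      r (MulOpposite.op (ρ.x b)) * (h.vertexGen ρ).1 i)
    rw [h.vertexGen_apply, mul_assoc, sub_mul]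
  -- If v is a cycle, the homotopy applied to its boundary gives 0; on the other hand it gives minus
  -- the class of v in the cokernel.
  have h5 : ∑ b, μ (v.1 b * (l (ρ.x b) - r (MulOpposite.op (ρ.x b)))) = 0 := by
    rw [← Finset.sum_congr rfl fun b _ => hE _, ← map_sum]
    simp_rw [Finset.mul_sum]
    rw [Finset.sum_comm, Finset.sum_congr rfl fun i _ => h3 i, Finset.sum_const_zero, map_zero]
  have h6 : N.mkQ v = 0 := by
    rw [GrMod.eq_sum_freeGen h.arrow_idem v, map_sum, ← neg_eq_zero, ← h5, ← Finset.sum_neg_distrib]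
    refine Finset.sum_congr rfl fun b _ => ?_
    rw [hX, map_smul]
  exact (Submodule.Quotient.mk_eq_zero _).1 h6

theorem IsEnveloping.relGen_apply (h : IsEnveloping l r) (hρ : IsPreprojective k ρ bar sgn)
    (c : Q) : (h.relGen ρ bar sgn).1 c = algebraMap k R (sgn c) *
      ((r (MulOpposite.op (ρ.x (bar c))) - l (ρ.x (bar c))) * envArrow ρ l r c) := by
  have h1 : ∀ b, (algebraMap k R (sgn b) •
      (r (MulOpposite.op (ρ.x (bar b))) • GrMod.freeGen h.arrow_idem b +
      l (ρ.x b) • GrMod.freeGen h.arrow_idem (bar b)) : GrMod.FreeMod (envArrow ρ l r)).1 c =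
      algebraMap k R (sgn b) * (r (MulOpposite.op (ρ.x (bar b))) *
        (GrMod.freeGen h.arrow_idem b).1 c) +
      algebraMap k R (sgn b) * (l (ρ.x b) * (GrMod.freeGen h.arrow_idem (bar b)).1 c) :=
    fun b => mul_add _ _ _
  rw [relGen, GrMod.FreeMod.coe_sum, Finset.sum_congr rfl fun b _ => h1 b, Finset.sum_add_distrib,
    Finset.sum_eq_single c, Finset.sum_eq_single (bar c)]
  · rw [hρ.bar_bar, GrMod.freeGen_same, hρ.sgn_bar, map_neg]
    noncomm_ring
  · intro b _ hb
    rw [GrMod.freeGen_ne, mul_zero, mul_zero]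
    rintro rfl
    exact hb (hρ.bar_bar b).symm
  · intro h; exact absurd (Finset.mem_univ _) h
  · intro b _ hb
    rw [GrMod.freeGen_ne _ hb.symm, mul_zero, mul_zero]
  · intro h; exact absurd (Finset.mem_univ _) h

/-- Put w = ∑ f_i. The component of `relDiff f` at c is sgn(c) w (1 ⊗ x_{bar c} - x_{bar c} ⊗ 1). It
vanishes for all c exactly when w equalises a ⊗ 1 and 1 ⊗ a for arrows; this is automatic for
vertices and passes to products. -/
theorem IsEnveloping.relDiff_eq_zero_iff (h : IsEnveloping l r) (hρ : IsPreprojective k ρ bar sgn)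
    (f : GrMod.FreeMod (envVertex ρ l r)) : h.relDiff ρ bar sgn f = 0 ↔
      ∀ a, (∑ i, f.1 i) * r (MulOpposite.op a) = (∑ i, f.1 i) * l a := by
  classical
  set w := ∑ i, f.1 i with hw
  have hwe : ∀ j, w * envVertex ρ l r j = f.1 j := fun j => by
    rw [hw, Finset.sum_mul, Finset.sum_eq_single j]
    · exact f.2 j
    · intro i _ hi
      rw [← f.2 i, mul_assoc, h.vertex_mul, if_neg hi, mul_zero]
    · intro h; exact absurd (Finset.mem_univ _) h
  have hfl : ∀ j i, f.1 i * l (ρ.e j) = if i = j then f.1 i else 0 := fun j i => by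
    rw [← f.2 i, envVertex, mul_assoc, mul_assoc, ← h.comm, ← mul_assoc (l _), ← map_mul,
      ρ.e_mul_e]
    split_ifs with hi
    · rfl
    · rw [map_zero, zero_mul, mul_zero]
  have hfr : ∀ j i, f.1 i * r (MulOpposite.op (ρ.e j)) = if i = j then f.1 i else 0 :=
      fun j i => by
    rw [← f.2 i, envVertex, mul_assoc, mul_assoc, ← map_mul, ← MulOpposite.op_mul,
      ρ.e_mul_e]
    by_cases hi : i = j
    · subst hi; simp
    · rw [if_neg hi, if_neg (Ne.symm hi), MulOpposite.op_zero, map_zero, mul_zero, mul_zero]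
  have hwl : ∀ j, w * r (MulOpposite.op (ρ.e j)) = w * l (ρ.e j) := fun j => by
    rw [hw, Finset.sum_mul, Finset.sum_mul]
    exact Finset.sum_congr rfl fun i _ => (hfr j i).trans (hfl j i).symm
  have hx : ∀ c, w * ((r (MulOpposite.op (ρ.x c)) - l (ρ.x c)) * envArrow ρ l r (bar c)) =
      w * r (MulOpposite.op (ρ.x c)) - w * l (ρ.x c) := by
    intro c
    have h1 : r (MulOpposite.op (ρ.x c)) * envArrow ρ l r (bar c) =
        l (ρ.e (tgt c)) * r (MulOpposite.op (ρ.x c)) := by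
      rw [envArrow, hρ.src_bar, hρ.tgt_bar, ← mul_assoc, ← h.comm, mul_assoc, ← map_mul,
        ← MulOpposite.op_mul, ρ.src_mul]
    have h2 : l (ρ.x c) * envArrow ρ l r (bar c) =
        r (MulOpposite.op (ρ.e (src c))) * l (ρ.x c) := by
      rw [envArrow, hρ.src_bar, hρ.tgt_bar, ← mul_assoc, ← map_mul, ρ.mul_tgt, h.comm]
    rw [sub_mul, mul_sub, h1, h2, ← mul_assoc, ← mul_assoc, ← hwl, hwl (src c), mul_assoc, ← map_mul,
      ← MulOpposite.op_mul, ρ.mul_tgt, mul_assoc, ← map_mul, ρ.src_mul]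
  have hcomp : ∀ c, (h.relDiff ρ bar sgn f).1 c = algebraMap k R (sgn c) *
      (w * r (MulOpposite.op (ρ.x (bar c))) - w * l (ρ.x (bar c))) := fun c => by
    rw [← hx, hρ.bar_bar, relDiff_apply]
    change w * (h.relGen ρ bar sgn).1 c = _
    rw [h.relGen_apply hρ, ← mul_assoc, ← Algebra.commutes, mul_assoc]
  constructor
  · intro h0 a
    have ha : a ∈ ρ.adjoin k := hρ.adjoin_eq_top ▸ Algebra.mem_top
    induction ha using Algebra.adjoin_induction with
    | mem p hp =>
      rcases hp with ⟨i, rfl⟩ | ⟨b, rfl⟩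
      · exact hwl i
      · have h1 := hcomp (bar b)
        rw [h0, hρ.bar_bar] at h1
        have h2 := congrArg (algebraMap k R (sgn (bar b)) * ·) h1
        simp only [← mul_assoc (algebraMap k R _), ← map_mul] at h2
        rw [hρ.sgn_mul_self, map_one, one_mul] at h2
        refine sub_eq_zero.1 (h2.symm.trans ?_)
        exact mul_zero _
    | algebraMap c =>
      rw [← MulOpposite.algebraMap_apply, AlgHom.commutes, AlgHom.commutes]
    | add p q _ _ hp hq =>
      rw [MulOpposite.op_add, map_add, map_add, mul_add, mul_add, hp, hq]
    | mul p q _ _ hp hq =>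
      rw [MulOpposite.op_mul, map_mul, map_mul, ← mul_assoc, hq, mul_assoc, h.comm, ← mul_assoc, hp,
        mul_assoc]
  · intro ha
    apply Subtype.ext
    funext c
    rw [hcomp, ha, sub_self, mul_zero]
    rfl

end Enveloping

/-! ### The dual bimodule as the kernel of the resolution -/

section Enveloping

variable {I Q : Type} [Fintype I] [Fintype Q] {src tgt : Q → I}
  {k A R : Type u} [Field k] [Ring A] [Algebra k A] [Ring R] [Algebra k R]
  {ρ : QuiverRep src tgt A} {bar : Q → Q} {sgn : Q → k}
  {l : A →ₐ[k] R} {r : Aᵐᵒᵖ →ₐ[k] R}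

section Dual

variable {σ : R →ₐ[k] Rᵐᵒᵖ} [Module R A]

/-- An enveloping algebra with its anti-automorphism `a ⊗ b ↦ b ⊗ a` and its action on `A`. -/
structure IsEnvelopingDual (l : A →ₐ[k] R) (r : Aᵐᵒᵖ →ₐ[k] R) (σ : R →ₐ[k] Rᵐᵒᵖ) : Prop
    extends IsEnveloping l r where
  left : ∀ a, σ (l a) = MulOpposite.op (r (MulOpposite.op a))
  right : ∀ a, σ (r (MulOpposite.op a)) = MulOpposite.op (l a)
  smul : ∀ p q m : A, (l p * r (MulOpposite.op q)) • m = p * (m * q)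

theorem IsEnvelopingDual.unop_unop (h : IsEnvelopingDual l r σ) (x : R) : (σ (σ x).unop).unop = x := by
  refine h.induction
    { carrier := {x | (σ (σ x).unop).unop = x}
      zero_mem' := by
        change (σ (σ 0).unop).unop = 0
        simp
      add_mem' := fun {x y} hx hy => by
        change (σ (σ (x + y)).unop).unop = x + y
        rw [map_add, MulOpposite.unop_add, map_add, MulOpposite.unop_add]
        exact congrArg₂ _ hx hy } (fun p q => ?_) x
  change (σ (σ (l p * r (MulOpposite.op q))).unop).unop = _
  rw [map_mul, h.left, h.right, ← MulOpposite.op_mul, MulOpposite.unop_op, map_mul, h.left, h.right,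
    ← MulOpposite.op_mul, MulOpposite.unop_op]

theorem IsEnvelopingDual.unop_envVertex (h : IsEnvelopingDual l r σ) (i : I) :
    (σ (envVertex ρ l r i)).unop = envVertex ρ l r i := by
  rw [envVertex, map_mul, h.left, h.right, ← MulOpposite.op_mul, MulOpposite.unop_op]

theorem IsEnvelopingDual.map_eq (h : IsEnvelopingDual l r σ) (φ : A →ₗ[R] R) (a : A) : φ a = l a * φ 1 := by
  rw [← smul_eq_mul, ← map_smul]
  have := h.smul a 1 1
  rw [MulOpposite.op_one, map_one, mul_one, mul_one, mul_one] at this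
  rw [this]

theorem IsEnvelopingDual.map_eq' (h : IsEnvelopingDual l r σ) (φ : A →ₗ[R] R) (a : A) :
    φ a = r (MulOpposite.op a) * φ 1 := by
  rw [← smul_eq_mul, ← map_smul]
  have := h.smul 1 a 1
  rw [map_one, one_mul, one_mul, one_mul] at this
  rw [this]

theorem IsEnvelopingDual.map_e (h : IsEnvelopingDual l r σ) (φ : A →ₗ[R] R) (i : I) :
    φ (ρ.e i) = envVertex ρ l r i * φ (ρ.e i) := by
  rw [← smul_eq_mul, ← map_smul, envVertex, h.smul, (ρ.complete.idem i).eq, (ρ.complete.idem i).eq]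

/-- The map from the dual of the bimodule `A` to `⨁ A e_i ⊗ e_i A`. -/
def IsEnvelopingDual.dualLin (h : IsEnvelopingDual l r σ) (ρ : QuiverRep src tgt A) :
    DualCarrier σ A →ₗ[R] GrMod.FreeMod (envVertex ρ l r) where
  toFun φ := ⟨fun i => (σ ((show A →ₗ[R] R from φ) (ρ.e i))).unop, fun i => by
    change (σ ((show A →ₗ[R] R from φ) (ρ.e i))).unop * envVertex ρ l r i =
      (σ ((show A →ₗ[R] R from φ) (ρ.e i))).unop
    conv_rhs => rw [h.map_e (show A →ₗ[R] R from φ), map_mul, MulOpposite.unop_mul,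
      h.unop_envVertex]⟩
  map_add' φ ψ := by
    apply Subtype.ext
    funext i
    change (σ ((show A →ₗ[R] R from φ) (ρ.e i) + (show A →ₗ[R] R from ψ) (ρ.e i))).unop = _
    rw [map_add]
    rfl
  map_smul' s φ := by
    apply Subtype.ext
    funext i
    change (σ ((show A →ₗ[R] R from φ) (ρ.e i) * (σ s).unop)).unop = s *
      (σ ((show A →ₗ[R] R from φ) (ρ.e i))).unop
    rw [map_mul, MulOpposite.unop_mul, h.unop_unop]

theorem IsEnvelopingDual.sum_dualLin (h : IsEnvelopingDual l r σ) (φ : DualCarrier σ A) :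
    ∑ i, (h.dualLin ρ φ).1 i = (σ ((show A →ₗ[R] R from φ) 1)).unop := by
  rw [← ρ.complete.complete, map_sum, map_sum, Finset.unop_sum]
  rfl

theorem IsEnvelopingDual.dualLin_injective (h : IsEnvelopingDual l r σ) :
    Function.Injective (h.dualLin ρ) := by
  rw [injective_iff_map_eq_zero]
  intro φ hφ
  have h1 : (show A →ₗ[R] R from φ) 1 = 0 := by
    rw [← h.unop_unop ((show A →ₗ[R] R from φ) 1), ← h.sum_dualLin (ρ := ρ), hφ]
    have h2 : ∑ i, (0 : GrMod.FreeMod (envVertex ρ l r)).1 i = 0 :=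
      Finset.sum_eq_zero fun _ _ => rfl
    rw [h2, map_zero, MulOpposite.unop_zero]
  apply LinearMap.ext
  intro a
  rw [h.map_eq φ a]
  exact (congrArg (l a * ·) h1).trans (mul_zero _)

/-- Bimodule maps satisfy φ(a) = (a ⊗ 1) φ(1) = (1 ⊗ a) φ(1). The anti-automorphism turns this into
the criterion of `IsEnveloping.relDiff_eq_zero_iff`. -/
theorem IsEnvelopingDual.relDiff_dualLin (h : IsEnvelopingDual l r σ) (hρ : IsPreprojective k ρ bar sgn)
    (φ : DualCarrier σ A) : h.relDiff ρ bar sgn (h.dualLin ρ φ) = 0 := by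
  rw [h.relDiff_eq_zero_iff hρ]
  intro a
  have h1 := h.map_eq φ a
  have h2 := h.map_eq' φ a
  rw [h.sum_dualLin]
  have h3 := congrArg (fun x => (σ x).unop) (h1.symm.trans h2)
  simp only [map_mul, MulOpposite.unop_mul, h.left, h.right, MulOpposite.unop_op] at h3
  exact h3

/-- Conversely, the kernel condition gives (a ⊗ 1) u = (1 ⊗ a) u for u = σ(w), so a ↦ (a ⊗ 1) u is a
bimodule map A → Aᵉ. -/
theorem IsEnvelopingDual.exists_dualLin_eq (h : IsEnvelopingDual l r σ) (hρ : IsPreprojective k ρ bar sgn)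
    (f : GrMod.FreeMod (envVertex ρ l r)) (hf : h.relDiff ρ bar sgn f = 0) :
    ∃ φ, h.dualLin ρ φ = f := by
  classical
  rw [h.relDiff_eq_zero_iff hρ] at hf
  set w := ∑ i, f.1 i with hw
  have hw' : ∀ a, l a * (σ w).unop = r (MulOpposite.op a) * (σ w).unop := fun a => by
    have h3 := congrArg (fun x => (σ x).unop) (hf a)
    simp only [map_mul, MulOpposite.unop_mul, h.left, h.right, MulOpposite.unop_op] at h3
    exact h3
  let φ : A →ₗ[R] R :=
    { toFun := fun a => l a * (σ w).unop
      map_add' := fun a b => by rw [map_add, add_mul]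
      map_smul' := fun x m => by
        refine h.induction
          { carrier := {x : R | l (x • m) * (σ w).unop = x • (l m * (σ w).unop)}
            zero_mem' := by
              change l ((0 : R) • m) * _ = (0 : R) • _
              rw [zero_smul, zero_smul, map_zero, zero_mul]
            add_mem' := fun {x y} hx hy => by
              change l ((x + y) • m) * _ = (x + y) • _
              rw [add_smul, add_smul, map_add, add_mul]
              exact congrArg₂ _ hx hy } (fun p q => ?_) x
        change l ((l p * r (MulOpposite.op q)) • m) * _ = (l p * r (MulOpposite.op q)) * _
        rw [h.smul, map_mul, map_mul, mul_assoc, mul_assoc, hw', ← mul_assoc (l m), h.comm, mul_assoc,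
          mul_assoc] }
  refine ⟨φ, ?_⟩
  apply Subtype.ext
  funext i
  change (σ (l (ρ.e i) * (σ w).unop)).unop = f.1 i
  rw [map_mul, MulOpposite.unop_mul, h.unop_unop, h.left, MulOpposite.unop_op, hw,
    Finset.sum_mul, Finset.sum_eq_single i]
  · conv_lhs => rw [← f.2 i, envVertex, mul_assoc, mul_assoc, ← map_mul, ← MulOpposite.op_mul,
      (ρ.complete.idem i).eq]
    exact f.2 i
  · intro j _ hj
    rw [← f.2 j, envVertex, mul_assoc, mul_assoc, ← map_mul, ← MulOpposite.op_mul,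
      ρ.e_mul_e, if_neg hj.symm, MulOpposite.op_zero, map_zero, mul_zero, mul_zero]
  · intro h; exact absurd (Finset.mem_univ _) h

theorem IsEnvelopingDual.left_smul (h : IsEnvelopingDual l r σ) (a m : A) :
    l a • m = a * m := by
  have := h.smul a 1 m
  rwa [MulOpposite.op_one, map_one, mul_one, mul_one] at this

theorem IsEnvelopingDual.right_smul (h : IsEnvelopingDual l r σ) (a m : A) :
    r (MulOpposite.op a) • m = m * a := by
  have := h.smul 1 a m
  rwa [map_one, one_mul, one_mul] at this

theorem IsEnvelopingDual.freeLin_vertexGen (h : IsEnvelopingDual l r σ) :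
    GrMod.freeLin _ ρ.e (h.vertexGen ρ) = 1 := by
  change ∑ i, (h.vertexGen ρ).1 i • ρ.e i = 1
  rw [← ρ.complete.complete]
  refine Finset.sum_congr rfl fun i _ => ?_
  rw [h.vertexGen_apply, envVertex, h.smul, (ρ.complete.idem i).eq, (ρ.complete.idem i).eq]

theorem IsEnvelopingDual.freeLin_surjective (h : IsEnvelopingDual l r σ) :
    Function.Surjective (GrMod.freeLin (envVertex ρ l r) ρ.e) := fun a =>
  ⟨l a • h.vertexGen ρ, by rw [map_smul, h.freeLin_vertexGen, h.left_smul, mul_one]⟩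

theorem IsEnvelopingDual.freeLin_arrowDiff (h : IsEnvelopingDual l r σ)
    (f : GrMod.FreeMod (envArrow ρ l r)) :
    GrMod.freeLin (envVertex ρ l r) ρ.e (h.arrowDiff ρ f) = 0 := by
  rw [h.arrowDiff_apply, map_sum]
  refine Finset.sum_eq_zero fun b _ => ?_
  rw [map_smul, map_sub, map_smul, map_smul, h.freeLin_vertexGen, h.left_smul, h.right_smul,
    mul_one, one_mul, sub_self, smul_zero]

end Dual

section Graded

variable {σ : R →ₐ[k] Rᵐᵒᵖ} [Module R A] [Module.Finite k R]
  {𝒜 : ℕ → Submodule k A} [GradedAlgebra 𝒜] {ℬ : ℕ → Submodule k R} [GradedAlgebra ℬ]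

/-- The regular bimodule as a module over the enveloping algebra. -/
def envRegular (hA : ∀ {i : ℕ} {j : ℤ} {x : R} {m : A}, x ∈ ℬ i → m ∈ intGr 𝒜 j →
    x • m ∈ intGr 𝒜 (i + j)) (hfin : Module.Finite R A) : GrMod ℬ where
  carrier := A
  gr n := (intGr 𝒜 n).toAddSubgroup
  isInternal := intGr_isInternal 𝒜
  smul_mem hr hm := hA hr hm
  finite := hfin

/-- The start of the projective resolution of the bimodule `A`, and its dual. -/
theorem IsEnvelopingDual.exists_sequence [IsNoetherianRing R] (h : IsEnvelopingDual l r σ)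
    (hρ : IsPreprojective k ρ bar sgn)
    (deg : Q → ℕ) (hdeg : ∀ b, deg b + deg (bar b) = 1) (he : ∀ i, ρ.e i ∈ 𝒜 0)
    (hx : ∀ b, ρ.x b ∈ 𝒜 (deg b)) (hl : ∀ n, ∀ a ∈ 𝒜 n, l a ∈ ℬ n)
    (hr : ∀ n, ∀ a ∈ 𝒜 n, r (MulOpposite.op a) ∈ ℬ n)
    (hσ : ∀ i, ∀ x ∈ ℬ i, (σ x).unop ∈ ℬ i)
    (hA : ∀ {i : ℕ} {j : ℤ} {x : R} {m : A}, x ∈ ℬ i → m ∈ intGr 𝒜 j →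
      x • m ∈ intGr 𝒜 (i + j)) (hfin : Module.Finite R A) :
    ∃ (X₀ X₁ X₂ : GrMod ℬ) (π : X₀ ⟶ (envRegular hA hfin).shift 1) (d₁ : X₁ ⟶ X₀) (d₂ : X₂ ⟶ X₁)
      (ι : GrMod.dual σ hσ (envRegular hA hfin) ⟶ X₂),
      Projective X₀ ∧ Projective X₁ ∧ Projective X₂ ∧ Function.Surjective (GrMod.Hom.lin π) ∧
      (∀ x, GrMod.Hom.lin π x = 0 ↔ ∃ y, GrMod.Hom.lin d₁ y = x) ∧
      (∀ x, GrMod.Hom.lin d₁ x = 0 ↔ ∃ y, GrMod.Hom.lin d₂ y = x) ∧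
      (∀ x, GrMod.Hom.lin d₂ x = 0 ↔ ∃ y, GrMod.Hom.lin ι y = x) ∧
      Function.Injective (GrMod.Hom.lin ι) := by
  have hmul : ∀ {x y : R}, x ∈ ℬ 0 → y ∈ ℬ 0 → x * y ∈ ℬ 0 := fun hx hy =>
    SetLike.GradedMul.mul_mem (A := ℬ) hx hy
  have hv : ∀ i, envVertex ρ l r i ∈ ℬ 0 := fun i => hmul (hl 0 _ (he i)) (hr 0 _ (he i))
  have ha : ∀ b, envArrow ρ l r b ∈ ℬ 0 := fun b => hmul (hl 0 _ (he _)) (hr 0 _ (he _))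
  -- A vertex has degree -1 in A(1), which fixes the degrees of the generators of X₀ and then of X₁.
  -- Since deg b + deg (bar b) = 1, the relation has degree 0 in X₁. So X₂ is generated in degree 0,
  -- and the dual of A enters it without a shift.
  let X₀ : GrMod ℬ := GrMod.free _ h.vertex_idem hv fun _ => -1
  let X₁ : GrMod ℬ := GrMod.free _ h.arrow_idem ha fun b => deg b - 1
  let X₂ : GrMod ℬ := GrMod.free _ h.vertex_idem hv fun _ => 0
  have hsmul : ∀ (M : GrMod ℬ) {n : ℕ} {i j : ℤ} {x : R} {m : M.carrier}, x ∈ ℬ n → m ∈ M.gr i →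
      n + i = j → x • m ∈ M.gr j := fun M n i j x m hx hm hj => hj ▸ M.smul_mem hx hm
  let B := (envRegular hA hfin).shift 1
  have hB : ∀ i, ρ.e i ∈ B.gr (-1) := fun i => he i
  let π : X₀ ⟶ B := GrMod.freeDesc h.vertex_idem hv (fun _ => -1) B (fun i => ρ.e i) hB
  have hg : h.vertexGen ρ ∈ X₀.gr (-1) :=
    sum_mem fun i _ => GrMod.freeGen_mem_gr h.vertex_idem hv (fun _ => -1) i
  let d₁ : X₁ ⟶ X₀ := GrMod.freeDesc h.arrow_idem ha (fun b => (deg b : ℤ) - 1) X₀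
    (fun b => l (ρ.x b) • h.vertexGen ρ - r (MulOpposite.op (ρ.x b)) • h.vertexGen ρ)
    (fun b => sub_mem (hsmul X₀ (hl _ _ (hx b)) hg rfl) (hsmul X₀ (hr _ _ (hx b)) hg rfl))
  have hγ : ∀ b, GrMod.freeGen h.arrow_idem b ∈ X₁.gr (deg b - 1) :=
    fun b => GrMod.freeGen_mem_gr h.arrow_idem ha (fun b => (deg b : ℤ) - 1) b
  have hrel : h.relGen ρ bar sgn ∈ X₁.gr 0 := by
    refine sum_mem fun b _ => ?_
    have hb := hdeg b
    refine hsmul X₁ (SetLike.algebraMap_mem_graded ℬ (sgn b)) (i := 0) ?_ (by simp)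
    exact add_mem (hsmul X₁ (hr _ _ (hx (bar b))) (hγ b) (by omega))
      (hsmul X₁ (hl _ _ (hx b)) (hγ (bar b)) (by omega))
  let d₂ : X₂ ⟶ X₁ := GrMod.freeDesc h.vertex_idem hv (fun _ => 0) X₁
    (fun _ => h.relGen ρ bar sgn) (fun _ => hrel)
  have hσ' : ∀ {n : ℤ} {x : R}, x ∈ intGr ℬ n → (σ x).unop ∈ intGr ℬ n := by
    intro n x hx
    cases n with
    | ofNat n => exact hσ n x hx
    | negSucc n =>
      have h0 : x = 0 := hx
      rw [h0, map_zero]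
      exact Submodule.zero_mem _
  let ι : GrMod.dual σ hσ (envRegular hA hfin) ⟶ X₂ :=
    { lin := h.dualLin ρ
      map_mem := fun {p φ} hφ i => hσ' (by
        have := hφ 0 _ (he i)
        rwa [zero_add, ← sub_zero p] at this) }
  refine ⟨X₀, X₁, X₂, π, d₁, d₂, ι, inferInstanceAs (Projective (GrMod.free _ _ _ _)),
    inferInstanceAs (Projective (GrMod.free _ _ _ _)),
    inferInstanceAs (Projective (GrMod.free _ _ _ _)), ?_, ?_, ?_, ?_, h.dualLin_injective⟩
  · exact h.freeLin_surjective
  · intro x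
    refine ⟨fun hx => h.exists_arrowDiff_eq hρ.adjoin_eq_top h.smul x hx, ?_⟩
    rintro ⟨y, rfl⟩
    exact h.freeLin_arrowDiff y
  · intro x
    refine ⟨fun hx => h.exists_relDiff_eq hρ x hx, ?_⟩
    rintro ⟨y, rfl⟩
    exact h.arrowDiff_relDiff hρ y
  · intro x
    refine ⟨fun hx => h.exists_dualLin_eq hρ x hx, ?_⟩
    rintro ⟨y, rfl⟩
    exact h.relDiff_dualLin hρ y

end Graded

end Enveloping

/-! ### The exact sequence over A ⊗ Aᵒᵖ -/

section Bimodule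

variable {I Q : Type} [Fintype I] [Fintype Q] {src tgt : Q → I}
  {k A : Type u} [Field k] [Ring A] [Algebra k A] [Module.Finite k A]
  {ρ : QuiverRep src tgt A} {bar : Q → Q} {sgn : Q → k}

attribute [local instance] TensorProduct.Algebra.module

theorem isEnvelopingDual_envSwap (k A : Type u) [Field k] [Ring A] [Algebra k A]
    [Module.Finite k A] :
    IsEnvelopingDual (Algebra.TensorProduct.includeLeft : A →ₐ[k] A ⊗[k] Aᵐᵒᵖ)
      Algebra.TensorProduct.includeRight (envSwap k A) where
  comm a b := by simp
  induction N hN x := by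
    induction x using TensorProduct.induction_on with
    | zero => exact N.zero_mem
    | add x y hx hy => exact N.add_mem hx hy
    | tmul p q =>
      have := hN p q.unop
      simpa using this
  exists_lift {M} _ _ f := by
    refine ⟨TensorProduct.lift (f.compl₂ (MulOpposite.opLinearEquiv k).symm.toLinearMap), ?_⟩
    intro p q
    simp
  left a := envSwap_tmul a 1
  right a := envSwap_tmul 1 a
  smul p q m := by
    have h : (Algebra.TensorProduct.includeLeft : A →ₐ[k] A ⊗[k] Aᵐᵒᵖ) p *
        (Algebra.TensorProduct.includeRight : Aᵐᵒᵖ →ₐ[k] A ⊗[k] Aᵐᵒᵖ) (MulOpposite.op q) =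
        p ⊗ₜ MulOpposite.op q := by simp
    rw [h]
    exact env_smul_tmul p q m

/-- The start of the projective resolution of the bimodule `A`, and its dual. -/
theorem IsPreprojective.exists_sequence (hρ : IsPreprojective k ρ bar sgn)
    (𝒜 : ℕ → Submodule k A) [GradedAlgebra 𝒜]
    (deg : Q → ℕ) (hdeg : ∀ b, deg b + deg (bar b) = 1) (he : ∀ i, ρ.e i ∈ 𝒜 0)
    (hx : ∀ b, ρ.x b ∈ 𝒜 (deg b)) :
    ∃ (X₀ X₁ X₂ : GrMod (envGr 𝒜)) (π : X₀ ⟶ (regularBimodule 𝒜).shift 1) (d₁ : X₁ ⟶ X₀)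
      (d₂ : X₂ ⟶ X₁) (ι : (bimoduleDual 𝒜).obj (.op (regularBimodule 𝒜)) ⟶ X₂),
      Projective X₀ ∧ Projective X₁ ∧ Projective X₂ ∧ Function.Surjective (GrMod.Hom.lin π) ∧
      (∀ x, GrMod.Hom.lin π x = 0 ↔ ∃ y, GrMod.Hom.lin d₁ y = x) ∧
      (∀ x, GrMod.Hom.lin d₁ x = 0 ↔ ∃ y, GrMod.Hom.lin d₂ y = x) ∧
      (∀ x, GrMod.Hom.lin d₂ x = 0 ↔ ∃ y, GrMod.Hom.lin ι y = x) ∧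
      Function.Injective (GrMod.Hom.lin ι) :=
  (isEnvelopingDual_envSwap k A).exists_sequence (𝒜 := 𝒜) (ℬ := envGr 𝒜) hρ deg hdeg he hx
    (fun n a ha => Submodule.subset_span
      ⟨n, 0, a, 1, add_zero n, ha, SetLike.GradedOne.one_mem, rfl⟩)
    (fun n a ha => Submodule.subset_span
      ⟨0, n, 1, a, zero_add n, SetLike.GradedOne.one_mem, ha, rfl⟩)
    (envSwap_mem 𝒜) (env_smul_mem 𝒜) (regularBimodule 𝒜).finite

end Bimodule

/-! ### Dimension shifting in the quotient by perfect complexes -/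

section Derived

open Pretriangulated Triangulated

variable (C : Type*) [Category C] [Abelian C] [HasDerivedCategory C]

/-- The perfect objects of the derived category. -/
def perfDerived : ObjectProperty (DerivedCategory C) := fun X =>
  ∃ K : CochainComplex C ℤ, (∀ n, Projective (K.X n)) ∧
    (∃ a b : ℤ, K.IsStrictlyGE a ∧ K.IsStrictlyLE b) ∧
    Nonempty (DerivedCategory.Q.obj K ≅ X)

theorem perf_eq_inverseImage : perf C = (perfDerived C).inverseImage DerivedCategory.Bounded.ι :=
  rfl

instance : (perfDerived C).IsClosedUnderIsomorphisms where
  of_iso e := by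
    rintro ⟨K, h₁, h₂, ⟨i⟩⟩
    exact ⟨K, h₁, h₂, ⟨i ≪≫ e⟩⟩

instance : (perfDerived C).IsStableUnderShift ℤ where
  isStableUnderShiftBy n :=
    { le_shift := by
        rintro X ⟨K, h₁, ⟨a, b, ha, hb⟩, ⟨i⟩⟩
        exact ⟨K⟦n⟧, fun m => h₁ (m + n),
          ⟨a - n, b - n, K.isStrictlyGE_shift a n (a - n) (by omega),
            K.isStrictlyLE_shift b n (b - n) (by omega)⟩,
          ⟨(DerivedCategory.Q.commShiftIso n).app K ≪≫ (shiftFunctor _ n).mapIso i⟩⟩ }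

variable {C}

theorem perfDerived_single (X : C) [Projective X] :
    perfDerived C ((DerivedCategory.singleFunctor C 0).obj X) := by
  refine ⟨(CochainComplex.singleFunctor C 0).obj X, fun n => ?_, ⟨0, 0, inferInstance,
    inferInstance⟩, ⟨((DerivedCategory.singleFunctorIsoCompQ C 0).app X).symm⟩⟩
  by_cases hn : n = 0
  · subst hn
    exact Projective.of_iso (HomologicalComplex.singleObjXSelf (ComplexShape.up ℤ) 0 X).symm ‹_›
  · exact (HomologicalComplex.isZero_single_obj_X (ComplexShape.up ℤ) 0 X n hn).projective

instance : (perf C).IsStableUnderShift ℤ where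
  isStableUnderShiftBy n :=
    { le_shift := fun X hX => (perfDerived C).prop_of_iso
        ((DerivedCategory.Bounded.ι.commShiftIso n).app X).symm
        ((perfDerived C).le_shift n _ hX) }

/-- In the rotated triangle X₂ → X₃ → X₁[1] the first object is projective, so the connecting
morphism has a perfect cone. -/
theorem trW_singleδ {S : ShortComplex C} (hS : S.ShortExact) [Projective S.X₂] :
    (perfDerived C).trW hS.singleδ :=
  ObjectProperty.trW.mk' _ (rot_of_distTriang _ hS.singleTriangle_distinguished)
    (perfDerived_single S.X₂)

theorem exists_trW {S : ShortComplex C} (hS : S.ShortExact) [Projective S.X₂] :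
    ∃ f : toBounded S.X₃ ⟶ (toBounded S.X₁)⟦(1 : ℤ)⟧, (perf C).trW f := by
  let e := (DerivedCategory.Bounded.ι (C := C).commShiftIso (1 : ℤ)).symm.app (toBounded S.X₁)
  refine ⟨ObjectProperty.homMk (hS.singleδ ≫ e.hom), ?_⟩
  rw [perf_eq_inverseImage, ObjectProperty.inverseImage_trW_iff]
  exact ((perfDerived C).trW.cancel_right_of_respectsIso _ e.hom).2 (trW_singleδ hS)

/-- The end terms of a short exact sequence with projective middle term agree up to a shift in the
stable derived category. -/
theorem stableQ_iso_shift {S : ShortComplex C} (hS : S.ShortExact) [Projective S.X₂] (n : ℤ) :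
    Nonempty ((stableQ C).obj ((toBounded S.X₃)⟦n⟧) ≅
      (stableQ C).obj (((toBounded S.X₁)⟦(1 : ℤ)⟧)⟦n⟧)) := by
  obtain ⟨f, hf⟩ := exists_trW hS
  have := Localization.inverts (stableQ C) (perf C).trW (f⟦n⟧') (hf.shift n)
  exact ⟨asIso ((stableQ C).map (f⟦n⟧'))⟩

/-- The composite of three dimension shifts along an exact sequence with three projective middle
terms; the equalities of objects express that the short exact sequences splice. -/
theorem stableQ_iso_shift_three {X Y Z W : C} {S₀ S₁ S₂ : ShortComplex C} (h₀ : S₀.ShortExact)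
    (h₁ : S₁.ShortExact) (h₂ : S₂.ShortExact) [Projective S₀.X₂] [Projective S₁.X₂]
    [Projective S₂.X₂] (e₀ : S₀.X₃ = X) (e₀₁ : S₀.X₁ = Y) (e₁ : S₁.X₃ = Y) (e₁₂ : S₁.X₁ = Z)
    (e₂ : S₂.X₃ = Z) (e₃ : S₂.X₁ = W) :
    Nonempty ((stableQ C).obj (toBounded X) ≅
      (stableQ C).obj ((toBounded W)⟦(2 : ℤ) + 1⟧)) := by
  subst e₀ e₀₁ e₁₂ e₃
  obtain ⟨i₀⟩ := stableQ_iso_shift h₀ 0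
  obtain ⟨i₁⟩ := stableQ_iso_shift h₁ 1
  obtain ⟨i₂⟩ := stableQ_iso_shift h₂ 2
  rw [e₁] at i₁
  rw [e₂] at i₂
  let T : DerivedCategory.Bounded C ⥤ _ := stableQ C
  have z : ∀ U : DerivedCategory.Bounded C, Nonempty (T.obj (U⟦(0 : ℤ)⟧) ≅ T.obj U) := fun U =>
    ⟨T.mapIso ((shiftFunctorZero _ ℤ).app U)⟩
  obtain ⟨z₀⟩ := z (toBounded S₀.X₃)
  obtain ⟨z₁⟩ := z ((toBounded S₀.X₁)⟦(1 : ℤ)⟧)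
  let a : T.obj (((toBounded S₁.X₁)⟦(1 : ℤ)⟧)⟦(1 : ℤ)⟧) ≅ T.obj ((toBounded S₁.X₁)⟦(2 : ℤ)⟧) :=
    T.mapIso ((shiftFunctorAdd' _ (1 : ℤ) 1 2 rfl).symm.app _)
  let b : T.obj (((toBounded S₂.X₁)⟦(1 : ℤ)⟧)⟦(2 : ℤ)⟧) ≅ T.obj ((toBounded S₂.X₁)⟦(2 : ℤ) + 1⟧) :=
    T.mapIso ((shiftFunctorAdd' _ (1 : ℤ) 2 (2 + 1) rfl).symm.app _)
  exact ⟨z₀.symm ≪≫ i₀ ≪≫ z₁ ≪≫ i₁ ≪≫ a ≪≫ i₂ ≪≫ b⟩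

/-- The image in the derived category of the complex obtained by applying an exact contravariant
functor to a projective resolution. -/
theorem map_resolution_iso {D : Type*} [Category D] [Abelian D] (F : Dᵒᵖ ⥤ C) [F.Additive]
    [F.PreservesHomology] {M : D} (P : ProjectiveResolution M) :
    Nonempty (DerivedCategory.Q.obj
      (((F.mapHomologicalComplex (ComplexShape.up ℕ)).obj P.complex.op).extend
        ComplexShape.embeddingUpNat) ≅ (DerivedCategory.singleFunctor C 0).obj (F.obj (.op M))) := by
  let K₀ : CochainComplex Dᵒᵖ ℕ := ((ChainComplex.single₀ D).obj M).op
  let K₁ : CochainComplex Dᵒᵖ ℕ := P.complex.op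
  -- The augmentation of the resolution is a quasi-isomorphism, and stays one under the exact
  -- functor F; hence the complex is F(M) in degree 0.
  let φ : K₀ ⟶ K₁ := (HomologicalComplex.opFunctor D (ComplexShape.down ℕ)).map P.π.op
  have hφ : QuasiIso φ :=
    (HomologicalComplex.quasiIso_opFunctor_map_iff P.π).2 P.quasiIso
  let ψ := (F.mapHomologicalComplex (ComplexShape.up ℕ)).map φ
  have hψ : QuasiIso ψ := HomologicalComplex.quasiIso_map_of_preservesHomology _ _
  let L : CochainComplex C ℤ := ((F.mapHomologicalComplex (ComplexShape.up ℕ)).obj K₀).extend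
    ComplexShape.embeddingUpNat
  let χ : L ⟶ _ := HomologicalComplex.extendMap ψ ComplexShape.embeddingUpNat
  have hχ : QuasiIso χ := inferInstanceAs
    (QuasiIso (HomologicalComplex.extendMap ψ ComplexShape.embeddingUpNat))
  have hz : ∀ n : ℕ, n ≠ 0 → IsZero (K₀.X n) := fun n hn =>
    (HomologicalComplex.isZero_single_obj_X (ComplexShape.down ℕ) 0 M n hn).op
  have hL : ∀ n : ℤ, n ≠ 0 → IsZero (L.X n) := by
    intro n hn
    cases n with
    | ofNat n =>
      refine IsZero.of_iso ?_ (HomologicalComplex.extendXIso _ ComplexShape.embeddingUpNat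
        (i := n) rfl)
      exact F.map_isZero (hz n (by rintro rfl; exact hn rfl))
    | negSucc n =>
      exact HomologicalComplex.isZero_extend_X _ _ _ fun i hi => by
        simp at hi
  have h₁ : L.IsStrictlyGE 0 := (L.isStrictlyGE_iff 0).2 fun i hi => hL i hi.ne
  have h₂ : L.IsStrictlyLE 0 := (L.isStrictlyLE_iff 0).2 fun i hi => hL i hi.ne'
  obtain ⟨N, ⟨e⟩⟩ := L.exists_iso_single 0
  have e₁ : N ≅ F.obj (.op M) :=
    (HomologicalComplex.singleObjXSelf (ComplexShape.up ℤ) 0 N).symm ≪≫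
      (HomologicalComplex.eval C (ComplexShape.up ℤ) 0).mapIso e.symm ≪≫
      HomologicalComplex.extendXIso _ ComplexShape.embeddingUpNat (i := 0) rfl ≪≫
      F.mapIso (HomologicalComplex.singleObjXSelf (ComplexShape.down ℕ) 0 M).op.symm
  exact ⟨(asIso (DerivedCategory.Q.map χ)).symm ≪≫ DerivedCategory.Q.mapIso e ≪≫
    ((DerivedCategory.singleFunctorIsoCompQ C 0).app N).symm ≪≫
    (DerivedCategory.singleFunctor C 0).mapIso e₁⟩

end Derived

/-! ### Exactness for graded modules and for the dual -/

namespace GrMod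

variable {k : Type u} [Field k] {R : Type u} [Ring R] [Algebra k R]
  {𝒜 : ℕ → Submodule k R} [IsNoetherianRing R] [Module.Finite k R] [GradedAlgebra 𝒜]

/-- Exactness of graded modules can be checked on elements. -/
theorem exact_iff (S : ShortComplex (GrMod 𝒜)) :
    S.Exact ↔ ∀ x, Hom.lin S.g x = 0 → ∃ y, Hom.lin S.f y = x := by
  let S' : ShortComplex (GrMod 𝒜) := ShortComplex.mk (kerι S.g) S.g (kerι_comp S.g)
  have hS' : S'.Exact := S'.exact_of_f_is_kernel (kerIsLimit S.g)
  constructor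
  · intro hS x hx
    rw [ShortComplex.exact_iff_exact_up_to_refinements] at hS
    obtain ⟨B, p, _, y, hy⟩ := hS (kerι S.g) (kerι_comp S.g)
    obtain ⟨b, hb⟩ := surjective_of_epi p ⟨x, hx⟩
    refine ⟨Hom.lin y b, ?_⟩
    have h := LinearMap.congr_fun (congrArg (fun a : B ⟶ S.X₂ => Hom.lin a) hy) b
    refine h.symm.trans ?_
    exact congrArg (Hom.lin (kerι S.g)) hb
  · intro h
    let φ : S ⟶ S' :=
      { τ₁ := kerLift S.g S.f S.zero
        τ₂ := 𝟙 _
        τ₃ := 𝟙 _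
        comm₁₂ := rfl
        comm₂₃ := rfl }
    have h₁ : Epi φ.τ₁ := epi_of_surjective _ (by
      rintro ⟨x, hx⟩
      obtain ⟨y, hy⟩ := h x hx
      exact ⟨y, Subtype.ext hy⟩)
    have h₂ : IsIso φ.τ₂ := inferInstanceAs (IsIso (𝟙 _))
    have h₃ : Mono φ.τ₃ := inferInstanceAs (Mono (𝟙 _))
    exact (ShortComplex.exact_iff_of_epi_of_isIso_of_mono φ).2 hS'

theorem shortExact {L M N : GrMod 𝒜} (f : L ⟶ M) (g : M ⟶ N)
    (hf : Function.Injective (Hom.lin f)) (hg : Function.Surjective (Hom.lin g))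
    (h : ∀ x, Hom.lin g x = 0 ↔ ∃ y, Hom.lin f y = x) :
    ∃ w : f ≫ g = 0, (ShortComplex.mk f g w).ShortExact := by
  have w : f ≫ g = 0 := by
    apply hom_ext
    apply LinearMap.ext
    intro x
    exact (h _).2 ⟨x, rfl⟩
  have := mono_of_injective f hf
  have := epi_of_surjective g hg
  exact ⟨w, { exact := (exact_iff _).2 fun x hx => (h x).1 hx }⟩

/-- Exactness is tested on all elements, so ungraded selfinjectivity suffices: a functional that
vanishes on a kernel is defined on the image and extends from there. -/
theorem dualFunctor_preservesHomology (σ : R →ₐ[k] Rᵐᵒᵖ)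
    (hσ : ∀ i, ∀ r ∈ 𝒜 i, (σ r).unop ∈ 𝒜 i) (h : Module.Injective R R) :
    (dualFunctor σ hσ).PreservesHomology := by
  refine ((Functor.exact_tfae (dualFunctor σ hσ)).out 1 2).1 fun S hS => ?_
  rw [exact_iff]
  intro (φ : S.X₂.unop.carrier →ₗ[R] R) hφ
  have hex := (exact_iff S.unop).1 ((ShortComplex.exact_unop_iff S).2 hS)
  let g := Hom.lin S.f.unop
  have hker : LinearMap.ker g ≤ LinearMap.ker φ := by
    intro x hx
    obtain ⟨y, rfl⟩ := hex x hx
    exact LinearMap.congr_fun (show φ ∘ₗ Hom.lin S.g.unop = 0 from hφ) y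
  obtain ⟨ψ, hψ⟩ := h.out ((LinearMap.ker g).liftQ g le_rfl)
    (LinearMap.ker_eq_bot.1 (Submodule.ker_liftQ_eq_bot _ _ _ le_rfl))
    ((LinearMap.ker g).liftQ φ hker)
  exact ⟨ψ, LinearMap.ext fun x => hψ (Submodule.Quotient.mk x)⟩

end GrMod

/-! ### The bimodule stably twisted Calabi–Yau property -/

section StablyCY

variable {I Q : Type} [Fintype I] [Fintype Q] {src tgt : Q → I}
  {k A : Type u} [Field k] [Ring A] [Algebra k A] [Module.Finite k A]
  {ρ : QuiverRep src tgt A} {bar : Q → Q} {sgn : Q → k}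

theorem exists_shortExact_of_exact {R : Type u} [Ring R] [Algebra k R] [IsNoetherianRing R]
    [Module.Finite k R] {ℬ : ℕ → Submodule k R} [GradedAlgebra ℬ] {Y X₂ X₁ X₀ M : GrMod ℬ} (π : X₀ ⟶ M) (d₁ : X₁ ⟶ X₀) (d₂ : X₂ ⟶ X₁)
    (ι : Y ⟶ X₂) (hπ : Function.Surjective (GrMod.Hom.lin π))
    (h₀ : ∀ x, GrMod.Hom.lin π x = 0 ↔ ∃ y, GrMod.Hom.lin d₁ y = x)
    (h₁ : ∀ x, GrMod.Hom.lin d₁ x = 0 ↔ ∃ y, GrMod.Hom.lin d₂ y = x)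
    (h₂ : ∀ x, GrMod.Hom.lin d₂ x = 0 ↔ ∃ y, GrMod.Hom.lin ι y = x)
    (hι : Function.Injective (GrMod.Hom.lin ι)) :
    ∃ (K₀ K₁ : GrMod ℬ) (f₀ : K₀ ⟶ X₀) (g₁ : X₁ ⟶ K₀) (f₁ : K₁ ⟶ X₁) (g₂ : X₂ ⟶ K₁)
      (w₀ : f₀ ≫ π = 0) (w₁ : f₁ ≫ g₁ = 0) (w₂ : ι ≫ g₂ = 0),
      (ShortComplex.mk f₀ π w₀).ShortExact ∧ (ShortComplex.mk f₁ g₁ w₁).ShortExact ∧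
      (ShortComplex.mk ι g₂ w₂).ShortExact := by
  have z₁ : d₁ ≫ π = 0 := GrMod.hom_ext (LinearMap.ext fun x => (h₀ _).2 ⟨x, rfl⟩)
  let g₁ : X₁ ⟶ GrMod.ker π := GrMod.kerLift π d₁ z₁
  have hg₁ : ∀ x, GrMod.Hom.lin g₁ x = 0 ↔ GrMod.Hom.lin d₁ x = 0 := fun x =>
    ⟨fun h => congrArg Subtype.val h, fun h => Subtype.ext h⟩
  have z₂ : d₂ ≫ g₁ = 0 := GrMod.hom_ext (LinearMap.ext fun x =>
    (hg₁ _).2 ((h₁ _).2 ⟨x, rfl⟩))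
  let g₂ : X₂ ⟶ GrMod.ker g₁ := GrMod.kerLift g₁ d₂ z₂
  have hg₂ : ∀ x, GrMod.Hom.lin g₂ x = 0 ↔ GrMod.Hom.lin d₂ x = 0 := fun x =>
    ⟨fun h => congrArg Subtype.val h, fun h => Subtype.ext h⟩
  obtain ⟨w₀, s₀⟩ := GrMod.shortExact (GrMod.kerι π) π (Submodule.subtype_injective _) hπ
    fun x => ⟨fun h => ⟨⟨x, h⟩, rfl⟩, fun ⟨y, hy⟩ => hy ▸ y.2⟩
  obtain ⟨w₁, s₁⟩ := GrMod.shortExact (GrMod.kerι g₁) g₁ (Submodule.subtype_injective _)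
    (fun ⟨x, hx⟩ => by
      obtain ⟨y, hy⟩ := (h₀ x).1 hx
      exact ⟨y, Subtype.ext hy⟩)
    fun x => ⟨fun h => ⟨⟨x, h⟩, rfl⟩, fun ⟨y, hy⟩ => hy ▸ y.2⟩
  obtain ⟨w₂, s₂⟩ := GrMod.shortExact ι g₂ hι
    (fun ⟨x, hx⟩ => by
      obtain ⟨y, hy⟩ := (h₁ x).1 ((hg₁ x).1 hx)
      exact ⟨y, Subtype.ext hy⟩)
    fun x => (hg₂ x).trans (h₂ x)
  exact ⟨_, _, _, _, _, _, w₀, w₁, w₂, s₀, s₁, s₂⟩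

/-- A preprojective algebra is bimodule stably `(1)`-twisted `2`-Calabi-Yau. -/
theorem IsPreprojective.isBimoduleStablyTwistedCY (hρ : IsPreprojective k ρ bar sgn)
    (𝒜 : ℕ → Submodule k A) [GradedAlgebra 𝒜]
    (deg : Q → ℕ) (hdeg : ∀ b, deg b + deg (bar b) = 1) (he : ∀ i, ρ.e i ∈ 𝒜 0)
    (hx : ∀ b, ρ.x b ∈ 𝒜 (deg b)) : IsBimoduleStablyTwistedCY 𝒜 1 2 := by
  let _ := HasDerivedCategory.standard (GrMod (envGr 𝒜))
  -- A and its opposite are both preprojective, hence selfinjective, and so is Aᵉ. Therefore RHom(A,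
  -- Aᵉ) is concentrated in degree 0, which also gives the boundedness.
  have hinj : Module.Injective (A ⊗[k] Aᵐᵒᵖ) (A ⊗[k] Aᵐᵒᵖ) :=
    injective_tensorProduct hρ.injective hρ.op.injective
  have hF : (bimoduleDual 𝒜).PreservesHomology :=
    GrMod.dualFunctor_preservesHomology _ _ hinj
  let P : ProjectiveResolution (regularBimodule 𝒜) := ProjectiveResolution.of _
  obtain ⟨e⟩ := map_resolution_iso (bimoduleDual 𝒜) P
  let Y := (bimoduleDual 𝒜).obj (.op (regularBimodule 𝒜))
  have h : (DerivedCategory.TStructure.t (C := GrMod (envGr 𝒜))).bounded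
      (DerivedCategory.Q.obj (rHomComplex 𝒜 P)) :=
    ObjectProperty.prop_of_iso _ e.symm (bounded_single Y)
  refine ⟨P, h, ?_⟩
  obtain ⟨X₀, X₁, X₂, π, d₁, d₂, ι, p₀, p₁, p₂, hπ, h₀, h₁, h₂, hι⟩ :=
    hρ.exists_sequence 𝒜 deg hdeg he hx
  obtain ⟨K₀, K₁, f₀, g₁, f₁, g₂, w₀, w₁, w₂, s₀, s₁, s₂⟩ :=
    exists_shortExact_of_exact π d₁ d₂ ι hπ h₀ h₁ h₂ hι
  obtain ⟨i⟩ := stableQ_iso_shift_three s₀ s₁ s₂ rfl rfl rfl rfl rfl rfl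
  let e' : (⟨_, h⟩ : DerivedCategory.Bounded (GrMod (envGr 𝒜))) ≅ toBounded Y :=
    ObjectProperty.isoMk _ e
  exact ⟨(stableQ _).mapIso ((shiftFunctor _ ((2 : ℤ) + 1)).mapIso e') ≪≫ i.symm⟩

end StablyCY

end
end Preproj

theorem mainTheorem5 {k : Type u} [Field k] [IsAlgClosed k]
    (Λ : Type u) [Ring Λ] [Algebra k Λ] [Module.Finite k Λ]
    (hbasic : Preproj.IsBasic Λ)
    (hgldim : Preproj.HasGlobalDimensionLE Λ 1)
    (hτ : Preproj.IsTau₁Finite k Λ) :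
    ∃ _ : Module.Finite k (Preproj.Preprojective₂ k Λ),
      Preproj.IsSelfinjective (Preproj.Preprojective₂ k Λ) ∧
      Preproj.IsBimoduleStablyTwistedCY (Preproj.TensorAlg.gr k Λ (Preproj.ExtDual k Λ)) 1 2 ∧
      Preproj.IsStMod_CalabiYau k (Preproj.Preprojective₂ k Λ) 2 := by
  obtain ⟨I, Q, _, _, src, tgt, ρ, hρ⟩ :=
    Preproj.exists_isPathAlgebra (k := k) (Λ := Λ) hbasic hgldim
  have hfin : Module.Finite k (Preproj.Preprojective₂ k Λ) := Preproj.finite_preprojective hρ hτ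
  obtain ⟨ρ', hρ', he, hl, hr⟩ := Preproj.exists_isPreprojective hρ
  refine ⟨hfin, hρ'.isSelfinjective,
    hρ'.isBimoduleStablyTwistedCY _ (Sum.elim (fun _ => 0) (fun _ => 1)) ?_ he ?_,
    hρ'.isStMod_calabiYau⟩
  -- Exactly one arrow of each pair b, bar b comes from Ext¹ and has degree 1; this is the source of
  -- the twist (1).
  · rintro (b | b) <;> rfl
  · rintro (b | b)
    · exact hl b
    · exact hr b
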